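/- **Setting ($d=2$).** Let $H=\{v\in[L^2(\mathbb R^2)]^2:\operatorname{div}v=0\}$ (real vector fields) with the $L^2$ norm, $J^s=(I-\Delta)^{s/2}$, and let $H^{s,p}_{\rm sol}$ be the space of real divergence-free tempered vector distributions $u$ with norm $\|J^su\|_{L^p}<\infty$; write $H^s=H^{s,2}_{\rm sol}$. Put $A=-\Delta$ and let $B(u,v)$ be given by $\langle B(u,v),\psi\rangle=-\int_{\mathbb R^2}((u\cdot\nabla)\psi)\cdot v\,d\xi$ for divergence-free $\psi$. For a real separable Hilbert space $Y$ let $\gamma(Y;X)$ denote the $\gamma$-radonifying operators from $Y$ to $X$. Let $w$ be a $Y$-cylindrical Wiener process on a filtered probability space $(\Omega,\mathbb F,(\mathbb F_t)_{t\ge0},\mathbb P)$, let $\gamma>0$, $g\in(0,1)$, and let $G$ be a map assigning to every $v\in H$ an operator $G(v)$ on $Y$, with $v\mapsto G(v)y$ Borel measurable for every $y\in Y$, such that $$\sup_{v\in H}\|G(v)\|_{\gamma(Y;H^{-g})}<\infty,\qquad \sup_{v\in H}\|G(v)\|_{\gamma(Y;H^{-g,4}_{\rm sol})}<\infty .$$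 Let $v$ be a progressively measurable $H$-valued process with a.s. continuous paths, and for $\alpha>0$ let $$\zeta^\alpha(t)=\int_0^t e^{-(\gamma+\alpha)(t-s)}e^{-(t-s)A}G(v(s))\,dw(s),\qquad t\ge0$$ (in a jointly measurable version). **Proposition.** Let $f\in H^{-1}$ and, for every $\alpha>0$, let $u^\alpha$ be a jointly measurable process which is, almost surely, the solution in $C([0,\infty);H)\cap L^2_{\rm loc}([0,\infty);H^1)$ of $$\frac{du}{dt}(t)+Au(t)+\gamma u(t)+B\big(u(t)+\zeta^\alpha(t),u(t)+\zeta^\alpha(t)\big)=\alpha\,\zeta^\alpha(t)+f,\qquad u(0)=0,$$ understood in integrated form, tested with divergence-free Schwartz fields. Then for every $\varepsilon>0$ there exist $\alpha,R>0$ such that $$\frac1T\int_0^T\mathbb P\big(\|u^\alpha(t)\|_H>R\big)\,dt<\varepsilon\qquad\text{for all }T>0 .$$ -/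

import Mathlib

open MeasureTheory ProbabilityTheory Filter Topology
open scoped NNReal ENNReal SchwartzMap

noncomputable section

namespace DampedNS

/-! ### Vector fields and distributions on the plane -/

/-- The plane `ℝ²`. -/
abbrev Plane := EuclideanSpace ℝ (Fin 2)

/-- The `i`-th vector of the standard basis of the plane. -/
def e (i : Fin 2) : Plane := EuclideanSpace.single i 1

/-- Vector-valued tempered distributions `u = (u¹, u²)`; the real ones are singled out by
`IsRealDist`. -/
abbrev VecDist := Fin 2 → 𝓢'(Plane, ℂ)

/-- A tempered distribution is real if it takes real values on real test functions. -/
def IsRealDist (u : 𝓢'(Plane, ℂ)) : Prop :=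
  ∀ φ : 𝓢(Plane, ℂ), (∀ x, (φ x).im = 0) → (u φ).im = 0

/-- The divergence `∂₁ u¹ + ∂₂ u²`, in the sense of distributions. -/
def divergence : VecDist →ₗ[ℂ] 𝓢'(Plane, ℂ) :=
  ∑ i : Fin 2, (LineDeriv.lineDerivOpCLM ℂ 𝓢'(Plane, ℂ) (e i) : 𝓢'(Plane, ℂ) →ₗ[ℂ] 𝓢'(Plane, ℂ))
    ∘ₗ LinearMap.proj i

/-- `J^s = (I - Δ)^{s/2}`. In Mathlib's normalisation of the Fourier transform, `-Δ` has the
symbol `4π²‖ξ‖²`. -/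
def J (s : ℝ) : 𝓢'(Plane, ℂ) →L[ℂ] 𝓢'(Plane, ℂ) :=
  TemperedDistribution.fourierMultiplierCLM ℂ
    (fun ξ : Plane ↦ (((1 + 4 * Real.pi ^ 2 * ‖ξ‖ ^ 2) ^ (s / 2) : ℝ) : ℂ))

/-- The heat operator `e^{tΔ} = e^{-tA}`, `t ≥ 0`, acting on tempered distributions. -/
def heat (t : ℝ) : 𝓢'(Plane, ℂ) →L[ℂ] 𝓢'(Plane, ℂ) :=
  TemperedDistribution.fourierMultiplierCLM ℂ
    (fun ξ : Plane ↦ ((Real.exp (-(4 * Real.pi ^ 2 * t * ‖ξ‖ ^ 2)) : ℝ) : ℂ))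

/-- The heat operator acting on each component. -/
def heatVec (t : ℝ) : VecDist →ₗ[ℝ] VecDist :=
  LinearMap.pi fun k ↦
    ((heat t : 𝓢'(Plane, ℂ) →ₗ[ℂ] 𝓢'(Plane, ℂ)).restrictScalars ℝ) ∘ₗ LinearMap.proj k

/-- The `L^p` norm of a scalar tempered distribution; it is `∞` if the distribution is not
given by an `L^p` function. -/
def distLpNorm (p : ℝ≥0∞) [Fact (1 ≤ p)] (u : 𝓢'(Plane, ℂ)) : ℝ≥0∞ :=
  ⨅ (f : Lp ℂ p (volume : Measure Plane)) (_ : u = Lp.toTemperedDistribution f), ‖f‖ₑ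

/-- The norm `‖J^s u‖_{L^p} = (∑ₖ ‖J^s uᵏ‖_{L^p}^p)^{1/p}` of the space `H^{s,p}`, for finite `p`;
it is `∞` outside that space. -/
def sobNorm (s : ℝ) (p : ℝ≥0∞) [Fact (1 ≤ p)] (u : VecDist) : ℝ≥0∞ :=
  (∑ k, distLpNorm p (J s (u k)) ^ p.toReal) ^ (1 / p.toReal)

/-- Membership in `H^{s,p}_sol`: the real divergence-free vector distributions
of finite `H^{s,p}` norm. -/
structure MemHsol (s : ℝ) (p : ℝ≥0∞) [Fact (1 ≤ p)] (u : VecDist) : Prop where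
  real : ∀ k, IsRealDist (u k)
  div_free : divergence u = 0
  finite : sobNorm s p u < ∞

instance fact_one_le_four : Fact ((1 : ℝ≥0∞) ≤ 4) := ⟨by norm_num⟩

/-! ### The space `H` of finite energy velocity fields -/

/-- Square integrable vector fields on the plane. -/
abbrev L2Field := Lp Plane 2 (volume : Measure Plane)

/-- A square integrable vector field as a vector of tempered distributions. -/
def toDistL2 : L2Field →ₗ[ℝ] VecDist :=
  LinearMap.pi fun k ↦
    ((Lp.toTemperedDistributionCLM ℂ (volume : Measure Plane) 2 :
        Lp ℂ 2 (volume : Measure Plane) →ₗ[ℂ] 𝓢'(Plane, ℂ)).restrictScalars ℝ) ∘ₗ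
      ((Complex.ofRealCLM ∘L (EuclideanSpace.proj k : Plane →L[ℝ] ℝ)).compLpL 2
        (volume : Measure Plane) : L2Field →ₗ[ℝ] Lp ℂ 2 (volume : Measure Plane))

/-- `H = {v ∈ [L²(ℝ²)]² : div v = 0}` with the scalar product of `[L²(ℝ²)]²`. -/
def HSub : Submodule ℝ L2Field := LinearMap.ker (divergence.restrictScalars ℝ ∘ₗ toDistL2)

/-- The Hilbert space `H`. -/
abbrev HSp := ↥HSub

instance : MeasurableSpace HSp := borel HSp

instance : BorelSpace HSp := ⟨rfl⟩

/-- The embedding of `H` into the vector-valued tempered distributions. -/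
def toDist : HSp →ₗ[ℝ] VecDist := toDistL2 ∘ₗ HSub.subtype

/-! ### Radonifying operators -/

section Radonifying

variable {Y : Type*} [NormedAddCommGroup Y] [InnerProductSpace ℝ Y]

/-- The rank one operator `y' ↦ ⟨y, y'⟩ x`. -/
def rankOne {V : Type*} [AddCommGroup V] [Module ℝ V] (y : Y) (x : V) : Y →ₗ[ℝ] V :=
  LinearMap.smulRight (innerₗ Y y) x

/-- The norm of `γ(Y; H^{s,p})`: the supremum over the finite orthonormal systems `y₁, …, yₙ` of
`(𝔼 ‖∑ᵢ βᵢ R yᵢ‖²_{H^{s,p}})^{1/2}`, where `β₁, …, βₙ` are independent standard Gaussians. -/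
def gammaNorm (s : ℝ) (p : ℝ≥0∞) [Fact (1 ≤ p)] (R : Y →ₗ[ℝ] VecDist) : ℝ≥0∞ :=
  ⨆ (n : ℕ) (y : Fin n → Y) (_ : Orthonormal ℝ y),
    (∫⁻ β, (sobNorm s p (∑ i, β i • R (y i))) ^ 2
      ∂(Measure.pi fun _ : Fin n ↦ gaussianReal 0 1)) ^ (1 / 2 : ℝ)

/-- `R ∈ γ(Y; H^{s,p}_sol)`: the operator `R` takes values in `H^{s,p}_sol` and is a limit, in the
`γ`-norm, of operators of finite rank with values in `H^{s,p}_sol`. -/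
def IsGammaRadonifying (s : ℝ) (p : ℝ≥0∞) [Fact (1 ≤ p)] (R : Y →ₗ[ℝ] VecDist) : Prop :=
  (∀ y, MemHsol s p (R y)) ∧
    ∀ ε : ℝ≥0∞, 0 < ε → ∃ (n : ℕ) (y : Fin n → Y) (x : Fin n → VecDist),
      (∀ i, MemHsol s p (x i)) ∧ gammaNorm s p (R - ∑ i, rankOne (y i) (x i)) < ε

/-- `G` maps `H` into `γ(Y; H^{s,p}_sol)` and is bounded in that space. -/
structure IsBoundedNoise (s : ℝ) (p : ℝ≥0∞) [Fact (1 ≤ p)] (G : HSp → Y →ₗ[ℝ] VecDist) :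
    Prop where
  radonifying : ∀ v, IsGammaRadonifying s p (G v)
  bounded : ⨆ v, gammaNorm s p (G v) < ∞

end Radonifying

/-! ### Cylindrical Wiener process and Itô integral -/

section Stochastic

variable {Ω : Type*} [mΩ : MeasurableSpace Ω] {Y : Type*} [NormedAddCommGroup Y]
  [InnerProductSpace ℝ Y]

/-- `w` is a `Y`-cylindrical Wiener process on the filtered probability space `(Ω, 𝓕, P)`;
`w t y` stands for `⟨w(t), y⟩`. -/
structure IsCylindricalWiener (𝓕 : Filtration ℝ≥0 mΩ) (P : Measure Ω) (w : ℝ≥0 → Y → Ω → ℝ) :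
    Prop where
  adapted : ∀ t y, Measurable[𝓕 t] (w t y)
  zero : ∀ y, ∀ᵐ ω ∂P, w 0 y ω = 0
  linear : ∀ t (a b : ℝ) (y y' : Y), ∀ᵐ ω ∂P, w t (a • y + b • y') ω = a * w t y ω + b * w t y' ω
  law : ∀ s t y, s ≤ t →
    P.map (fun ω ↦ w t y ω - w s y ω) = gaussianReal 0 ((t - s) * ‖y‖₊ ^ 2)
  indep : ∀ s t y, s ≤ t →
    Indep (MeasurableSpace.comap (fun ω ↦ w t y ω - w s y ω) inferInstance) (𝓕 s) P
  continuous : ∀ y, ∀ᵐ ω ∂P, Continuous fun t ↦ w t y ω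

/-- The data of an elementary process `ξ 1_{(a,b]}(s) ⟨y, ·⟩ h` with a bounded
`𝓕 a`-measurable real random variable `ξ`. -/
structure ElemTerm (𝓕 : Filtration ℝ≥0 mΩ) (Y : Type*) where
  a : ℝ≥0
  b : ℝ≥0
  le : a ≤ b
  ξ : Ω → ℝ
  meas : Measurable[𝓕 a] ξ
  bdd : ∃ C, ∀ ω, |ξ ω| ≤ C
  y : Y
  h : HSp

open Classical in
/-- The operator `ξ(ω) 1_{(a,b]}(s) ⟨y, ·⟩ h`. -/
def ElemTerm.op {𝓕 : Filtration ℝ≥0 mΩ} (X : ElemTerm 𝓕 Y) (s : ℝ≥0) (ω : Ω) : Y →ₗ[ℝ] HSp :=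
  if X.a < s ∧ s ≤ X.b then X.ξ ω • rankOne X.y X.h else 0

/-- The integral `∫₀ᵗ ξ 1_{(a,b]}(s) ⟨y, dw(s)⟩ h = ξ ⟨w(b ∧ t) - w(a ∧ t), y⟩ h`. -/
def ElemTerm.integral {𝓕 : Filtration ℝ≥0 mΩ} (X : ElemTerm 𝓕 Y) (w : ℝ≥0 → Y → Ω → ℝ)
    (t : ℝ≥0) (ω : Ω) : HSp :=
  (X.ξ ω * (w (min X.b t) X.y ω - w (min X.a t) X.y ω)) • X.h

/-- `I = ∫₀ᵗ Φ(s) dw(s)`, the Itô integral in `H` of an operator-valued process `Φ` against the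
cylindrical Wiener process `w`: there is a sequence of elementary processes (finite sums of
`ElemTerm`s) converging to `Φ` in `L²(Ω × (0,t); γ(Y; H))` (the `γ`-norm being the
Hilbert-Schmidt norm as `H` is a Hilbert space), whose integrals converge to `I` in `L²(Ω; H)`. -/
def IsItoIntegral (𝓕 : Filtration ℝ≥0 mΩ) (P : Measure Ω) (w : ℝ≥0 → Y → Ω → ℝ) (t : ℝ≥0)
    (Φ : ℝ≥0 → Ω → Y →ₗ[ℝ] VecDist) (I : Ω → HSp) : Prop :=
  AEStronglyMeasurable I P ∧ ∃ (m : ℕ → ℕ) (X : (n : ℕ) → Fin (m n) → ElemTerm 𝓕 Y),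
    Tendsto (fun n ↦ ∫⁻ ω, (∫⁻ s in Set.Ioo (0 : ℝ) t,
        (gammaNorm 0 2 (Φ s.toNNReal ω - toDist ∘ₗ ∑ j, (X n j).op s.toNNReal ω)) ^ 2) ∂P)
      atTop (𝓝 0) ∧
    Tendsto (fun n ↦ ∫⁻ ω, ‖∑ j, (X n j).integral w t ω - I ω‖ₑ ^ 2 ∂P) atTop (𝓝 0)

/-- The stochastic convolution
`ζ(t) = ∫₀ᵗ e^{-(γ+α)(t-s)} e^{-(t-s)A} G(v(s)) dw(s)`, `t ≥ 0`, in a jointly measurable version. -/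
structure IsStochasticConvolution (𝓕 : Filtration ℝ≥0 mΩ) (P : Measure Ω)
    (w : ℝ≥0 → Y → Ω → ℝ) (G : HSp → Y →ₗ[ℝ] VecDist) (v : ℝ≥0 → Ω → HSp) (γ α : ℝ)
    (ζ : ℝ≥0 → Ω → HSp) : Prop where
  measurable : StronglyMeasurable (Function.uncurry ζ)
  eq_integral : ∀ t : ℝ≥0, IsItoIntegral 𝓕 P w t
    (fun s ω ↦ Real.exp (-((γ + α) * ((t : ℝ) - s))) • (heatVec ((t : ℝ) - s) ∘ₗ G (v s ω))) (ζ t)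

end Stochastic

/-! ### The damped Navier-Stokes equation -/

/-- The duality pairing `⟨u, ψ⟩ = ∑ₖ ⟨uᵏ, ψᵏ⟩` (bilinear, without complex conjugation). -/
def pair (u : VecDist) (ψ : Fin 2 → 𝓢(Plane, ℂ)) : ℂ := ∑ k, u k (ψ k)

/-- `⟨A u, ψ⟩` with `A = -Δ`. -/
def pairA (u : VecDist) (ψ : Fin 2 → 𝓢(Plane, ℂ)) : ℂ := pair (fun k ↦ -Laplacian.laplacian (u k)) ψ

/-- `⟨B(u, v), ψ⟩ = -⟨B(u, ψ), v⟩ = -∫ ((u · ∇) ψ) · v dx`. -/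
def pairB (u v : HSp) (ψ : Fin 2 → 𝓢(Plane, ℂ)) : ℂ :=
  -∫ x : Plane, ∑ i : Fin 2, ∑ j : Fin 2,
    (((u : L2Field) x i : ℝ) : ℂ) * (LineDeriv.lineDerivOp (e i) (ψ j)) x *
      (((v : L2Field) x j : ℝ) : ℂ)

/-- `u ∈ C([0,∞); H) ∩ L²_loc([0,∞); H¹)` is the solution of
`du/dt + A u + γ u + B(u + ζ, u + ζ) = α ζ + f`, `u(0) = 0`,
the equation being integrated in time and tested with divergence-free Schwartz fields `ψ`. -/
structure IsSolution (γ α : ℝ) (f : VecDist) (ζ u : ℝ≥0 → HSp) : Prop where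
  continuous : Continuous u
  locally_L2_H1 : ∀ T : ℝ≥0, ∫⁻ t in Set.Ioo (0 : ℝ) T, (sobNorm 1 2 (toDist (u t.toNNReal))) ^ 2 < ∞
  initial : u 0 = 0
  equation : ∀ (t : ℝ≥0) (ψ : Fin 2 → 𝓢(Plane, ℂ)),
    ∑ i, LineDeriv.lineDerivOp (e i) (ψ i) = 0 →
    pair (toDist (u t)) ψ
      + ∫ s in (0 : ℝ)..t, (pairA (toDist (u s.toNNReal)) ψ
          + γ * pair (toDist (u s.toNNReal)) ψ
          + pairB (u s.toNNReal + ζ s.toNNReal) (u s.toNNReal + ζ s.toNNReal) ψ)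
    = ∫ s in (0 : ℝ)..t, (α * pair (toDist (ζ s.toNNReal)) ψ + pair f ψ)

end DampedNS

end

open DampedNS

/-! The mechanism is an energy estimate for log(R + ‖u‖²). When the equation is tested with u, the
worst part of the transport term disappears: z = u + ζ is divergence free, so ∑ ∫ zᵢ ∂ᵢuₖ uₖ = 0
(`integral_transport_eq_zero`) and only terms containing ζ remain. The inequalities of Ladyzhenskaya
and Young absorb these into the dissipation and give (‖u‖²)' ≤ -γ‖u‖² + C(1 + ‖u‖²)‖ζ‖₄⁴ + C(α²‖ζ‖²
+ ‖f‖²), where C depends on γ alone (`exists_energyRate_le`).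

Gronwall's lemma would call for exponential moments of ∫‖ζ‖₄⁴, whereas only moments of order two and
four in space are controlled here. Division by R + ‖u‖² removes the multiplicative growth. As u(0) =
0, the logarithm never ends below its initial value log R, so γ∫‖u‖²/(R + ‖u‖²) is at most the time
integral of C(1 + 1/R)‖ζ‖₄⁴ + (C/R)(α²‖ζ‖² + ‖f‖²) (`exists_lintegral_energy_ratio_le`). The ratio
exceeds 1/2 where ‖u‖² > R, so expectations bound the time average of P(‖u‖ > √R). First α is chosen
to make 𝔼‖ζ(t)‖₄⁴ small uniformly in t; then R, depending on α, makes the remaining terms small.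

Smallness of the noise (`exists_small_noise`): tested with a heat kernel of time δ centred at x,
ζ(t) becomes a scalar Itô integral, whose second and fourth moments are bounded by the isometry and
a Burkholder inequality (`ito_moment_bounds`), both first proved for step processes. The kernel of
J^g e^{-rA} has L¹ norm at most C(1 + 1/r)^{g/2} (`exists_lintegral_enorm_kerJH_le`), so the γ-norms
of G(v) control the square functions in L² and L⁴. After integration in x the bound is a power of ∫
e^{-2(γ+α)r}(1 + 1/r)^g dr times constants; the integral is finite because g < 1 and vanishes as α →
∞. Nothing depends on δ, so Fatou's lemma lets δ tend to 0.

The energy identity (`SpectralData.energy_identity`) is proved frequency by frequency. Tested with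
Fourier transforms of curl fields, the weak equation says that at almost every ξ the transformed
vorticity is the time primitive of an integrable function. The chain rule yields its squared
modulus; division by the symbol of -Δ and integration over ξ give ‖u‖². The products of components
of u + ζ are square integrable in space-time because u and ζ lie in L⁴ there. -/

noncomputable section

namespace DampedNS

/-! ### Moments of Gaussian increments -/

/-- The fourth moment of the standard Gaussian law. -/
def gaussM4 : ℝ := ∫ x, x ^ 4 ∂(gaussianReal 0 1)

lemma gaussM4_nonneg : 0 ≤ gaussM4 := integral_nonneg fun x ↦ by positivity

lemma integrable_pow_gaussianReal (v : ℝ≥0) (n : ℕ) :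
    Integrable (fun x : ℝ ↦ x ^ n) (gaussianReal 0 v) := by
  have h := memLp_id_gaussianReal (μ := 0) (v := v) n
  have h2 := h.integrable_norm_pow'
  refine (integrable_norm_iff (by fun_prop)).1 ?_
  simpa [norm_pow] using h2

lemma integral_pow_three_gaussianReal (v : ℝ≥0) : ∫ x, x ^ 3 ∂(gaussianReal 0 v) = 0 := by
  have h := gaussianReal_map_neg (μ := 0) (v := v)
  have h2 : ∫ x, x ^ 3 ∂(gaussianReal 0 v) = ∫ x, (-x) ^ 3 ∂(gaussianReal 0 v) := by
    conv_lhs => rw [← neg_zero, ← h]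
    rw [integral_map (by fun_prop) (by fun_prop)]
  have h3 : ∫ x, (-x) ^ 3 ∂(gaussianReal 0 v) = - ∫ x, x ^ 3 ∂(gaussianReal 0 v) := by
    rw [← integral_neg]; congr 1; ext x; ring
  linarith

lemma integral_pow_two_gaussianReal (v : ℝ≥0) : ∫ x, x ^ 2 ∂(gaussianReal 0 v) = v := by
  have := variance_fun_id_gaussianReal (μ := 0) (v := v)
  rw [variance_eq_integral (by fun_prop)] at this
  simpa using this

lemma integral_pow_four_gaussianReal (v : ℝ≥0) :
    ∫ x, x ^ 4 ∂(gaussianReal 0 v) = gaussM4 * v ^ 2 := by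
  have h := gaussianReal_map_const_mul (μ := 0) (v := 1) (Real.sqrt v)
  have h1 : (⟨Real.sqrt v ^ 2, sq_nonneg _⟩ : ℝ≥0) * 1 = v := by
    ext; simp
  have h1' : NNReal.mk (Real.sqrt v ^ 2) (sq_nonneg _) * 1 = v := h1
  rw [mul_zero, h1'] at h
  rw [← h, integral_map (by fun_prop) (by fun_prop)]
  simp_rw [mul_pow]
  rw [integral_const_mul, gaussM4, mul_comm]
  congr 1
  have hs : Real.sqrt v ^ 2 = v := Real.sq_sqrt v.2
  rw [show (4 : ℕ) = 2 * 2 from rfl, pow_mul, hs]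

/-! ### Isometry and fourth moments for stochastic integrals of finitely valued step processes. -/

section Ito

set_option linter.unusedSectionVars false

variable {Ω : Type*} [mΩ : MeasurableSpace Ω] {P : Measure Ω} [IsProbabilityMeasure P]
  {𝓕 : Filtration ℝ≥0 mΩ} {Y : Type*} [NormedAddCommGroup Y] [InnerProductSpace ℝ Y]
  {w : ℝ≥0 → Y → Ω → ℝ}

/-- A random variable with finitely many values, each of them taken on an `m`-measurable event. -/
structure IsSimple {Ω Y : Type*} (m : MeasurableSpace Ω) (η : Ω → Y) : Prop where
  finite : (Set.range η).Finite
  meas : ∀ y, MeasurableSet[m] (η ⁻¹' {y})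

namespace IsSimple

variable {Ω Y Y' Y'' : Type*} {m : MeasurableSpace Ω}

/-- Only finitely many fibres occur, so their measurability suffices and no σ-algebra on the target
is needed. -/
lemma measurableSet_preimage {η : Ω → Y} (h : IsSimple m η) (S : Set Y) :
    MeasurableSet[m] (η ⁻¹' S) := by
  have : η ⁻¹' S = ⋃ y ∈ h.finite.toFinset, ⋃ (_ : y ∈ S), η ⁻¹' {y} := by
    ext ω; simp only [Set.mem_preimage, Set.mem_iUnion, Set.mem_singleton_iff, Set.Finite.mem_toFinset]
    exact ⟨fun hω ↦ ⟨η ω, ⟨ω, rfl⟩, hω, rfl⟩, by rintro ⟨_, -, hy, rfl⟩; exact hy⟩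
  rw [this]
  exact Finset.measurableSet_biUnion _ fun y _ ↦ MeasurableSet.iUnion fun _ ↦ h.meas y

lemma comp₂ {η : Ω → Y} {η' : Ω → Y'} (h : IsSimple m η) (h' : IsSimple m η') (F : Y → Y' → Y'') :
    IsSimple m (fun ω ↦ F (η ω) (η' ω)) := by
  refine ⟨((h.finite.prod h'.finite).image fun p ↦ F p.1 p.2).subset ?_, fun y ↦ ?_⟩
  · rintro _ ⟨ω, rfl⟩
    exact ⟨(η ω, η' ω), ⟨⟨ω, rfl⟩, ⟨ω, rfl⟩⟩, rfl⟩
  · have : (fun ω ↦ F (η ω) (η' ω)) ⁻¹' {y} = ⋃ z ∈ h.finite.toFinset,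
        η ⁻¹' {z} ∩ η' ⁻¹' {z' | F z z' = y} := by
      ext ω
      simp only [Set.mem_preimage, Set.mem_iUnion, Set.mem_singleton_iff, Set.Finite.mem_toFinset,
        Set.mem_inter_iff, Set.mem_ofPred_eq]
      exact ⟨fun hω ↦ ⟨η ω, ⟨ω, rfl⟩, rfl, hω⟩, by rintro ⟨_, -, rfl, hy⟩; exact hy⟩
    rw [this]
    exact Finset.measurableSet_biUnion _ fun z _ ↦ (h.meas z).inter (h'.measurableSet_preimage _)

lemma const (y : Y) : IsSimple m (fun _ : Ω ↦ y) :=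
  ⟨(Set.finite_singleton y).subset (by rintro _ ⟨_, rfl⟩; rfl), fun _ ↦ MeasurableSet.const _⟩

lemma comp {η : Ω → Y} (h : IsSimple m η) (F : Y → Y') : IsSimple m (fun ω ↦ F (η ω)) :=
  h.comp₂ (const ()) fun y _ ↦ F y

lemma mono {m' : MeasurableSpace Ω} (hm : m ≤ m') {η : Ω → Y} (h : IsSimple m η) : IsSimple m' η :=
  ⟨h.finite, fun y ↦ hm _ (h.meas y)⟩

lemma measurable {η : Ω → Y} [MeasurableSpace Y] (h : IsSimple m η) : Measurable[m] η :=
  fun S _ ↦ h.measurableSet_preimage S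

lemma sum [AddCommMonoid Y] {ι : Type*} (s : Finset ι) {η : ι → Ω → Y}
    (h : ∀ i ∈ s, IsSimple m (η i)) : IsSimple m (fun ω ↦ ∑ i ∈ s, η i ω) := by
  classical
  induction s using Finset.induction_on with
  | empty => simpa using const 0
  | insert i s hi ih =>
    simp_rw [Finset.sum_insert hi]
    exact (h i (Finset.mem_insert_self _ _)).comp₂
      (ih fun j hj ↦ h j (Finset.mem_insert_of_mem hj)) (· + ·)

lemma bounded {η : Ω → Y} [SeminormedAddCommGroup Y] (h : IsSimple m η) :
    ∃ C : ℝ, 0 ≤ C ∧ ∀ ω, ‖η ω‖ ≤ C := by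
  refine ⟨∑ y ∈ h.finite.toFinset, ‖y‖, by positivity, fun ω ↦ ?_⟩
  exact Finset.single_le_sum (f := fun y ↦ ‖y‖) (fun _ _ ↦ norm_nonneg _) (by simp)

end IsSimple

/-- The increment `⟨w(t) - w(s), η⟩` along a random direction `η`. -/
def incr (w : ℝ≥0 → Y → Ω → ℝ) (s t : ℝ≥0) (η : Ω → Y) (ω : Ω) : ℝ :=
  w t (η ω) ω - w s (η ω) ω

variable (hw : IsCylindricalWiener 𝓕 P w)
include hw

lemma wiener_measurable (t : ℝ≥0) (y : Y) : Measurable (w t y) :=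
  (hw.adapted t y).mono (𝓕.le t) le_rfl

omit hw in
lemma comp_incr_eq_sum {s : ℝ≥0} {η : Ω → Y} (hη : IsSimple (𝓕 s) η) (t : ℝ≥0) (F : ℝ → ℝ) (ω : Ω) :
    F (incr w s t η ω) =
      ∑ y ∈ hη.finite.toFinset, (η ⁻¹' {y}).indicator (fun _ ↦ F (w t y ω - w s y ω)) ω := by
  classical
  rw [Finset.sum_eq_single (η ω)]
  · simp [incr, Set.indicator]
  · intro b _ hb
    simp [Set.indicator, hb.symm]
  · intro h
    simp at h

lemma integral_mul_increment {s t : ℝ≥0} (hst : s ≤ t) (y : Y) {Z : Ω → ℝ}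
    (hZ : Measurable[𝓕 s] Z) (hZi : Integrable Z P) {F : ℝ → ℝ} (hF : Measurable F)
    (hFi : Integrable F (gaussianReal 0 ((t - s) * ‖y‖₊ ^ 2))) :
    Integrable (fun ω ↦ Z ω * F (w t y ω - w s y ω)) P ∧
    ∫ ω, Z ω * F (w t y ω - w s y ω) ∂P
      = (∫ ω, Z ω ∂P) * ∫ x, F x ∂(gaussianReal 0 ((t - s) * ‖y‖₊ ^ 2)) := by
  have hD : Measurable (fun ω ↦ w t y ω - w s y ω) :=
    (wiener_measurable hw t y).sub (wiener_measurable hw s y)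
  have hlaw := hw.law s t y hst
  have hFD : Integrable (fun ω ↦ F (w t y ω - w s y ω)) P := by
    rw [← hlaw] at hFi
    exact (integrable_map_measure hF.aestronglyMeasurable hD.aemeasurable).1 hFi
  have hind : IndepFun Z (fun ω ↦ F (w t y ω - w s y ω)) P := by
    have h := (hw.indep s t y hst).symm
    rw [IndepFun_iff_Indep]
    refine indep_of_indep_of_le_left (indep_of_indep_of_le_right h ?_) ?_
    · rintro _ ⟨S, hS, rfl⟩
      exact ⟨F ⁻¹' S, hF hS, rfl⟩
    · exact hZ.comap_le
  refine ⟨hind.integrable_mul hZi hFD, ?_⟩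
  rw [← hlaw, integral_map hD.aemeasurable hF.aestronglyMeasurable]
  exact hind.integral_fun_mul_eq_mul_integral hZi.aestronglyMeasurable hFD.aestronglyMeasurable

/-- Conditioning on the past: the event splits according to the finitely many values y of η, and for
a fixed y the increment is independent of `𝓕 s` with a Gaussian law of variance (t - s)‖y‖². -/
lemma integral_mul_incr {s t : ℝ≥0} (hst : s ≤ t) {η : Ω → Y} (hη : IsSimple (𝓕 s) η) {Z : Ω → ℝ}
    (hZ : Measurable[𝓕 s] Z) (hZi : Integrable Z P) {F : ℝ → ℝ} (hF : Measurable F)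
    (hFi : ∀ v, Integrable F (gaussianReal 0 v)) :
    Integrable (fun ω ↦ Z ω * F (incr w s t η ω)) P ∧
    ∫ ω, Z ω * F (incr w s t η ω) ∂P
      = ∫ ω, Z ω * (∫ x, F x ∂(gaussianReal 0 ((t - s) * ‖η ω‖₊ ^ 2))) ∂P := by
  have hms : ∀ y, MeasurableSet[𝓕 s] (η ⁻¹' {y}) := hη.meas
  have hms' : ∀ y, MeasurableSet (η ⁻¹' {y}) := fun y ↦ 𝓕.le s _ (hms y)
  have key : ∀ y, Integrable (fun ω ↦ (η ⁻¹' {y}).indicator Z ω * F (w t y ω - w s y ω)) P ∧ _ :=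
    fun y ↦ integral_mul_increment hw hst y (hZ.indicator (hms y)) (hZi.indicator (hms' y)) hF
      (hFi _)
  have e1 : (fun ω ↦ Z ω * F (incr w s t η ω)) = fun ω ↦
      ∑ y ∈ hη.finite.toFinset, (η ⁻¹' {y}).indicator Z ω * F (w t y ω - w s y ω) := by
    ext ω
    rw [comp_incr_eq_sum hη t F, Finset.mul_sum]
    refine Finset.sum_congr rfl fun y _ ↦ ?_
    by_cases h : ω ∈ η ⁻¹' {y} <;> simp [h]
  have e2 : (fun ω ↦ Z ω * (∫ x, F x ∂(gaussianReal 0 ((t - s) * ‖η ω‖₊ ^ 2)))) = fun ω ↦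
      ∑ y ∈ hη.finite.toFinset, (η ⁻¹' {y}).indicator Z ω *
        (∫ x, F x ∂(gaussianReal 0 ((t - s) * ‖y‖₊ ^ 2))) := by
    ext ω
    rw [Finset.sum_eq_single (η ω)]
    · simp
    · intro b _ hb
      simp [Set.indicator, hb.symm]
    · intro h
      simp at h
  rw [e1, e2]
  refine ⟨integrable_finsetSum _ fun y _ ↦ (key y).1, ?_⟩
  rw [integral_finsetSum _ fun y _ ↦ (key y).1, integral_finsetSum _ fun y _ ↦ ?_]
  · refine Finset.sum_congr rfl fun y _ ↦ ?_
    rw [(key y).2, integral_mul_const]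
  · exact (hZi.indicator (hms' y)).mul_const _

lemma incr_measurable {s t : ℝ≥0} (hst : s ≤ t) {η : Ω → Y} (hη : IsSimple (𝓕 s) η) :
    Measurable[𝓕 t] (incr w s t η) := by
  have : incr w s t η = fun ω ↦ ∑ y ∈ hη.finite.toFinset,
      (η ⁻¹' {y}).indicator (fun ω ↦ w t y ω - w s y ω) ω := by
    ext ω
    exact comp_incr_eq_sum hη t id ω
  rw [this]
  refine Finset.measurable_sum _ fun y _ ↦ ?_
  refine Measurable.indicator ?_ (𝓕.mono hst _ (hη.meas y))
  exact (hw.adapted t y).sub ((hw.adapted s y).mono (𝓕.mono hst) le_rfl)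

omit hw in
/-- The stochastic integral of a step process. -/
def stepInt (w : ℝ≥0 → Y → Ω → ℝ) (τ : ℕ → ℝ≥0) (η : ℕ → Ω → Y) (n : ℕ) (ω : Ω) : ℝ :=
  ∑ k ∈ Finset.range n, incr w (τ k) (τ (k + 1)) (η k) ω

omit hw in
/-- The quadratic variation of the stochastic integral of a step process. -/
def stepQ (τ : ℕ → ℝ≥0) (η : ℕ → Ω → Y) (n : ℕ) (ω : Ω) : ℝ :=
  ∑ k ∈ Finset.range n, ((τ (k + 1) - τ k : ℝ≥0) : ℝ) * ‖η k ω‖ ^ 2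

variable {τ : ℕ → ℝ≥0} (hτ : Monotone τ)
include hτ

lemma stepInt_measurable {η : ℕ → Ω → Y} (hη : ∀ k, IsSimple (𝓕 (τ k)) (η k)) (n : ℕ) :
    Measurable[𝓕 (τ n)] (stepInt w τ η n) := by
  unfold stepInt
  refine Finset.measurable_sum _ fun k hk ↦ ?_
  exact (incr_measurable hw (hτ k.le_succ) (hη k)).mono
    (𝓕.mono (hτ (Nat.succ_le_of_lt (Finset.mem_range.1 hk)))) le_rfl

omit hτ in
lemma memLp_incr {s t : ℝ≥0} (hst : s ≤ t) {η : Ω → Y} (hη : IsSimple (𝓕 s) η) :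
    MemLp (incr w s t η) 4 P := by
  have : incr w s t η = fun ω ↦ ∑ y ∈ hη.finite.toFinset,
      (η ⁻¹' {y}).indicator (fun ω ↦ w t y ω - w s y ω) ω := by
    ext ω
    exact comp_incr_eq_sum hη t id ω
  rw [this]
  refine memLp_finsetSum _ fun y _ ↦ MemLp.indicator (𝓕.le s _ (hη.meas y)) ?_
  have h := memLp_id_gaussianReal' (μ := 0) (v := (t - s) * ‖y‖₊ ^ 2) 4 (by norm_num)
  rw [← hw.law s t y hst] at h
  exact (memLp_map_measure_iff (by fun_prop)
    ((wiener_measurable hw t y).sub (wiener_measurable hw s y)).aemeasurable).1 h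

lemma memLp_stepInt {η : ℕ → Ω → Y} (hη : ∀ k, IsSimple (𝓕 (τ k)) (η k)) (n : ℕ) :
    MemLp (stepInt w τ η n) 4 P :=
  memLp_finsetSum _ fun k _ ↦ memLp_incr hw (hτ k.le_succ) (hη k)

omit hw in
lemma stepQ_isSimple {η : ℕ → Ω → Y} (hη : ∀ k, IsSimple (𝓕 (τ k)) (η k)) (n : ℕ) :
    IsSimple (𝓕 (τ n)) (stepQ τ η n) := by
  unfold stepQ
  refine IsSimple.sum _ fun k hk ↦ ?_
  exact ((hη k).mono (𝓕.mono (hτ (Finset.mem_range.1 hk).le))).comp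
    fun y ↦ ((τ (k + 1) - τ k : ℝ≥0) : ℝ) * ‖y‖ ^ 2

omit hw [IsProbabilityMeasure P] hτ in
lemma IsSimple.integrable_mul {s : ℝ≥0} {q : Ω → ℝ} (hq : IsSimple (𝓕 s) q) {f : Ω → ℝ}
    (hf : Integrable f P) : Integrable (fun ω ↦ q ω * f ω) P := by
  obtain ⟨C, -, hC⟩ := hq.bounded
  exact hf.bdd_mul (hq.measurable.mono (𝓕.le s) le_rfl).aestronglyMeasurable (ae_of_all _ hC)

omit hw hτ in
lemma IsSimple.integrable {s : ℝ≥0} {q : Ω → ℝ} (hq : IsSimple (𝓕 s) q) : Integrable q P := by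
  simpa using hq.integrable_mul (integrable_const (1 : ℝ))

omit hw hτ in
lemma integrable_pow_of_memLp_four {f : Ω → ℝ} (hf : MemLp f 4 P) {n : ℕ} (hn : n ≤ 4) :
    Integrable (fun ω ↦ f ω ^ n) P := by
  have h : MemLp f n P := hf.mono_exponent (by exact_mod_cast hn)
  refine (integrable_norm_iff (h.1.pow n)).1 ?_
  simpa [norm_pow] using h.integrable_norm_pow'

/-- The Itô isometry for step processes. -/
lemma integral_stepInt_sq {η : ℕ → Ω → Y} (hη : ∀ k, IsSimple (𝓕 (τ k)) (η k)) (n : ℕ) :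
    ∫ ω, stepInt w τ η n ω ^ 2 ∂P = ∫ ω, stepQ τ η n ω ∂P := by
  induction n with
  | zero => simp [stepInt, stepQ]
  | succ n ih =>
    have hle : τ n ≤ τ (n + 1) := hτ n.le_succ
    set M := stepInt w τ η n with hM
    set W := incr w (τ n) (τ (n + 1)) (η n) with hW
    have hM4 : MemLp M 4 P := memLp_stepInt hw hτ hη n
    have hMm := stepInt_measurable hw hτ hη n
    have hMi := fun {n} ↦ integrable_pow_of_memLp_four (n := n) hM4
    have h1 := integral_mul_incr hw hle (hη n) hMm (by simpa using hMi (n := 1) (by norm_num))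
      (F := fun x ↦ x ^ 1) (by fun_prop) fun v ↦ integrable_pow_gaussianReal v 1
    have h2 := integral_mul_incr hw hle (hη n) (Z := fun _ ↦ 1) measurable_const
      (integrable_const _) (F := fun x ↦ x ^ 2) (by fun_prop) fun v ↦ integrable_pow_gaussianReal v 2
    simp only [one_mul, pow_one, integral_pow_two_gaussianReal, integral_id_gaussianReal,
      mul_zero, integral_zero] at h1 h2
    have e1 : ∀ ω, stepInt w τ η (n + 1) ω ^ 2 = M ω ^ 2 + (2 * (M ω * W ω) + W ω ^ 2) := by
      intro ω
      have : stepInt w τ η (n + 1) ω = M ω + W ω := Finset.sum_range_succ _ _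
      rw [this]; ring
    have e2 : ∀ ω, stepQ τ η (n + 1) ω = stepQ τ η n ω +
        (((τ (n + 1) - τ n) * ‖η n ω‖₊ ^ 2 : ℝ≥0) : ℝ) := by
      intro ω
      simp [stepQ, Finset.sum_range_succ]
    have hq : IsSimple (𝓕 (τ n)) fun ω ↦ (((τ (n + 1) - τ n) * ‖η n ω‖₊ ^ 2 : ℝ≥0) : ℝ) :=
      (hη n).comp fun y ↦ (((τ (n + 1) - τ n) * ‖y‖₊ ^ 2 : ℝ≥0) : ℝ)
    simp_rw [e1, e2]
    rw [integral_add (hMi (n := 2) (by norm_num)) ((h1.1.const_mul _).fun_add h2.1),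
      integral_add (h1.1.const_mul _) h2.1, integral_const_mul, h1.2, h2.2, ih,
      integral_add (stepQ_isSimple hτ hη n).integrable hq.integrable]
    simp

/-- A Burkholder inequality with exponent `4` for step processes, before absorption. -/
lemma integral_stepInt_pow_four_le {η : ℕ → Ω → Y} (hη : ∀ k, IsSimple (𝓕 (τ k)) (η k)) (n : ℕ) :
    ∫ ω, stepInt w τ η n ω ^ 4 ∂P ≤ 6 * ∫ ω, stepQ τ η n ω * stepInt w τ η n ω ^ 2 ∂P
      + gaussM4 * ∫ ω, stepQ τ η n ω ^ 2 ∂P := by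
  induction n with
  | zero => simp [stepInt, stepQ]
  | succ n ih =>
    have hle : τ n ≤ τ (n + 1) := hτ n.le_succ
    set M := stepInt w τ η n with hM
    set Q := stepQ τ η n with hQ
    set W := incr w (τ n) (τ (n + 1)) (η n) with hW
    set q : Ω → ℝ := fun ω ↦ (((τ (n + 1) - τ n) * ‖η n ω‖₊ ^ 2 : ℝ≥0) : ℝ) with hqdef
    have hq : IsSimple (𝓕 (τ n)) q :=
      (hη n).comp fun y ↦ (((τ (n + 1) - τ n) * ‖y‖₊ ^ 2 : ℝ≥0) : ℝ)
    have hQs : IsSimple (𝓕 (τ n)) Q := stepQ_isSimple hτ hη n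
    have hqQ : IsSimple (𝓕 (τ n)) fun ω ↦ Q ω + q ω := hQs.comp₂ hq (· + ·)
    have hM4 : MemLp M 4 P := memLp_stepInt hw hτ hη n
    have hMm := stepInt_measurable hw hτ hη n
    have hMi := fun {n} ↦ integrable_pow_of_memLp_four (n := n) hM4
    have gen := fun (Z : Ω → ℝ) (hZ : Measurable[𝓕 (τ n)] Z) (hZi : Integrable Z P) (j : ℕ) ↦
      integral_mul_incr hw hle (hη n) hZ hZi (F := fun x ↦ x ^ j) (by fun_prop)
        fun v ↦ integrable_pow_gaussianReal v j
    have g1 := gen (fun ω ↦ M ω ^ 3) (hMm.pow_const 3) (hMi (by norm_num)) 1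
    have g2 := gen (fun ω ↦ M ω ^ 2) (hMm.pow_const 2) (hMi (by norm_num)) 2
    have g3 := gen M hMm (by simpa using hMi (n := 1) (by norm_num)) 3
    have g4 := gen (fun _ ↦ 1) measurable_const (integrable_const _) 4
    have k1 := gen (fun ω ↦ (Q ω + q ω) * M ω) (hqQ.measurable.mul hMm)
      (hqQ.integrable_mul (by simpa using hMi (n := 1) (by norm_num))) 1
    have k2 := gen (fun ω ↦ Q ω + q ω) hqQ.measurable hqQ.integrable 2
    simp only [one_mul, pow_one, integral_pow_two_gaussianReal, integral_id_gaussianReal,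
      integral_pow_three_gaussianReal, integral_pow_four_gaussianReal,
      mul_zero, integral_zero] at g1 g2 g3 g4 k1 k2
    have iM4 := hMi (n := 4) le_rfl
    have iQM := hQs.integrable_mul (hMi (n := 2) (by norm_num))
    have iqM := hq.integrable_mul (hMi (n := 2) (by norm_num))
    have iqq : Integrable (fun ω ↦ q ω ^ 2) P := (hq.comp fun x ↦ x ^ 2).integrable
    have iQQ : Integrable (fun ω ↦ Q ω ^ 2) P := (hQs.comp fun x ↦ x ^ 2).integrable
    have iQq : Integrable (fun ω ↦ Q ω * q ω) P := hQs.integrable_mul hq.integrable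
    have eM : ∀ ω, stepInt w τ η (n + 1) ω = M ω + W ω := fun ω ↦ Finset.sum_range_succ _ _
    have eQ : ∀ ω, stepQ τ η (n + 1) ω = Q ω + q ω := fun ω ↦ by
      simp [hQ, stepQ, hqdef, Finset.sum_range_succ]
    have E1 : ∫ ω, stepInt w τ η (n + 1) ω ^ 4 ∂P = ∫ ω, M ω ^ 4 ∂P +
        (6 * ∫ ω, q ω * M ω ^ 2 ∂P + gaussM4 * ∫ ω, q ω ^ 2 ∂P) := by
      have : ∀ ω, stepInt w τ η (n + 1) ω ^ 4 = M ω ^ 4 + (4 * (M ω ^ 3 * W ω) +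
          (6 * (M ω ^ 2 * W ω ^ 2) + (4 * (M ω * W ω ^ 3) + W ω ^ 4))) := fun ω ↦ by
        rw [eM]; ring
      simp_rw [this]
      have a4 := (g3.1.const_mul 4).fun_add g4.1
      have a3 := (g2.1.const_mul 6).fun_add a4
      have a2 := (g1.1.const_mul 4).fun_add a3
      rw [integral_add iM4 a2, integral_add (g1.1.const_mul 4) a3,
        integral_add (g2.1.const_mul 6) a4, integral_add (g3.1.const_mul 4) g4.1]
      simp_rw [integral_const_mul]
      rw [g1.2, g2.2, g3.2, g4.2, integral_const_mul]
      simp only [mul_comm (q _)]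
      simp [hqdef]
    have E2 : ∫ ω, stepQ τ η (n + 1) ω * stepInt w τ η (n + 1) ω ^ 2 ∂P = ∫ ω, Q ω * M ω ^ 2 ∂P +
        (∫ ω, q ω * M ω ^ 2 ∂P + (∫ ω, Q ω * q ω ∂P + ∫ ω, q ω ^ 2 ∂P)) := by
      have : ∀ ω, stepQ τ η (n + 1) ω * stepInt w τ η (n + 1) ω ^ 2 = Q ω * M ω ^ 2 +
          (q ω * M ω ^ 2 + (2 * ((Q ω + q ω) * M ω * W ω) + (Q ω + q ω) * W ω ^ 2)) := fun ω ↦ by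
        rw [eM, eQ]; ring
      simp_rw [this]
      have a3 := (k1.1.const_mul 2).fun_add k2.1
      have a2 := iqM.fun_add a3
      rw [integral_add iQM a2, integral_add iqM a3, integral_add (k1.1.const_mul 2) k2.1,
        integral_const_mul, k1.2, k2.2, ← integral_add iQq iqq]
      simp only [mul_zero, zero_add]
      congr 3
      ext ω
      simp only [hqdef]
      ring
    have E3 : ∫ ω, stepQ τ η (n + 1) ω ^ 2 ∂P = ∫ ω, Q ω ^ 2 ∂P +
        (2 * ∫ ω, Q ω * q ω ∂P + ∫ ω, q ω ^ 2 ∂P) := by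
      have : ∀ ω, stepQ τ η (n + 1) ω ^ 2 = Q ω ^ 2 + (2 * (Q ω * q ω) + q ω ^ 2) := fun ω ↦ by
        rw [eQ]; ring
      simp_rw [this]
      rw [integral_add iQQ ((iQq.const_mul 2).fun_add iqq), integral_add (iQq.const_mul 2) iqq,
        integral_const_mul]
    -- Right side minus left side grows by 6𝔼[Qq] + 6𝔼[q²] + 2·`gaussM4`·𝔼[Qq], all of whose terms
    -- are nonnegative.
    rw [E1, E2, E3]
    have hQ0 : ∀ ω, 0 ≤ Q ω := fun ω ↦ Finset.sum_nonneg fun k _ ↦ by positivity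
    have p1 : 0 ≤ ∫ ω, Q ω * q ω ∂P := integral_nonneg fun ω ↦ mul_nonneg (hQ0 ω) (by positivity)
    have p2 : 0 ≤ ∫ ω, q ω ^ 2 ∂P := integral_nonneg fun ω ↦ by positivity
    have p3 := mul_nonneg gaussM4_nonneg p1
    nlinarith

/-- A Burkholder inequality with exponent `4` for step processes. -/
lemma integral_stepInt_pow_four_le' {η : ℕ → Ω → Y} (hη : ∀ k, IsSimple (𝓕 (τ k)) (η k)) (n : ℕ) :
    ∫ ω, stepInt w τ η n ω ^ 4 ∂P ≤ (36 + 2 * gaussM4) * ∫ ω, stepQ τ η n ω ^ 2 ∂P := by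
  have h := integral_stepInt_pow_four_le hw hτ hη n
  have hM4 : MemLp (stepInt w τ η n) 4 P := memLp_stepInt hw hτ hη n
  have hQs := stepQ_isSimple hτ hη n
  have iQM := hQs.integrable_mul (integrable_pow_of_memLp_four hM4 (n := 2) (by norm_num))
  have iM4 := integrable_pow_of_memLp_four hM4 (n := 4) le_rfl
  have iQQ : Integrable (fun ω ↦ stepQ τ η n ω ^ 2) P := (hQs.comp fun x ↦ x ^ 2).integrable
  -- The weight 1/12 turns the factor 6 into 1/2, so half of the fourth moment, which is finite, is
  -- absorbed on the left; this produces 36 + 2·`gaussM4`.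
  have h2 : ∫ ω, stepQ τ η n ω * stepInt w τ η n ω ^ 2 ∂P ≤
      ∫ ω, ((1 / 12) * stepInt w τ η n ω ^ 4 + 3 * stepQ τ η n ω ^ 2) ∂P := by
    refine integral_mono iQM ((iM4.const_mul _).add (iQQ.const_mul _)) fun ω ↦ ?_
    dsimp only
    nlinarith [sq_nonneg (stepInt w τ η n ω ^ 2 - 6 * stepQ τ η n ω)]
  rw [integral_add (iM4.const_mul _) (iQQ.const_mul _), integral_const_mul, integral_const_mul] at h2
  linarith

end Ito

/-! ### Elementary processes with finitely valued coefficients as step processes on a common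
partition. -/

section Discretization

set_option linter.unusedSectionVars false

variable {Ω : Type*} [mΩ : MeasurableSpace Ω] {P : Measure Ω} [IsProbabilityMeasure P]
  {𝓕 : Filtration ℝ≥0 mΩ} {Y : Type*} [NormedAddCommGroup Y] [InnerProductSpace ℝ Y]
  {w : ℝ≥0 → Y → Ω → ℝ}

open Classical in
/-- A step process. -/
def stepProc (τ : ℕ → ℝ≥0) (η : ℕ → Ω → Y) (n : ℕ) (s : ℝ≥0) (ω : Ω) : Y :=
  ∑ k ∈ Finset.range n, if τ k < s ∧ s ≤ τ (k + 1) then η k ω else 0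

open Classical in
/-- The `Y`-valued process `∑ ξ 1_{(a,b]}(s) y` of a family of elementary terms. -/
def elemProc {m : ℕ} (X : Fin m → ElemTerm 𝓕 Y) (s : ℝ≥0) (ω : Ω) : Y :=
  ∑ j, if (X j).a < s ∧ s ≤ (X j).b then (X j).ξ ω • (X j).y else 0

/-- The scalar stochastic integral of a family of elementary terms. -/
def elemInt {m : ℕ} (w : ℝ≥0 → Y → Ω → ℝ) (X : Fin m → ElemTerm 𝓕 Y) (t : ℝ≥0) (ω : Ω) : ℝ :=
  ∑ j, (X j).ξ ω * (w (min (X j).b t) (X j).y ω - w (min (X j).a t) (X j).y ω)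

lemma stepProc_of_mem {τ : ℕ → ℝ≥0} (hτ : Monotone τ) (η : ℕ → Ω → Y) {n k : ℕ} (hk : k < n)
    {s : ℝ≥0} (h1 : τ k < s) (h2 : s ≤ τ (k + 1)) (ω : Ω) : stepProc τ η n s ω = η k ω := by
  classical
  unfold stepProc
  rw [Finset.sum_eq_single k]
  · simp [h1, h2]
  · intro j _ hj
    rw [if_neg]
    rintro ⟨h3, h4⟩
    rcases lt_or_gt_of_ne hj with h | h
    · exact absurd (h4.trans (hτ h)) (not_le.2 h1)
    · exact absurd (h2.trans (hτ h)) (not_le.2 h3)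
  · intro h
    exact absurd (Finset.mem_range.2 hk) h

lemma exists_step {τ : ℕ → ℝ≥0} (h0 : τ 0 = 0) {n : ℕ} {s : ℝ≥0} (hs : 0 < s)
    (hsn : s ≤ τ n) : ∃ k < n, τ k < s ∧ s ≤ τ (k + 1) := by
  classical
  have hex : ∃ k, s ≤ τ k := ⟨n, hsn⟩
  have h1 := Nat.find_spec hex
  have h2 : Nat.find hex ≤ n := Nat.find_min' hex hsn
  obtain ⟨k, hk⟩ : ∃ k, Nat.find hex = k + 1 := by
    refine Nat.exists_eq_succ_of_ne_zero fun h ↦ ?_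
    rw [h, h0] at h1
    exact absurd h1 (not_le.2 hs)
  refine ⟨k, by omega, ?_, hk ▸ h1⟩
  exact not_le.1 (Nat.find_min hex (by omega))

lemma lintegral_stepProc_sq {τ : ℕ → ℝ≥0} (hτ : Monotone τ) (η : ℕ → Ω → Y)
    (n : ℕ) (ω : Ω) :
    ∫⁻ s in Set.Ioo (0 : ℝ) (τ n), ‖stepProc τ η n s.toNNReal ω‖ₑ ^ 2 =
      ENNReal.ofReal (stepQ τ η n ω) := by
  have e : ∀ s : ℝ, ‖stepProc τ η n s.toNNReal ω‖ₑ ^ 2 = ∑ k ∈ Finset.range n,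
      (Set.Ioc (τ k : ℝ) (τ (k + 1))).indicator (fun _ ↦ ‖η k ω‖ₑ ^ 2) s := by
    intro s
    have hiff : ∀ k, (τ k < s.toNNReal ∧ s.toNNReal ≤ τ (k + 1)) ↔
        s ∈ Set.Ioc (τ k : ℝ) (τ (k + 1)) := fun k ↦ by
      simp [Real.lt_toNNReal_iff_coe_lt, Real.toNNReal_le_iff_le_coe]
    by_cases h : ∃ k < n, τ k < s.toNNReal ∧ s.toNNReal ≤ τ (k + 1)
    · obtain ⟨k, hk, h1, h2⟩ := h
      rw [stepProc_of_mem hτ η hk h1 h2, Finset.sum_eq_single k]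
      · rw [Set.indicator_of_mem ((hiff k).1 ⟨h1, h2⟩)]
      · intro j _ hj
        rw [Set.indicator_of_notMem]
        rw [← hiff]
        rintro ⟨h3, h4⟩
        rcases lt_or_gt_of_ne hj with h | h
        · exact absurd (h4.trans (hτ h)) (not_le.2 h1)
        · exact absurd (h2.trans (hτ h)) (not_le.2 h3)
      · intro h
        exact absurd (Finset.mem_range.2 hk) h
    · push Not at h
      rw [Finset.sum_eq_zero, stepProc, Finset.sum_eq_zero]
      · simp
      · intro k hk
        rw [if_neg]
        exact fun h' ↦ absurd h'.2 (not_le.2 (h k (Finset.mem_range.1 hk) h'.1))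
      · intro k hk
        rw [Set.indicator_of_notMem]
        rw [← hiff]
        exact fun h' ↦ absurd h'.2 (not_le.2 (h k (Finset.mem_range.1 hk) h'.1))
  rw [restrict_Ioo_eq_restrict_Ioc]
  simp_rw [e]
  rw [lintegral_finsetSum _ fun k _ ↦ measurable_const.indicator measurableSet_Ioc, stepQ,
    ENNReal.ofReal_sum_of_nonneg fun k _ ↦ by positivity]
  refine Finset.sum_congr rfl fun k hk ↦ ?_
  rw [lintegral_indicator_const measurableSet_Ioc, Measure.restrict_apply measurableSet_Ioc,
    Set.inter_eq_left.2, Real.volume_Ioc, mul_comm, ENNReal.ofReal_mul (by positivity),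
    NNReal.coe_sub (hτ k.le_succ), ENNReal.ofReal_pow (norm_nonneg _), ofReal_norm]
  exact Set.Ioc_subset_Ioc (τ k).2 (by exact_mod_cast hτ (Finset.mem_range.1 hk))

/-- A telescoping sum. An index k ≥ i passes the test only on a degenerate interval τ k = τ (k + 1),
where the increment vanishes. -/
lemma sum_ite_le_sub {τ : ℕ → ℝ≥0} (hτ : Monotone τ) (W : ℝ≥0 → ℝ) {n i : ℕ} (hi : i ≤ n) :
    ∑ k ∈ Finset.range n, (if τ (k + 1) ≤ τ i then W (τ (k + 1)) - W (τ k) else 0) =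
      W (τ i) - W (τ 0) := by
  rw [← Finset.sum_range_sub (fun k ↦ W (τ k)) i]
  symm
  refine Finset.sum_subset_zero_on_sdiff (Finset.range_subset_range.2 hi) (fun k hk ↦ ?_)
    (fun k hk ↦ ?_)
  · simp only [Finset.mem_sdiff, Finset.mem_range, not_lt] at hk
    split_ifs with h
    · have h1 : τ (k + 1) = τ k := le_antisymm (h.trans (hτ hk.2)) (hτ k.le_succ)
      rw [h1, sub_self]
    · rfl
  · rw [if_pos (hτ (Finset.mem_range.1 hk))]

lemma exists_partition (S : Finset ℝ≥0) {t : ℝ≥0} (h0 : 0 ∈ S) (ht : t ∈ S)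
    (hle : ∀ s ∈ S, s ≤ t) :
    ∃ (n : ℕ) (τ : ℕ → ℝ≥0), Monotone τ ∧ τ 0 = 0 ∧ τ n = t ∧ ∀ s ∈ S, ∃ i ≤ n, τ i = s := by
  have hcard : 0 < S.card := Finset.card_pos.2 ⟨0, h0⟩
  obtain ⟨N, hN⟩ : ∃ N, S.card = N + 1 := ⟨S.card - 1, by omega⟩
  let f := S.orderEmbOfFin hN
  have hf : ∀ s ∈ S, ∃ i, f i = s := fun s hs ↦ by
    have : s ∈ Set.range f := by rw [Finset.range_orderEmbOfFin]; exact hs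
    exact this
  have hfS : ∀ i, f i ∈ S := fun i ↦ Finset.orderEmbOfFin_mem S hN i
  have hτ : ∀ i : Fin (N + 1), f ⟨min (i : ℕ) N, by omega⟩ = f i := fun i ↦ by
    congr 1; ext; simp; omega
  refine ⟨N, fun k ↦ f ⟨min k N, by omega⟩, ?_, ?_, ?_, ?_⟩
  · intro a b hab
    apply f.monotone
    simp only [Fin.mk_le_mk]
    omega
  · obtain ⟨i, hi⟩ := hf 0 h0
    refine le_antisymm ?_ bot_le
    rw [← hi]
    apply f.monotone
    rw [Fin.le_def]; simp
  · obtain ⟨i, hi⟩ := hf t ht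
    refine le_antisymm (hle _ (hfS _)) ?_
    rw [← hi]
    apply f.monotone
    rw [Fin.le_def]; simp; omega
  · intro s hs
    obtain ⟨i, hi⟩ := hf s hs
    exact ⟨i, by omega, by rw [← hi]; exact hτ i⟩

variable (hw : IsCylindricalWiener 𝓕 P w)
include hw

lemma wiener_sum {ι : Type*} (t : ℝ≥0) (s : Finset ι) (c : ι → ℝ) (y : ι → Y) :
    ∀ᵐ ω ∂P, w t (∑ j ∈ s, c j • y j) ω = ∑ j ∈ s, c j * w t (y j) ω := by
  classical
  induction s using Finset.induction_on with
  | empty =>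
    filter_upwards [hw.linear t 0 0 0 0] with ω h
    simpa using h
  | insert i s hi ih =>
    filter_upwards [ih, hw.linear t (c i) 1 (y i) (∑ j ∈ s, c j • y j)] with ω h1 h2
    rw [Finset.sum_insert hi, Finset.sum_insert hi, ← h1]
    simpa using h2

lemma wiener_sum_simple {ι : Type*} [Fintype ι] (t : ℝ≥0) {c : Ω → ι → ℝ}
    (hc : (Set.range c).Finite) (y : ι → Y) :
    ∀ᵐ ω ∂P, w t (∑ j, c ω j • y j) ω = ∑ j, c ω j * w t (y j) ω := by
  have := (ae_ball_iff hc.countable).2 fun c' _ ↦ wiener_sum hw t Finset.univ c' y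
  filter_upwards [this] with ω h
  exact h (c ω) ⟨ω, rfl⟩

lemma incr_sub {r : ℝ≥0} (s t : ℝ≥0) {η η' : Ω → Y} (hη : IsSimple (𝓕 r) η)
    (hη' : IsSimple (𝓕 r) η') :
    ∀ᵐ ω ∂P, incr w s t (fun ω ↦ η ω - η' ω) ω = incr w s t η ω - incr w s t η' ω := by
  have key : ∀ r, ∀ᵐ ω ∂P, ∀ p ∈ (Set.range η) ×ˢ (Set.range η'),
      w r (p.1 - p.2) ω = w r p.1 ω - w r p.2 ω := fun r ↦ by
    refine (ae_ball_iff (hη.finite.prod hη'.finite).countable).2 fun p _ ↦ ?_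
    filter_upwards [hw.linear r 1 (-1) p.1 p.2] with ω h
    simpa [sub_eq_add_neg] using h
  filter_upwards [key s, key t] with ω h1 h2
  have hp : (η ω, η' ω) ∈ (Set.range η) ×ˢ (Set.range η') := ⟨⟨ω, rfl⟩, ⟨ω, rfl⟩⟩
  have e1 := h1 _ hp
  have e2 := h2 _ hp
  simp only [incr] at *
  rw [e1, e2]
  ring

/-- A family of elementary terms with finitely valued coefficients is a step process. -/
lemma exists_step_eq_elem {m : ℕ} (X : Fin m → ElemTerm 𝓕 Y)
    (hX : ∀ j, IsSimple (𝓕 (X j).a) (X j).ξ) (t : ℝ≥0) :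
    ∃ (n : ℕ) (τ : ℕ → ℝ≥0) (η : ℕ → Ω → Y), Monotone τ ∧ τ n = t ∧
      (∀ k, IsSimple (𝓕 (τ k)) (η k)) ∧
      (∀ s ω, 0 < s → s ≤ t → stepProc τ η n s ω = elemProc X s ω) ∧
      ∀ᵐ ω ∂P, stepInt w τ η n ω = elemInt w X t ω := by
  classical
  let S : Finset ℝ≥0 := {0, t} ∪ (Finset.univ.image fun j ↦ min (X j).a t) ∪
    Finset.univ.image fun j ↦ min (X j).b t
  obtain ⟨n, τ, hτ, h0, hn, hS⟩ := exists_partition S (t := t) (by simp [S]) (by simp [S]) (by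
    intro s hs
    simp only [S, Finset.mem_union, Finset.mem_insert, Finset.mem_singleton, Finset.mem_image,
      Finset.mem_univ, true_and] at hs
    rcases hs with ((rfl | rfl) | ⟨j, rfl⟩) | ⟨j, rfl⟩ <;> simp)
  have hA : ∀ j, ∃ i ≤ n, τ i = min (X j).a t := fun j ↦ hS _ (by simp [S])
  have hB : ∀ j, ∃ i ≤ n, τ i = min (X j).b t := fun j ↦ hS _ (by simp [S])
  -- Every endpoint is a partition point, hence an endpoint lying before τ (k + 1) lies at or before
  -- τ k. This gives both adaptedness and constancy on each cell.
  have hstep : ∀ c : ℝ≥0, (∃ i ≤ n, τ i = min c t) → ∀ k, c < τ (k + 1) → k < n → c ≤ τ k := by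
    rintro c ⟨i, hi, hc⟩ k hk hkn
    have hct : c < t := hk.trans_le (hn ▸ hτ (Nat.succ_le_of_lt hkn))
    rw [min_eq_left hct.le] at hc
    rw [← hc] at hk ⊢
    exact hτ (Nat.lt_succ_iff.1 (hτ.reflect_lt hk))
  -- The value on a cell (τ k, τ (k + 1)] is read off at its right end, which belongs to the
  -- half-open cell. Beyond n the value is 0, since `hstep` says nothing there.
  let η : ℕ → Ω → Y := fun k ω ↦ if k < n then
    ∑ j, (if (X j).a < τ (k + 1) ∧ τ (k + 1) ≤ (X j).b then (X j).ξ ω else 0) • (X j).y else 0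
  refine ⟨n, τ, η, hτ, hn, fun k ↦ ?_, fun s ω hs hst ↦ ?_, ?_⟩
  · by_cases hk : k < n
    · simp only [η, hk, if_true]
      refine IsSimple.sum _ fun j _ ↦ ?_
      by_cases h : (X j).a < τ (k + 1) ∧ τ (k + 1) ≤ (X j).b
      · simp only [h, and_self, if_true]
        exact ((hX j).mono (𝓕.mono (hstep _ (hA j) k h.1 hk))).comp fun c ↦ c • (X j).y
      · simp only [h, if_false]
        exact IsSimple.const _
    · simp only [η, hk, if_false]
      exact IsSimple.const _
  · obtain ⟨k, hk, h1, h2⟩ := exists_step h0 hs (hst.trans_eq hn.symm)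
    rw [stepProc_of_mem hτ η hk h1 h2]
    simp only [η, hk, if_true, elemProc]
    refine Finset.sum_congr rfl fun j _ ↦ ?_
    have hiff : ((X j).a < τ (k + 1) ∧ τ (k + 1) ≤ (X j).b) ↔ ((X j).a < s ∧ s ≤ (X j).b) := by
      refine and_congr ⟨fun h ↦ (hstep _ (hA j) k h hk).trans_lt h1, fun h ↦ h.trans_le h2⟩
        ⟨fun h ↦ h2.trans h, fun h ↦ ?_⟩
      by_contra h3
      exact absurd (hstep _ (hB j) k (not_le.1 h3) hk) (not_le.2 (h1.trans_le h))
    by_cases h : (X j).a < s ∧ s ≤ (X j).b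
    · rw [if_pos h, if_pos (hiff.2 h)]
    · rw [if_neg h, if_neg (hiff.not.2 h), zero_smul]
  -- Linearity of w holds almost surely for each fixed combination only; the coefficient vector has
  -- finite range, so finitely many exceptional sets occur.
  · have hc : ∀ k, (Set.range fun ω j ↦
        if (X j).a < τ (k + 1) ∧ τ (k + 1) ≤ (X j).b then (X j).ξ ω else 0).Finite := fun k ↦ by
      refine (Set.Finite.pi' fun j ↦ ((hX j).finite.insert 0)).subset ?_
      rintro _ ⟨ω, rfl⟩ j
      dsimp only
      split_ifs
      · exact Or.inr ⟨ω, rfl⟩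
      · exact Or.inl rfl
    have hlin : ∀ r : ℝ≥0, ∀ᵐ ω ∂P, ∀ k, k < n → w r (η k ω) ω = ∑ j,
        (if (X j).a < τ (k + 1) ∧ τ (k + 1) ≤ (X j).b then (X j).ξ ω else 0) * w r (X j).y ω := by
      intro r
      rw [ae_all_iff]
      intro k
      filter_upwards [wiener_sum_simple hw r (hc k) fun j ↦ (X j).y] with ω h hk
      simpa only [η, hk, if_true] using h
    have hlin' : ∀ᵐ ω ∂P, ∀ i, ∀ k, k < n → w (τ i) (η k ω) ω = ∑ j,
        (if (X j).a < τ (k + 1) ∧ τ (k + 1) ≤ (X j).b then (X j).ξ ω else 0) *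
          w (τ i) (X j).y ω := ae_all_iff.2 fun i ↦ hlin (τ i)
    filter_upwards [hlin'] with ω h
    have e1 : ∀ k ∈ Finset.range n, incr w (τ k) (τ (k + 1)) (η k) ω =
        ∑ j, (X j).ξ ω * (if (X j).a < τ (k + 1) ∧ τ (k + 1) ≤ (X j).b then
          w (τ (k + 1)) (X j).y ω - w (τ k) (X j).y ω else 0) := by
      intro k hk
      rw [incr, h (k + 1) k (Finset.mem_range.1 hk), h k k (Finset.mem_range.1 hk),
        ← Finset.sum_sub_distrib]
      refine Finset.sum_congr rfl fun j _ ↦ ?_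
      split_ifs <;> ring
    rw [stepInt, Finset.sum_congr rfl e1, Finset.sum_comm, elemInt]
    refine Finset.sum_congr rfl fun j _ ↦ ?_
    rw [← Finset.mul_sum]
    congr 1
    obtain ⟨ia, hia, ha⟩ := hA j
    obtain ⟨ib, hib, hb⟩ := hB j
    rw [← ha, ← hb, ← sub_sub_sub_cancel_right _ _ (w (τ 0) (X j).y ω),
      ← sum_ite_le_sub hτ (fun r ↦ w r (X j).y ω) hib,
      ← sum_ite_le_sub hτ (fun r ↦ w r (X j).y ω) hia, ← Finset.sum_sub_distrib]
    refine Finset.sum_congr rfl fun k hk ↦ ?_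
    have hkt : τ (k + 1) ≤ t := hn ▸ hτ (Nat.succ_le_of_lt (Finset.mem_range.1 hk))
    have hab := (X j).le
    rw [ha, hb]
    by_cases h1 : τ (k + 1) ≤ (X j).a
    · have h2 : τ (k + 1) ≤ (X j).b := h1.trans hab
      simp [h1, h2, hkt]
    · by_cases h2 : τ (k + 1) ≤ (X j).b
      · simp [h1, h2, hkt, not_le.1 h1]
      · simp [h1, h2]

end Discretization

/-! ### Rounding of coefficients, truncation of values, and the moment bounds as Lebesgue integrals.
-/

section Approximation

set_option linter.unusedSectionVars false

variable {Ω : Type*} [mΩ : MeasurableSpace Ω] {P : Measure Ω} [IsProbabilityMeasure P]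
  {𝓕 : Filtration ℝ≥0 mΩ} {Y : Type*} [NormedAddCommGroup Y] [InnerProductSpace ℝ Y]
  {w : ℝ≥0 → Y → Ω → ℝ}

lemma enorm_add_sq_le {E : Type*} [NormedAddCommGroup E] (x y : E) :
    ‖x + y‖ₑ ^ 2 ≤ 2 * ‖x‖ₑ ^ 2 + 2 * ‖y‖ₑ ^ 2 := by
  have h : ‖x + y‖ₑ ≤ ‖x‖ₑ + ‖y‖ₑ := enorm_add_le x y
  refine (pow_le_pow_left₀ bot_le h 2).trans ?_
  have := ENNReal.rpow_add_le_mul_rpow_add_rpow ‖x‖ₑ ‖y‖ₑ (p := 2) (by norm_num)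
  rw [← mul_add]
  norm_num at this
  exact_mod_cast this

/-- Rounding down to a multiple of `1 / (l + 1)`. -/
def roundDown (l : ℕ) (x : ℝ) : ℝ := ⌊((l : ℝ) + 1) * x⌋ / ((l : ℝ) + 1)

lemma abs_roundDown_sub_le (l : ℕ) (x : ℝ) : |roundDown l x - x| ≤ 1 / ((l : ℝ) + 1) := by
  have hl : (0 : ℝ) < (l : ℝ) + 1 := by positivity
  have h1 := Int.floor_le (((l : ℝ) + 1) * x)
  have h2 := Int.lt_floor_add_one (((l : ℝ) + 1) * x)
  have : roundDown l x - x = (⌊((l : ℝ) + 1) * x⌋ - ((l : ℝ) + 1) * x) / ((l : ℝ) + 1) := by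
    unfold roundDown; field_simp
  rw [this, abs_div, abs_of_pos hl]
  gcongr
  rw [abs_le]
  constructor <;> linarith

/-- The elementary term with rounded coefficient. -/
def ElemTerm.round (X : ElemTerm 𝓕 Y) (l : ℕ) : ElemTerm 𝓕 Y where
  a := X.a
  b := X.b
  le := X.le
  ξ := fun ω ↦ roundDown l (X.ξ ω)
  meas := by
    unfold roundDown
    exact (measurable_from_top.comp (Int.measurable_floor.comp (X.meas.const_mul _))).div_const _
  bdd := by
    obtain ⟨C, hC⟩ := X.bdd
    refine ⟨C + 1, fun ω ↦ ?_⟩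
    have h1 := abs_roundDown_sub_le l (X.ξ ω)
    have h2 : 1 / ((l : ℝ) + 1) ≤ 1 := by
      rw [div_le_one (by positivity)]; linarith [Nat.cast_nonneg (α := ℝ) l]
    have h3 := abs_sub_abs_le_abs_sub (roundDown l (X.ξ ω)) (X.ξ ω)
    linarith [hC ω]
  y := X.y
  h := X.h

lemma ElemTerm.round_isSimple (X : ElemTerm 𝓕 Y) (l : ℕ) :
    IsSimple (𝓕 X.a) (X.round l).ξ := by
  refine ⟨?_, fun y ↦ (X.round l).meas (measurableSet_singleton y)⟩
  obtain ⟨C, hC⟩ := X.bdd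
  refine ((Set.finite_Icc (⌊-(((l : ℝ) + 1) * C)⌋) ⌊((l : ℝ) + 1) * C⌋).image
    fun k : ℤ ↦ (k : ℝ) / ((l : ℝ) + 1)).subset ?_
  rintro _ ⟨ω, rfl⟩
  have := abs_le.1 (hC ω)
  refine ⟨⌊((l : ℝ) + 1) * X.ξ ω⌋, ⟨Int.floor_le_floor ?_, Int.floor_le_floor ?_⟩, rfl⟩
  · rw [← mul_neg]; gcongr; exact this.1
  · gcongr; exact this.2

lemma elemProc_measurable {m : ℕ} (X : Fin m → ElemTerm 𝓕 Y) :
    StronglyMeasurable fun p : Ω × ℝ ↦ elemProc X p.2.toNNReal p.1 := by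
  classical
  unfold elemProc
  refine Finset.stronglyMeasurable_fun_sum _ fun j _ ↦ ?_
  refine StronglyMeasurable.ite ?_ ?_ stronglyMeasurable_const
  · have : Measurable fun p : Ω × ℝ ↦ p.2.toNNReal := by fun_prop
    have h1 : MeasurableSet {p : Ω × ℝ | (X j).a < p.2.toNNReal} :=
      measurableSet_lt measurable_const this
    have h2 : MeasurableSet {p : Ω × ℝ | p.2.toNNReal ≤ (X j).b} :=
      measurableSet_le this measurable_const
    exact h1.inter h2
  · have : Measurable fun p : Ω × ℝ ↦ (X j).ξ p.1 :=
      ((X j).meas.mono (𝓕.le _) le_rfl).comp measurable_fst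
    exact this.stronglyMeasurable.smul_const _

lemma norm_elemProc_round_sub_le {m : ℕ} (X : Fin m → ElemTerm 𝓕 Y) (l : ℕ) (s : ℝ≥0) (ω : Ω) :
    ‖elemProc (fun j ↦ (X j).round l) s ω - elemProc X s ω‖ ≤
      (1 / ((l : ℝ) + 1)) * ∑ j, ‖(X j).y‖ := by
  classical
  unfold elemProc
  rw [← Finset.sum_sub_distrib, Finset.mul_sum]
  refine (norm_sum_le _ _).trans (Finset.sum_le_sum fun j _ ↦ ?_)
  change ‖(if (X j).a < s ∧ s ≤ (X j).b then roundDown l ((X j).ξ ω) • (X j).y else 0) -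
    (if (X j).a < s ∧ s ≤ (X j).b then (X j).ξ ω • (X j).y else 0)‖ ≤ _
  by_cases h : (X j).a < s ∧ s ≤ (X j).b
  · rw [if_pos h, if_pos h, ← sub_smul, norm_smul]
    gcongr
    exact abs_roundDown_sub_le l _
  · rw [if_neg h, if_neg h, sub_self, norm_zero]
    positivity

lemma abs_elemInt_round_sub_le {m : ℕ} (X : Fin m → ElemTerm 𝓕 Y) (l : ℕ) (t : ℝ≥0) (ω : Ω) :
    |elemInt w (fun j ↦ (X j).round l) t ω - elemInt w X t ω| ≤
      (1 / ((l : ℝ) + 1)) *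
        ∑ j, |w (min (X j).b t) (X j).y ω - w (min (X j).a t) (X j).y ω| := by
  unfold elemInt
  rw [← Finset.sum_sub_distrib, Finset.mul_sum]
  refine (Finset.abs_sum_le_sum_abs _ _).trans (Finset.sum_le_sum fun j _ ↦ ?_)
  simp only [ElemTerm.round]
  rw [← sub_mul, abs_mul]
  gcongr
  exact abs_roundDown_sub_le l _

lemma lintegral_stepInt_sq (hw : IsCylindricalWiener 𝓕 P w) {τ : ℕ → ℝ≥0} (hτ : Monotone τ)
    {η : ℕ → Ω → Y} (hη : ∀ k, IsSimple (𝓕 (τ k)) (η k)) (n : ℕ) :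
    ∫⁻ ω, ‖stepInt w τ η n ω‖ₑ ^ 2 ∂P =
      ∫⁻ ω, (∫⁻ s in Set.Ioo (0 : ℝ) (τ n), ‖stepProc τ η n s.toNNReal ω‖ₑ ^ 2) ∂P := by
  simp_rw [lintegral_stepProc_sq hτ η n]
  have h0 : ∀ ω, 0 ≤ stepQ τ η n ω := fun ω ↦ Finset.sum_nonneg fun k _ ↦ by positivity
  have hM := memLp_stepInt hw hτ hη n
  rw [← ofReal_integral_eq_lintegral_ofReal (stepQ_isSimple hτ hη n).integrable (ae_of_all _ h0),
    ← integral_stepInt_sq hw hτ hη n,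
    ofReal_integral_eq_lintegral_ofReal (integrable_pow_of_memLp_four hM (by norm_num))
      (ae_of_all _ fun ω ↦ sq_nonneg _)]
  refine lintegral_congr fun ω ↦ ?_
  rw [← sq_abs, ENNReal.ofReal_pow (abs_nonneg _), ← Real.norm_eq_abs, ofReal_norm]

lemma lintegral_stepInt_pow_four_le (hw : IsCylindricalWiener 𝓕 P w) {τ : ℕ → ℝ≥0}
    (hτ : Monotone τ) {η : ℕ → Ω → Y} (hη : ∀ k, IsSimple (𝓕 (τ k)) (η k)) (n : ℕ) :
    ∫⁻ ω, ‖stepInt w τ η n ω‖ₑ ^ 4 ∂P ≤ ENNReal.ofReal (36 + 2 * gaussM4) *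
      ∫⁻ ω, (∫⁻ s in Set.Ioo (0 : ℝ) (τ n), ‖stepProc τ η n s.toNNReal ω‖ₑ ^ 2) ^ 2 ∂P := by
  simp_rw [lintegral_stepProc_sq hτ η n]
  have h0 : ∀ ω, 0 ≤ stepQ τ η n ω := fun ω ↦ Finset.sum_nonneg fun k _ ↦ by positivity
  have hM := memLp_stepInt hw hτ hη n
  have hc : 0 ≤ 36 + 2 * gaussM4 := by linarith [gaussM4_nonneg]
  simp_rw [← ENNReal.ofReal_pow (h0 _)]
  rw [← ofReal_integral_eq_lintegral_ofReal
      ((stepQ_isSimple hτ hη n).comp fun x ↦ x ^ 2).integrable (ae_of_all _ fun ω ↦ sq_nonneg _),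
    ← ENNReal.ofReal_mul hc]
  refine le_trans (le_of_eq ?_)
    (ENNReal.ofReal_le_ofReal (integral_stepInt_pow_four_le' hw hτ hη n))
  rw [ofReal_integral_eq_lintegral_ofReal (integrable_pow_of_memLp_four hM (by norm_num))
      (ae_of_all _ fun ω ↦ by positivity)]
  refine lintegral_congr fun ω ↦ ?_
  rw [← (show Even 4 by decide).pow_abs, ENNReal.ofReal_pow (abs_nonneg _), ← Real.norm_eq_abs,
    ofReal_norm]

lemma stepProc_measurable {τ : ℕ → ℝ≥0} {η : ℕ → Ω → Y} (hη : ∀ k, IsSimple (𝓕 (τ k)) (η k))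
    (n : ℕ) : StronglyMeasurable fun p : Ω × ℝ ↦ stepProc τ η n p.2.toNNReal p.1 := by
  classical
  unfold stepProc
  refine Finset.stronglyMeasurable_fun_sum _ fun k _ ↦ ?_
  refine StronglyMeasurable.ite ?_ ?_ stronglyMeasurable_const
  · have : Measurable fun p : Ω × ℝ ↦ p.2.toNNReal := by fun_prop
    have h1 : MeasurableSet {p : Ω × ℝ | τ k < p.2.toNNReal} :=
      measurableSet_lt measurable_const this
    have h2 : MeasurableSet {p : Ω × ℝ | p.2.toNNReal ≤ τ (k + 1)} :=
      measurableSet_le this measurable_const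
    exact h1.inter h2
  · have h1 : StronglyMeasurable (η k) := by
      borelize Y
      exact stronglyMeasurable_iff_measurable_separable.2
        ⟨((hη k).mono (𝓕.le _)).measurable, (hη k).finite.isSeparable⟩
    exact h1.comp_measurable measurable_fst

/-- The truncation sending the vectors of norm `> K` to `0`. -/
def truncate (K : ℝ) (y : Y) : Y := open Classical in if ‖y‖ ≤ K then y else 0

lemma norm_truncate_le {K : ℝ} (hK : 0 ≤ K) (y : Y) : ‖truncate K y‖ ≤ K := by
  unfold truncate; split_ifs with h
  · exact h
  · simpa using hK

/-- A vector y that is cut off has norm above 2K, so it is further from z than K ≥ ‖z‖, the distance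
from 0 to z. -/
lemma norm_truncate_sub_le {K : ℝ} (y z : Y) (hz : ‖z‖ ≤ K) :
    ‖truncate (2 * K) y - z‖ ≤ ‖y - z‖ := by
  unfold truncate; split_ifs with h
  · exact le_rfl
  · rw [zero_sub, norm_neg]
    have := norm_sub_norm_le y z
    linarith [not_le.1 h]

lemma stepProc_truncate {τ : ℕ → ℝ≥0} (hτ : Monotone τ) (η : ℕ → Ω → Y) (n : ℕ) {K : ℝ}
    (hK : 0 ≤ K) (s : ℝ≥0) (ω : Ω) :
    stepProc τ (fun k ω ↦ truncate K (η k ω)) n s ω = truncate K (stepProc τ η n s ω) := by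
  classical
  by_cases h : ∃ k < n, τ k < s ∧ s ≤ τ (k + 1)
  · obtain ⟨k, hk, h1, h2⟩ := h
    rw [stepProc_of_mem hτ _ hk h1 h2, stepProc_of_mem hτ _ hk h1 h2]
  · push Not at h
    have : ∀ η : ℕ → Ω → Y, stepProc τ η n s ω = 0 := fun η ↦ Finset.sum_eq_zero fun k hk ↦ by
      rw [if_neg]
      exact fun h' ↦ absurd h'.2 (not_le.2 (h k (Finset.mem_range.1 hk) h'.1))
    rw [this, this]
    simp [truncate, hK]

end Approximation

/-- Fatou's lemma along a sequence converging in `L²`. -/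
lemma lintegral_comp_le_of_tendsto {α E : Type*} [MeasurableSpace α] {μ : Measure α}
    [NormedAddCommGroup E] {f : ℕ → α → E} {g : α → E} (hf : ∀ n, AEStronglyMeasurable (f n) μ)
    (hg : AEStronglyMeasurable g μ)
    (hfg : Tendsto (fun n ↦ ∫⁻ x, ‖f n x - g x‖ₑ ^ 2 ∂μ) atTop (𝓝 0))
    {Ψ : α → E → ℝ≥0∞} (hΨ : ∀ x, Continuous (Ψ x))
    (hΨm : ∀ n, AEMeasurable (fun x ↦ Ψ x (f n x)) μ) {c : ℕ → ℝ≥0∞} {C : ℝ≥0∞}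
    (hc : ∀ n, ∫⁻ x, Ψ x (f n x) ∂μ ≤ c n) (hC : Tendsto c atTop (𝓝 C)) :
    ∫⁻ x, Ψ x (g x) ∂μ ≤ C := by
  have h1 : Tendsto (fun n ↦ eLpNorm (f n - g) 2 μ) atTop (𝓝 0) := by
    have : Tendsto (fun n ↦ (∫⁻ x, ‖f n x - g x‖ₑ ^ 2 ∂μ) ^ (1 / 2 : ℝ)) atTop
        (𝓝 ((0 : ℝ≥0∞) ^ (1 / 2 : ℝ))) := (ENNReal.continuous_rpow_const.tendsto _).comp hfg
    rw [ENNReal.zero_rpow_of_pos (by norm_num)] at this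
    refine this.congr fun n ↦ ?_
    rw [eLpNorm_eq_lintegral_rpow_enorm_toReal (by norm_num) (by norm_num)]
    simp
  obtain ⟨φ, hφ, hae⟩ :=
    (tendstoInMeasure_of_tendsto_eLpNorm (by norm_num) hf hg h1).exists_seq_tendsto_ae
  calc ∫⁻ x, Ψ x (g x) ∂μ ≤ ∫⁻ x, liminf (fun n ↦ Ψ x (f (φ n) x)) atTop ∂μ := by
        refine lintegral_mono_ae ?_
        filter_upwards [hae] with x hx
        exact (((hΨ x).tendsto _).comp hx).liminf_eq.ge
    _ ≤ liminf (fun n ↦ ∫⁻ x, Ψ x (f (φ n) x) ∂μ) atTop :=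
        lintegral_liminf_le' fun n ↦ hΨm (φ n)
    _ ≤ liminf (fun n ↦ c (φ n)) atTop := liminf_le_liminf (Eventually.of_forall fun n ↦ hc _)
    _ = C := (hC.comp hφ.tendsto_atTop).liminf_eq

/-! ### Passage from step processes to general bounded integrands. -/

section Limit

set_option linter.unusedSectionVars false

variable {Ω : Type*} [mΩ : MeasurableSpace Ω] {P : Measure Ω} [IsProbabilityMeasure P]
  {𝓕 : Filtration ℝ≥0 mΩ} {Y : Type*} [NormedAddCommGroup Y] [InnerProductSpace ℝ Y]
  {w : ℝ≥0 → Y → Ω → ℝ}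

lemma lintegral_lintegral_eq_prod (t : ℝ≥0) {f : Ω × ℝ → ℝ≥0∞}
    (hf : Measurable f) :
    ∫⁻ ω, (∫⁻ s in Set.Ioo (0 : ℝ) t, f (ω, s)) ∂P =
      ∫⁻ p, f p ∂(P.prod (volume.restrict (Set.Ioo (0 : ℝ) t))) :=
  (lintegral_prod _ hf.aemeasurable).symm

lemma elemInt_measurable (hw : IsCylindricalWiener 𝓕 P w) {m : ℕ} (X : Fin m → ElemTerm 𝓕 Y)
    (t : ℝ≥0) : Measurable (elemInt w X t) := by
  unfold elemInt
  refine Finset.measurable_sum _ fun j _ ↦ ?_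
  exact ((X j).meas.mono (𝓕.le _) le_rfl).mul
    ((wiener_measurable hw _ _).sub (wiener_measurable hw _ _))

/-- Rounding to multiples of 1/(l + 1) gives finitely many values and a uniform error. The error of
the integrals is 1/(l + 1) times a fixed sum of Gaussian increments, which is square integrable. -/
lemma exists_simple_approx (hw : IsCylindricalWiener 𝓕 P w) {m : ℕ} (X : Fin m → ElemTerm 𝓕 Y)
    (t : ℝ≥0) {κ : ℝ≥0∞} (hκ : 0 < κ) :
    ∃ X' : Fin m → ElemTerm 𝓕 Y, (∀ j, IsSimple (𝓕 (X' j).a) (X' j).ξ) ∧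
      ∫⁻ ω, ‖elemInt w X' t ω - elemInt w X t ω‖ₑ ^ 2 ∂P ≤ κ ∧
      ∫⁻ ω, (∫⁻ s in Set.Ioo (0 : ℝ) t,
        ‖elemProc X' s.toNNReal ω - elemProc X s.toNNReal ω‖ₑ ^ 2) ∂P ≤ κ := by
  set D : Ω → ℝ := fun ω ↦
    ∑ j, |w (min (X j).b t) (X j).y ω - w (min (X j).a t) (X j).y ω| with hD
  have hDL : MemLp D 2 P := by
    refine memLp_finsetSum _ fun j _ ↦ ?_
    have h := memLp_id_gaussianReal' (μ := 0)
      (v := (min (X j).b t - min (X j).a t) * ‖(X j).y‖₊ ^ 2) 2 (by norm_num)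
    rw [← hw.law _ _ (X j).y (min_le_min_right t (X j).le)] at h
    exact ((memLp_map_measure_iff (by fun_prop)
      ((wiener_measurable hw _ _).sub (wiener_measurable hw _ _)).aemeasurable).1 h).abs
  have hDfin : ∫⁻ ω, ‖D ω‖ₑ ^ 2 ∂P ≠ ∞ := by
    have := hDL.eLpNorm_lt_top
    rw [eLpNorm_lt_top_iff_lintegral_rpow_enorm_lt_top (by norm_num) (by norm_num)] at this
    simpa using this.ne
  set B : ℝ := ∑ j, ‖(X j).y‖
  have hlim0 : Tendsto (fun l : ℕ ↦ ENNReal.ofReal (1 / ((l : ℝ) + 1)) ^ 2) atTop (𝓝 0) := by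
    have h := ENNReal.tendsto_ofReal (tendsto_one_div_add_atTop_nhds_zero_nat (𝕜 := ℝ))
    rw [ENNReal.ofReal_zero] at h
    simpa using ENNReal.Tendsto.pow (n := 2) h
  have hlim : ∀ c : ℝ≥0∞, c ≠ ∞ →
      ∀ᶠ l : ℕ in atTop, ENNReal.ofReal (1 / ((l : ℝ) + 1)) ^ 2 * c ≤ κ := fun c hc ↦ by
    have h := ENNReal.Tendsto.mul_const hlim0 (Or.inr hc)
    rw [zero_mul] at h
    exact h.eventually_le_const hκ
  obtain ⟨l, hl1, hl2⟩ := ((hlim _ hDfin).and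
    (hlim (‖B‖ₑ ^ 2 * ENNReal.ofReal t) (by finiteness))).exists
  refine ⟨fun j ↦ (X j).round l, fun j ↦ (X j).round_isSimple l, ?_, ?_⟩
  · refine le_trans ?_ hl1
    rw [← lintegral_const_mul' _ _ (by finiteness)]
    refine lintegral_mono fun ω ↦ ?_
    rw [← mul_pow]
    refine pow_le_pow_left₀ bot_le ?_ 2
    rw [← ofReal_norm, ← ofReal_norm, ← ENNReal.ofReal_mul (by positivity)]
    refine ENNReal.ofReal_le_ofReal ((abs_elemInt_round_sub_le X l t ω).trans ?_)
    exact mul_le_mul_of_nonneg_left (le_abs_self _) (by positivity)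
  · refine le_trans ?_ hl2
    calc _ ≤ ∫⁻ _ω, (∫⁻ _s in Set.Ioo (0 : ℝ) t,
        ENNReal.ofReal (1 / ((l : ℝ) + 1)) ^ 2 * ‖B‖ₑ ^ 2) ∂P := by
          refine lintegral_mono fun ω ↦ lintegral_mono fun s ↦ ?_
          rw [← mul_pow]
          refine pow_le_pow_left₀ bot_le ?_ 2
          rw [← ofReal_norm, ← ofReal_norm, ← ENNReal.ofReal_mul (by positivity)]
          refine ENNReal.ofReal_le_ofReal ((norm_elemProc_round_sub_le X l _ ω).trans ?_)
          exact mul_le_mul_of_nonneg_left (le_abs_self _) (by positivity)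
      _ = _ := by
        simp [mul_assoc]

/-- A bounded integrand that is approximated by elementary processes is approximated by bounded
step processes, and the integrals have the same limit. -/
lemma exists_bounded_step_approx (hw : IsCylindricalWiener 𝓕 P w) {m : ℕ}
    (X : Fin m → ElemTerm 𝓕 Y) (t : ℝ≥0) {ψ : ℝ → Ω → Y}
    (hψ : StronglyMeasurable fun p : Ω × ℝ ↦ ψ p.2 p.1) {K : ℝ} (hK : 0 ≤ K)
    (hψK : ∀ s ω, ‖ψ s ω‖ ≤ K) {I : Ω → ℝ}
    {κ : ℝ≥0∞} (hκ : 0 < κ)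
    (h1 : ∫⁻ ω, (∫⁻ s in Set.Ioo (0 : ℝ) t, ‖elemProc X s.toNNReal ω - ψ s ω‖ₑ ^ 2) ∂P ≤ κ)
    (h2 : ∫⁻ ω, ‖elemInt w X t ω - I ω‖ₑ ^ 2 ∂P ≤ κ) :
    ∃ (n : ℕ) (τ : ℕ → ℝ≥0) (η : ℕ → Ω → Y), Monotone τ ∧ τ n = t ∧
      (∀ k, IsSimple (𝓕 (τ k)) (η k)) ∧ (∀ k ω, ‖η k ω‖ ≤ 2 * K) ∧
      ∫⁻ ω, (∫⁻ s in Set.Ioo (0 : ℝ) t,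
        ‖stepProc τ η n s.toNNReal ω - ψ s ω‖ₑ ^ 2) ∂P ≤ 4 * κ ∧
      ∫⁻ ω, ‖stepInt w τ η n ω - I ω‖ₑ ^ 2 ∂P ≤ 40 * κ := by
  obtain ⟨X', hX', hX1, hX2⟩ := exists_simple_approx hw X t hκ
  obtain ⟨n, τ, η, hτ, hn, hη, hproc, hint⟩ := exists_step_eq_elem hw X' hX' t
  -- The truncation supplies a pointwise bound on the step process, which the fourth moment
  -- requires; mean-square closeness alone does not control the square of the quadratic variation.
  set η' : ℕ → Ω → Y := fun k ω ↦ truncate (2 * K) (η k ω) with hη'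
  have hη's : ∀ k, IsSimple (𝓕 (τ k)) (η' k) := fun k ↦ (hη k).comp _
  have hds : ∀ k, IsSimple (𝓕 (τ k)) (fun ω ↦ η' k ω - η k ω) := fun k ↦
    (hη's k).comp₂ (hη k) (· - ·)
  have m1 := elemProc_measurable X'
  have m2 := elemProc_measurable X
  have m3 := stepProc_measurable hη n
  have m4 := stepProc_measurable hη's n
  -- the untruncated step process
  have a1 : ∫⁻ ω, (∫⁻ s in Set.Ioo (0 : ℝ) t,
      ‖stepProc τ η n s.toNNReal ω - ψ s ω‖ₑ ^ 2) ∂P ≤ 4 * κ := by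
    have e0 : ∫⁻ ω, (∫⁻ s in Set.Ioo (0 : ℝ) t,
        ‖stepProc τ η n s.toNNReal ω - ψ s ω‖ₑ ^ 2) ∂P ≤
        ∫⁻ ω, (∫⁻ s in Set.Ioo (0 : ℝ) t,
          (2 * ‖elemProc X' s.toNNReal ω - elemProc X s.toNNReal ω‖ₑ ^ 2 +
            2 * ‖elemProc X s.toNNReal ω - ψ s ω‖ₑ ^ 2)) ∂P := by
      refine lintegral_mono fun ω ↦ setLIntegral_mono_ae' measurableSet_Ioo
        (ae_of_all _ fun s hs ↦ ?_)
      have hs0 : 0 < s.toNNReal := by simpa using hs.1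
      have hst : s.toNNReal ≤ t := Real.toNNReal_le_iff_le_coe.2 hs.2.le
      rw [hproc _ _ hs0 hst]
      refine le_trans (le_of_eq ?_) (enorm_add_sq_le _ _)
      congr 2; abel
    refine e0.trans ?_
    have q1 : Measurable fun p : Ω × ℝ ↦
        ‖elemProc X' p.2.toNNReal p.1 - elemProc X p.2.toNNReal p.1‖ₑ ^ 2 :=
      (m1.sub m2).enorm.pow_const 2
    have q2 : Measurable fun p : Ω × ℝ ↦ ‖elemProc X p.2.toNNReal p.1 - ψ p.2 p.1‖ₑ ^ 2 :=
      (m2.sub hψ).enorm.pow_const 2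
    rw [lintegral_lintegral_eq_prod t ((q1.const_mul 2).fun_add (q2.const_mul 2)),
      lintegral_add_left (q1.const_mul _),
      lintegral_const_mul' _ _ (by norm_num), lintegral_const_mul' _ _ (by norm_num),
      ← lintegral_lintegral_eq_prod t q1, ← lintegral_lintegral_eq_prod t q2]
    calc _ ≤ 2 * κ + 2 * κ := by gcongr
      _ = 4 * κ := by ring
  have hle : ∀ s ω, ‖stepProc τ η' n s.toNNReal ω - ψ s ω‖ₑ ^ 2 ≤
      ‖stepProc τ η n s.toNNReal ω - ψ s ω‖ₑ ^ 2 := fun s ω ↦ by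
    refine pow_le_pow_left₀ bot_le ?_ 2
    rw [stepProc_truncate hτ η n (by positivity), ← ofReal_norm, ← ofReal_norm]
    exact ENNReal.ofReal_le_ofReal (norm_truncate_sub_le _ _ (hψK s ω))
  have a2 : ∫⁻ ω, (∫⁻ s in Set.Ioo (0 : ℝ) t,
      ‖stepProc τ η' n s.toNNReal ω - ψ s ω‖ₑ ^ 2) ∂P ≤ 4 * κ :=
    (lintegral_mono fun ω ↦ lintegral_mono fun s ↦ hle s ω).trans a1
  refine ⟨n, τ, η', hτ, hn, hη's, fun k ω ↦ norm_truncate_le (by positivity) _, a2, ?_⟩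
  -- the truncation error, by the isometry
  have hadd : ∀ s ω, stepProc τ (fun k ω ↦ η' k ω - η k ω) n s ω =
      stepProc τ η' n s ω - stepProc τ η n s ω := fun s ω ↦ by
    unfold stepProc
    rw [← Finset.sum_sub_distrib]
    exact Finset.sum_congr rfl fun k _ ↦ by split_ifs <;> simp
  have a3 : ∫⁻ ω, ‖stepInt w τ η' n ω - stepInt w τ η n ω‖ₑ ^ 2 ∂P ≤ 16 * κ := by
    have hae : ∀ᵐ ω ∂P, stepInt w τ (fun k ω ↦ η' k ω - η k ω) n ω =
        stepInt w τ η' n ω - stepInt w τ η n ω := by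
      have := ae_all_iff.2 fun k ↦ incr_sub hw (τ k) (τ (k + 1)) (hη's k) (hη k)
      filter_upwards [this] with ω h
      unfold stepInt
      rw [← Finset.sum_sub_distrib]
      exact Finset.sum_congr rfl fun k _ ↦ h k
    have e1 : ∫⁻ ω, ‖stepInt w τ η' n ω - stepInt w τ η n ω‖ₑ ^ 2 ∂P =
        ∫⁻ ω, ‖stepInt w τ (fun k ω ↦ η' k ω - η k ω) n ω‖ₑ ^ 2 ∂P := by
      refine lintegral_congr_ae ?_
      filter_upwards [hae] with ω h
      rw [h]
    rw [e1, lintegral_stepInt_sq hw hτ hds n, hn]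
    simp_rw [hadd]
    have e2 : ∀ s ω, ‖stepProc τ η' n s.toNNReal ω - stepProc τ η n s.toNNReal ω‖ₑ ^ 2 ≤
        4 * ‖stepProc τ η n s.toNNReal ω - ψ s ω‖ₑ ^ 2 := fun s ω ↦ by
      have h3 := enorm_add_sq_le (stepProc τ η' n s.toNNReal ω - ψ s ω)
        (-(stepProc τ η n s.toNNReal ω - ψ s ω))
      rw [enorm_neg, ← sub_eq_add_neg, sub_sub_sub_cancel_right] at h3
      refine h3.trans ?_
      calc _ ≤ 2 * ‖stepProc τ η n s.toNNReal ω - ψ s ω‖ₑ ^ 2 +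
          2 * ‖stepProc τ η n s.toNNReal ω - ψ s ω‖ₑ ^ 2 := by gcongr 2 * ?_ + _; exact hle s ω
        _ = _ := by ring
    refine (lintegral_mono fun ω ↦ lintegral_mono fun s ↦ e2 s ω).trans ?_
    simp_rw [lintegral_const_mul' (4 : ℝ≥0∞) _ (by norm_num)]
    calc _ ≤ 4 * (4 * κ) := by gcongr
      _ = _ := by ring
  have b1 : AEMeasurable (fun ω ↦ ‖stepInt w τ η' n ω - stepInt w τ η n ω‖ₑ ^ 2) P :=
    (((stepInt_measurable hw hτ hη's n).mono (𝓕.le _) le_rfl).sub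
      ((stepInt_measurable hw hτ hη n).mono (𝓕.le _) le_rfl)).enorm.pow_const 2 |>.aemeasurable
  have b2 : AEMeasurable (fun ω ↦ ‖elemInt w X' t ω - elemInt w X t ω‖ₑ ^ 2) P :=
    ((elemInt_measurable hw X' t).sub (elemInt_measurable hw X t)).enorm.pow_const 2
      |>.aemeasurable
  calc ∫⁻ ω, ‖stepInt w τ η' n ω - I ω‖ₑ ^ 2 ∂P
      ≤ ∫⁻ ω, (2 * ‖stepInt w τ η' n ω - stepInt w τ η n ω‖ₑ ^ 2 +
          (4 * ‖elemInt w X' t ω - elemInt w X t ω‖ₑ ^ 2 +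
            4 * ‖elemInt w X t ω - I ω‖ₑ ^ 2)) ∂P := by
        refine lintegral_mono_ae ?_
        filter_upwards [hint] with ω h
        have c1 := enorm_add_sq_le (stepInt w τ η' n ω - stepInt w τ η n ω)
          (stepInt w τ η n ω - I ω)
        have c2 := enorm_add_sq_le (elemInt w X' t ω - elemInt w X t ω) (elemInt w X t ω - I ω)
        rw [sub_add_sub_cancel] at c1 c2
        refine c1.trans ?_
        rw [h] at *
        gcongr
        calc _ ≤ 2 * (2 * ‖elemInt w X' t ω - elemInt w X t ω‖ₑ ^ 2 +
            2 * ‖elemInt w X t ω - I ω‖ₑ ^ 2) := by gcongr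
          _ = _ := by ring
    _ ≤ 2 * (16 * κ) + (4 * κ + 4 * κ) := by
        rw [lintegral_add_left' (b1.const_mul _), lintegral_add_left' (b2.const_mul _),
          lintegral_const_mul' _ _ (by norm_num), lintegral_const_mul' _ _ (by norm_num),
          lintegral_const_mul' _ _ (by norm_num)]
        gcongr
    _ = 40 * κ := by ring

/-- The constant of the Burkholder inequality with exponent `4`. -/
def burkholderConst : ℝ≥0∞ := 4 * ENNReal.ofReal (36 + 2 * gaussM4)

/-- Moment bounds for the scalar Itô integral of a bounded integrand. -/
theorem ito_moment_bounds (hw : IsCylindricalWiener 𝓕 P w) {m : ℕ → ℕ}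
    (X : (n : ℕ) → Fin (m n) → ElemTerm 𝓕 Y) (t : ℝ≥0) {ψ : ℝ → Ω → Y}
    (hψ : StronglyMeasurable fun p : Ω × ℝ ↦ ψ p.2 p.1) {K : ℝ}
    (hψK : ∀ s ω, ‖ψ s ω‖ ≤ K) {I : Ω → ℝ} (hI : AEStronglyMeasurable I P)
    (h1 : Tendsto (fun n ↦ ∫⁻ ω, (∫⁻ s in Set.Ioo (0 : ℝ) t,
      ‖elemProc (X n) s.toNNReal ω - ψ s ω‖ₑ ^ 2) ∂P) atTop (𝓝 0))
    (h2 : Tendsto (fun n ↦ ∫⁻ ω, ‖elemInt w (X n) t ω - I ω‖ₑ ^ 2 ∂P) atTop (𝓝 0)) :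
    ∫⁻ ω, ‖I ω‖ₑ ^ 2 ∂P ≤ 2 * ∫⁻ ω, (∫⁻ s in Set.Ioo (0 : ℝ) t, ‖ψ s ω‖ₑ ^ 2) ∂P ∧
    ∫⁻ ω, ‖I ω‖ₑ ^ 4 ∂P ≤ burkholderConst *
      ∫⁻ ω, (∫⁻ s in Set.Ioo (0 : ℝ) t, ‖ψ s ω‖ₑ ^ 2) ^ 2 ∂P := by
  obtain ⟨ω₀⟩ := P.nonempty_of_neZero
  have hK : 0 ≤ K := (norm_nonneg _).trans (hψK 0 ω₀)
  set κ : ℕ → ℝ≥0∞ := fun n ↦ ENNReal.ofReal (1 / ((n : ℝ) + 1)) with hκdef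
  have hκpos : ∀ n, 0 < κ n := fun n ↦ ENNReal.ofReal_pos.2 (by positivity)
  have hκlim : Tendsto κ atTop (𝓝 0) := by
    have h := ENNReal.tendsto_ofReal (tendsto_one_div_add_atTop_nhds_zero_nat (𝕜 := ℝ))
    rwa [ENNReal.ofReal_zero] at h
  have hchoose : ∀ n, ∃ (N : ℕ) (τ : ℕ → ℝ≥0) (η : ℕ → Ω → Y), Monotone τ ∧ τ N = t ∧
      (∀ k, IsSimple (𝓕 (τ k)) (η k)) ∧ (∀ k ω, ‖η k ω‖ ≤ 2 * K) ∧
      ∫⁻ ω, (∫⁻ s in Set.Ioo (0 : ℝ) t,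
        ‖stepProc τ η N s.toNNReal ω - ψ s ω‖ₑ ^ 2) ∂P ≤ 4 * κ n ∧
      ∫⁻ ω, ‖stepInt w τ η N ω - I ω‖ₑ ^ 2 ∂P ≤ 40 * κ n := fun n ↦ by
    obtain ⟨j, hj1, hj2⟩ := ((h1.eventually_le_const (hκpos n)).and
      (h2.eventually_le_const (hκpos n))).exists
    exact exists_bounded_step_approx hw (X j) t hψ hK hψK (hκpos n) hj1 hj2
  choose N τ η hτ hN hη hηK hD hE using hchoose
  have hEmeas : ∀ n, AEStronglyMeasurable (stepInt w (τ n) (η n) (N n)) P := fun n ↦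
    ((stepInt_measurable hw (hτ n) (hη n) (N n)).mono (𝓕.le _) le_rfl).aestronglyMeasurable
  have hElim : Tendsto (fun n ↦ ∫⁻ ω, ‖stepInt w (τ n) (η n) (N n) ω - I ω‖ₑ ^ 2 ∂P)
      atTop (𝓝 0) := by
    refine tendsto_of_tendsto_of_tendsto_of_le_of_le tendsto_const_nhds ?_ (fun _ ↦ bot_le) hE
    simpa using ENNReal.Tendsto.const_mul hκlim (Or.inr (by norm_num : (40 : ℝ≥0∞) ≠ ∞))
  -- the pointwise comparison of the quadratic variations
  set Q : Ω → ℝ≥0∞ := fun ω ↦ ∫⁻ s in Set.Ioo (0 : ℝ) t, ‖ψ s ω‖ₑ ^ 2 with hQdef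
  set d : ℕ → Ω → ℝ≥0∞ := fun n ω ↦ ∫⁻ s in Set.Ioo (0 : ℝ) t,
    ‖stepProc (τ n) (η n) (N n) s.toNNReal ω - ψ s ω‖ₑ ^ 2 with hddef
  set Q' : ℕ → Ω → ℝ≥0∞ := fun n ω ↦ ∫⁻ s in Set.Ioo (0 : ℝ) t,
    ‖stepProc (τ n) (η n) (N n) s.toNNReal ω‖ₑ ^ 2 with hQ'def
  have mQ : Measurable Q := by
    have : Measurable fun p : Ω × ℝ ↦ ‖ψ p.2 p.1‖ₑ ^ 2 := hψ.enorm.pow_const 2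
    exact this.lintegral_prod_right'
  have hQ'le : ∀ n ω, Q' n ω ≤ 2 * Q ω + 2 * d n ω := fun n ω ↦ by
    have hm : Measurable fun s ↦ ‖ψ s ω‖ₑ ^ 2 :=
      (hψ.comp_measurable (measurable_const.prodMk measurable_id)).enorm.pow_const 2
    rw [hQdef, hddef, ← lintegral_const_mul' _ _ (by norm_num),
      ← lintegral_const_mul' _ _ (by norm_num), ← lintegral_add_left (hm.const_mul _)]
    refine lintegral_mono fun s ↦ ?_
    have := enorm_add_sq_le (ψ s ω) (stepProc (τ n) (η n) (N n) s.toNNReal ω - ψ s ω)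
    rwa [add_sub_cancel] at this
  set C : ℝ≥0∞ := ENNReal.ofReal ((2 * K) ^ 2) * ENNReal.ofReal t with hCdef
  have hsub : ∀ (f : ℝ → Y), (∀ s, ‖f s‖ ≤ 2 * K) →
      ∫⁻ s in Set.Ioo (0 : ℝ) t, ‖f s‖ₑ ^ 2 ≤ C := fun f hf ↦ by
    calc _ ≤ ∫⁻ _s in Set.Ioo (0 : ℝ) t, ENNReal.ofReal ((2 * K) ^ 2) := by
          refine lintegral_mono fun s ↦ ?_
          rw [ENNReal.ofReal_pow (by positivity), ← ofReal_norm]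
          exact pow_le_pow_left₀ bot_le (ENNReal.ofReal_le_ofReal (hf s)) 2
      _ = C := by simp [hCdef]
  have hQ'C : ∀ n ω, Q' n ω ≤ C := fun n ω ↦ hsub _ fun s ↦ by
    by_cases h : ∃ k < N n, τ n k < s.toNNReal ∧ s.toNNReal ≤ τ n (k + 1)
    · obtain ⟨k, hk, h1, h2⟩ := h
      rw [stepProc_of_mem (hτ n) _ hk h1 h2]
      exact hηK n k ω
    · push Not at h
      rw [stepProc, Finset.sum_eq_zero fun k hk ↦ ?_]
      · simpa using hK
      · rw [if_neg]
        exact fun h' ↦ absurd h'.2 (not_le.2 (h k (Finset.mem_range.1 hk) h'.1))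
  have hQC : ∀ ω, 2 * Q ω ≤ 2 * C := fun ω ↦ by
    gcongr
    exact hsub _ fun s ↦ (hψK s ω).trans (by linarith)
  -- Thanks to the uniform bound C, the squared quadratic variation is controlled by an error linear
  -- in d, whose expectation tends to 0.
  have hQ'sq : ∀ n ω, Q' n ω ^ 2 ≤ 4 * Q ω ^ 2 + 6 * C * d n ω := fun n ω ↦ by
    calc Q' n ω ^ 2 = Q' n ω * Q' n ω := sq _
      _ ≤ Q' n ω * (2 * Q ω + 2 * d n ω) := by gcongr; exact hQ'le n ω
      _ = Q' n ω * (2 * Q ω) + Q' n ω * (2 * d n ω) := by ring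
      _ ≤ (2 * Q ω + 2 * d n ω) * (2 * Q ω) + C * (2 * d n ω) := by
          gcongr
          · exact hQ'le n ω
          · exact hQ'C n ω
      _ = 4 * Q ω ^ 2 + (2 * d n ω * (2 * Q ω) + C * (2 * d n ω)) := by ring
      _ ≤ 4 * Q ω ^ 2 + (2 * d n ω * (2 * C) + C * (2 * d n ω)) := by
          exact add_le_add le_rfl (add_le_add (mul_le_mul' le_rfl (hQC ω)) le_rfl)
      _ = _ := by ring
  have hC : C ≠ ∞ := by finiteness
  constructor
  · refine lintegral_comp_le_of_tendsto hEmeas hI hElim (Ψ := fun _ x ↦ ‖x‖ₑ ^ 2)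
      (fun _ ↦ by fun_prop) (fun n ↦ (hEmeas n).enorm.pow_const 2)
      (c := fun n ↦ 2 * (∫⁻ ω, Q ω ∂P) + 2 * (4 * κ n)) (fun n ↦ ?_) ?_
    · rw [lintegral_stepInt_sq hw (hτ n) (hη n), hN]
      refine (lintegral_mono (hQ'le n)).trans ?_
      rw [lintegral_add_left (mQ.const_mul _), lintegral_const_mul' _ _ (by norm_num),
        lintegral_const_mul' _ _ (by norm_num)]
      gcongr
      exact hD n
    · have := ((ENNReal.Tendsto.const_mul (ENNReal.Tendsto.const_mul hκlim
        (Or.inr (by norm_num : (4 : ℝ≥0∞) ≠ ∞))) (Or.inr (by norm_num : (2 : ℝ≥0∞) ≠ ∞)))).const_add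
          (2 * ∫⁻ ω, Q ω ∂P)
      simpa using this
  · set c₀ := ENNReal.ofReal (36 + 2 * gaussM4) with hc₀
    refine lintegral_comp_le_of_tendsto hEmeas hI hElim (Ψ := fun _ x ↦ ‖x‖ₑ ^ 4)
      (fun _ ↦ by fun_prop) (fun n ↦ (hEmeas n).enorm.pow_const 4)
      (c := fun n ↦ c₀ * (4 * (∫⁻ ω, Q ω ^ 2 ∂P) + 6 * C * (4 * κ n))) (fun n ↦ ?_) ?_
    · refine (lintegral_stepInt_pow_four_le hw (hτ n) (hη n) (N n)).trans ?_
      rw [hN]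
      gcongr
      refine (lintegral_mono (hQ'sq n)).trans ?_
      rw [lintegral_add_left ((mQ.pow_const 2).const_mul _),
        lintegral_const_mul' _ _ (by norm_num), lintegral_const_mul' _ _ (by finiteness)]
      gcongr
      exact hD n
    · have := ENNReal.Tendsto.const_mul (a := c₀) ((ENNReal.Tendsto.const_mul
        (ENNReal.Tendsto.const_mul hκlim
        (Or.inr (by norm_num : (4 : ℝ≥0∞) ≠ ∞))) (Or.inr (by finiteness : 6 * C ≠ ∞))).const_add
          (4 * ∫⁻ ω, Q ω ^ 2 ∂P)) (Or.inr ENNReal.ofReal_ne_top)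
      convert this using 2
      rw [burkholderConst]
      simp only [mul_zero, add_zero]
      ring

end Limit

/-! ### Fourier symbols -/

/-- The symbol `4π²‖ξ‖²` of `-Δ`. -/
def lam (ξ : Plane) : ℝ := 4 * Real.pi ^ 2 * ‖ξ‖ ^ 2

lemma lam_nonneg (ξ : Plane) : 0 ≤ lam ξ := by unfold lam; positivity

@[fun_prop]
lemma continuous_lam : Continuous lam := by unfold lam; fun_prop

/-- The symbol of `J^s`. -/
def symJ (s : ℝ) (ξ : Plane) : ℂ := (((1 + lam ξ) ^ (s / 2) : ℝ) : ℂ)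

/-- The symbol of the heat operator `e^{-rA}`. -/
def symH (r : ℝ) (ξ : Plane) : ℂ := ((Real.exp (-(r * lam ξ)) : ℝ) : ℂ)

lemma J_eq (s : ℝ) : J s = TemperedDistribution.fourierMultiplierCLM ℂ (symJ s) := rfl

lemma heat_eq (r : ℝ) : heat r = TemperedDistribution.fourierMultiplierCLM ℂ (symH r) := by
  unfold heat symH lam
  congr 2
  ext ξ
  congr 3
  ring

lemma symJ_temperate (s : ℝ) : (symJ s).HasTemperateGrowth := by
  have h1 := Function.HasTemperateGrowth.comp (f := fun ξ : Plane ↦ (2 * Real.pi) • ξ)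
    (Function.hasTemperateGrowth_one_add_norm_sq_rpow Plane (s / 2)) (by fun_prop)
  have h2 := Function.Complex.hasTemperateGrowth_ofReal.comp h1
  have h3 : symJ s = Complex.ofReal ∘ (fun x : Plane ↦ (1 + ‖x‖ ^ 2) ^ (s / 2)) ∘
      fun ξ ↦ (2 * Real.pi) • ξ := by
    funext ξ
    simp only [symJ, lam, Function.comp, norm_smul, Real.norm_eq_abs]
    rw [mul_pow, sq_abs]
    congr 4
    ring
  rw [h3]
  exact h2

/-- From 1 + r ≤ eʳ and completion of the square in Nr - cr². -/
lemma one_add_pow_mul_exp_le {c : ℝ} (hc : 0 < c) (N : ℕ) {r : ℝ} (hr : 0 ≤ r) :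
    (1 + r) ^ N * Real.exp (-(c * r ^ 2)) ≤ Real.exp ((N : ℝ) ^ 2 / (4 * c)) := by
  have h1 : (1 + r) ^ N ≤ Real.exp (N * r) := by
    rw [Real.exp_nat_mul]
    exact pow_le_pow_left₀ (by positivity) (by linarith [Real.add_one_le_exp r]) N
  calc _ ≤ Real.exp (N * r) * Real.exp (-(c * r ^ 2)) := by gcongr
    _ = Real.exp (N * r + -(c * r ^ 2)) := (Real.exp_add _ _).symm
    _ ≤ _ := by
      apply Real.exp_le_exp.2
      rw [le_div_iff₀ (by positivity)]
      nlinarith [sq_nonneg ((N : ℝ) - 2 * c * r)]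

/-- The bound for derivatives of a composition exp ∘ f: the derivatives of the quadratic exponent
grow polynomially, and the Gaussian beats every polynomial. The constant C + 1 makes D ≥ 1, so that
D ≤ D^i for i ≥ 1. -/
lemma gaussian_decay {c : ℝ} (hc : 0 < c) (k n : ℕ) :
    ∃ C : ℝ, ∀ x : Plane,
      ‖x‖ ^ k * ‖iteratedFDeriv ℝ n (fun x : Plane ↦ Real.exp (-(c * ‖x‖ ^ 2))) x‖ ≤ C := by
  have hf : Function.HasTemperateGrowth (fun x : Plane ↦ -(c * ‖x‖ ^ 2)) := by fun_prop
  obtain ⟨m, C, hC, hb⟩ := hf.norm_iteratedFDeriv_le_uniform n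
  refine ⟨n.factorial * (C + 1) ^ n * Real.exp (((k + m * n : ℕ) : ℝ) ^ 2 / (4 * c)), fun x ↦ ?_⟩
  have hx : 1 ≤ 1 + ‖x‖ := by linarith [norm_nonneg x]
  have h := norm_iteratedFDeriv_comp_le (g := Real.exp) (f := fun x : Plane ↦ -(c * ‖x‖ ^ 2))
    (n := n) (N := n) Real.contDiff_exp (hf.1.of_le (by exact_mod_cast le_top)) le_rfl x
    (C := Real.exp (-(c * ‖x‖ ^ 2))) (D := (C + 1) * (1 + ‖x‖) ^ m) (fun i _ ↦ ?_) (fun i hi hin ↦ ?_)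
  · calc _ ≤ ‖x‖ ^ k * (n.factorial * Real.exp (-(c * ‖x‖ ^ 2)) * ((C + 1) * (1 + ‖x‖) ^ m) ^ n) := by
          gcongr
          exact h
      _ ≤ (1 + ‖x‖) ^ k *
          (n.factorial * Real.exp (-(c * ‖x‖ ^ 2)) * ((C + 1) * (1 + ‖x‖) ^ m) ^ n) := by
          gcongr
          linarith
      _ = n.factorial * (C + 1) ^ n * ((1 + ‖x‖) ^ (k + m * n) * Real.exp (-(c * ‖x‖ ^ 2))) := by
          rw [mul_pow, ← pow_mul, pow_add]
          ring
      _ ≤ _ := by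
          gcongr
          exact one_add_pow_mul_exp_le hc _ (norm_nonneg x)
  · rw [norm_iteratedFDeriv_eq_norm_iteratedDeriv, iteratedDeriv_eq_iterate, Real.iter_deriv_exp]
    simp
  · have h1 : 1 ≤ (C + 1) * (1 + ‖x‖) ^ m :=
      one_le_mul_of_one_le_of_one_le (by linarith) (one_le_pow₀ hx)
    calc _ ≤ C * (1 + ‖x‖) ^ m := hb i hin x
      _ ≤ (C + 1) * (1 + ‖x‖) ^ m := by gcongr; linarith
      _ ≤ _ := le_self_pow₀ h1 (by omega)

/-- The Gaussian `e^{-r 4π²‖ξ‖²}`, `r > 0`, as a Schwartz function. -/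
def gaussS {r : ℝ} (hr : 0 < r) : 𝓢(Plane, ℂ) :=
  SchwartzMap.postcompCLM (𝕜 := ℝ) Complex.ofRealCLM
    ({ toFun := fun x ↦ Real.exp (-(r * (4 * Real.pi ^ 2) * ‖x‖ ^ 2))
       smooth' := by
        have : ContDiff ℝ ⊤ fun x : Plane ↦ -(r * (4 * Real.pi ^ 2) * ‖x‖ ^ 2) :=
          (contDiff_const.mul (contDiff_norm_sq ℝ)).neg
        exact (Real.contDiff_exp.comp this).of_le le_top
       decay' := fun k n ↦ gaussian_decay (by positivity) k n } : 𝓢(Plane, ℝ))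

lemma gaussS_apply {r : ℝ} (hr : 0 < r) (ξ : Plane) : gaussS hr ξ = symH r ξ := by
  change ((Real.exp (-(r * (4 * Real.pi ^ 2) * ‖ξ‖ ^ 2)) : ℝ) : ℂ) = _
  rw [symH, lam, mul_assoc]

lemma symH_temperate {r : ℝ} (hr : 0 ≤ r) : (symH r).HasTemperateGrowth := by
  rcases hr.eq_or_lt with rfl | h
  · have : symH 0 = fun _ ↦ 1 := by ext; simp [symH]
    rw [this]
    exact Function.HasTemperateGrowth.const _
  · have := (gaussS h).hasTemperateGrowth
    rwa [show (gaussS h : Plane → ℂ) = symH r from funext (gaussS_apply h)] at this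

lemma symH_mul (r s : ℝ) : symH r * symH s = symH (r + s) := by
  ext ξ
  simp only [symH, Pi.mul_apply]
  rw [← Complex.ofReal_mul, ← Real.exp_add]
  ring_nf

/-! ### The heat kernel -/

/-- The heat kernel of the plane. -/
def heatKer (r : ℝ) (z : Plane) : ℝ := (4 * Real.pi * r)⁻¹ * Real.exp (-((4 * r)⁻¹ * ‖z‖ ^ 2))

lemma heatKer_nonneg {r : ℝ} (hr : 0 < r) (z : Plane) : 0 ≤ heatKer r z := by
  unfold heatKer; positivity

lemma fourier_symH {r : ℝ} (hr : 0 < r) (z : Plane) :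
    ∫ ξ, Complex.exp (((-2 * Real.pi * inner ℝ ξ z : ℝ) : ℂ) * Complex.I) * symH r ξ =
      (heatKer r z : ℂ) := by
  have h := fourier_gaussian_innerProductSpace (V := Plane)
    (b := ((4 * Real.pi ^ 2 * r : ℝ) : ℂ)) (by rw [Complex.ofReal_re]; positivity) z
  rw [Real.fourier_eq'] at h
  have e1 : (fun v : Plane ↦ Complex.exp (-((4 * Real.pi ^ 2 * r : ℝ) : ℂ) * (‖v‖ : ℂ) ^ 2)) =
      symH r := by
    ext ξ
    simp only [symH, lam]
    push_cast
    ring_nf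
  simp only [smul_eq_mul] at h
  calc _ = _ := by
        refine integral_congr_ae (ae_of_all _ fun v ↦ ?_)
        simp only
        rw [← congrFun e1 v]
    _ = _ := h
    _ = _ := by
        simp only [heatKer, finrank_euclideanSpace, Fintype.card_fin]
        push_cast
        have hpi : (Real.pi : ℂ) ≠ 0 := by exact_mod_cast Real.pi_ne_zero
        have hr' : (r : ℂ) ≠ 0 := by exact_mod_cast hr.ne'
        rw [div_self (by norm_num : (2 : ℂ) ≠ 0), Complex.cpow_one]
        congr 1
        · field_simp
        · congr 1
          field_simp

lemma integrable_heatKer {r : ℝ} (hr : 0 < r) : Integrable (heatKer r) := by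
  have h := (SchwartzMap.integrable (gaussS (r := (4 * r)⁻¹ / (4 * Real.pi ^ 2)) (by positivity))
    (μ := (volume : Measure Plane))).norm
  refine (h.const_mul (4 * Real.pi * r)⁻¹).congr (ae_of_all _ fun z ↦ ?_)
  simp only [gaussS_apply, symH, lam, heatKer, Complex.norm_real, Real.norm_eq_abs, Real.abs_exp]
  congr 3
  have := Real.pi_ne_zero
  field_simp

lemma integral_heatKer {r : ℝ} (hr : 0 < r) : ∫ z, heatKer r z = 1 := by
  have h := GaussianFourier.integral_rexp_neg_mul_sq_norm (V := Plane) (b := (4 * r)⁻¹)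
    (by positivity)
  unfold heatKer
  simp_rw [← neg_mul]
  rw [integral_const_mul, h]
  simp only [finrank_euclideanSpace, Fintype.card_fin]
  norm_num
  have := Real.pi_ne_zero
  field_simp

/-- The exponential increases with the time and the prefactors differ by the ratio (r + s)/r. -/
lemma heatKer_le {r s : ℝ} (hr : 0 < r) (hs : 0 ≤ s) (z : Plane) :
    heatKer r z ≤ (1 + s / r) * heatKer (r + s) z := by
  unfold heatKer
  have h1 : (1 + s / r) * ((4 * Real.pi * (r + s))⁻¹ * Real.exp (-((4 * (r + s))⁻¹ * ‖z‖ ^ 2))) =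
      (4 * Real.pi * r)⁻¹ * Real.exp (-((4 * (r + s))⁻¹ * ‖z‖ ^ 2)) := by
    have : r + s ≠ 0 := by positivity
    field_simp
  rw [h1]
  gcongr
  linarith

/-- This is |x| = 2x⁺ - x, where the positive part is dominated by means of `heatKer_le`. The right
side has an explicit integral. -/
lemma abs_heatKer_sub_le {r s : ℝ} (hr : 0 < r) (hs : 0 ≤ s) (z : Plane) :
    |heatKer r z - Real.exp (-s) * heatKer (r + s) z| ≤
      2 * (1 + s / r - Real.exp (-s)) * heatKer (r + s) z -
        (heatKer r z - Real.exp (-s) * heatKer (r + s) z) := by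
  have h1 := heatKer_le hr hs z
  have h2 := heatKer_nonneg (r := r + s) (by positivity) z
  have h3 : Real.exp (-s) ≤ 1 := Real.exp_le_one_iff.2 (by linarith)
  have h4 : 0 ≤ s / r := by positivity
  have h5 : 0 ≤ (1 + s / r - Real.exp (-s)) * heatKer (r + s) z := mul_nonneg (by linarith) h2
  rcases abs_cases (heatKer r z - Real.exp (-s) * heatKer (r + s) z) with h | h <;> nlinarith

/-- The bound 2 is the triangle inequality for two kernels of mass at most 1. The bound linear in s
comes from the signed majorant, whose integral is 2s/r + 1 - e⁻ˢ. -/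
lemma integral_abs_heatKer_sub_le {r s : ℝ} (hr : 0 < r) (hs : 0 ≤ s) :
    ∫ z, |heatKer r z - Real.exp (-s) * heatKer (r + s) z| ≤ 2 * min 1 (s * (1 + 1 / r)) := by
  have hrs : 0 < r + s := by positivity
  have i1 := integrable_heatKer hr
  have i2 := integrable_heatKer hrs
  have i3 : Integrable fun z ↦ heatKer r z - Real.exp (-s) * heatKer (r + s) z :=
    i1.sub (i2.const_mul _)
  have h3 : Real.exp (-s) ≤ 1 := Real.exp_le_one_iff.2 (by linarith)
  rw [mul_min_of_nonneg _ _ (by norm_num)]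
  refine le_min ?_ ?_
  · calc _ ≤ ∫ z, (heatKer r z + heatKer (r + s) z) := by
          refine integral_mono i3.abs (i1.add i2) fun z ↦ ?_
          have h1 := heatKer_nonneg hr z
          have h2 := heatKer_nonneg hrs z
          have h4 := Real.exp_pos (-s)
          dsimp only
          rw [abs_le]
          constructor <;> nlinarith
      _ = _ := by rw [integral_add i1 i2, integral_heatKer hr, integral_heatKer hrs]; norm_num
  · calc _ ≤ ∫ z, (2 * (1 + s / r - Real.exp (-s)) * heatKer (r + s) z -
            (heatKer r z - Real.exp (-s) * heatKer (r + s) z)) :=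
          integral_mono i3.abs ((i2.const_mul _).sub i3) (abs_heatKer_sub_le hr hs)
      _ = 2 * (s / r) + (1 - Real.exp (-s)) := by
          rw [integral_sub (i2.const_mul _) i3, integral_sub i1 (i2.const_mul _),
            integral_const_mul, integral_const_mul, integral_heatKer hr, integral_heatKer hrs]
          ring
      _ ≤ _ := by
          have := Real.add_one_le_exp (-s)
          have h5 : s / r = s * (1 / r) := by ring
          rw [h5]
          nlinarith

/-! ### The kernel of `J^g e^{-rA}` -/

/-- Positivity of β gives integrability at infinity, β < 1 gives it at 0. -/
lemma integrableOn_min_mul_rpow {β : ℝ} (h0 : 0 < β) (h1 : β < 1) :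
    IntegrableOn (fun u : ℝ ↦ min 1 u * u ^ (-1 - β)) (Set.Ioi 0) := by
  have hm : Measurable fun u : ℝ ↦ min 1 u * u ^ (-1 - β) := by fun_prop
  rw [← Set.Ioc_union_Ioi_eq_Ioi (zero_le_one (α := ℝ))]
  refine IntegrableOn.union ?_ ?_
  · have h2 := (intervalIntegral.intervalIntegrable_rpow' (a := 0) (b := 1) (r := -β)
      (by linarith)).1
    refine h2.congr_fun (fun u hu ↦ ?_) measurableSet_Ioc
    dsimp only
    rw [min_eq_right hu.2, ← Real.rpow_one_add' hu.1.le (by linarith)]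
    ring_nf
  · have h2 := integrableOn_Ioi_rpow_of_lt (a := -1 - β) (c := 1) (by linarith) one_pos
    refine h2.congr_fun (fun u hu ↦ ?_) measurableSet_Ioi
    dsimp only
    rw [min_eq_left (le_of_lt hu), one_mul]

lemma one_sub_exp_nonneg {u : ℝ} (hu : 0 ≤ u) : 0 ≤ 1 - Real.exp (-u) :=
  sub_nonneg.2 (Real.exp_le_one_iff.2 (by linarith))

lemma one_sub_exp_le_min {u : ℝ} : 1 - Real.exp (-u) ≤ min 1 u :=
  le_min (by linarith [Real.exp_pos (-u)]) (by linarith [Real.add_one_le_exp (-u)])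

lemma integrableOn_one_sub_exp_mul_rpow {β : ℝ} (h0 : 0 < β) (h1 : β < 1) :
    IntegrableOn (fun u : ℝ ↦ (1 - Real.exp (-u)) * u ^ (-1 - β)) (Set.Ioi 0) := by
  refine (integrableOn_min_mul_rpow h0 h1).mono'
    (Measurable.aestronglyMeasurable (by fun_prop))
    ((ae_restrict_iff' measurableSet_Ioi).2 (ae_of_all _ fun u hu ↦ ?_))
  have hu : 0 < u := hu
  rw [Real.norm_eq_abs, abs_of_nonneg (mul_nonneg (one_sub_exp_nonneg hu.le) (by positivity))]
  gcongr
  exact one_sub_exp_le_min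

lemma comp_mul_mul_rpow {β a s : ℝ} (ha : 0 < a) (hs : 0 < s) (h : ℝ → ℝ) :
    h (a * s) * s ^ (-1 - β) = a ^ (1 + β) * (h (a * s) * (a * s) ^ (-1 - β)) := by
  rw [Real.mul_rpow ha.le hs.le]
  have : a ^ (1 + β) * a ^ (-1 - β) = 1 := by
    rw [← Real.rpow_add ha]; ring_nf; exact Real.rpow_zero a
  linear_combination (-(h (a * s) * s ^ (-1 - β))) * this

lemma integral_comp_mul_mul_rpow {β a : ℝ} (ha : 0 < a) (h : ℝ → ℝ) :
    ∫ s in Set.Ioi 0, h (a * s) * s ^ (-1 - β) = a ^ β * ∫ u in Set.Ioi 0, h u * u ^ (-1 - β) := by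
  have h1 := integral_comp_mul_left_Ioi (fun u ↦ h u * u ^ (-1 - β)) 0 ha
  rw [mul_zero] at h1
  rw [setIntegral_congr_fun measurableSet_Ioi fun s hs ↦ comp_mul_mul_rpow ha hs h,
    integral_const_mul, h1, smul_eq_mul, ← mul_assoc, Real.rpow_add ha, Real.rpow_one]
  congr 1
  field_simp

lemma integrableOn_comp_mul_mul_rpow {β a : ℝ} (ha : 0 < a) {h : ℝ → ℝ}
    (hi : IntegrableOn (fun u ↦ h u * u ^ (-1 - β)) (Set.Ioi 0)) :
    IntegrableOn (fun s ↦ h (a * s) * s ^ (-1 - β)) (Set.Ioi 0) := by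
  have h1 := (integrableOn_Ioi_comp_mul_left_iff (fun u ↦ h u * u ^ (-1 - β)) 0 ha).2
    (by rwa [mul_zero])
  have h2 : IntegrableOn (fun s ↦ a ^ (1 + β) * (h (a * s) * (a * s) ^ (-1 - β))) (Set.Ioi 0) :=
    Integrable.const_mul h1 _
  exact h2.congr_fun (fun s hs ↦ (comp_mul_mul_rpow ha hs h).symm) measurableSet_Ioi

/-- The normalising constant in the subordination formula for the fractional powers. -/
def subordConst (β : ℝ) : ℝ := ∫ u in Set.Ioi (0 : ℝ), (1 - Real.exp (-u)) * u ^ (-1 - β)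

lemma subordConst_pos {β : ℝ} (h0 : 0 < β) (h1 : β < 1) : 0 < subordConst β := by
  unfold subordConst
  rw [setIntegral_pos_iff_support_of_nonneg_ae _ (integrableOn_one_sub_exp_mul_rpow h0 h1)]
  · have : Set.Ioi (0 : ℝ) ⊆
        (Function.support fun u : ℝ ↦ (1 - Real.exp (-u)) * u ^ (-1 - β)) ∩ Set.Ioi 0 := by
      intro u hu
      have hu : 0 < u := hu
      refine ⟨?_, hu⟩
      have h2 : Real.exp (-u) < 1 := Real.exp_lt_one_iff.2 (by linarith)
      have h3 : 0 < u ^ (-1 - β) := by positivity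
      exact (mul_pos (by linarith) h3).ne'
    refine lt_of_lt_of_le ?_ (measure_mono this)
    simp
  · refine (ae_restrict_iff' measurableSet_Ioi).2 (ae_of_all _ fun u hu ↦ ?_)
    have hu : 0 < u := hu
    exact mul_nonneg (one_sub_exp_nonneg hu.le) (by positivity)

/-- The symbol of `J^g e^{-rA}` as a Schwartz function. -/
def symJH (g : ℝ) {r : ℝ} (hr : 0 < r) : 𝓢(Plane, ℂ) :=
  SchwartzMap.smulLeftCLM ℂ (symJ g) (gaussS hr)

lemma symJH_apply (g : ℝ) {r : ℝ} (hr : 0 < r) (ξ : Plane) :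
    symJH g hr ξ = symJ g ξ * symH r ξ := by
  rw [symJH, SchwartzMap.smulLeftCLM_apply_apply (symJ_temperate g), gaussS_apply, smul_eq_mul]

/-- The kernel of `J^g e^{-rA}`. -/
def kerJH (g : ℝ) {r : ℝ} (hr : 0 < r) : 𝓢(Plane, ℂ) := FourierTransform.fourier (symJH g hr)

/-- Subordination: a^β is a constant times ∫ (1 - e^{-as}) s^{-1-β} ds, used with a = 1 + `lam ξ`
and β = g/2. It writes J^g e^{-rA} as a superposition of differences of heat operators, whose
kernels are explicit. -/
lemma symJ_mul_symH_eq {g : ℝ} (h0 : 0 < g) (h1 : g < 2) (r : ℝ) (ξ : Plane) :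
    symJ g ξ * symH r ξ = ((subordConst (g / 2))⁻¹ : ℝ) * ∫ s in Set.Ioi (0 : ℝ),
      ((s ^ (-1 - g / 2) : ℝ) : ℂ) * (symH r ξ - (Real.exp (-s) : ℝ) * symH (r + s) ξ) := by
  have h2 : ∀ s : ℝ, ((s ^ (-1 - g / 2) : ℝ) : ℂ) *
      (symH r ξ - (Real.exp (-s) : ℝ) * symH (r + s) ξ) =
      (((1 - Real.exp (-((1 + lam ξ) * s))) * s ^ (-1 - g / 2) : ℝ) : ℂ) * symH r ξ := by
    intro s
    rw [← symH_mul, Pi.mul_apply]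
    have h3 : symH s ξ * (Real.exp (-s) : ℝ) = (Real.exp (-((1 + lam ξ) * s)) : ℝ) := by
      rw [symH, ← Complex.ofReal_mul, ← Real.exp_add]
      ring_nf
    push_cast at h3 ⊢
    linear_combination (-(symH r ξ * ((s ^ (-1 - g / 2) : ℝ) : ℂ))) * h3
  simp_rw [h2]
  rw [integral_mul_const, integral_complex_ofReal,
    integral_comp_mul_mul_rpow (by linarith [lam_nonneg ξ]) fun u ↦ 1 - Real.exp (-u)]
  rw [← subordConst, symJ, ← mul_assoc, ← Complex.ofReal_mul]
  congr 2
  have := (subordConst_pos (β := g / 2) (by linarith) (by linarith)).ne'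
  field_simp

lemma norm_symH_sub (r : ℝ) {s : ℝ} (hs : 0 < s) (ξ : Plane) (β : ℝ) :
    ‖((s ^ (-1 - β) : ℝ) : ℂ) * (symH r ξ - (Real.exp (-s) : ℝ) * symH (r + s) ξ)‖ =
      (1 - Real.exp (-((1 + lam ξ) * s))) * s ^ (-1 - β) * Real.exp (-(r * lam ξ)) := by
  have h1 := one_sub_exp_nonneg (u := (1 + lam ξ) * s)
    (mul_nonneg (by linarith [lam_nonneg ξ]) hs.le)
  have h2 : ((s ^ (-1 - β) : ℝ) : ℂ) * (symH r ξ - (Real.exp (-s) : ℝ) * symH (r + s) ξ) =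
      (((1 - Real.exp (-((1 + lam ξ) * s))) * s ^ (-1 - β) * Real.exp (-(r * lam ξ)) : ℝ) : ℂ) := by
    have h3 : Real.exp (-s) * Real.exp (-((r + s) * lam ξ)) =
        Real.exp (-((1 + lam ξ) * s)) * Real.exp (-(r * lam ξ)) := by
      rw [← Real.exp_add, ← Real.exp_add]; ring_nf
    simp only [symH]
    rw [← Complex.ofReal_mul, h3]
    push_cast
    ring
  rw [h2, Complex.norm_real, Real.norm_eq_abs, abs_of_nonneg (by positivity)]

/-- Up to the power of s the integrand is real and nonnegative, so the integral of its modulus in s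
is again given by subordination and equals a constant times the Schwartz function |`symJH`|. -/
lemma integrable_subord {g : ℝ} (h0 : 0 < g) (h1 : g < 2) {r : ℝ} (hr : 0 < r) :
    Integrable (fun p : Plane × ℝ ↦ ((p.2 ^ (-1 - g / 2) : ℝ) : ℂ) *
      (symH r p.1 - (Real.exp (-p.2) : ℝ) * symH (r + p.2) p.1))
      ((volume : Measure Plane).prod (volume.restrict (Set.Ioi 0))) := by
  have hm : Measurable fun p : Plane × ℝ ↦ ((p.2 ^ (-1 - g / 2) : ℝ) : ℂ) *
      (symH r p.1 - (Real.exp (-p.2) : ℝ) * symH (r + p.2) p.1) := by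
    unfold symH; fun_prop
  have hi := integrableOn_one_sub_exp_mul_rpow (β := g / 2) (by linarith) (by linarith)
  rw [integrable_prod_iff hm.aestronglyMeasurable]
  have h2 (ξ : Plane) := integrableOn_comp_mul_mul_rpow (a := 1 + lam ξ)
    (by linarith [lam_nonneg ξ]) hi
  have h3 (ξ : Plane) : ∫ s in Set.Ioi (0 : ℝ), ‖((s ^ (-1 - g / 2) : ℝ) : ℂ) *
      (symH r ξ - (Real.exp (-s) : ℝ) * symH (r + s) ξ)‖ =
      subordConst (g / 2) * ‖symJH g hr ξ‖ := by
    rw [setIntegral_congr_fun measurableSet_Ioi fun s hs ↦ norm_symH_sub r hs ξ _]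
    rw [integral_mul_const,
      integral_comp_mul_mul_rpow (by linarith [lam_nonneg ξ]) fun u ↦ 1 - Real.exp (-u),
      ← subordConst, symJH_apply, norm_mul, symJ, symH, Complex.norm_real, Complex.norm_real,
      Real.norm_eq_abs, Real.norm_eq_abs, Real.abs_exp, abs_of_nonneg]
    · ring
    · have := lam_nonneg ξ
      positivity
  refine ⟨ae_of_all _ fun ξ ↦ ?_, ?_⟩
  · refine ((h2 ξ).mul_const (Real.exp (-(r * lam ξ)))).mono'
      (hm.comp measurable_prodMk_left).aestronglyMeasurable
      ((ae_restrict_iff' measurableSet_Ioi).2 (ae_of_all _ fun s hs ↦ ?_))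
    exact (norm_symH_sub r hs ξ _).le
  · simp_rw [h3]
    exact (SchwartzMap.integrable (symJH g hr)).norm.const_mul _

lemma integrable_symH {r : ℝ} (hr : 0 < r) : Integrable (symH r) := by
  rw [← funext (gaussS_apply hr)]
  exact SchwartzMap.integrable _

lemma kerJH_eq {g : ℝ} (h0 : 0 < g) (h1 : g < 2) {r : ℝ} (hr : 0 < r) (z : Plane) :
    kerJH g hr z = ((subordConst (g / 2))⁻¹ : ℝ) * ∫ s in Set.Ioi (0 : ℝ),
      ((s ^ (-1 - g / 2) * (heatKer r z - Real.exp (-s) * heatKer (r + s) z) : ℝ) : ℂ) := by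
  have hI : Integrable (Function.uncurry fun (ξ : Plane) (s : ℝ) ↦
      Complex.exp (((-2 * Real.pi * inner ℝ ξ z : ℝ) : ℂ) * Complex.I) *
      (((s ^ (-1 - g / 2) : ℝ) : ℂ) * (symH r ξ - (Real.exp (-s) : ℝ) * symH (r + s) ξ)))
      ((volume : Measure Plane).prod (volume.restrict (Set.Ioi 0))) := by
    refine (integrable_subord h0 h1 hr).norm.mono' ?_ (ae_of_all _ fun p ↦ ?_)
    · refine Measurable.aestronglyMeasurable ?_
      unfold symH; fun_prop
    · rw [Function.uncurry_def, norm_mul, Complex.norm_exp_ofReal_mul_I, one_mul]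
  rw [kerJH, SchwartzMap.fourier_coe, Real.fourier_eq']
  simp_rw [smul_eq_mul, symJH_apply, symJ_mul_symH_eq h0 h1]
  simp_rw [mul_left_comm (Complex.exp _), ← integral_const_mul (Complex.exp _)]
  rw [integral_const_mul, integral_integral_swap hI]
  congr 1
  refine setIntegral_congr_fun measurableSet_Ioi fun s hs ↦ ?_
  have hs : 0 < s := hs
  have e1 := fourier_symH hr z
  have e2 := fourier_symH (r := r + s) (by positivity) z
  have hn (t : ℝ) (ht : 0 < t) : Integrable fun ξ : Plane ↦
      Complex.exp (((-2 * Real.pi * inner ℝ ξ z : ℝ) : ℂ) * Complex.I) * symH t ξ := by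
    refine (integrable_symH ht).norm.mono' ?_ (ae_of_all _ fun p ↦ ?_)
    · refine Measurable.aestronglyMeasurable ?_
      unfold symH; fun_prop
    · rw [norm_mul, Complex.norm_exp_ofReal_mul_I, one_mul]
  push_cast
  rw [← e1, ← e2, ← integral_const_mul, ← integral_sub (hn r hr) ((hn _ (by positivity)).const_mul _),
    ← integral_const_mul]
  congr 1
  ext ξ
  push_cast
  ring

/-- Tonelli's theorem reduces the claim to ∫ min(1, as) s^{-1-g/2} ds with a = 1 + 1/r, which scales
like a^{g/2}. The summand 1 in the constant only makes it visibly positive. -/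
lemma exists_lintegral_enorm_kerJH_le {g : ℝ} (h0 : 0 < g) (h1 : g < 2) :
    ∃ C : ℝ, 0 < C ∧ ∀ (r : ℝ) (hr : 0 < r),
      ∫⁻ z, ‖kerJH g hr z‖ₑ ≤ ENNReal.ofReal (C * (1 + 1 / r) ^ (g / 2)) := by
  have hc := subordConst_pos (β := g / 2) (by linarith) (by linarith)
  have hi := integrableOn_min_mul_rpow (β := g / 2) (by linarith) (by linarith)
  set D := ∫ u in Set.Ioi (0 : ℝ), min 1 u * u ^ (-1 - g / 2)
  have hD : 0 ≤ D := setIntegral_nonneg measurableSet_Ioi fun u hu ↦ by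
    have hu : 0 < u := hu
    positivity
  refine ⟨(subordConst (g / 2))⁻¹ * 2 * D + 1, by positivity, fun r hr ↦ ?_⟩
  have ha : 0 < 1 + 1 / r := by positivity
  have hm : Measurable fun p : Plane × ℝ ↦
      ‖(((subordConst (g / 2))⁻¹ * (p.2 ^ (-1 - g / 2) *
      (heatKer r p.1 - Real.exp (-p.2) * heatKer (r + p.2) p.1)) : ℝ) : ℂ)‖ₑ := by
    unfold heatKer; fun_prop
  calc ∫⁻ z, ‖kerJH g hr z‖ₑ ≤ ∫⁻ z, ∫⁻ s in Set.Ioi (0 : ℝ),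
        ‖(((subordConst (g / 2))⁻¹ * (s ^ (-1 - g / 2) *
          (heatKer r z - Real.exp (-s) * heatKer (r + s) z)) : ℝ) : ℂ)‖ₑ := by
        refine lintegral_mono fun z ↦ ?_
        rw [kerJH_eq h0 h1, ← integral_const_mul]
        simp_rw [← Complex.ofReal_mul]
        exact enorm_integral_le_lintegral_enorm _
    _ = ∫⁻ s in Set.Ioi (0 : ℝ), ∫⁻ z, ‖(((subordConst (g / 2))⁻¹ * (s ^ (-1 - g / 2) *
          (heatKer r z - Real.exp (-s) * heatKer (r + s) z)) : ℝ) : ℂ)‖ₑ :=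
        lintegral_lintegral_swap hm.aemeasurable
    _ ≤ ∫⁻ s in Set.Ioi (0 : ℝ), ENNReal.ofReal ((subordConst (g / 2))⁻¹ * 2 *
          (min 1 ((1 + 1 / r) * s) * s ^ (-1 - g / 2))) := by
        refine setLIntegral_mono' measurableSet_Ioi fun s hs ↦ ?_
        have hs : 0 < s := hs
        have i3 : Integrable fun z ↦ |heatKer r z - Real.exp (-s) * heatKer (r + s) z| :=
          ((integrable_heatKer hr).sub
            ((integrable_heatKer (r := r + s) (by positivity)).const_mul _)).abs
        have e1 : ∀ z, ‖(((subordConst (g / 2))⁻¹ * (s ^ (-1 - g / 2) *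
            (heatKer r z - Real.exp (-s) * heatKer (r + s) z)) : ℝ) : ℂ)‖ₑ =
            ENNReal.ofReal ((subordConst (g / 2))⁻¹ * (s ^ (-1 - g / 2) *
              |heatKer r z - Real.exp (-s) * heatKer (r + s) z|)) := by
          intro z
          rw [← ofReal_norm, Complex.norm_real, Real.norm_eq_abs, abs_mul, abs_mul,
            abs_of_nonneg (inv_nonneg.2 hc.le), abs_of_nonneg (by positivity : 0 ≤ s ^ (-1 - g / 2))]
        simp_rw [e1]
        rw [← ofReal_integral_eq_lintegral_ofReal ((i3.const_mul _).const_mul _)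
          (ae_of_all _ fun z ↦ by positivity), integral_const_mul, integral_const_mul]
        apply ENNReal.ofReal_le_ofReal
        have := integral_abs_heatKer_sub_le hr hs.le
        calc _ ≤ (subordConst (g / 2))⁻¹ * (s ^ (-1 - g / 2) * (2 * min 1 (s * (1 + 1 / r)))) := by
              gcongr
          _ = _ := by rw [mul_comm s (1 + 1 / r)]; ring
    _ = ENNReal.ofReal ((subordConst (g / 2))⁻¹ * 2 * ((1 + 1 / r) ^ (g / 2) * D)) := by
        rw [← ofReal_integral_eq_lintegral_ofReal, integral_const_mul,
          integral_comp_mul_mul_rpow ha fun u ↦ min 1 u]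
        · exact (integrableOn_comp_mul_mul_rpow ha hi).const_mul _
        · refine (ae_restrict_iff' measurableSet_Ioi).2 (ae_of_all _ fun u hu ↦ ?_)
          have hu : 0 < u := hu
          positivity
    _ ≤ _ := by
        apply ENNReal.ofReal_le_ofReal
        have : 0 < (1 + 1 / r) ^ (g / 2) := by positivity
        nlinarith

/-! ### Testing distributions with heat kernels -/

/-- The character `ξ ↦ e^{2πi⟨x, ξ⟩}`. -/
def trig (x ξ : Plane) : ℂ := Complex.exp (((2 * Real.pi * inner ℝ ξ x : ℝ) : ℂ) * Complex.I)

lemma norm_trig (x ξ : Plane) : ‖trig x ξ‖ = 1 := Complex.norm_exp_ofReal_mul_I _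

@[fun_prop]
lemma continuous_trig : Continuous fun p : Plane × Plane ↦ trig p.1 p.2 := by
  unfold trig; fun_prop

lemma fourierInv_compSubConst (x : Plane) (F : 𝓢(Plane, ℂ)) (ξ : Plane) :
    FourierTransformInv.fourierInv (SchwartzMap.compSubConstCLM ℂ x (FourierTransform.fourier F)) ξ =
      trig x ξ * F ξ := by
  have h1 : F ξ = FourierTransformInv.fourierInv (FourierTransform.fourier F) ξ := by
    rw [FourierTransform.fourierInv_fourier_eq]
  rw [h1, SchwartzMap.fourierInv_coe, SchwartzMap.fourierInv_coe, Real.fourierInv_eq',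
    Real.fourierInv_eq', ← integral_const_mul]
  symm
  rw [← integral_sub_right_eq_self _ x]
  congr 1
  ext y
  rw [SchwartzMap.compSubConstCLM_apply, smul_eq_mul, smul_eq_mul, trig, ← mul_assoc,
    ← Complex.exp_add, inner_sub_left, real_inner_comm x ξ]
  congr 2
  push_cast
  ring

/-- On the Fourier side a translation is multiplication by a character, which commutes with
multiplication by m. -/
lemma fourier_smulLeft_fourierInv_compSubConst {m : Plane → ℂ} (hm : m.HasTemperateGrowth)
    (x : Plane) (F : 𝓢(Plane, ℂ)) :
    FourierTransform.fourier (SchwartzMap.smulLeftCLM ℂ m (FourierTransformInv.fourierInv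
      (SchwartzMap.compSubConstCLM ℂ x (FourierTransform.fourier F)))) =
      SchwartzMap.compSubConstCLM ℂ x (FourierTransform.fourier (SchwartzMap.smulLeftCLM ℂ m F)) := by
  have h : SchwartzMap.smulLeftCLM ℂ m (FourierTransformInv.fourierInv
      (SchwartzMap.compSubConstCLM ℂ x (FourierTransform.fourier F))) =
      FourierTransformInv.fourierInv (SchwartzMap.compSubConstCLM ℂ x
        (FourierTransform.fourier (SchwartzMap.smulLeftCLM ℂ m F))) := by
    ext ξ
    rw [SchwartzMap.smulLeftCLM_apply_apply hm, fourierInv_compSubConst, fourierInv_compSubConst,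
      SchwartzMap.smulLeftCLM_apply_apply hm, smul_eq_mul, smul_eq_mul]
    ring
  rw [h, FourierTransform.fourier_fourierInv_eq]

open Classical in
/-- The heat kernel centred at `x`, as a Schwartz function. -/
def heatS (r : ℝ) (x : Plane) : 𝓢(Plane, ℂ) :=
  if h : 0 < r then SchwartzMap.compSubConstCLM ℂ x (FourierTransform.fourier (gaussS h)) else 0

lemma heatS_of_pos {r : ℝ} (hr : 0 < r) (x : Plane) :
    heatS r x = SchwartzMap.compSubConstCLM ℂ x (FourierTransform.fourier (gaussS hr)) := dif_pos hr

lemma heatS_apply {r : ℝ} (hr : 0 < r) (x y : Plane) : heatS r x y = (heatKer r (y - x) : ℂ) := by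
  rw [heatS_of_pos hr, SchwartzMap.compSubConstCLM_apply, SchwartzMap.fourier_coe,
    Real.fourier_eq', ← fourier_symH hr]
  simp_rw [gaussS_apply, smul_eq_mul]

/-- By the semigroup law, evolving a distribution and testing with a heat kernel lengthens the time
of that kernel. This is how the stochastic convolution is tested. -/
lemma heat_heatS {r r' : ℝ} (hr : 0 < r) (hr' : 0 ≤ r') (u : 𝓢'(Plane, ℂ)) (x : Plane) :
    heat r' u (heatS r x) = u (heatS (r' + r) x) := by
  rw [heat_eq, TemperedDistribution.fourierMultiplierCLM_apply_apply, heatS_of_pos hr,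
    fourier_smulLeft_fourierInv_compSubConst (symH_temperate hr'),
    heatS_of_pos (show 0 < r' + r by positivity)]
  congr 3
  ext ξ
  rw [SchwartzMap.smulLeftCLM_apply_apply (symH_temperate hr'), gaussS_apply, gaussS_apply,
    ← symH_mul, Pi.mul_apply, smul_eq_mul]

lemma symJ_mul_neg (s : ℝ) : symJ (-s) * symJ s = fun _ ↦ 1 := by
  ext ξ
  have := lam_nonneg ξ
  rw [Pi.mul_apply, symJ, symJ, ← Complex.ofReal_mul, ← Real.rpow_add (by positivity)]
  ring_nf
  simp

lemma J_J_neg (s : ℝ) (u : 𝓢'(Plane, ℂ)) : J s (J (-s) u) = u := by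
  rw [J_eq, J_eq, TemperedDistribution.fourierMultiplierCLM_fourierMultiplierCLM_apply
    (symJ_temperate _) (symJ_temperate _), symJ_mul_neg]
  simp

lemma J_zero (u : 𝓢'(Plane, ℂ)) : J 0 u = u := by
  have : symJ 0 = fun _ ↦ 1 := by ext; simp [symJ]
  rw [J_eq, this]
  simp

/-- Writing u = J^g U and moving J^g onto the heat kernel replaces a rough distribution by U, which
is a function in the intended uses. -/
lemma apply_heatS_eq {g r : ℝ} (hr : 0 < r) {u U : 𝓢'(Plane, ℂ)} (hU : J (-g) u = U) (x : Plane) :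
    u (heatS r x) = U (SchwartzMap.compSubConstCLM ℂ x (kerJH g hr)) := by
  rw [← J_J_neg g u, hU, J_eq, TemperedDistribution.fourierMultiplierCLM_apply_apply,
    heatS_of_pos hr, fourier_smulLeft_fourierInv_compSubConst (symJ_temperate g)]
  rfl

lemma apply_heatS_eq_integral {g r : ℝ} (hr : 0 < r) {u : 𝓢'(Plane, ℂ)} {p : ℝ≥0∞}
    [Fact (1 ≤ p)] {a : Lp ℂ p (volume : Measure Plane)}
    (ha : J (-g) u = Lp.toTemperedDistribution a) (x : Plane) :
    u (heatS r x) = ∫ y, kerJH g hr (y - x) * a y := by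
  rw [apply_heatS_eq hr ha, Lp.toTemperedDistribution_apply]
  rfl

lemma apply_heatS_eq_integral_fourier {g r : ℝ} (hr : 0 < r) {u : 𝓢'(Plane, ℂ)}
    {a : Lp ℂ 2 (volume : Measure Plane)} (ha : J (-g) u = Lp.toTemperedDistribution a)
    (x : Plane) :
    u (heatS r x) = ∫ ξ, trig x ξ * (symJ g ξ * symH r ξ) *
      (FourierTransform.fourier a : Lp ℂ 2 (volume : Measure Plane)) ξ := by
  rw [apply_heatS_eq hr ha, ← FourierTransform.fourier_fourierInv_eq
    (F := 𝓢(Plane, ℂ)) (SchwartzMap.compSubConstCLM ℂ x (kerJH g hr)), ← TemperedDistribution.fourier_apply,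
    Lp.fourier_toTemperedDistribution_eq, Lp.toTemperedDistribution_apply]
  congr 1
  ext ξ
  rw [kerJH, fourierInv_compSubConst, symJH_apply, smul_eq_mul]

lemma symH_norm_le {r r' : ℝ} (h : r' ≤ r) (ξ : Plane) : ‖symH r ξ‖ ≤ ‖symH r' ξ‖ := by
  rw [symH, symH, Complex.norm_real, Complex.norm_real, Real.norm_eq_abs, Real.norm_eq_abs,
    Real.abs_exp, Real.abs_exp]
  have := mul_le_mul_of_nonneg_right h (lam_nonneg ξ)
  gcongr

lemma integrable_symJH_mul (g : ℝ) {r : ℝ} (hr : 0 < r) (b : Lp ℂ 2 (volume : Measure Plane)) :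
    Integrable fun ξ ↦ symJH g hr ξ * b ξ :=
  (SchwartzMap.memLp (symJH g hr) 2).integrable_mul (Lp.memLp b)

/-- Dominated convergence on the Fourier side. The cutoff `max p.1 δ` keeps the time away from 0,
where no integrable majorant is available. -/
lemma continuousOn_apply_heatS {g : ℝ} {u : 𝓢'(Plane, ℂ)}
    {a : Lp ℂ 2 (volume : Measure Plane)} (ha : J (-g) u = Lp.toTemperedDistribution a)
    {δ : ℝ} (hδ : 0 < δ) :
    Continuous fun p : ℝ × Plane ↦ u (heatS (max p.1 δ) p.2) := by
  have h (p : ℝ × Plane) := apply_heatS_eq_integral_fourier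
    (r := max p.1 δ) (lt_max_of_lt_right hδ) ha p.2
  simp_rw [h]
  refine continuous_of_dominated (bound := fun ξ ↦ ‖symJH g hδ ξ *
    (FourierTransform.fourier a : Lp ℂ 2 (volume : Measure Plane)) ξ‖) (fun p ↦ ?_) (fun p ↦ ?_)
    (integrable_symJH_mul g hδ _).norm (ae_of_all _ fun ξ ↦ ?_)
  · refine AEStronglyMeasurable.mul (Continuous.aestronglyMeasurable ?_) (Lp.aestronglyMeasurable _)
    have := (symJ_temperate g).1.continuous
    have h1 : Continuous (trig p.2) := continuous_trig.comp (Continuous.prodMk_right p.2)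
    have h2 : Continuous (symH (max p.1 δ)) := by unfold symH; fun_prop
    fun_prop
  · refine ae_of_all _ fun ξ ↦ ?_
    rw [symJH_apply, norm_mul, norm_mul, norm_mul, norm_mul, norm_mul, norm_trig, one_mul]
    gcongr
    exact symH_norm_le (le_max_right _ _) ξ
  · have h1 : Continuous fun p : ℝ × Plane ↦ trig p.2 ξ :=
      continuous_trig.comp (by fun_prop : Continuous fun p : ℝ × Plane ↦ (p.2, ξ))
    have h2 : Continuous fun p : ℝ × Plane ↦ symH (max p.1 δ) ξ := by unfold symH; fun_prop
    fun_prop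

lemma norm_apply_heatS_le {g : ℝ} {u : 𝓢'(Plane, ℂ)}
    {a : Lp ℂ 2 (volume : Measure Plane)} (ha : J (-g) u = Lp.toTemperedDistribution a)
    {δ r : ℝ} (hδ : 0 < δ) (hr : δ ≤ r) (x : Plane) :
    ‖u (heatS r x)‖ₑ ≤ eLpNorm (symJH g hδ) 2 volume * ‖a‖ₑ := by
  have h1 : ‖a‖ₑ = ‖(FourierTransform.fourier a : Lp ℂ 2 (volume : Measure Plane))‖ₑ := by
    rw [← ofReal_norm, ← ofReal_norm, Lp.norm_fourier_eq]
  rw [apply_heatS_eq_integral_fourier (hδ.trans_le hr) ha, h1, Lp.enorm_def]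
  have h2 : AEStronglyMeasurable (symJH g hδ) := (symJH g hδ).continuous.aestronglyMeasurable
  refine (enorm_integral_le_lintegral_enorm _).trans ?_
  have h3 := eLpNorm_smul_le_mul_eLpNorm (p := 2) (q := 2) (r := 1)
    (Lp.aestronglyMeasurable (FourierTransform.fourier a : Lp ℂ 2 (volume : Measure Plane))) h2
  refine le_trans ?_ h3
  rw [eLpNorm_one_eq_lintegral_enorm]
  refine lintegral_mono fun ξ ↦ ?_
  rw [Pi.smul_apply', smul_eq_mul, symJH_apply, enorm_mul, enorm_mul, enorm_mul, enorm_mul]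
  have h4 : ‖trig x ξ‖ₑ = 1 := by rw [← ofReal_norm, norm_trig]; simp
  have h5 : ‖symH r ξ‖ₑ ≤ ‖symH δ ξ‖ₑ := by
    rw [← ofReal_norm, ← ofReal_norm]
    exact ENNReal.ofReal_le_ofReal (symH_norm_le hr ξ)
  rw [h4, one_mul, enorm_mul]
  gcongr

/-! ### Integral inequalities -/

section Ineq

variable {α β : Type*} [MeasurableSpace α] [MeasurableSpace β] {μ : Measure α} {ν : Measure β}

lemma rpow_half_sq (a : ℝ≥0∞) : (a ^ (1 / 2 : ℝ)) ^ 2 = a := by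
  rw [← ENNReal.rpow_natCast, ← ENNReal.rpow_mul]
  norm_num

lemma sq_lintegral_mul_le {f g : α → ℝ≥0∞} (hf : AEMeasurable f μ) (hg : AEMeasurable g μ) :
    (∫⁻ a, f a * g a ∂μ) ^ 2 ≤ (∫⁻ a, f a ^ 2 ∂μ) * ∫⁻ a, g a ^ 2 ∂μ := by
  have h := ENNReal.lintegral_mul_le_Lp_mul_Lq μ Real.HolderConjugate.two_two hf hg
  simp only [ENNReal.rpow_two, Pi.mul_apply] at h
  calc _ ≤ _ := pow_le_pow_left' h 2
    _ = _ := by rw [mul_pow, rpow_half_sq, rpow_half_sq]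

/-- The Cauchy-Schwarz inequality after the splitting k f = √k · (√k f). -/
lemma sq_lintegral_weight_le {k f : α → ℝ≥0∞} (hk : AEMeasurable k μ) (hf : AEMeasurable f μ) :
    (∫⁻ a, k a * f a ∂μ) ^ 2 ≤ (∫⁻ a, k a ∂μ) * ∫⁻ a, k a * f a ^ 2 ∂μ := by
  have hk' : AEMeasurable (fun a ↦ k a ^ (1 / 2 : ℝ)) μ := hk.pow_const _
  have h := sq_lintegral_mul_le hk' (hk'.mul hf)
  simp only [Pi.mul_apply, ← mul_assoc, mul_pow, rpow_half_sq] at h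
  simpa only [← sq, rpow_half_sq] using h

/-- Minkowski's integral inequality for the square. -/
lemma lintegral_sq_lintegral_le [SFinite μ] [SFinite ν] {F : α → β → ℝ≥0∞}
    (hF : Measurable (Function.uncurry F)) :
    ∫⁻ b, (∫⁻ a, F a b ∂μ) ^ 2 ∂ν ≤ (∫⁻ a, (∫⁻ b, F a b ^ 2 ∂ν) ^ (1 / 2 : ℝ) ∂μ) ^ 2 := by
  have hN : Measurable fun a ↦ (∫⁻ b, F a b ^ 2 ∂ν) ^ (1 / 2 : ℝ) :=
    (Measurable.lintegral_prod_right (f := fun a b ↦ F a b ^ 2) (hF.pow_const 2)).pow_const _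
  have hb (b : β) : Measurable fun a ↦ F a b := hF.comp measurable_prodMk_right
  have ha (a : α) : Measurable (F a) := hF.comp measurable_prodMk_left
  -- The square becomes a double integral; after Tonelli's theorem, Cauchy-Schwarz in b applies to
  -- each pair of parameters.
  have e1 (b : β) : (∫⁻ a, F a b ∂μ) ^ 2 = ∫⁻ p, F p.1 b * F p.2 b ∂(μ.prod μ) := by
    rw [sq, ← lintegral_prod_mul (hb b).aemeasurable (hb b).aemeasurable]
  have hm : Measurable fun q : β × (α × α) ↦ F q.2.1 q.1 * F q.2.2 q.1 := by
    refine Measurable.mul ?_ ?_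
    · exact hF.comp ((measurable_fst.comp measurable_snd).prodMk measurable_fst)
    · exact hF.comp ((measurable_snd.comp measurable_snd).prodMk measurable_fst)
  simp_rw [e1]
  rw [lintegral_lintegral_swap (f := fun (b : β) (p : α × α) ↦ F p.1 b * F p.2 b) hm.aemeasurable, sq,
    ← lintegral_prod_mul hN.aemeasurable hN.aemeasurable]
  refine lintegral_mono fun p ↦ ?_
  have h := sq_lintegral_mul_le (μ := ν) (ha p.1).aemeasurable (ha p.2).aemeasurable
  rw [← ENNReal.mul_rpow_of_nonneg _ _ (by norm_num : (0 : ℝ) ≤ 1 / 2)]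
  calc _ = ((∫⁻ b, F p.1 b * F p.2 b ∂ν) ^ 2) ^ (1 / 2 : ℝ) := by
        rw [← ENNReal.rpow_natCast, ← ENNReal.rpow_mul]
        norm_num
    _ ≤ _ := by gcongr

/-- Young's convolution inequality with an integrable kernel. -/
lemma lintegral_pow_conv_le {q : ℕ} (hq : q = 1 ∨ q = 2) {k S : Plane → ℝ≥0∞} (hk : Measurable k)
    (hS : Measurable S) :
    ∫⁻ x, ((∫⁻ z, k z) * ∫⁻ y, k (y - x) * S y) ^ q ≤ (∫⁻ z, k z) ^ (2 * q) * ∫⁻ y, S y ^ q := by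
  have key : ∀ S : Plane → ℝ≥0∞, Measurable S →
      ∫⁻ x, ∫⁻ y, k (y - x) * S y = (∫⁻ z, k z) * ∫⁻ y, S y := by
    intro S hS
    rw [lintegral_lintegral_swap (f := fun x y ↦ k (y - x) * S y)
      (Measurable.aemeasurable (by unfold Function.uncurry; fun_prop)), ← lintegral_const_mul _ hS]
    refine lintegral_congr fun y ↦ ?_
    rw [lintegral_mul_const _ (by fun_prop), lintegral_sub_left_eq_self k y]
  have hm : Measurable fun x ↦ ∫⁻ y, k (y - x) * S y :=
    Measurable.lintegral_prod_right (f := fun x y ↦ k (y - x) * S y) (by fun_prop)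
  rcases hq with rfl | rfl
  · simp only [pow_one]
    rw [lintegral_const_mul _ hm, key S hS]
    ring_nf
    exact le_rfl
  · have hx (x : Plane) : ((∫⁻ z, k z) * ∫⁻ y, k (y - x) * S y) ^ 2 ≤
        (∫⁻ z, k z) ^ 2 * ((∫⁻ z, k z) * ∫⁻ y, k (y - x) * S y ^ 2) := by
      rw [mul_pow]
      gcongr
      have := sq_lintegral_weight_le (μ := volume) (k := fun y ↦ k (y - x)) (f := S)
        (by fun_prop) hS.aemeasurable
      rwa [lintegral_sub_right_eq_self k x] at this
    calc _ ≤ _ := lintegral_mono hx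
      _ = _ := by
        rw [lintegral_const_mul, lintegral_const_mul, key _ (hS.pow_const 2)]
        · ring
        · exact Measurable.lintegral_prod_right (f := fun x y ↦ k (y - x) * S y ^ 2) (by fun_prop)
        · exact (Measurable.lintegral_prod_right (f := fun x y ↦ k (y - x) * S y ^ 2)
            (by fun_prop)).const_mul _

end Ineq

/-! ### Gaussian sums -/

/-- The summands are independent and centred, so their variances add. -/
lemma lintegral_sq_gaussian_sum_real {n : ℕ} (c : Fin n → ℝ) :
    ∫⁻ β, ‖∑ i, β i * c i‖ₑ ^ 2 ∂(Measure.pi fun _ : Fin n ↦ gaussianReal 0 1) =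
      ∑ i, ‖c i‖ₑ ^ 2 := by
  set μ := Measure.pi fun _ : Fin n ↦ gaussianReal 0 1
  have hmp (i : Fin n) : MeasurePreserving (fun β : Fin n → ℝ ↦ β i) μ (gaussianReal 0 1) :=
    measurePreserving_eval _ i
  have hL (i : Fin n) : MemLp (fun β : Fin n → ℝ ↦ β i * c i) 2 μ := by
    have h : MemLp (fun β : Fin n → ℝ ↦ β i) 2 μ :=
      (memLp_id_gaussianReal (μ := 0) (v := 1) 2).comp_measurePreserving (hmp i)
    exact h.mul_const _
  have hmean (i : Fin n) : ∫ β, β i * c i ∂μ = 0 := by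
    rw [integral_mul_const]
    have h2 : ∫ β, β i ∂μ = ∫ x, x ∂(gaussianReal 0 1) := by
      rw [← (hmp i).map_eq, integral_map (hmp i).measurable.aemeasurable (by fun_prop)]
    rw [h2, integral_id_gaussianReal, zero_mul]
  have hvar (i : Fin n) : variance (fun β : Fin n → ℝ ↦ β i * c i) μ = c i ^ 2 := by
    rw [variance_mul_const]
    have h2 : variance (fun β : Fin n → ℝ ↦ β i) μ = variance id (gaussianReal 0 1) := by
      rw [← (hmp i).map_eq, variance_map (by fun_prop) (hmp i).measurable.aemeasurable]
      rfl
    rw [h2, variance_id_gaussianReal]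
    simp
  have hind : iIndepFun (fun (i : Fin n) (β : Fin n → ℝ) ↦ β i * c i) μ :=
    iIndepFun_pi (X := fun i (x : ℝ) ↦ x * c i) fun i ↦ by fun_prop
  have hsum := IndepFun.variance_sum (s := Finset.univ) (fun i _ ↦ hL i)
    fun i _ j _ hij ↦ hind.indepFun hij
  have hLs : MemLp (∑ i, fun β : Fin n → ℝ ↦ β i * c i) 2 μ := memLp_finsetSum' _ fun i _ ↦ hL i
  rw [variance_eq_sub hLs] at hsum
  simp only [Finset.sum_apply, Pi.pow_apply, hvar] at hsum
  rw [integral_finsetSum _ fun i _ ↦ (hL i).integrable (by norm_num)] at hsum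
  simp only [hmean, Finset.sum_const_zero] at hsum
  have hint : Integrable (fun β : Fin n → ℝ ↦ (∑ i, β i * c i) ^ 2) μ := by
    have := hLs.integrable_sq
    simpa only [Finset.sum_apply] using this
  have e1 (x : ℝ) : ‖x‖ₑ ^ 2 = ENNReal.ofReal (x ^ 2) := by
    rw [← ofReal_norm, ← ENNReal.ofReal_pow (norm_nonneg _), Real.norm_eq_abs, sq_abs]
  simp_rw [e1]
  rw [← ofReal_integral_eq_lintegral_ofReal hint (ae_of_all _ fun _ ↦ sq_nonneg _),
    ← ENNReal.ofReal_sum_of_nonneg fun _ _ ↦ sq_nonneg _, ← hsum]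
  simp

lemma enorm_sq_eq_re_add_im (z : ℂ) : ‖z‖ₑ ^ 2 = ‖z.re‖ₑ ^ 2 + ‖z.im‖ₑ ^ 2 := by
  rw [← ofReal_norm, ← ofReal_norm, ← ofReal_norm, ← ENNReal.ofReal_pow (norm_nonneg _),
    ← ENNReal.ofReal_pow (norm_nonneg _), ← ENNReal.ofReal_pow (norm_nonneg _),
    ← ENNReal.ofReal_add (by positivity) (by positivity), Complex.sq_norm, Complex.normSq_apply,
    Real.norm_eq_abs, Real.norm_eq_abs, sq_abs, sq_abs]
  ring_nf

lemma lintegral_sq_gaussian_sum {n : ℕ} (c : Fin n → ℂ) :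
    ∫⁻ β, ‖∑ i, (β i : ℂ) * c i‖ₑ ^ 2 ∂(Measure.pi fun _ : Fin n ↦ gaussianReal 0 1) =
      ∑ i, ‖c i‖ₑ ^ 2 := by
  simp_rw [enorm_sq_eq_re_add_im]
  rw [lintegral_add_left (by fun_prop), Finset.sum_add_distrib,
    ← lintegral_sq_gaussian_sum_real, ← lintegral_sq_gaussian_sum_real]
  simp

/-! ### Sobolev norms and radonifying norms -/

section LpNorms

variable {p : ℝ≥0∞} [Fact (1 ≤ p)]

lemma toTemperedDistribution_injective :
    Function.Injective (Lp.toTemperedDistribution : Lp ℂ p (volume : Measure Plane) → _) :=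
  LinearMap.ker_eq_bot.1 (Lp.ker_toTemperedDistributionCLM_eq_bot (F := ℂ)
    (μ := (volume : Measure Plane)) (p := p))

lemma distLpNorm_toTemperedDistribution (a : Lp ℂ p (volume : Measure Plane)) :
    distLpNorm p (Lp.toTemperedDistribution a) = ‖a‖ₑ := by
  refine le_antisymm (iInf₂_le (f := fun (f : Lp ℂ p (volume : Measure Plane))
    (_ : Lp.toTemperedDistribution a = Lp.toTemperedDistribution f) ↦ ‖f‖ₑ) a rfl) (le_iInf₂ fun f hf ↦ ?_)
  rw [toTemperedDistribution_injective hf]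

lemma exists_of_distLpNorm_lt_top {u : 𝓢'(Plane, ℂ)} (h : distLpNorm p u < ∞) :
    ∃ a : Lp ℂ p (volume : Measure Plane), u = Lp.toTemperedDistribution a := by
  by_contra! hn
  simp [distLpNorm, hn] at h

lemma real_smul_eq (β : ℝ) (u : 𝓢'(Plane, ℂ)) : β • u = (β : ℂ) • u := by
  ext φ
  simp

lemma J_real_smul (s β : ℝ) (u : 𝓢'(Plane, ℂ)) : J s (β • u) = β • J s u := by
  rw [real_smul_eq, map_smul, real_smul_eq]

lemma enorm_mul_distLpNorm_le (β : ℝ) (u : 𝓢'(Plane, ℂ)) :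
    ‖β‖ₑ * distLpNorm p u ≤ distLpNorm p (β • u) := by
  rcases eq_or_ne β 0 with rfl | hβ
  · simp
  refine le_iInf₂ fun f hf ↦ ?_
  have h1 : u = Lp.toTemperedDistribution ((β : ℂ)⁻¹ • f) := by
    change u = Lp.toTemperedDistributionCLM ℂ volume p ((β : ℂ)⁻¹ • f)
    rw [map_smul, Lp.toTemperedDistributionCLM_apply, ← hf]
    ext φ
    simp [hβ]
  rw [h1, distLpNorm_toTemperedDistribution, enorm_smul, ← mul_assoc]
  have : ‖β‖ₑ * ‖(β : ℂ)⁻¹‖ₑ = 1 := by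
    rw [← ofReal_norm, ← ofReal_norm, ← ENNReal.ofReal_mul (norm_nonneg _), norm_inv,
      Complex.norm_real, mul_inv_cancel₀ (norm_ne_zero_iff.2 hβ), ENNReal.ofReal_one]
  rw [this, one_mul]

lemma distLpNorm_le_sobNorm (hp : p ≠ ∞) (s : ℝ) (u : VecDist) (k : Fin 2) :
    distLpNorm p (J s (u k)) ≤ sobNorm s p u := by
  have h1 : (1 : ℝ≥0∞) ≤ p := Fact.out
  have hp' : 0 < p.toReal := ENNReal.toReal_pos (one_pos.trans_le h1).ne' hp
  unfold sobNorm
  calc _ = (distLpNorm p (J s (u k)) ^ p.toReal) ^ (1 / p.toReal) := by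
        rw [← ENNReal.rpow_mul, mul_one_div_cancel hp'.ne', ENNReal.rpow_one]
    _ ≤ _ := by
        gcongr
        exact Finset.single_le_sum (f := fun k ↦ distLpNorm p (J s (u k)) ^ p.toReal)
          (fun _ _ ↦ zero_le) (Finset.mem_univ k)

lemma MemHsol.exists_lp (hp : p ≠ ∞) {s : ℝ} {u : VecDist} (hu : MemHsol s p u) (k : Fin 2) :
    ∃ a : Lp ℂ p (volume : Measure Plane), J s (u k) = Lp.toTemperedDistribution a :=
  exists_of_distLpNorm_lt_top ((distLpNorm_le_sobNorm hp s u k).trans_lt hu.finite)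

variable {Y : Type*} [NormedAddCommGroup Y] [InnerProductSpace ℝ Y]

lemma lintegral_sobNorm_le_gammaNorm (s : ℝ) (R : Y →ₗ[ℝ] VecDist) {n : ℕ} {y : Fin n → Y}
    (hy : Orthonormal ℝ y) :
    ∫⁻ β, (sobNorm s p (∑ i, β i • R (y i))) ^ 2 ∂(Measure.pi fun _ : Fin n ↦ gaussianReal 0 1) ≤
      gammaNorm s p R ^ 2 := by
  refine (rpow_half_sq _).symm.le.trans ?_
  gcongr
  exact le_iSup₂_of_le n y (le_iSup_of_le hy le_rfl)

/-- The orthonormal system consisting of y alone, together with 𝔼 β² = 1. -/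
lemma distLpNorm_le_gammaNorm (hp : p ≠ ∞) (s : ℝ) (R : Y →ₗ[ℝ] VecDist) {y : Y} (hy : ‖y‖ = 1)
    (k : Fin 2) : distLpNorm p (J s (R y k)) ≤ gammaNorm s p R := by
  have ho : Orthonormal ℝ (fun _ : Fin 1 ↦ y) :=
    ⟨fun _ ↦ hy, fun i j h ↦ (h (Subsingleton.elim i j)).elim⟩
  have h1 := lintegral_sobNorm_le_gammaNorm (p := p) s R ho
  have h2 : distLpNorm p (J s (R y k)) ^ 2 ≤ gammaNorm s p R ^ 2 := by
    refine le_trans ?_ h1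
    have h3 := lintegral_sq_gaussian_sum_real (n := 1) (fun _ ↦ 1)
    simp only [Finset.univ_unique, Finset.sum_singleton, mul_one, enorm_one, one_pow] at h3
    calc _ = ∫⁻ β, ‖β default‖ₑ ^ 2 * distLpNorm p (J s (R y k)) ^ 2
          ∂(Measure.pi fun _ : Fin 1 ↦ gaussianReal 0 1) := by
          rw [lintegral_mul_const _ (by fun_prop), h3, one_mul]
      _ ≤ _ := by
          refine lintegral_mono fun β ↦ ?_
          rw [← mul_pow]
          gcongr
          refine le_trans ?_ (distLpNorm_le_sobNorm hp s _ k)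
          simp only [Finset.univ_unique, Finset.sum_singleton, Pi.smul_apply]
          rw [J_real_smul]
          exact enorm_mul_distLpNorm_le _ _
  exact (ENNReal.pow_le_pow_left_iff two_ne_zero).1 h2

lemma lintegral_enorm_gaussian_sum_le (hp : p ≠ ∞) (s : ℝ) (R : Y →ₗ[ℝ] VecDist) {n : ℕ}
    {y : Fin n → Y} (hy : Orthonormal ℝ y) (k : Fin 2)
    {a : Fin n → Lp ℂ p (volume : Measure Plane)}
    (ha : ∀ i, J s (R (y i) k) = Lp.toTemperedDistribution (a i)) :
    ∫⁻ β, eLpNorm (fun x ↦ ∑ i, ((β i : ℝ) : ℂ) * a i x) p volume ^ 2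
      ∂(Measure.pi fun _ : Fin n ↦ gaussianReal 0 1) ≤ gammaNorm s p R ^ 2 := by
  refine (lintegral_mono fun β ↦ ?_).trans (lintegral_sobNorm_le_gammaNorm s R hy)
  gcongr
  refine le_trans ?_ (distLpNorm_le_sobNorm hp s _ k)
  have h1 : J s ((∑ i, β i • R (y i)) k) =
      Lp.toTemperedDistribution (∑ i, ((β i : ℝ) : ℂ) • a i) := by
    change _ = Lp.toTemperedDistributionCLM ℂ volume p (∑ i, ((β i : ℝ) : ℂ) • a i)
    rw [Finset.sum_apply, map_sum, map_sum]
    refine Finset.sum_congr rfl fun i _ ↦ ?_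
    rw [Pi.smul_apply, J_real_smul, ha, map_smul, real_smul_eq]
    rfl
  rw [h1, distLpNorm_toTemperedDistribution, Lp.enorm_def]
  refine (eLpNorm_congr_ae ?_).le
  have h2 : ∀ᵐ x, ∀ i, (((β i : ℝ) : ℂ) • a i : Lp ℂ p (volume : Measure Plane)) x =
      ((β i : ℝ) : ℂ) * a i x := ae_all_iff.2 fun i ↦ by
    filter_upwards [Lp.coeFn_smul ((β i : ℝ) : ℂ) (a i)] with x hx
    rw [hx, Pi.smul_apply, smul_eq_mul]
  filter_upwards [h2, Lp.coeFn_finsetSum Finset.univ fun i ↦ ((β i : ℝ) : ℂ) • a i] with x hx hx'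
  rw [hx', Finset.sum_apply]
  exact Finset.sum_congr rfl fun i _ ↦ (hx i).symm

end LpNorms

section Gamma

variable {Y : Type*} [NormedAddCommGroup Y] [InnerProductSpace ℝ Y]

lemma measurable_gaussian_sum {p : ℝ≥0∞} {n : ℕ} (a : Fin n → Lp ℂ p (volume : Measure Plane)) :
    Measurable (Function.uncurry fun (β : Fin n → ℝ) (x : Plane) ↦
      ‖∑ i, ((β i : ℝ) : ℂ) * a i x‖ₑ ^ 2) := by
  have h (i : Fin n) : Measurable (a i : Plane → ℂ) := (Lp.stronglyMeasurable (a i)).measurable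
  unfold Function.uncurry
  fun_prop

lemma lintegral_sum_sq_le_gammaNorm_two (s : ℝ) (R : Y →ₗ[ℝ] VecDist) {n : ℕ}
    {y : Fin n → Y} (hy : Orthonormal ℝ y) (k : Fin 2)
    {a : Fin n → Lp ℂ 2 (volume : Measure Plane)}
    (ha : ∀ i, J s (R (y i) k) = Lp.toTemperedDistribution (a i)) :
    ∫⁻ x, ∑ i, ‖a i x‖ₑ ^ 2 ≤ gammaNorm s 2 R ^ 2 := by
  refine le_trans (le_of_eq ?_) (lintegral_enorm_gaussian_sum_le (by norm_num) s R hy k ha)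
  simp_rw [← lintegral_sq_gaussian_sum]
  rw [lintegral_lintegral_swap (f := fun (x : Plane) (β : Fin n → ℝ) ↦
    ‖∑ i, ((β i : ℝ) : ℂ) * a i x‖ₑ ^ 2)
    ((measurable_gaussian_sum a).comp measurable_swap).aemeasurable]
  refine lintegral_congr fun β ↦ ?_
  rw [eLpNorm_eq_lintegral_rpow_enorm_toReal (by norm_num) (by norm_num)]
  simp only [ENNReal.toReal_ofNat, ENNReal.rpow_two]
  rw [rpow_half_sq]

/-- The square function is the second moment of a Gaussian sum at each x. Minkowski's inequality
exchanges this moment with the L⁴ norm in x, which leaves the second moment of the L⁴ norm, that is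
the γ-norm. -/
lemma lintegral_sum_sq_le_gammaNorm_four (s : ℝ) (R : Y →ₗ[ℝ] VecDist) {n : ℕ}
    {y : Fin n → Y} (hy : Orthonormal ℝ y) (k : Fin 2)
    {a : Fin n → Lp ℂ 4 (volume : Measure Plane)}
    (ha : ∀ i, J s (R (y i) k) = Lp.toTemperedDistribution (a i)) :
    ∫⁻ x, (∑ i, ‖a i x‖ₑ ^ 2) ^ 2 ≤ gammaNorm s 4 R ^ 4 := by
  simp_rw [← lintegral_sq_gaussian_sum]
  refine (lintegral_sq_lintegral_le (measurable_gaussian_sum a)).trans ?_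
  rw [show (4 : ℕ) = 2 * 2 from rfl, pow_mul]
  gcongr
  refine le_trans (le_of_eq ?_) (lintegral_enorm_gaussian_sum_le (by norm_num) s R hy k ha)
  refine lintegral_congr fun β ↦ ?_
  rw [eLpNorm_eq_lintegral_rpow_enorm_toReal (by norm_num) (by norm_num), ← ENNReal.rpow_two,
    ← ENNReal.rpow_mul]
  simp only [← pow_mul, ENNReal.toReal_ofNat]
  norm_num

/-- Cauchy-Schwarz with weight |`kerJH`| is applied to each index separately, so the sum of squares
passes under the convolution and scalar Young inequalities suffice afterwards. -/
lemma sum_enorm_sq_apply_heatS_le {g r : ℝ} (hr : 0 < r) {p : ℝ≥0∞} [Fact (1 ≤ p)] {n : ℕ}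
    {u : Fin n → 𝓢'(Plane, ℂ)} {a : Fin n → Lp ℂ p (volume : Measure Plane)}
    (ha : ∀ i, J (-g) (u i) = Lp.toTemperedDistribution (a i)) (x : Plane) :
    ∑ i, ‖u i (heatS r x)‖ₑ ^ 2 ≤ (∫⁻ z, ‖kerJH g hr z‖ₑ) *
      ∫⁻ y, ‖kerJH g hr (y - x)‖ₑ * ∑ i, ‖a i y‖ₑ ^ 2 := by
  have hm (i : Fin n) : Measurable (a i : Plane → ℂ) := (Lp.stronglyMeasurable (a i)).measurable
  have hk : Measurable (kerJH g hr) := (kerJH g hr).continuous.measurable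
  simp_rw [Finset.mul_sum]
  rw [lintegral_finsetSum _ fun i _ ↦ by fun_prop, Finset.mul_sum]
  refine Finset.sum_le_sum fun i _ ↦ ?_
  rw [apply_heatS_eq_integral hr (ha i)]
  calc _ ≤ (∫⁻ y, ‖kerJH g hr (y - x)‖ₑ * ‖a i y‖ₑ) ^ 2 := by
        gcongr
        refine (enorm_integral_le_lintegral_enorm _).trans (le_of_eq ?_)
        simp_rw [enorm_mul]
    _ ≤ _ := by
        refine (sq_lintegral_weight_le (by fun_prop) (by fun_prop)).trans (le_of_eq ?_)
        rw [lintegral_sub_right_eq_self (fun y ↦ ‖kerJH g hr y‖ₑ) x]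

/-- The Hilbert-Schmidt type bound for the smoothing of a radonifying operator. -/
theorem lintegral_tsum_heatS_le {g r : ℝ} (hr : 0 < r) {p : ℝ≥0∞} [Fact (1 ≤ p)] {q : ℕ}
    (hpq : p = 2 ∧ q = 1 ∨ p = 4 ∧ q = 2) {R : Y →ₗ[ℝ] VecDist} (hR : ∀ y, MemHsol (-g) p (R y))
    {ι : Type*} [Countable ι] {b : ι → Y} (hb : Orthonormal ℝ b) (k : Fin 2) :
    ∫⁻ x, (∑' i, ‖R (b i) k (heatS r x)‖ₑ ^ 2) ^ q ≤
      (∫⁻ z, ‖kerJH g hr z‖ₑ) ^ (2 * q) * gammaNorm (-g) p R ^ (2 * q) := by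
  have hp : p ≠ ∞ := by rcases hpq with ⟨rfl, -⟩ | ⟨rfl, -⟩ <;> norm_num
  choose a ha using fun y ↦ (hR y).exists_lp hp k
  have hm (y : Y) : Measurable (a y : Plane → ℂ) := (Lp.stronglyMeasurable (a y)).measurable
  have hk : Measurable (kerJH g hr) := (kerJH g hr).continuous.measurable
  have hS (y : Y) : Measurable fun x ↦ ‖R y k (heatS r x)‖ₑ ^ 2 := by
    simp_rw [apply_heatS_eq_integral hr (ha y)]
    refine (StronglyMeasurable.measurable ?_).enorm.pow_const 2
    refine StronglyMeasurable.integral_prod_right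
      (f := fun x z : Plane ↦ kerJH g hr (z - x) * a y z) ?_
    exact Measurable.stronglyMeasurable (by unfold Function.uncurry; fun_prop)
  -- The γ-norm is a supremum over finite orthonormal systems, so each finite part of the basis is
  -- bounded uniformly; monotone convergence then gives the full sum.
  have hfin (s : Finset ι) : ∫⁻ x, (∑ i ∈ s, ‖R (b i) k (heatS r x)‖ₑ ^ 2) ^ q ≤
      (∫⁻ z, ‖kerJH g hr z‖ₑ) ^ (2 * q) * gammaNorm (-g) p R ^ (2 * q) := by
    set y : Fin s.card → Y := fun j ↦ b (s.equivFin.symm j)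
    have hy : Orthonormal ℝ y :=
      hb.comp (fun j ↦ ((s.equivFin.symm j : s) : ι))
        (Subtype.val_injective.comp s.equivFin.symm.injective)
    have h1 (x : Plane) : ∑ i ∈ s, ‖R (b i) k (heatS r x)‖ₑ ^ 2 =
        ∑ j, ‖R (y j) k (heatS r x)‖ₑ ^ 2 := by
      rw [← Finset.sum_coe_sort s, ← Equiv.sum_comp s.equivFin.symm]
    simp_rw [h1]
    have h2 : ∫⁻ x, (∑ j, ‖a (y j) x‖ₑ ^ 2) ^ q ≤ gammaNorm (-g) p R ^ (2 * q) := by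
      rcases hpq with ⟨rfl, rfl⟩ | ⟨rfl, rfl⟩
      · simpa using lintegral_sum_sq_le_gammaNorm_two (-g) R hy k fun i ↦ ha (y i)
      · exact lintegral_sum_sq_le_gammaNorm_four (-g) R hy k fun i ↦ ha (y i)
    calc _ ≤ ∫⁻ x, ((∫⁻ z, ‖kerJH g hr z‖ₑ) *
          ∫⁻ z, ‖kerJH g hr (z - x)‖ₑ * ∑ i, ‖a (y i) z‖ₑ ^ 2) ^ q := by
          refine lintegral_mono fun x ↦ ?_
          gcongr
          exact sum_enorm_sq_apply_heatS_le hr (fun i ↦ ha (y i)) x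
      _ ≤ _ := lintegral_pow_conv_le (hpq.imp And.right And.right) hk.enorm (by fun_prop)
      _ ≤ _ := by gcongr
  simp_rw [ENNReal.tsum_eq_iSup_sum, ENNReal.iSup_pow]
  rw [lintegral_iSup_directed (fun s ↦ ((Finset.measurable_fun_sum s fun i _ ↦
    hS (b i)).pow_const q).aemeasurable)]
  · exact iSup_le hfin
  · refine Monotone.directed_le fun s s' hss x ↦ ?_
    dsimp only
    gcongr

end Gamma

/-! ### Mollification -/

section Mollify

instance fact_two_ne_top : Fact ((2 : ℝ≥0∞) ≠ ∞) := ⟨by norm_num⟩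

/-- The `L²` distance of `a` from its translate by `z`. -/
def transDist (a : Lp ℂ 2 (volume : Measure Plane)) (z : Plane) : ℝ :=
  ‖(DomAddAct.mk z +ᵥ a : Lp ℂ 2 (volume : Measure Plane)) - a‖

lemma continuous_transDist (a : Lp ℂ 2 (volume : Measure Plane)) : Continuous (transDist a) := by
  have h : Continuous fun z : Plane ↦ (DomAddAct.mk z : Planeᵈᵃᵃ) := DomAddAct.continuous_mk
  unfold transDist
  fun_prop

lemma transDist_zero (a : Lp ℂ 2 (volume : Measure Plane)) : transDist a 0 = 0 := by
  rw [transDist, DomAddAct.mk_zero, zero_vadd, sub_self, norm_zero]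

lemma transDist_le (a : Lp ℂ 2 (volume : Measure Plane)) (z : Plane) :
    transDist a z ≤ 2 * ‖a‖ := by
  refine (norm_sub_le _ _).trans ?_
  rw [DomAddAct.norm_vadd_Lp]
  linarith

lemma lintegral_enorm_sq_eq (a : Lp ℂ 2 (volume : Measure Plane)) :
    ∫⁻ x, ‖a x‖ₑ ^ 2 = ‖a‖ₑ ^ 2 := by
  rw [Lp.enorm_def, eLpNorm_eq_lintegral_rpow_enorm_toReal (by norm_num) (by norm_num)]
  simp only [ENNReal.toReal_ofNat, ENNReal.rpow_two]
  rw [rpow_half_sq]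

lemma ofReal_transDist_sq (a : Lp ℂ 2 (volume : Measure Plane)) (z : Plane) :
    ENNReal.ofReal (transDist a z ^ 2) = ∫⁻ x, ‖a (z + x) - a x‖ₑ ^ 2 := by
  rw [transDist, ENNReal.ofReal_pow (norm_nonneg _), ofReal_norm, ← lintegral_enorm_sq_eq]
  refine lintegral_congr_ae ?_
  filter_upwards [Lp.coeFn_sub (DomAddAct.mk z +ᵥ a) a, DomAddAct.vadd_Lp_ae_eq (DomAddAct.mk z) a]
    with x h1 h2
  rw [h1, Pi.sub_apply, h2]
  rfl

lemma heatKer_scale {δ : ℝ} (hδ : 0 < δ) (w : Plane) :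
    heatKer δ (√δ • w) = δ⁻¹ * heatKer 1 w := by
  simp only [heatKer, norm_smul, mul_pow, Real.norm_eq_abs, sq_abs, Real.sq_sqrt hδ.le]
  have := Real.pi_ne_zero
  rw [show (4 * δ)⁻¹ * (δ * ‖w‖ ^ 2) = (4 * 1)⁻¹ * ‖w‖ ^ 2 by field_simp]
  field_simp

/-- The substitution z = √δ w moves the scale from the kernel to D, and dominated convergence
applies. -/
lemma tendsto_integral_heatKer_mul {D : Plane → ℝ} (hD : Continuous D) (h0 : D 0 = 0) {C : ℝ}
    (hC : ∀ z, |D z| ≤ C) {δ : ℕ → ℝ} (hδ : ∀ n, 0 < δ n) (hδ0 : Tendsto δ atTop (𝓝 0)) :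
    Tendsto (fun n ↦ ∫ z, heatKer (δ n) z * D z) atTop (𝓝 0) := by
  have h1 (n : ℕ) : ∫ z, heatKer (δ n) z * D z = ∫ w, heatKer 1 w * D (√(δ n) • w) := by
    have h2 := Measure.integral_comp_smul (volume : Measure Plane)
      (fun z ↦ heatKer (δ n) z * D z) (√(δ n))
    simp only [heatKer_scale (hδ n), finrank_euclideanSpace, Fintype.card_fin,
      Real.sq_sqrt (hδ n).le, smul_eq_mul, mul_assoc] at h2
    rw [integral_const_mul, abs_of_nonneg (inv_nonneg.2 (hδ n).le)] at h2
    exact (mul_left_cancel₀ (inv_ne_zero (hδ n).ne') h2).symm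
  simp_rw [h1]
  have h3 : Tendsto (fun n ↦ √(δ n)) atTop (𝓝 0) := by
    have := (Real.continuous_sqrt.tendsto 0).comp hδ0
    rwa [Real.sqrt_zero] at this
  have hm : Continuous (heatKer 1) := by unfold heatKer; fun_prop
  have := tendsto_integral_of_dominated_convergence (μ := volume)
    (F := fun n w ↦ heatKer 1 w * D (√(δ n) • w)) (f := fun _ ↦ 0)
    (fun w ↦ heatKer 1 w * C) (fun n ↦ by
      refine Continuous.aestronglyMeasurable ?_
      fun_prop)
    ((integrable_heatKer one_pos).mul_const C)
    (fun n ↦ ae_of_all _ fun w ↦ by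
      rw [norm_mul, Real.norm_eq_abs, Real.norm_eq_abs, abs_of_nonneg (heatKer_nonneg one_pos w)]
      exact mul_le_mul_of_nonneg_left (hC _) (heatKer_nonneg one_pos w))
    (ae_of_all _ fun w ↦ by
      have h4 : Tendsto (fun n ↦ √(δ n) • w) atTop (𝓝 0) := by
        simpa using h3.smul_const w
      have h5 := ((hD.tendsto 0).comp h4).const_mul (heatKer 1 w)
      rwa [h0, mul_zero] at h5)
  simpa using this

lemma apply_heatS_eq_integral_shift {δ : ℝ} (hδ : 0 < δ) (a : Lp ℂ 2 (volume : Measure Plane))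
    (x : Plane) : Lp.toTemperedDistribution a (heatS δ x) = ∫ z, (heatKer δ z : ℂ) * a (z + x) := by
  rw [Lp.toTemperedDistribution_apply,
    ← integral_add_right_eq_self (fun y ↦ heatS δ x y • a y) x]
  simp [heatS_apply hδ]

lemma lintegral_heatKer {δ : ℝ} (hδ : 0 < δ) : ∫⁻ z, ‖heatKer δ z‖ₑ = 1 := by
  have h1 (z : Plane) : ‖heatKer δ z‖ₑ = ENNReal.ofReal (heatKer δ z) := by
    rw [← ofReal_norm, Real.norm_eq_abs, abs_of_nonneg (heatKer_nonneg hδ z)]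
  simp_rw [h1]
  rw [← ofReal_integral_eq_lintegral_ofReal (integrable_heatKer hδ)
    (ae_of_all _ (heatKer_nonneg hδ)), integral_heatKer hδ, ENNReal.ofReal_one]

/-- The heat kernel has mass 1, so mollification minus identity is an average of translation
differences, and Cauchy-Schwarz moves the square inside the average. -/
lemma lintegral_mollify_sub_le {δ : ℝ} (hδ : 0 < δ) (a : Lp ℂ 2 (volume : Measure Plane)) :
    ∫⁻ x, ‖Lp.toTemperedDistribution a (heatS δ x) - a x‖ₑ ^ 2 ≤
      ENNReal.ofReal (∫ z, heatKer δ z * transDist a z ^ 2) := by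
  have ha : Measurable (a : Plane → ℂ) := (Lp.stronglyMeasurable a).measurable
  have hk : Measurable (heatKer δ) := by unfold heatKer; fun_prop
  have hi (x : Plane) : Integrable fun z ↦ (heatKer δ z : ℂ) * a (z + x) := by
    have h1 : MemLp (heatS δ 0) 2 (volume : Measure Plane) := SchwartzMap.memLp _ 2 _
    have h2 : MemLp (fun z ↦ a (z + x)) 2 (volume : Measure Plane) :=
      (Lp.memLp a).comp_measurePreserving (measurePreserving_add_right volume x)
    refine (h1.integrable_mul h2).congr (ae_of_all _ fun z ↦ ?_)
    simp [heatS_apply hδ]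
  have h1 (x : Plane) : Lp.toTemperedDistribution a (heatS δ x) - a x =
      ∫ z, (heatKer δ z : ℂ) * (a (z + x) - a x) := by
    have h2 : ∫ z, (heatKer δ z : ℂ) * a x = a x := by
      rw [integral_mul_const, integral_complex_ofReal, integral_heatKer hδ]
      simp
    simp_rw [mul_sub]
    have h4 : Integrable fun z ↦ (heatKer δ z : ℂ) * a x :=
      (integrable_heatKer hδ).ofReal.mul_const _
    rw [integral_sub (hi x) h4, h2,
      apply_heatS_eq_integral_shift hδ]
  have h3 (x : Plane) : ‖Lp.toTemperedDistribution a (heatS δ x) - a x‖ₑ ^ 2 ≤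
      ∫⁻ z, ‖heatKer δ z‖ₑ * ‖a (z + x) - a x‖ₑ ^ 2 := by
    calc _ ≤ (∫⁻ z, ‖heatKer δ z‖ₑ * ‖a (z + x) - a x‖ₑ) ^ 2 := by
          rw [h1]
          gcongr
          refine (enorm_integral_le_lintegral_enorm _).trans (le_of_eq ?_)
          refine lintegral_congr fun z ↦ ?_
          rw [enorm_mul]
          congr 1
          rw [← ofReal_norm, ← ofReal_norm, Complex.norm_real]
      _ ≤ _ := by
          refine (sq_lintegral_weight_le (by fun_prop) (by fun_prop)).trans (le_of_eq ?_)
          rw [lintegral_heatKer hδ, one_mul]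
  refine (lintegral_mono h3).trans (le_of_eq ?_)
  rw [lintegral_lintegral_swap (f := fun x z ↦ ‖heatKer δ z‖ₑ * ‖a (z + x) - a x‖ₑ ^ 2)
    (Measurable.aemeasurable (by unfold Function.uncurry; fun_prop)),
    ofReal_integral_eq_lintegral_ofReal]
  · refine lintegral_congr fun z ↦ ?_
    rw [lintegral_const_mul _ (by fun_prop), ← ofReal_transDist_sq,
      ENNReal.ofReal_mul (heatKer_nonneg hδ z), ← ofReal_norm, Real.norm_eq_abs,
      abs_of_nonneg (heatKer_nonneg hδ z)]
  · refine ((integrable_heatKer hδ).mul_const ((2 * ‖a‖) ^ 2)).mono'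
      (hk.mul ((continuous_transDist a).measurable.pow_const 2)).aestronglyMeasurable
      (ae_of_all _ fun z ↦ ?_)
    have := transDist_le a z
    have h4 : 0 ≤ transDist a z := norm_nonneg _
    rw [norm_mul, Real.norm_eq_abs, Real.norm_eq_abs, abs_of_nonneg (heatKer_nonneg hδ z),
      abs_of_nonneg (sq_nonneg _)]
    have := heatKer_nonneg hδ z
    gcongr
  · exact ae_of_all _ fun z ↦ mul_nonneg (heatKer_nonneg hδ z) (sq_nonneg _)

theorem tendsto_mollify {δ : ℕ → ℝ} (hδ : ∀ n, 0 < δ n) (hδ0 : Tendsto δ atTop (𝓝 0))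
    (a : Lp ℂ 2 (volume : Measure Plane)) :
    Tendsto (fun n ↦ ∫⁻ x, ‖Lp.toTemperedDistribution a (heatS (δ n) x) - a x‖ₑ ^ 2)
      atTop (𝓝 0) := by
  have h := tendsto_integral_heatKer_mul (D := fun z ↦ transDist a z ^ 2)
    ((continuous_transDist a).pow 2) (by simp [transDist_zero]) (C := (2 * ‖a‖) ^ 2)
    (fun z ↦ by
      rw [abs_of_nonneg (sq_nonneg _)]
      have := transDist_le a z
      have h4 : 0 ≤ transDist a z := norm_nonneg _
      gcongr) hδ hδ0
  have h2 := ENNReal.tendsto_ofReal h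
  rw [ENNReal.ofReal_zero] at h2
  exact tendsto_of_tendsto_of_tendsto_of_le_of_le tendsto_const_nhds h2 (fun _ ↦ zero_le)
    fun n ↦ lintegral_mollify_sub_le (hδ n) a

end Mollify

/-! ### Fatou's lemma along mean-square convergent sequences -/

/-- For c' above the liminf, a subsequence has all its integrals below c'; along it Fatou's lemma
applies almost everywhere after a further extraction. -/
lemma lintegral_pow_le_liminf {α E : Type*} [MeasurableSpace α] {μ : Measure α}
    [NormedAddCommGroup E] {f : ℕ → α → E} {g : α → E} (hf : ∀ n, AEStronglyMeasurable (f n) μ) (hg : AEStronglyMeasurable g μ)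
    (h : Tendsto (fun n ↦ ∫⁻ x, ‖f n x - g x‖ₑ ^ 2 ∂μ) atTop (𝓝 0)) (p : ℕ) :
    ∫⁻ x, ‖g x‖ₑ ^ p ∂μ ≤ liminf (fun n ↦ ∫⁻ x, ‖f n x‖ₑ ^ p ∂μ) atTop := by
  refine le_of_forall_gt fun c hc ↦ ?_
  obtain ⟨c', hc1, hc2⟩ := exists_between hc
  obtain ⟨φ, hφ, hφc⟩ := extraction_of_frequently_atTop (frequently_lt_of_liminf_lt (by isBoundedDefault) hc1)
  refine lt_of_le_of_lt ?_ hc2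
  exact lintegral_comp_le_of_tendsto (fun n ↦ hf (φ n)) hg (h.comp hφ.tendsto_atTop)
    (Ψ := fun _ z ↦ ‖z‖ₑ ^ p) (c := fun _ ↦ c') (fun _ ↦ (ENNReal.continuous_pow p).comp continuous_enorm)
    (fun n ↦ (hf _).enorm.pow_const p) (fun n ↦ (hφc n).le) tendsto_const_nhds

/-! ### Scalar components of Itô integrals -/

section Riesz

variable {Y : Type*} [NormedAddCommGroup Y] [InnerProductSpace ℝ Y]

lemma enorm_le_of_inner {z : Y} {M : ℝ≥0∞} (h : ∀ y : Y, ‖y‖ = 1 → ‖inner ℝ z y‖ₑ ≤ M) :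
    ‖z‖ₑ ≤ M := by
  rcases eq_or_ne z 0 with rfl | hz
  · simp
  have hz' : ‖z‖ ≠ 0 := norm_ne_zero_iff.2 hz
  have h1 := h (‖z‖⁻¹ • z) (by rw [norm_smul, norm_inv, norm_norm, inv_mul_cancel₀ hz'])
  rw [inner_smul_right, real_inner_self_eq_norm_sq, sq, inv_mul_cancel_left₀ hz'] at h1
  rwa [← ofReal_norm, norm_norm, ofReal_norm] at h1

open Classical in
/-- The vector representing the functional `ℓ`, if there is one. -/
def rieszVec (ℓ : Y →ₗ[ℝ] ℝ) : Y := if h : ∃ z, ∀ y, inner ℝ z y = ℓ y then h.choose else 0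

lemma inner_rieszVec [CompleteSpace Y] {ℓ : Y →ₗ[ℝ] ℝ} {C : ℝ} (h : ∀ y, ‖y‖ = 1 → |ℓ y| ≤ C)
    (y : Y) : inner ℝ (rieszVec ℓ) y = ℓ y := by
  have h1 (y : Y) : ‖ℓ y‖ ≤ C * ‖y‖ := by
    rcases eq_or_ne y 0 with rfl | hy
    · simp
    have hy' : ‖y‖ ≠ 0 := norm_ne_zero_iff.2 hy
    have h2 := h (‖y‖⁻¹ • y) (by rw [norm_smul, norm_inv, norm_norm, inv_mul_cancel₀ hy'])
    rw [map_smul, smul_eq_mul, abs_mul, abs_inv, abs_norm, inv_mul_le_iff₀ (by positivity)] at h2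
    rw [Real.norm_eq_abs]
    linarith
  have h3 : ∃ z, ∀ y, inner ℝ z y = ℓ y :=
    ⟨(InnerProductSpace.toDual ℝ Y).symm (ℓ.mkContinuous C h1), fun y ↦ by
      rw [InnerProductSpace.toDual_symm_apply]
      rfl⟩
  rw [rieszVec, dif_pos h3]
  exact h3.choose_spec y

lemma countable_of_orthonormal [TopologicalSpace.SeparableSpace Y] {ι : Type*} {b : ι → Y}
    (hb : Orthonormal ℝ b) : Countable ι := by
  have h1 : (Set.univ : Set ι).PairwiseDisjoint fun i ↦ Metric.ball (b i) (1 / 2) := by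
    intro i _ j _ hij
    refine Metric.ball_disjoint_ball ?_
    have h2 : ‖b i - b j‖ ^ 2 = 2 := by
      rw [@norm_sub_sq_real, hb.1 i, hb.1 j, hb.2 hij]
      norm_num
    rw [dist_eq_norm]
    nlinarith [norm_nonneg (b i - b j)]
  exact Set.countable_univ_iff.1 (h1.countable_of_isOpen (fun i _ ↦ Metric.isOpen_ball)
    fun i _ ↦ ⟨b i, Metric.mem_ball_self (by norm_num)⟩)

lemma enorm_sq_eq_tsum {ι : Type*} (b : HilbertBasis ι ℝ Y) (z : Y) :
    ‖z‖ₑ ^ 2 = ∑' i, ‖inner ℝ z (b i)‖ₑ ^ 2 := by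
  have h := b.hasSum_inner_mul_inner z z
  have h1 (i : ι) : inner ℝ z (b i) * inner ℝ (b i) z = ‖inner ℝ z (b i)‖ ^ 2 := by
    rw [real_inner_comm z (b i), Real.norm_eq_abs, sq_abs, sq]
  simp_rw [h1, real_inner_self_eq_norm_sq] at h
  rw [← ofReal_norm, ← ENNReal.ofReal_pow (norm_nonneg _), ← h.tsum_eq,
    ENNReal.ofReal_tsum_of_nonneg (fun i ↦ sq_nonneg _) h.summable]
  simp_rw [ENNReal.ofReal_pow (norm_nonneg _), ofReal_norm]

/-- Weak measurability suffices in a separable Hilbert space: the expansion in a countable basis is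
a pointwise limit of measurable finite sums. -/
lemma stronglyMeasurable_of_inner [CompleteSpace Y] [TopologicalSpace.SeparableSpace Y]
    {A : Type*} [MeasurableSpace A] {z : A → Y} (h : ∀ y, Measurable fun a ↦ inner ℝ (z a) y) :
    StronglyMeasurable z := by
  obtain ⟨s, b, -⟩ := exists_hilbertBasis ℝ Y
  have := countable_of_orthonormal b.orthonormal
  refine stronglyMeasurable_of_tendsto (u := atTop)
    (f := fun (F : Finset s) a ↦ ∑ i ∈ F, (inner ℝ (z a) (b i)) • b i) (fun F ↦ ?_) ?_
  · exact Finset.stronglyMeasurable_fun_sum _ fun i _ ↦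
      (h (b i)).stronglyMeasurable.smul_const (b i)
  · rw [tendsto_pi_nhds]
    intro a
    have h1 := b.hasSum_repr (z a)
    simp_rw [b.repr_apply_apply, fun i ↦ real_inner_comm (z a) (b i)] at h1
    exact h1

end Riesz

/-- The real part of the pairing of the `k`-th component with `φ`. -/
def testRe (k : Fin 2) (φ : 𝓢(Plane, ℂ)) : VecDist →ₗ[ℝ] ℝ where
  toFun u := (u k φ).re
  map_add' u v := by
    change (u k φ + v k φ).re = _
    rw [Complex.add_re]
  map_smul' c u := by
    change ((c • u k) φ).re = c * (u k φ).re
    rw [real_smul_eq]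
    change ((c : ℂ) * u k φ).re = _
    simp

lemma testRe_apply (k : Fin 2) (φ : 𝓢(Plane, ℂ)) (u : VecDist) : testRe k φ u = (u k φ).re := rfl

lemma enorm_apply_toTemperedDistribution_le (φ : 𝓢(Plane, ℂ)) (a : Lp ℂ 2 (volume : Measure Plane)) :
    ‖Lp.toTemperedDistribution a φ‖ₑ ≤ eLpNorm φ 2 volume * ‖a‖ₑ := by
  rw [Lp.toTemperedDistribution_apply, Lp.enorm_def]
  have h2 : AEStronglyMeasurable φ := φ.continuous.aestronglyMeasurable
  have h3 := eLpNorm_smul_le_mul_eLpNorm (p := 2) (q := 2) (r := 1) (Lp.aestronglyMeasurable a) h2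
  refine (enorm_integral_le_lintegral_enorm _).trans (le_trans ?_ h3)
  rw [eLpNorm_one_eq_lintegral_enorm]
  exact lintegral_mono fun x ↦ le_rfl

/-- The summand 1 keeps the factor nonzero, so that the right side is ∞ when `u k` is not square
integrable, even for φ = 0. -/
lemma enorm_testRe_le (k : Fin 2) (φ : 𝓢(Plane, ℂ)) (u : VecDist) :
    ‖testRe k φ u‖ₑ ≤ (eLpNorm φ 2 volume + 1) * distLpNorm 2 (u k) := by
  by_cases h : distLpNorm 2 (u k) < ∞
  · obtain ⟨a, ha⟩ := exists_of_distLpNorm_lt_top h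
    rw [testRe_apply, ha, distLpNorm_toTemperedDistribution]
    calc _ ≤ ‖Lp.toTemperedDistribution a φ‖ₑ := by
          rw [← ofReal_norm, ← ofReal_norm]
          exact ENNReal.ofReal_le_ofReal (Complex.abs_re_le_norm _)
      _ ≤ _ := enorm_apply_toTemperedDistribution_le φ a
      _ ≤ _ := by gcongr; exact le_self_add
  · rw [not_lt_top_iff.1 h, ENNReal.mul_top (by simp)]
    exact le_top

/-- The `k`-th component of a square integrable vector field. -/
def compLp (k : Fin 2) : L2Field →L[ℝ] Lp ℂ 2 (volume : Measure Plane) :=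
  (Complex.ofRealCLM ∘L (EuclideanSpace.proj k : Plane →L[ℝ] ℝ)).compLpL 2 volume

lemma toDist_apply (h : HSp) (k : Fin 2) :
    toDist h k = Lp.toTemperedDistribution (compLp k (h : L2Field)) := rfl

lemma compLp_ae (k : Fin 2) (h : L2Field) : ∀ᵐ x, compLp k h x = ((h x k : ℝ) : ℂ) :=
  ContinuousLinearMap.coeFn_compLpL _ h

lemma norm_compLp_le (k : Fin 2) (h : L2Field) : ‖compLp k h‖ ≤ ‖h‖ := by
  refine Lp.norm_le_norm_of_ae_le ?_
  filter_upwards [compLp_ae k h] with x hx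
  rw [hx, Complex.norm_real]
  exact PiLp.norm_apply_le _ _

lemma enorm_testRe_toDist_le (k : Fin 2) (φ : 𝓢(Plane, ℂ)) (h : HSp) :
    ‖testRe k φ (toDist h)‖ₑ ≤ (eLpNorm φ 2 volume + 1) * ‖h‖ₑ := by
  refine (enorm_testRe_le k φ _).trans ?_
  gcongr
  rw [toDist_apply, distLpNorm_toTemperedDistribution, ← ofReal_norm, ← ofReal_norm]
  exact ENNReal.ofReal_le_ofReal (norm_compLp_le k h)

lemma continuous_testRe_toDist (k : Fin 2) (φ : 𝓢(Plane, ℂ)) :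
    Continuous fun h : HSp ↦ testRe k φ (toDist h) := by
  have hC : eLpNorm φ 2 volume + 1 ≠ ∞ :=
    ENNReal.add_ne_top.2 ⟨(SchwartzMap.memLp φ 2 volume).2.ne, ENNReal.one_ne_top⟩
  refine AddMonoidHomClass.continuous_of_bound (testRe k φ ∘ₗ toDist)
    (eLpNorm φ 2 volume + 1).toReal fun h ↦ ?_
  have h1 := ENNReal.toReal_mono (ENNReal.mul_ne_top hC enorm_ne_top) (enorm_testRe_toDist_le k φ h)
  rwa [ENNReal.toReal_mul, toReal_enorm, toReal_enorm] at h1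

section Scalar

variable {Ω : Type*} [mΩ : MeasurableSpace Ω] {P : Measure Ω} [IsProbabilityMeasure P]
  {𝓕 : Filtration ℝ≥0 mΩ} {Y : Type*} [NormedAddCommGroup Y] [InnerProductSpace ℝ Y]
  {w : ℝ≥0 → Y → Ω → ℝ}

/-- An elementary term composed with a functional on `H`. -/
def ElemTerm.scale (X : ElemTerm 𝓕 Y) (c : ℝ) : ElemTerm 𝓕 Y where
  a := X.a
  b := X.b
  le := X.le
  ξ ω := X.ξ ω * c
  meas := X.meas.mul_const c
  bdd := by
    obtain ⟨C, hC⟩ := X.bdd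
    refine ⟨C * |c|, fun ω ↦ ?_⟩
    rw [abs_mul]
    exact mul_le_mul_of_nonneg_right (hC ω) (abs_nonneg c)
  y := X.y
  h := X.h

lemma testRe_gammaNorm_le (k : Fin 2) (φ : 𝓢(Plane, ℂ)) (R : Y →ₗ[ℝ] VecDist) {y : Y}
    (hy : ‖y‖ = 1) : ‖testRe k φ (R y)‖ₑ ≤ (eLpNorm φ 2 volume + 1) * gammaNorm 0 2 R := by
  refine (enorm_testRe_le k φ _).trans ?_
  gcongr
  have := distLpNorm_le_gammaNorm (p := 2) (by norm_num) 0 R hy k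
  rwa [J_zero] at this

/-- Testing commutes with elementary integrals: each vector h is replaced by the number ⟨h, φ⟩. The
Y-norm of the representing vector of an error is a supremum over unit vectors, hence at most a
multiple of the γ-norm, and both mean-square convergences are inherited. -/
theorem ito_scalar_moment_bounds [CompleteSpace Y] (hw : IsCylindricalWiener 𝓕 P w) {t : ℝ≥0}
    {Φ : ℝ≥0 → Ω → Y →ₗ[ℝ] VecDist} {I : Ω → HSp} (hI : IsItoIntegral 𝓕 P w t Φ I) (k : Fin 2)
    (φ : 𝓢(Plane, ℂ)) {ψ : ℝ → Ω → Y} (hψ : StronglyMeasurable fun p : Ω × ℝ ↦ ψ p.2 p.1) {K : ℝ}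
    (hψK : ∀ s ω, ‖ψ s ω‖ ≤ K)
    (hψΦ : ∀ s ∈ Set.Ioo (0 : ℝ) t, ∀ ω y, inner ℝ (ψ s ω) y = testRe k φ (Φ s.toNNReal ω y)) :
    ∫⁻ ω, ‖testRe k φ (toDist (I ω))‖ₑ ^ 2 ∂P ≤
        2 * ∫⁻ ω, (∫⁻ s in Set.Ioo (0 : ℝ) t, ‖ψ s ω‖ₑ ^ 2) ∂P ∧
      ∫⁻ ω, ‖testRe k φ (toDist (I ω))‖ₑ ^ 4 ∂P ≤
        burkholderConst * ∫⁻ ω, (∫⁻ s in Set.Ioo (0 : ℝ) t, ‖ψ s ω‖ₑ ^ 2) ^ 2 ∂P := by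
  obtain ⟨hIm, m, X, h1, h2⟩ := hI
  set C := eLpNorm φ 2 volume + 1
  have hC : C ≠ ∞ :=
    ENNReal.add_ne_top.2 ⟨(SchwartzMap.memLp φ 2 volume).2.ne, ENNReal.one_ne_top⟩
  refine ito_moment_bounds hw (fun n j ↦ (X n j).scale (testRe k φ (toDist (X n j).h))) t hψ hψK
    ((continuous_testRe_toDist k φ).comp_aestronglyMeasurable hIm) ?_ ?_
  · have h3 := ENNReal.Tendsto.const_mul h1 (Or.inr (ENNReal.pow_ne_top hC : C ^ 2 ≠ ∞))
    rw [mul_zero] at h3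
    refine tendsto_of_tendsto_of_tendsto_of_le_of_le tendsto_const_nhds h3 (fun _ ↦ zero_le)
      fun n ↦ ?_
    dsimp only
    rw [← lintegral_const_mul' _ _ (ENNReal.pow_ne_top hC)]
    refine lintegral_mono fun ω ↦ ?_
    rw [← lintegral_const_mul' _ _ (ENNReal.pow_ne_top hC)]
    refine setLIntegral_mono' measurableSet_Ioo fun s hs ↦ ?_
    rw [← mul_pow]
    gcongr
    rw [enorm_sub_rev]
    refine enorm_le_of_inner fun y hy ↦ ?_
    have h4 : inner ℝ (ψ s ω - elemProc (fun j ↦ (X n j).scale (testRe k φ (toDist (X n j).h)))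
        s.toNNReal ω) y = testRe k φ ((Φ s.toNNReal ω -
          toDist ∘ₗ ∑ j, (X n j).op s.toNNReal ω) y) := by
      rw [inner_sub_left, hψΦ s hs, LinearMap.sub_apply, map_sub, elemProc, sum_inner,
        LinearMap.comp_apply, LinearMap.sum_apply, map_sum, map_sum]
      congr 1
      refine Finset.sum_congr rfl fun j _ ↦ ?_
      unfold ElemTerm.op ElemTerm.scale
      dsimp only
      split_ifs
      · simp only [LinearMap.smul_apply, rankOne, LinearMap.smulRight_apply, innerₗ_apply_apply,
          map_smul, inner_smul_left, smul_eq_mul]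
        simp
        ring
      · simp
    rw [h4]
    exact testRe_gammaNorm_le k φ _ hy
  · have h3 := ENNReal.Tendsto.const_mul h2 (Or.inr (ENNReal.pow_ne_top hC : C ^ 2 ≠ ∞))
    rw [mul_zero] at h3
    refine tendsto_of_tendsto_of_tendsto_of_le_of_le tendsto_const_nhds h3 (fun _ ↦ zero_le)
      fun n ↦ ?_
    dsimp only
    rw [← lintegral_const_mul' _ _ (ENNReal.pow_ne_top hC)]
    refine lintegral_mono fun ω ↦ ?_
    rw [← mul_pow]
    gcongr
    have h4 : elemInt w (fun j ↦ (X n j).scale (testRe k φ (toDist (X n j).h))) t ω =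
        testRe k φ (toDist (∑ j, (X n j).integral w t ω)) := by
      rw [elemInt, map_sum, map_sum]
      refine Finset.sum_congr rfl fun j _ ↦ ?_
      unfold ElemTerm.integral ElemTerm.scale
      dsimp only
      rw [map_smul, map_smul, smul_eq_mul]
      ring
    rw [h4, ← map_sub, ← map_sub]
    exact enorm_testRe_toDist_le k φ _

end Scalar

/-! ### Moments of the stochastic convolution -/

lemma continuous_testRe_heatS (k : Fin 2) {δ : ℝ} (hδ : 0 < δ) (h : HSp) :
    Continuous fun x ↦ testRe k (heatS δ x) (toDist h) := by
  have h4 : J (-0) (toDist h k) = Lp.toTemperedDistribution (compLp k (h : L2Field)) := by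
    rw [neg_zero, J_zero, toDist_apply]
  have h5 := (Complex.continuous_re.comp (continuousOn_apply_heatS h4 hδ)).comp
    (Continuous.prodMk_right δ)
  simpa [Function.comp_def, testRe_apply] using h5

lemma measurable_testRe_heatS {Ω : Type*} [MeasurableSpace Ω] (k : Fin 2) {δ : ℝ} (hδ : 0 < δ)
    {I : Ω → HSp} (hIm : StronglyMeasurable I) (n : ℕ) :
    Measurable (Function.uncurry fun (ω : Ω) (x : Plane) ↦
      ‖testRe k (heatS δ x) (toDist (I ω))‖ₑ ^ n) := by
  have h3 : Measurable (Function.uncurry fun (x : Plane) (h : HSp) ↦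
      testRe k (heatS δ x) (toDist h)) :=
    measurable_uncurry_of_continuous_of_measurable (fun h ↦ continuous_testRe_heatS k hδ h)
      fun x ↦ (continuous_testRe_toDist k _).measurable
  have h6 : Measurable fun p : Ω × Plane ↦ (p.2, I p.1) :=
    measurable_snd.prodMk (hIm.measurable.comp measurable_fst)
  exact (h3.comp h6).enorm.pow_const _

section Noise

variable {Ω : Type*} [mΩ : MeasurableSpace Ω] {P : Measure Ω} [IsProbabilityMeasure P]
  {𝓕 : Filtration ℝ≥0 mΩ} {Y : Type*} [NormedAddCommGroup Y] [InnerProductSpace ℝ Y]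
  {w : ℝ≥0 → Y → Ω → ℝ}

/-- Progressive measurability on [0, t] is exactly what the path stopped at t requires. -/
lemma measurable_stopped {v : ℝ≥0 → Ω → HSp} (hv : IsStronglyProgressive 𝓕 v) (t : ℝ≥0) :
    Measurable fun p : Ω × ℝ ↦ v (min p.2.toNNReal t) p.1 := by
  have h := (hv t).measurable
  have h1 : Measurable fun p : Ω × ℝ ↦ (⟨min p.2.toNNReal t, Set.mem_Iic.2 (min_le_right _ _)⟩ : Set.Iic t) :=
    Measurable.subtype_mk (by fun_prop)
  exact (h.mono (sup_le_sup le_rfl (MeasurableSpace.comap_mono (𝓕.le t))) le_rfl).comp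
    (h1.prodMk measurable_fst)

/-- The functional representing one point value of the mollified noise. -/
def noiseFun (G : HSp → Y →ₗ[ℝ] VecDist) (k : Fin 2) (δ r : ℝ) (x : Plane) (h : HSp) :
    Y →ₗ[ℝ] ℝ := testRe k (heatS (max r δ) x) ∘ₗ G h

/-- A Carathéodory function: continuous in the smoothing time and centre, measurable in h. The
radonifying hypothesis enters through the continuity. -/
lemma measurable_noiseFun {g : ℝ} {G : HSp → Y →ₗ[ℝ] VecDist}
    (hGm : ∀ (y : Y) (k : Fin 2) (φ : 𝓢(Plane, ℂ)), Measurable fun v : HSp ↦ G v y k φ)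
    (hG1 : IsBoundedNoise (-g) 2 G) (k : Fin 2) {δ : ℝ} (hδ : 0 < δ) (y : Y) :
    Measurable fun q : (ℝ × Plane) × HSp ↦ noiseFun G k δ q.1.1 q.1.2 q.2 y := by
  refine measurable_uncurry_of_continuous_of_measurable
    (u := fun (p : ℝ × Plane) (h : HSp) ↦ noiseFun G k δ p.1 p.2 h y) (fun h ↦ ?_) fun p ↦ ?_
  · obtain ⟨a, ha⟩ := ((hG1.radonifying h).1 y).exists_lp (by norm_num) k
    exact Complex.continuous_re.comp (continuousOn_apply_heatS ha hδ)
  · exact Complex.measurable_re.comp (hGm y k _)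

lemma exists_noiseFun_le {g : ℝ} {G : HSp → Y →ₗ[ℝ] VecDist}
    (hG1 : IsBoundedNoise (-g) 2 G) (k : Fin 2) {δ : ℝ} (hδ : 0 < δ) :
    ∃ K : ℝ, 0 ≤ K ∧ ∀ r x h y, ‖y‖ = 1 → |noiseFun G k δ r x h y| ≤ K := by
  set K := eLpNorm (symJH g hδ) 2 volume * ⨆ v, gammaNorm (-g) 2 (G v)
  have hK : K ≠ ∞ := ENNReal.mul_ne_top (SchwartzMap.memLp (symJH g hδ) 2 volume).2.ne
    hG1.bounded.ne
  refine ⟨K.toReal, ENNReal.toReal_nonneg, fun r x h y hy ↦ ?_⟩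
  obtain ⟨a, ha⟩ := ((hG1.radonifying h).1 y).exists_lp (by norm_num) k
  rw [← Real.norm_eq_abs, ← toReal_enorm]
  refine ENNReal.toReal_mono hK ?_
  calc _ ≤ ‖G h y k (heatS (max r δ) x)‖ₑ := by
        rw [← ofReal_norm, ← ofReal_norm]
        exact ENNReal.ofReal_le_ofReal (Complex.abs_re_le_norm _)
    _ ≤ _ := norm_apply_heatS_le ha hδ (le_max_right _ _) x
    _ ≤ _ := by
        unfold K
        gcongr
        rw [← distLpNorm_toTemperedDistribution, ← ha]
        exact (distLpNorm_le_gammaNorm (by norm_num) _ _ hy k).trans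
          (le_iSup (fun v ↦ gammaNorm (-g) 2 (G v)) h)

/-- The rate controlling the stochastic convolution. -/
def noiseRate (C g c : ℝ) : ℝ≥0∞ :=
  ∫⁻ r in Set.Ioi (0 : ℝ), ENNReal.ofReal (Real.exp (-(2 * c * r)) * (C * (1 + 1 / r) ^ (g / 2)) ^ 2)

lemma setLIntegral_sub_le_noiseRate (C g c : ℝ) (t : ℝ≥0) :
    ∫⁻ s in Set.Ioo (0 : ℝ) t, ENNReal.ofReal (Real.exp (-(2 * c * (t - s))) *
      (C * (1 + 1 / (t - s)) ^ (g / 2)) ^ 2) ≤ noiseRate C g c := by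
  set F : ℝ → ℝ≥0∞ := (Set.Ioi (0 : ℝ)).indicator fun r ↦
    ENNReal.ofReal (Real.exp (-(2 * c * r)) * (C * (1 + 1 / r) ^ (g / 2)) ^ 2)
  calc _ = ∫⁻ s in Set.Ioo (0 : ℝ) t, F (t - s) := by
        refine setLIntegral_congr_fun measurableSet_Ioo fun s hs ↦ ?_
        have : (t : ℝ) - s ∈ Set.Ioi (0 : ℝ) := sub_pos.2 hs.2
        dsimp only [F]
        rw [Set.indicator_of_mem this]
    _ ≤ ∫⁻ s, F (t - s) := setLIntegral_le_lintegral _ _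
    _ = ∫⁻ s, F s := lintegral_sub_left_eq_self F t
    _ = _ := by rw [lintegral_indicator measurableSet_Ioi, noiseRate]

variable [CompleteSpace Y] [TopologicalSpace.SeparableSpace Y]

/-- The integrand of one point value of the mollified stochastic convolution. -/
@[irreducible]
def noiseVec (G : HSp → Y →ₗ[ℝ] VecDist) (v : ℝ≥0 → Ω → HSp) (c : ℝ) (t : ℝ≥0) (k : Fin 2)
    (δ : ℝ) (x : Plane) (s : ℝ) (ω : Ω) : Y :=
  Real.exp (-(c * max (t - s) 0)) •
    rieszVec (noiseFun G k δ (t - s + δ) x (v (min s.toNNReal t) ω))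

section

variable {g : ℝ} {G : HSp → Y →ₗ[ℝ] VecDist} {v : ℝ≥0 → Ω → HSp}

/-- For 0 < s < t the cutoffs in `noiseVec` are inactive. Outside this interval they keep the vector
bounded and measurable in s, and they never look at v beyond time t. -/
lemma inner_noiseVec (hG1 : IsBoundedNoise (-g) 2 G) (c : ℝ) (t : ℝ≥0) (k : Fin 2) {δ : ℝ}
    (hδ : 0 < δ) (x : Plane) (s : ℝ) (ω : Ω) (y : Y) :
    inner ℝ (noiseVec G v c t k δ x s ω) y = Real.exp (-(c * max (t - s) 0)) *
      noiseFun G k δ (t - s + δ) x (v (min s.toNNReal t) ω) y := by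
  obtain ⟨K, hK0, hK⟩ := exists_noiseFun_le hG1 k hδ
  rw [noiseVec, inner_smul_left, inner_rieszVec (hK _ _ _)]
  rfl

lemma measurable_inner_noiseVec
    (hGm : ∀ (y : Y) (k : Fin 2) (φ : 𝓢(Plane, ℂ)), Measurable fun v : HSp ↦ G v y k φ)
    (hG1 : IsBoundedNoise (-g) 2 G) (hv : IsStronglyProgressive 𝓕 v) (c : ℝ) (t : ℝ≥0) (k : Fin 2)
    {δ : ℝ} (hδ : 0 < δ) (y : Y) :
    Measurable fun q : (Ω × ℝ) × Plane ↦ inner ℝ (noiseVec G v c t k δ q.2 q.1.2 q.1.1) y := by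
  simp_rw [inner_noiseVec hG1 c t k hδ]
  have h1 := measurable_noiseFun hGm hG1 k hδ y
  have h2 := measurable_stopped hv t
  have h3 : Measurable fun q : (Ω × ℝ) × Plane ↦
      (((t - q.1.2 + δ, q.2), v (min q.1.2.toNNReal t) q.1.1) : (ℝ × Plane) × HSp) :=
    Measurable.prodMk (by fun_prop) (h2.comp measurable_fst)
  exact Measurable.mul (by fun_prop) (h1.comp h3)

lemma measurable_enorm_noiseVec
    (hGm : ∀ (y : Y) (k : Fin 2) (φ : 𝓢(Plane, ℂ)), Measurable fun v : HSp ↦ G v y k φ)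
    (hG1 : IsBoundedNoise (-g) 2 G) (hv : IsStronglyProgressive 𝓕 v) (c : ℝ) (t : ℝ≥0) (k : Fin 2)
    {δ : ℝ} (hδ : 0 < δ) :
    Measurable fun q : (Ω × ℝ) × Plane ↦ ‖noiseVec G v c t k δ q.2 q.1.2 q.1.1‖ₑ ^ 2 := by
  have h : StronglyMeasurable fun q : (Ω × ℝ) × Plane ↦ noiseVec G v c t k δ q.2 q.1.2 q.1.1 :=
    stronglyMeasurable_of_inner fun y ↦ measurable_inner_noiseVec hGm hG1 hv c t k hδ y
  exact h.enorm.pow_const 2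

/-- Expansion in an orthonormal basis of Y gives the square function of G(v) smoothed for time t - s
+ δ. As t - s + δ ≥ t - s, the final bound does not involve δ. -/
lemma lintegral_enorm_noiseVec_le (h0 : 0 < g) {C : ℝ}
    (hC : ∀ (r : ℝ) (hr : 0 < r),
      ∫⁻ z, ‖kerJH g hr z‖ₑ ≤ ENNReal.ofReal (C * (1 + 1 / r) ^ (g / 2))) (hC0 : 0 < C)
    (hG1 : IsBoundedNoise (-g) 2 G) {p : ℝ≥0∞} [Fact (1 ≤ p)] (hG : IsBoundedNoise (-g) p G)
    {q : ℕ} (hpq : p = 2 ∧ q = 1 ∨ p = 4 ∧ q = 2) (c : ℝ) (t : ℝ≥0) (k : Fin 2)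
    {δ : ℝ} (hδ : 0 < δ) {s : ℝ} (hs : s ∈ Set.Ioo (0 : ℝ) t) (ω : Ω) :
    ∫⁻ x, (‖noiseVec G v c t k δ x s ω‖ₑ ^ 2) ^ q ≤
      (ENNReal.ofReal (Real.exp (-(2 * c * (t - s))) * (C * (1 + 1 / (t - s)) ^ (g / 2)) ^ 2) *
        (⨆ v, gammaNorm (-g) p (G v)) ^ 2) ^ q := by
  obtain ⟨B, b, -⟩ := exists_hilbertBasis ℝ Y
  have := countable_of_orthonormal b.orthonormal
  have hts : 0 < (t : ℝ) - s := sub_pos.2 hs.2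
  have hr : 0 < (t : ℝ) - s + δ := by positivity
  set h := v (min s.toNNReal t) ω
  have e1 (x : Plane) : ‖noiseVec G v c t k δ x s ω‖ₑ ^ 2 ≤
      ENNReal.ofReal (Real.exp (-(2 * c * (t - s)))) *
        ∑' i, ‖G h (b i) k (heatS (t - s + δ) x)‖ₑ ^ 2 := by
    rw [enorm_sq_eq_tsum b, ← ENNReal.tsum_mul_left]
    refine ENNReal.tsum_le_tsum fun i ↦ ?_
    rw [inner_noiseVec hG1 c t k hδ, enorm_mul, mul_pow, max_eq_left hts.le]
    gcongr
    · rw [← ofReal_norm, ← ENNReal.ofReal_pow (norm_nonneg _), Real.norm_eq_abs, Real.abs_exp,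
        ← Real.exp_nat_mul]
      refine (congrArg _ (congrArg _ ?_)).le
      push_cast
      ring
    · rw [noiseFun, max_eq_left (by linarith), ← ofReal_norm, ← ofReal_norm]
      exact ENNReal.ofReal_le_ofReal (Complex.abs_re_le_norm _)
  have e2 := lintegral_tsum_heatS_le hr hpq (hG.radonifying h).1 b.orthonormal k
  calc _ ≤ ∫⁻ x, (ENNReal.ofReal (Real.exp (-(2 * c * (t - s))))) ^ q *
        (∑' i, ‖G h (b i) k (heatS (t - s + δ) x)‖ₑ ^ 2) ^ q := by
        refine lintegral_mono fun x ↦ ?_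
        rw [← mul_pow]
        gcongr
        exact e1 x
    _ ≤ (ENNReal.ofReal (Real.exp (-(2 * c * (t - s))))) ^ q *
        ((∫⁻ z, ‖kerJH g hr z‖ₑ) ^ (2 * q) * gammaNorm (-g) p (G h) ^ (2 * q)) := by
        rw [lintegral_const_mul' _ _ (ENNReal.pow_ne_top ENNReal.ofReal_ne_top)]
        gcongr
    _ ≤ (ENNReal.ofReal (Real.exp (-(2 * c * (t - s))))) ^ q *
        (ENNReal.ofReal (C * (1 + 1 / (t - s)) ^ (g / 2)) ^ (2 * q) *
          (⨆ v, gammaNorm (-g) p (G v)) ^ (2 * q)) := by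
        gcongr
        · refine (hC _ hr).trans (ENNReal.ofReal_le_ofReal ?_)
          gcongr
          linarith
        · exact le_iSup (fun v ↦ gammaNorm (-g) p (G v)) h
    _ = _ := by
        rw [ENNReal.ofReal_mul (Real.exp_pos _).le, ENNReal.ofReal_pow (by positivity), pow_mul,
          pow_mul, ← mul_pow, ← mul_pow, ← mul_assoc]

/-- The space and time integrals are exchanged by Tonelli's theorem for q = 1 and by Minkowski's
inequality for q = 2. -/
lemma lintegral_pow_lintegral_noiseVec_le (h0 : 0 < g) {C : ℝ}
    (hC : ∀ (r : ℝ) (hr : 0 < r),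
      ∫⁻ z, ‖kerJH g hr z‖ₑ ≤ ENNReal.ofReal (C * (1 + 1 / r) ^ (g / 2))) (hC0 : 0 < C)
    (hGm : ∀ (y : Y) (k : Fin 2) (φ : 𝓢(Plane, ℂ)), Measurable fun v : HSp ↦ G v y k φ)
    (hG1 : IsBoundedNoise (-g) 2 G) {p : ℝ≥0∞} [Fact (1 ≤ p)] (hG : IsBoundedNoise (-g) p G)
    (hv : IsStronglyProgressive 𝓕 v)
    {q : ℕ} (hpq : p = 2 ∧ q = 1 ∨ p = 4 ∧ q = 2) (c : ℝ) (t : ℝ≥0) (k : Fin 2)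
    {δ : ℝ} (hδ : 0 < δ) (ω : Ω) :
    ∫⁻ x, (∫⁻ s in Set.Ioo (0 : ℝ) t, ‖noiseVec G v c t k δ x s ω‖ₑ ^ 2) ^ q ≤
      (noiseRate C g c * (⨆ v, gammaNorm (-g) p (G v)) ^ 2) ^ q := by
  set Γ := ⨆ v, gammaNorm (-g) p (G v)
  have hΓ : Γ ^ 2 ≠ ∞ := ENNReal.pow_ne_top hG.bounded.ne
  have hq1 : Measurable fun p : ℝ × Plane ↦ ((ω, p.1), p.2) :=
    (measurable_const.prodMk measurable_fst).prodMk measurable_snd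
  have hm : Measurable (Function.uncurry fun (s : ℝ) (x : Plane) ↦
      ‖noiseVec G v c t k δ x s ω‖ₑ ^ 2) :=
    (measurable_enorm_noiseVec hGm hG1 hv c t k hδ).comp hq1
  have key (s : ℝ) (hs : s ∈ Set.Ioo (0 : ℝ) t) :=
    lintegral_enorm_noiseVec_le (v := v) h0 hC hC0 hG1 hG hpq c t k hδ hs ω
  have hlast : ∫⁻ s in Set.Ioo (0 : ℝ) t, ENNReal.ofReal (Real.exp (-(2 * c * (t - s))) *
      (C * (1 + 1 / (t - s)) ^ (g / 2)) ^ 2) * Γ ^ 2 ≤ noiseRate C g c * Γ ^ 2 := by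
    rw [lintegral_mul_const' _ _ hΓ]
    gcongr
    exact setLIntegral_sub_le_noiseRate C g c t
  have hq := hpq.imp And.right And.right
  rcases hq with rfl | rfl
  · simp only [pow_one] at key ⊢
    rw [lintegral_lintegral_swap (f := fun (x : Plane) (s : ℝ) ↦
      ‖noiseVec G v c t k δ x s ω‖ₑ ^ 2) (hm.comp measurable_swap).aemeasurable]
    exact (setLIntegral_mono' measurableSet_Ioo key).trans hlast
  · refine (lintegral_sq_lintegral_le hm).trans ?_
    gcongr
    refine le_trans (setLIntegral_mono' measurableSet_Ioo fun s hs ↦ ?_) hlast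
    calc _ ≤ _ := ENNReal.rpow_le_rpow (key s hs) (by norm_num)
      _ = _ := by
        rw [← ENNReal.rpow_natCast, ← ENNReal.rpow_mul,
          show ((2 : ℕ) : ℝ) * (1 / 2) = 1 by norm_num, ENNReal.rpow_one]

/-- Scalar moment bounds at each centre x, integrated over x. The decisive identity is `heat_heatS`:
the semigroup inside the convolution and the mollifier combine into one heat kernel of time t - s +
δ. -/
lemma lintegral_mollified_le (h0 : 0 < g) {C : ℝ}
    (hC : ∀ (r : ℝ) (hr : 0 < r),
      ∫⁻ z, ‖kerJH g hr z‖ₑ ≤ ENNReal.ofReal (C * (1 + 1 / r) ^ (g / 2))) (hC0 : 0 < C)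
    (hw : IsCylindricalWiener 𝓕 P w)
    (hGm : ∀ (y : Y) (k : Fin 2) (φ : 𝓢(Plane, ℂ)), Measurable fun v : HSp ↦ G v y k φ)
    (hG1 : IsBoundedNoise (-g) 2 G) {p : ℝ≥0∞} [Fact (1 ≤ p)] (hG : IsBoundedNoise (-g) p G)
    (hv : IsStronglyProgressive 𝓕 v)
    {q : ℕ} (hpq : p = 2 ∧ q = 1 ∨ p = 4 ∧ q = 2) {c : ℝ} (hc : 0 ≤ c) (t : ℝ≥0) (k : Fin 2)
    {δ : ℝ} (hδ : 0 < δ) {I : Ω → HSp} (hIm : StronglyMeasurable I)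
    (hI : IsItoIntegral 𝓕 P w t
      (fun s ω ↦ Real.exp (-(c * ((t : ℝ) - s))) • (heatVec ((t : ℝ) - s) ∘ₗ G (v s ω))) I) :
    ∫⁻ ω, (∫⁻ x, ‖testRe k (heatS δ x) (toDist (I ω))‖ₑ ^ (2 * q)) ∂P ≤
      (2 + burkholderConst) * (noiseRate C g c * (⨆ v, gammaNorm (-g) p (G v)) ^ 2) ^ q := by
  obtain ⟨K, hK0, hK⟩ := exists_noiseFun_le hG1 k hδ
  have hψm (x : Plane) : StronglyMeasurable fun p : Ω × ℝ ↦ noiseVec G v c t k δ x p.2 p.1 :=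
    stronglyMeasurable_of_inner fun y ↦ (measurable_inner_noiseVec hGm hG1 hv c t k hδ y).comp
      (measurable_id.prodMk measurable_const)
  have hψK (x : Plane) (s : ℝ) (ω : Ω) : ‖noiseVec G v c t k δ x s ω‖ ≤ K := by
    have h2 : ‖noiseVec G v c t k δ x s ω‖ₑ ≤ ENNReal.ofReal K := by
      refine enorm_le_of_inner fun y hy ↦ ?_
      rw [inner_noiseVec hG1 c t k hδ, ← ofReal_norm]
      apply ENNReal.ofReal_le_ofReal
      have h3 := hK (t - s + δ) x (v (min s.toNNReal t) ω) y hy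
      have h4 : Real.exp (-(c * max (t - s) 0)) ≤ 1 := by
        rw [Real.exp_le_one_iff, neg_nonpos]
        exact mul_nonneg hc (le_max_right _ _)
      rw [Real.norm_eq_abs, abs_mul, Real.abs_exp]
      calc _ ≤ 1 * K := by gcongr
        _ = K := one_mul K
    rw [← ofReal_norm] at h2
    exact (ENNReal.ofReal_le_ofReal_iff hK0).1 h2
  have hψΦ (x : Plane) (s : ℝ) (hs : s ∈ Set.Ioo (0 : ℝ) t) (ω : Ω) (y : Y) :
      inner ℝ (noiseVec G v c t k δ x s ω) y = testRe k (heatS δ x)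
        ((Real.exp (-(c * ((t : ℝ) - s.toNNReal))) •
          (heatVec ((t : ℝ) - s.toNNReal) ∘ₗ G (v s.toNNReal ω))) y) := by
    have hts : 0 < (t : ℝ) - s := sub_pos.2 hs.2
    have hs' : min s.toNNReal t = s.toNNReal := min_eq_left (Real.toNNReal_le_iff_le_coe.2 hs.2.le)
    rw [inner_noiseVec hG1 c t k hδ, hs', max_eq_left hts.le, Real.coe_toNNReal _ hs.1.le,
      LinearMap.smul_apply, map_smul, smul_eq_mul, noiseFun, max_eq_left (by linarith)]
    congr 1
    rw [LinearMap.comp_apply, LinearMap.comp_apply, testRe_apply, testRe_apply]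
    change _ = (heat (t - s) (G (v s.toNNReal ω) y k) (heatS δ x)).re
    rw [heat_heatS hδ hts.le]
  have hmom (x : Plane) := ito_scalar_moment_bounds hw hI k (heatS δ x) (hψm x) (hψK x) (hψΦ x)
  have hpt (x : Plane) : ∫⁻ ω, ‖testRe k (heatS δ x) (toDist (I ω))‖ₑ ^ (2 * q) ∂P ≤
      (2 + burkholderConst) *
        ∫⁻ ω, (∫⁻ s in Set.Ioo (0 : ℝ) t, ‖noiseVec G v c t k δ x s ω‖ₑ ^ 2) ^ q ∂P := by
    rcases hpq.imp And.right And.right with rfl | rfl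
    · simp only [mul_one, pow_one]
      refine (hmom x).1.trans ?_
      gcongr
      exact le_self_add
    · refine (hmom x).2.trans ?_
      gcongr
      exact le_add_self
  have hZm := measurable_testRe_heatS k hδ hIm (2 * q)
  have hFm : Measurable (Function.uncurry fun (x : Plane) (ω : Ω) ↦
      (∫⁻ s in Set.Ioo (0 : ℝ) t, ‖noiseVec G v c t k δ x s ω‖ₑ ^ 2) ^ q) := by
    refine Measurable.pow_const ?_ q
    have hq1 : Measurable fun p : (Plane × Ω) × ℝ ↦ ((p.1.2, p.2), p.1.1) :=
      ((measurable_snd.comp measurable_fst).prodMk measurable_snd).prodMk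
        (measurable_fst.comp measurable_fst)
    have hq2 : Measurable fun p : (Plane × Ω) × ℝ ↦ ‖noiseVec G v c t k δ p.1.1 p.2 p.1.2‖ₑ ^ 2 :=
      (measurable_enorm_noiseVec hGm hG1 hv c t k hδ).comp hq1
    exact hq2.lintegral_prod_right'
  have hB : burkholderConst ≠ ∞ := 
    ENNReal.mul_ne_top (by norm_num) ENNReal.ofReal_ne_top
  rw [lintegral_lintegral_swap hZm.aemeasurable]
  calc _ ≤ ∫⁻ x, (2 + burkholderConst) * ∫⁻ ω, (∫⁻ s in Set.Ioo (0 : ℝ) t,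
        ‖noiseVec G v c t k δ x s ω‖ₑ ^ 2) ^ q ∂P := lintegral_mono hpt
    _ = (2 + burkholderConst) * ∫⁻ ω, (∫⁻ x, (∫⁻ s in Set.Ioo (0 : ℝ) t,
        ‖noiseVec G v c t k δ x s ω‖ₑ ^ 2) ^ q) ∂P := by
        rw [lintegral_const_mul' _ _ (ENNReal.add_ne_top.2 ⟨by norm_num, hB⟩),
          lintegral_lintegral_swap hFm.aemeasurable]
    _ ≤ (2 + burkholderConst) *
        ∫⁻ _, (noiseRate C g c * (⨆ v, gammaNorm (-g) p (G v)) ^ 2) ^ q ∂P := by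
        gcongr with ω
        exact lintegral_pow_lintegral_noiseVec_le h0 hC hC0 hGm hG1 hG hv hpq c t k hδ ω
    _ = _ := by simp

end

end Noise

/-! ### Removal of the mollification and smallness of the noise for large damping. -/

section NoiseLimit

variable {Ω : Type*} [mΩ : MeasurableSpace Ω] {P : Measure Ω} [IsProbabilityMeasure P]
  {𝓕 : Filtration ℝ≥0 mΩ} {Y : Type*} [NormedAddCommGroup Y] [InnerProductSpace ℝ Y]
  {w : ℝ≥0 → Y → Ω → ℝ}

/-- Mollifications converge in L², which suffices for lower semicontinuity of the integral of any
power. In particular, no a priori knowledge that h lies in L⁴ is used. -/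
lemma lintegral_component_le_liminf {δ : ℕ → ℝ} (hδ : ∀ n, 0 < δ n)
    (hδ0 : Tendsto δ atTop (𝓝 0)) (h : HSp) (k : Fin 2) (p : ℕ) :
    ∫⁻ x, ‖(h : L2Field) x k‖ₑ ^ p ≤
      liminf (fun n ↦ ∫⁻ x, ‖testRe k (heatS (δ n) x) (toDist h)‖ₑ ^ p) atTop := by
  refine lintegral_pow_le_liminf
    (fun n ↦ (continuous_testRe_heatS k (hδ n) h).aestronglyMeasurable) ?_ ?_ p
  · exact (EuclideanSpace.proj k : Plane →L[ℝ] ℝ).continuous.comp_aestronglyMeasurable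
      (Lp.aestronglyMeasurable (h : L2Field))
  · refine tendsto_of_tendsto_of_tendsto_of_le_of_le tendsto_const_nhds
      (tendsto_mollify hδ hδ0 (compLp k (h : L2Field))) (fun _ ↦ zero_le) fun n ↦ ?_
    refine lintegral_mono_ae ?_
    filter_upwards [compLp_ae k (h : L2Field)] with x hx
    gcongr
    rw [hx, ← ofReal_norm, ← ofReal_norm, testRe_apply, toDist_apply]
    apply ENNReal.ofReal_le_ofReal
    refine le_trans (le_of_eq ?_) (Complex.abs_re_le_norm _)
    rw [Complex.sub_re, Complex.ofReal_re, Real.norm_eq_abs]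

/-- Fatou's lemma in x and then in ω, applied to bounds that are uniform in δ. -/
theorem lintegral_component_le [CompleteSpace Y] [TopologicalSpace.SeparableSpace Y] {g : ℝ}
    {G : HSp → Y →ₗ[ℝ] VecDist} {v : ℝ≥0 → Ω → HSp} (h0 : 0 < g) {C : ℝ}
    (hC : ∀ (r : ℝ) (hr : 0 < r),
      ∫⁻ z, ‖kerJH g hr z‖ₑ ≤ ENNReal.ofReal (C * (1 + 1 / r) ^ (g / 2))) (hC0 : 0 < C)
    (hw : IsCylindricalWiener 𝓕 P w)
    (hGm : ∀ (y : Y) (k : Fin 2) (φ : 𝓢(Plane, ℂ)), Measurable fun v : HSp ↦ G v y k φ)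
    (hG1 : IsBoundedNoise (-g) 2 G) {p : ℝ≥0∞} [Fact (1 ≤ p)] (hG : IsBoundedNoise (-g) p G)
    (hv : IsStronglyProgressive 𝓕 v)
    {q : ℕ} (hpq : p = 2 ∧ q = 1 ∨ p = 4 ∧ q = 2) {c : ℝ} (hc : 0 ≤ c) (t : ℝ≥0) (k : Fin 2)
    {I : Ω → HSp} (hIm : StronglyMeasurable I)
    (hI : IsItoIntegral 𝓕 P w t
      (fun s ω ↦ Real.exp (-(c * ((t : ℝ) - s))) • (heatVec ((t : ℝ) - s) ∘ₗ G (v s ω))) I) :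
    ∫⁻ ω, (∫⁻ x, ‖(I ω : L2Field) x k‖ₑ ^ (2 * q)) ∂P ≤
      (2 + burkholderConst) * (noiseRate C g c * (⨆ v, gammaNorm (-g) p (G v)) ^ 2) ^ q := by
  set δ : ℕ → ℝ := fun n ↦ 1 / ((n : ℝ) + 1)
  have hδ (n : ℕ) : 0 < δ n := by positivity
  have hδ0 : Tendsto δ atTop (𝓝 0) := tendsto_one_div_add_atTop_nhds_zero_nat
  calc _ ≤ ∫⁻ ω, liminf (fun n ↦ ∫⁻ x, ‖testRe k (heatS (δ n) x) (toDist (I ω))‖ₑ ^ (2 * q))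
        atTop ∂P := lintegral_mono fun ω ↦ lintegral_component_le_liminf hδ hδ0 (I ω) k _
    _ ≤ liminf (fun n ↦ ∫⁻ ω, (∫⁻ x, ‖testRe k (heatS (δ n) x) (toDist (I ω))‖ₑ ^ (2 * q)) ∂P)
        atTop := lintegral_liminf_le fun n ↦
          (measurable_testRe_heatS k (hδ n) hIm (2 * q)).lintegral_prod_right
    _ ≤ _ := by
        refine liminf_le_of_le (by isBoundedDefault) fun b hb ↦ ?_
        obtain ⟨n, hn⟩ := hb.exists
        exact hn.trans
          (lintegral_mollified_le h0 hC hC0 hw hGm hG1 hG hv hpq hc t k (hδ n) hIm hI)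

/-- Subadditivity gives (1 + 1/r)^g ≤ 1 + r^{-g}, and the two terms are dominated by the Gamma
integrals at 1 and at 1 - g; this is where g < 1 enters. -/
lemma integrableOn_noiseRate (C : ℝ) {g : ℝ} (h0 : 0 < g) (h1 : g < 1) :
    IntegrableOn (fun r : ℝ ↦ Real.exp (-(2 * 1 * r)) * (C * (1 + 1 / r) ^ (g / 2)) ^ 2)
      (Set.Ioi 0) := by
  have i1 := Real.GammaIntegral_convergent (s := 1) one_pos
  have i2 := Real.GammaIntegral_convergent (s := 1 - g) (by linarith)
  refine ((i1.add i2).const_mul (C ^ 2)).mono' (Measurable.aestronglyMeasurable (by fun_prop))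
    ((ae_restrict_iff' measurableSet_Ioi).2 (ae_of_all _ fun r hr ↦ ?_))
  have hr : 0 < r := hr
  rw [Real.norm_eq_abs, abs_of_nonneg (by positivity)]
  simp only [Pi.add_apply]
  have e1 : ((1 + 1 / r) ^ (g / 2)) ^ 2 ≤ 1 + r ^ (-g) := by
    rw [← Real.rpow_natCast, ← Real.rpow_mul (by positivity)]
    have := Real.rpow_add_le_add_rpow (p := g) (a := 1) (b := 1 / r) zero_le_one (by positivity)
      h0.le h1.le
    rw [Real.one_rpow, one_div, Real.inv_rpow hr.le, ← Real.rpow_neg hr.le] at this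
    convert this using 2
    · rw [one_div]
    · push_cast; ring
  have e2 : Real.exp (-(2 * 1 * r)) ≤ Real.exp (-r) := Real.exp_le_exp.2 (by linarith)
  calc _ = C ^ 2 * (Real.exp (-(2 * 1 * r)) * ((1 + 1 / r) ^ (g / 2)) ^ 2) := by ring
    _ ≤ C ^ 2 * (Real.exp (-r) * (1 + r ^ (-g))) := by gcongr
    _ = _ := by
        rw [sub_self, Real.rpow_zero, show 1 - g - 1 = -g by ring]
        ring

lemma tendsto_noiseRate (C : ℝ) {g : ℝ} (h0 : 0 < g) (h1 : g < 1) :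
    Tendsto (noiseRate C g) atTop (𝓝 0) := by
  have h := tendsto_lintegral_filter_of_dominated_convergence
    (μ := volume.restrict (Set.Ioi (0 : ℝ))) (l := (atTop : Filter ℝ))
    (F := fun c r ↦ ENNReal.ofReal (Real.exp (-(2 * c * r)) * (C * (1 + 1 / r) ^ (g / 2)) ^ 2))
    (f := fun _ ↦ 0)
    (fun r ↦ ENNReal.ofReal (Real.exp (-(2 * 1 * r)) * (C * (1 + 1 / r) ^ (g / 2)) ^ 2))
    (Eventually.of_forall fun c ↦ by fun_prop) ?_ ?_ ?_
  · rw [lintegral_zero] at h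
    exact h
  · filter_upwards [eventually_ge_atTop 1] with c hc
    refine (ae_restrict_iff' measurableSet_Ioi).2 (ae_of_all _ fun r hr ↦ ?_)
    have hr : 0 < r := hr
    apply ENNReal.ofReal_le_ofReal
    gcongr
  · exact (integrableOn_noiseRate C h0 h1).lintegral_lt_top.ne
  · refine (ae_restrict_iff' measurableSet_Ioi).2 (ae_of_all _ fun r hr ↦ ?_)
    have hr : 0 < r := hr
    have e1 : Tendsto (fun c : ℝ ↦ Real.exp (-(2 * c * r))) atTop (𝓝 0) := by
      refine Real.tendsto_exp_neg_atTop_nhds_zero.comp ?_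
      have := (tendsto_id (α := ℝ)).atTop_mul_const (show 0 < 2 * r by positivity)
      refine this.congr fun c ↦ ?_
      simp only [id]
      ring
    have e2 := ENNReal.tendsto_ofReal (e1.mul_const ((C * (1 + 1 / r) ^ (g / 2)) ^ 2))
    simpa using e2

/-- The fourth moments of the stochastic convolution are uniformly small for strong damping. -/
theorem exists_small_noise [CompleteSpace Y] [TopologicalSpace.SeparableSpace Y] {g : ℝ}
    {G : HSp → Y →ₗ[ℝ] VecDist} {v : ℝ≥0 → Ω → HSp} (hg : g ∈ Set.Ioo (0 : ℝ) 1)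
    (hw : IsCylindricalWiener 𝓕 P w)
    (hGm : ∀ (y : Y) (k : Fin 2) (φ : 𝓢(Plane, ℂ)), Measurable fun v : HSp ↦ G v y k φ)
    (hG1 : IsBoundedNoise (-g) 2 G) (hG2 : IsBoundedNoise (-g) 4 G)
    (hv : IsStronglyProgressive 𝓕 v) {γ : ℝ} (hγ : 0 < γ) {ζ : ℝ → ℝ≥0 → Ω → HSp}
    (hζ : ∀ α, 0 < α → IsStochasticConvolution 𝓕 P w G v γ α (ζ α)) {η : ℝ≥0∞} (hη : 0 < η) :
    ∃ α : ℝ, 0 < α ∧ ∃ M : ℝ≥0∞, M < ∞ ∧ ∀ (t : ℝ≥0) (k : Fin 2),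
      ∫⁻ ω, (∫⁻ x, ‖(ζ α t ω : L2Field) x k‖ₑ ^ 4) ∂P ≤ η ∧
      ∫⁻ ω, (∫⁻ x, ‖(ζ α t ω : L2Field) x k‖ₑ ^ 2) ∂P ≤ M := by
  obtain ⟨C, hC0, hC⟩ := exists_lintegral_enorm_kerJH_le hg.1 (hg.2.trans one_lt_two)
  set Γ := ⨆ v, gammaNorm (-g) 4 (G v)
  set Γ' := ⨆ v, gammaNorm (-g) 2 (G v)
  have hB : 2 + burkholderConst ≠ ∞ := ENNReal.add_ne_top.2 ⟨by norm_num,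
    ENNReal.mul_ne_top (by norm_num) ENNReal.ofReal_ne_top⟩
  have hrate : Tendsto (fun α ↦ noiseRate C g (γ + α)) atTop (𝓝 0) :=
    (tendsto_noiseRate C hg.1 hg.2).comp (tendsto_atTop_add_const_left _ γ tendsto_id)
  have h1 : Tendsto (fun α ↦ (2 + burkholderConst) * (noiseRate C g (γ + α) * Γ ^ 2) ^ 2)
      atTop (𝓝 ((2 + burkholderConst) * (0 * Γ ^ 2) ^ 2)) :=
    ENNReal.Tendsto.const_mul (ENNReal.Tendsto.pow (ENNReal.Tendsto.mul_const hrate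
      (Or.inr (ENNReal.pow_ne_top hG2.bounded.ne)))) (Or.inr hB)
  rw [zero_mul, zero_pow two_ne_zero, mul_zero] at h1
  -- The first condition makes the fourth moment small; the second, rate below 1, serves only to
  -- keep the second-moment bound finite.
  obtain ⟨α, h2, h3, h4⟩ := ((h1.eventually (gt_mem_nhds hη)).and
    ((hrate.eventually (gt_mem_nhds one_pos)).and (eventually_gt_atTop 0))).exists
  have hmt (t : ℝ≥0) : StronglyMeasurable (ζ α t) :=
    (hζ α h4).measurable.comp_measurable measurable_prodMk_left
  refine ⟨α, h4, (2 + burkholderConst) * (noiseRate C g (γ + α) * Γ' ^ 2) ^ 1, ?_, fun t k ↦ ⟨?_, ?_⟩⟩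
  · refine ENNReal.mul_lt_top hB.lt_top ?_
    rw [pow_one]
    exact ENNReal.mul_lt_top (h3.trans ENNReal.one_lt_top) (ENNReal.pow_lt_top hG1.bounded)
  · exact (lintegral_component_le hg.1 hC hC0 hw hGm hG1 hG2 hv (Or.inr ⟨rfl, rfl⟩)
      (by positivity) t k (hmt t) ((hζ α h4).eq_integral t)).trans h2.le
  · exact lintegral_component_le hg.1 hC hC0 hw hGm hG1 hG1 hv (Or.inl ⟨rfl, rfl⟩)
      (by positivity) t k (hmt t) ((hζ α h4).eq_integral t)

end NoiseLimit

/-! ### A jointly measurable evaluation of square integrable functions -/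

/-- Complex square integrable functions on the plane. -/
abbrev LC2 := Lp ℂ 2 (volume : Measure Plane)

instance : MeasurableSpace LC2 := borel LC2

instance : BorelSpace LC2 := ⟨rfl⟩

/-- The squared distances are summable, so at almost every point the series of squared differences
converges and its terms vanish. -/
lemma ae_tendsto_of_summable_norm {d : ℕ → LC2} {a : LC2} (h : ∀ n, ‖d n - a‖ ≤ (1 / 2) ^ n) :
    ∀ᵐ x, Tendsto (fun n ↦ d n x) atTop (𝓝 (a x)) := by
  have h1 : ∫⁻ x, ∑' n, ‖(d n - a : LC2) x‖ₑ ^ 2 < ∞ := by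
    rw [lintegral_tsum fun n ↦ ((Lp.stronglyMeasurable _).enorm.pow_const 2).aemeasurable]
    simp_rw [lintegral_enorm_sq_eq]
    refine lt_of_le_of_lt (ENNReal.tsum_le_tsum (g := fun n ↦ ENNReal.ofReal ((1 / 4) ^ n))
      fun n ↦ ?_) ?_
    · rw [← ofReal_norm, ← ENNReal.ofReal_pow (norm_nonneg _)]
      refine ENNReal.ofReal_le_ofReal ((pow_le_pow_left₀ (norm_nonneg _) (h n) 2).trans_eq ?_)
      rw [← pow_mul, mul_comm, pow_mul]; norm_num
    · rw [← ENNReal.ofReal_tsum_of_nonneg (fun n ↦ by positivity)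
        (summable_geometric_of_lt_one (by norm_num) (by norm_num))]
      exact ENNReal.ofReal_lt_top
  have h2 := ae_lt_top (Measurable.tsum fun n ↦
    ((Lp.stronglyMeasurable (d n - a)).enorm.pow_const 2)) h1.ne
  have h3 : ∀ᵐ x, ∀ n, (d n - a : LC2) x = d n x - a x :=
    ae_all_iff.2 fun n ↦ Lp.coeFn_sub (d n) a
  filter_upwards [h2, h3] with x hx hx'
  have h4 := ENNReal.tendsto_atTop_zero_of_tsum_ne_top hx.ne
  simp_rw [hx'] at h4
  rw [tendsto_iff_edist_tendsto_0]
  simp_rw [edist_eq_enorm_sub]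
  have h5 := (ENNReal.continuous_rpow_const (y := (1 / 2 : ℝ))).tendsto 0 |>.comp h4
  refine (h5.congr fun n ↦ ?_).trans (by simp)
  simp only [Function.comp]
  rw [← ENNReal.rpow_natCast, ← ENNReal.rpow_mul]; norm_num

/-- An element of L² is approximated within 2⁻ⁿ by the first suitable member of a dense sequence.
This choice depends measurably on a, and the evaluations converge almost everywhere by the fast
rate. -/
theorem exists_evaluation : ∃ F : LC2 × Plane → ℂ, Measurable F ∧
    ∀ a : LC2, (fun x ↦ F (a, x)) =ᵐ[volume] a := by
  classical
  let d := TopologicalSpace.denseSeq LC2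
  have hex (n : ℕ) (a : LC2) : ∃ k, ‖d k - a‖ < (1 / 2) ^ n := by
    obtain ⟨k, hk⟩ := (TopologicalSpace.denseRange_denseSeq LC2).exists_dist_lt a
      (show (0 : ℝ) < (1 / 2) ^ n by positivity)
    exact ⟨k, by rwa [← dist_eq_norm, dist_comm]⟩
  have hmN (n : ℕ) : Measurable fun a ↦ Nat.find (hex n a) := by
    refine measurable_find (hex n) fun k ↦ ?_
    exact (isOpen_lt (by fun_prop) continuous_const).measurableSet
  let A (n : ℕ) (p : LC2 × Plane) : ℂ := d (Nat.find (hex n p.1)) p.2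
  have hd : Measurable fun q : ℕ × Plane ↦ d q.1 q.2 :=
    measurable_from_prod_countable_right fun k ↦ (Lp.stronglyMeasurable (d k)).measurable
  have hA (n : ℕ) : StronglyMeasurable (A n) := by
    have h1 : Measurable fun p : LC2 × Plane ↦ (Nat.find (hex n p.1), p.2) :=
      ((hmN n).comp measurable_fst).prodMk measurable_snd
    exact (hd.comp h1).stronglyMeasurable
  refine ⟨fun p ↦ limUnder atTop fun n ↦ A n p, (StronglyMeasurable.limUnder hA).measurable,
    fun a ↦ ?_⟩
  have h2 := ae_tendsto_of_summable_norm (d := fun n ↦ d (Nat.find (hex n a)))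
    (fun n ↦ (Nat.find_spec (hex n a)).le)
  filter_upwards [h2] with x hx
  exact hx.limUnder_eq

/-- A jointly measurable version of the evaluation `(a, x) ↦ a x` on `L²`. -/
def ev (a : LC2) (x : Plane) : ℂ := exists_evaluation.choose (a, x)

lemma measurable_ev : Measurable fun p : LC2 × Plane ↦ ev p.1 p.2 := exists_evaluation.choose_spec.1

lemma ev_ae (a : LC2) : ev a =ᵐ[volume] a := exists_evaluation.choose_spec.2 a

lemma measurable_ev_right (a : LC2) : Measurable (ev a) :=
  measurable_ev.comp (measurable_const.prodMk measurable_id)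

lemma measurable_lintegral_enorm_pow (p : ℕ) : Measurable fun a : LC2 ↦ ∫⁻ x, ‖a x‖ₑ ^ p := by
  have h1 : (fun a : LC2 ↦ ∫⁻ x, ‖a x‖ₑ ^ p) = fun a ↦ ∫⁻ x, ‖ev a x‖ₑ ^ p := by
    ext a
    refine lintegral_congr_ae ?_
    filter_upwards [ev_ae a] with x hx
    rw [hx]
  rw [h1]
  exact (measurable_ev.enorm.pow_const p).lintegral_prod_right'

/-! ### The chain rule for primitives of integrable functions -/

lemma LipschitzOnWith.comp_absolutelyContinuous {Φ X : ℝ → ℝ} {S : Set ℝ} {K : ℝ≥0} {a b : ℝ}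
    (hΦ : LipschitzOnWith K Φ S) (hX : AbsolutelyContinuousOnInterval X a b)
    (hS : ∀ t ∈ Set.uIcc a b, X t ∈ S) : AbsolutelyContinuousOnInterval (Φ ∘ X) a b := by
  rw [absolutelyContinuousOnInterval_iff] at hX ⊢
  intro ε hε
  obtain ⟨δ, hδ, h⟩ := hX (ε / (K + 1)) (by positivity)
  refine ⟨δ, hδ, fun E hE hlt ↦ ?_⟩
  have h1 := h E hE hlt
  calc
    _ ≤ ∑ i ∈ Finset.range E.1, K * dist (X (E.2 i).1) (X (E.2 i).2) :=
      Finset.sum_le_sum fun i hi ↦ hΦ.dist_le_mul _ (hS _ (hE.left i hi).left) _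
        (hS _ (hE.left i hi).right)
    _ = K * ∑ i ∈ Finset.range E.1, dist (X (E.2 i).1) (X (E.2 i).2) := by rw [Finset.mul_sum]
    _ ≤ K * (ε / (K + 1)) := by gcongr
    _ < (K + 1) * (ε / (K + 1)) := by gcongr; linarith
    _ = ε := by field

/-- A Lipschitz function of an absolutely continuous one is absolutely continuous, so the
fundamental theorem of calculus holds although h is merely integrable. -/
theorem comp_primitive {h : ℝ → ℝ} {T : ℝ} (hT : 0 ≤ T) (hh : IntervalIntegrable h volume 0 T)
    {S : Set ℝ} {Φ Φ' : ℝ → ℝ} {K : ℝ≥0} (hΦ : LipschitzOnWith K Φ S)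
    (hd : ∀ x ∈ S, HasDerivAt Φ (Φ' x) x) (hS : ∀ t ∈ Set.Icc 0 T, ∫ s in (0 : ℝ)..t, h s ∈ S) :
    Φ (∫ s in (0 : ℝ)..T, h s) - Φ 0 = ∫ t in (0 : ℝ)..T, Φ' (∫ s in (0 : ℝ)..t, h s) * h t := by
  have hu : Set.uIcc 0 T = Set.Icc 0 T := Set.uIcc_of_le hT
  have h1 := hh.absolutelyContinuousOnInterval_intervalIntegral (c := 0) (by simp)
  have h2 := LipschitzOnWith.comp_absolutelyContinuous hΦ h1 (by rwa [hu])
  have h3 := h2.integral_deriv_eq_sub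
  simp only [Function.comp, intervalIntegral.integral_same] at h3
  rw [← h3]
  refine intervalIntegral.integral_congr_ae ?_
  filter_upwards [hh.ae_hasDerivAt_integral] with t ht htm
  have htm' : t ∈ Set.uIcc 0 T := Set.uIoc_subset_uIcc htm
  exact ((hd _ (hS t (hu ▸ htm'))).comp t (ht htm' 0 (by simp))).deriv

/-- The square is Lipschitz only on bounded sets; a primitive on a compact interval stays in one. -/
lemma primitive_sq {h : ℝ → ℝ} {T : ℝ} (hT : 0 ≤ T) (hh : IntervalIntegrable h volume 0 T) :
    (∫ s in (0 : ℝ)..T, h s) ^ 2 = ∫ t in (0 : ℝ)..T, 2 * (∫ s in (0 : ℝ)..t, h s) * h t := by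
  obtain ⟨M, hM⟩ := (isCompact_Icc (a := (0 : ℝ)) (b := T)).exists_bound_of_continuousOn
    (intervalIntegral.continuousOn_primitive_interval' hh (Set.left_mem_uIcc) |>.mono
      (by rw [Set.uIcc_of_le hT]))
  have hl : LipschitzOnWith (Real.toNNReal (2 * M)) (fun x : ℝ ↦ x ^ 2) (Set.Icc (-M) M) := by
    refine (convex_Icc (-M) M).lipschitzOnWith_of_nnnorm_deriv_le (fun x _ ↦ by fun_prop)
      fun x hx ↦ ?_
    rw [← NNReal.coe_le_coe]
    refine le_trans ?_ (Real.le_coe_toNNReal _)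
    simp only [coe_nnnorm, Real.norm_eq_abs, differentiableAt_fun_id, deriv_fun_pow, deriv_id'']
    norm_num [abs_mul]
    exact abs_le.2 hx
  have := comp_primitive hT hh (Φ' := fun x ↦ 2 * x) hl
    (fun x _ ↦ by simpa using hasDerivAt_pow 2 x) (fun t ht ↦ abs_le.1 (hM t ht))
  simpa using this

/-- The integral equals log(R + X(T)) - log R for the nonnegative primitive X. On [0, ∞) the
logarithm of R + x is Lipschitz with constant 1/R. -/
lemma log_primitive {h : ℝ → ℝ} {T R : ℝ} (hT : 0 ≤ T) (hR : 0 < R)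
    (hh : IntervalIntegrable h volume 0 T) (h0 : ∀ t ∈ Set.Icc 0 T, 0 ≤ ∫ s in (0 : ℝ)..t, h s) :
    0 ≤ ∫ t in (0 : ℝ)..T, (R + ∫ s in (0 : ℝ)..t, h s)⁻¹ * h t := by
  have hd (x : ℝ) (hx : x ∈ Set.Ici (0 : ℝ)) :
      HasDerivAt (fun x ↦ Real.log (R + x)) (R + x)⁻¹ x := by
    have hx' : (0 : ℝ) ≤ x := hx
    have := ((hasDerivAt_id x).const_add R).log (by simp; positivity)
    simpa using this
  have hl : LipschitzOnWith (Real.toNNReal R⁻¹) (fun x : ℝ ↦ Real.log (R + x)) (Set.Ici 0) := by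
    refine (convex_Ici (0 : ℝ)).lipschitzOnWith_of_nnnorm_deriv_le
      (fun x hx ↦ (hd x hx).differentiableAt) fun x hx ↦ ?_
    have hx' : (0 : ℝ) ≤ x := hx
    rw [(hd x hx).deriv, ← NNReal.coe_le_coe]
    refine le_trans ?_ (Real.le_coe_toNNReal _)
    rw [coe_nnnorm, Real.norm_of_nonneg (by positivity)]
    gcongr
    linarith
  rw [← comp_primitive hT hh hl hd fun t ht ↦ h0 t ht, add_zero, sub_nonneg]
  exact Real.log_le_log hR (by linarith [h0 T ⟨hT, le_rfl⟩])

/-! ### Ladyzhenskaya's inequality for Schwartz functions -/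

lemma norm_fderiv_le_sum {φ : Plane → ℂ} (x : Plane) :
    ‖fderiv ℝ φ x‖ ≤ ∑ i, ‖fderiv ℝ φ x (e i)‖ := by
  refine ContinuousLinearMap.opNorm_le_bound _ (by positivity) fun v ↦ ?_
  have hv : v = ∑ i, v i • e i := by
    ext j
    fin_cases j <;> simp [e, Fin.sum_univ_two]
  conv_lhs => rw [hv]
  rw [map_sum, Finset.sum_mul]
  refine (norm_sum_le _ _).trans (Finset.sum_le_sum fun i _ ↦ ?_)
  rw [map_smul, norm_smul, mul_comm]
  gcongr
  exact PiLp.norm_apply_le v i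

/-- A smooth cutoff of the plane at scale `n + 1`. -/
lemma exists_cutoff : ∃ (χ : ℕ → Plane → ℝ) (K : ℝ), 0 ≤ K ∧
    (∀ n, ContDiff ℝ 1 (χ n)) ∧ (∀ n, HasCompactSupport (χ n)) ∧ (∀ n x, |χ n x| ≤ 1) ∧
    (∀ n x, ‖fderiv ℝ (χ n) x‖ ≤ K) ∧ ∀ x, ∀ᶠ n in atTop, χ n x = 1 := by
  let b : ContDiffBump (0 : Plane) := ⟨1, 2, by norm_num, by norm_num⟩
  have hb : ContDiff ℝ 1 b := b.contDiff
  obtain ⟨K, hK⟩ := (hb.continuous_fderiv (by norm_num)).bounded_above_of_compact_support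
    (b.hasCompactSupport.fderiv (𝕜 := ℝ))
  have hK0 : 0 ≤ K := (norm_nonneg _).trans (hK 0)
  have hc (n : ℕ) : (0 : ℝ) < ((n : ℝ) + 1)⁻¹ := by positivity
  refine ⟨fun n x ↦ b (((n : ℝ) + 1)⁻¹ • x), K, hK0, fun n ↦ hb.comp (contDiff_const_smul _),
    fun n ↦ b.hasCompactSupport.comp_homeomorph (Homeomorph.smulOfNeZero _ (hc n).ne'),
    fun n x ↦ ?_, fun n x ↦ ?_, fun x ↦ ?_⟩
  · rw [abs_of_nonneg b.nonneg]; exact b.le_one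
  · have h1 : HasFDerivAt (fun x ↦ b (((n : ℝ) + 1)⁻¹ • x))
        ((fderiv ℝ b (((n : ℝ) + 1)⁻¹ • x)).comp
          (((n : ℝ) + 1)⁻¹ • ContinuousLinearMap.id ℝ Plane)) x :=
      ((hb.differentiable (by norm_num)) _).hasFDerivAt.comp x
        (((n : ℝ) + 1)⁻¹ • ContinuousLinearMap.id ℝ Plane).hasFDerivAt
    rw [h1.fderiv]
    refine (ContinuousLinearMap.opNorm_comp_le _ _).trans ?_
    refine (mul_le_mul (hK _) (?_ : _ ≤ (1 : ℝ)) (norm_nonneg _) hK0).trans_eq (mul_one K)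
    refine (norm_smul_le (((n : ℝ) + 1)⁻¹) (ContinuousLinearMap.id ℝ Plane)).trans ?_
    refine (mul_le_mul (?_ : _ ≤ (1 : ℝ)) ContinuousLinearMap.norm_id_le (norm_nonneg _)
      zero_le_one).trans_eq (mul_one 1)
    rw [Real.norm_of_nonneg (hc n).le]
    exact inv_le_one_of_one_le₀ (by linarith [(Nat.cast_nonneg n : (0 : ℝ) ≤ n)])
  · filter_upwards [eventually_ge_atTop ⌈‖x‖⌉₊] with n hn
    refine b.one_of_mem_closedBall ?_
    have h1 : ‖x‖ ≤ n := Nat.ceil_le.1 hn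
    rw [mem_closedBall_zero_iff, norm_smul, Real.norm_of_nonneg (hc n).le,
      inv_mul_le_iff₀ (by positivity)]
    change ‖x‖ ≤ ((n : ℝ) + 1) * 1
    linarith

lemma fderiv_schwartz_apply (φ : 𝓢(Plane, ℂ)) (x : Plane) (i : Fin 2) :
    fderiv ℝ φ x (e i) = LineDeriv.lineDerivOp (e i) φ x :=
  (SchwartzMap.lineDerivOp_apply_eq_fderiv (e i) φ x).symm

/-- The embedding of W^{1,1} into L² in the plane, applied to φ²: its L² norm is the square of the
L⁴ norm of φ, and its gradient 2φ∇φ is estimated by Cauchy-Schwarz. The embedding is used for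
compact supports, hence the cutoffs χₙ and Fatou's lemma. The factor 3 counts the summands of D. -/
theorem ladyzhenskaya_schwartz : ∃ C : ℝ≥0, ∀ φ : 𝓢(Plane, ℂ),
    ∫⁻ x, ‖φ x‖ₑ ^ 4 ≤ C * (∫⁻ x, ‖φ x‖ₑ ^ 2) *
      ((∫⁻ x, ‖φ x‖ₑ ^ 2) + ∑ i, ∫⁻ x, ‖LineDeriv.lineDerivOp (e i) φ x‖ₑ ^ 2) := by
  obtain ⟨χ, K, hK0, hχ, hχc, hχ1, hχK, hχl⟩ := exists_cutoff
  let c := eLpNormLESNormFDerivOneConst (volume : Measure Plane) (2 : ℝ≥0)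
  let L : ℝ≥0 := 2 + K.toNNReal
  refine ⟨c ^ 2 * L ^ 2 * 3, fun φ ↦ ?_⟩
  let D : Plane → ℝ≥0∞ := fun x ↦ ‖φ x‖ₑ + ∑ i, ‖LineDeriv.lineDerivOp (e i) φ x‖ₑ
  have hφm : Measurable fun x ↦ ‖φ x‖ₑ := φ.continuous.measurable.enorm
  have hDm (i : Fin 2) : Measurable fun x ↦ ‖LineDeriv.lineDerivOp (e i) φ x‖ₑ :=
    (LineDeriv.lineDerivOp (e i) φ).continuous.measurable.enorm
  have hD : Measurable D := hφm.add (Finset.measurable_fun_sum _ fun i _ ↦ hDm i)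
  let u (n : ℕ) (x : Plane) : ℂ := χ n x • (φ x * φ x)
  have hu (n : ℕ) : ContDiff ℝ 1 (u n) := (hχ n).smul ((φ.smooth 1).mul (φ.smooth 1))
  have hfd (n : ℕ) (x : Plane) : ‖fderiv ℝ (u n) x‖ₑ ≤ L * (‖φ x‖ₑ * D x) := by
    have h1 : HasFDerivAt (φ : Plane → ℂ) (fderiv ℝ φ x) x := (φ.differentiableAt).hasFDerivAt
    have h2 := (((hχ n).differentiable (by norm_num) x).hasFDerivAt).smul (h1.mul h1)
    have h3 : ‖fderiv ℝ (u n) x‖ ≤ (2 + K) * (‖φ x‖ * (‖φ x‖ + ‖fderiv ℝ φ x‖)) := by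
      have h2' : fderiv ℝ (u n) x = _ := h2.fderiv
      rw [h2']
      have hn1 : ‖φ x • fderiv ℝ φ x + φ x • fderiv ℝ φ x‖ ≤ 2 * (‖φ x‖ * ‖fderiv ℝ φ x‖) := by
        refine (norm_add_le _ _).trans ?_
        have := norm_smul_le (φ x) (fderiv ℝ φ x)
        linarith
      have hn2 : ‖χ n x • (φ x • fderiv ℝ φ x + φ x • fderiv ℝ φ x)‖
          ≤ 2 * (‖φ x‖ * ‖fderiv ℝ φ x‖) := by
        refine (norm_smul_le (χ n x) (φ x • fderiv ℝ φ x + φ x • fderiv ℝ φ x)).trans ?_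
        rw [Real.norm_eq_abs]
        exact (mul_le_mul (hχ1 n x) hn1 (norm_nonneg _) zero_le_one).trans_eq (one_mul _)
      have hn3 : ‖(fderiv ℝ (χ n) x).smulRight (φ x * φ x)‖ ≤ K * (‖φ x‖ * ‖φ x‖) := by
        rw [ContinuousLinearMap.norm_smulRight_apply, norm_mul]
        exact mul_le_mul_of_nonneg_right (hχK n x) (by positivity)
      refine (norm_add_le _ _).trans ((add_le_add hn2 hn3).trans ?_)
      have := mul_nonneg (norm_nonneg (φ x)) (norm_nonneg (fderiv ℝ φ x))
      have := mul_nonneg (norm_nonneg (φ x)) (norm_nonneg (φ x))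
      nlinarith [mul_nonneg hK0 (mul_nonneg (norm_nonneg (φ x)) (norm_nonneg (fderiv ℝ φ x)))]
    have h4 : ‖fderiv ℝ φ x‖ₑ ≤ ∑ i, ‖LineDeriv.lineDerivOp (e i) φ x‖ₑ := by
      simp_rw [← fderiv_schwartz_apply, ← ofReal_norm]
      rw [← ENNReal.ofReal_sum_of_nonneg fun i _ ↦ norm_nonneg _]
      exact ENNReal.ofReal_le_ofReal (norm_fderiv_le_sum x)
    calc ‖fderiv ℝ (u n) x‖ₑ ≤ ENNReal.ofReal ((2 + K) * (‖φ x‖ * (‖φ x‖ + ‖fderiv ℝ φ x‖))) := by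
          rw [← ofReal_norm]; exact ENNReal.ofReal_le_ofReal h3
      _ = L * (‖φ x‖ₑ * (‖φ x‖ₑ + ‖fderiv ℝ φ x‖ₑ)) := by
          rw [ENNReal.ofReal_mul (by positivity), ENNReal.ofReal_mul (norm_nonneg _),
            ENNReal.ofReal_add (norm_nonneg _) (norm_nonneg _), ENNReal.ofReal_add (by norm_num) hK0]
          simp [L, ENNReal.ofReal, enorm_eq_nnnorm]
      _ ≤ _ := by
          simp only [D]
          gcongr
  have hgns (n : ℕ) : ∫⁻ x, ‖u n x‖ₑ ^ 2 ≤ c ^ 2 * L ^ 2 * (∫⁻ x, ‖φ x‖ₑ * D x) ^ 2 := by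
    have h1 : eLpNorm (u n) 2 volume ≤ c * eLpNorm (fderiv ℝ (u n)) 1 volume := by
      refine eLpNorm_le_eLpNorm_fderiv_one volume (hu n) ((hχc n).smul_right) ?_
      rw [finrank_euclideanSpace_fin]
      exact_mod_cast NNReal.HolderConjugate.two_two
    have h2 : eLpNorm (fderiv ℝ (u n)) 1 volume ≤ L * ∫⁻ x, ‖φ x‖ₑ * D x := by
      have hm : Measurable fun x ↦ ‖φ x‖ₑ * D x := hφm.mul hD
      rw [eLpNorm_one_eq_lintegral_enorm, ← lintegral_const_mul _ hm]
      exact lintegral_mono (hfd n)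
    have h3 : ∫⁻ x, ‖u n x‖ₑ ^ 2 = eLpNorm (u n) 2 volume ^ 2 := by
      have := eLpNorm_nnreal_pow_eq_lintegral (f := u n) (μ := volume) (p := 2) (by norm_num)
      simpa using this.symm
    rw [h3, ← mul_pow, ← mul_pow, mul_assoc]
    gcongr
    exact h1.trans (by gcongr)
  have hlim : ∫⁻ x, ‖φ x‖ₑ ^ 4 ≤ c ^ 2 * L ^ 2 * (∫⁻ x, ‖φ x‖ₑ * D x) ^ 2 := by
    have h1 : ∀ x, Tendsto (fun n ↦ ‖u n x‖ₑ ^ 2) atTop (𝓝 (‖φ x‖ₑ ^ 4)) := fun x ↦ by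
      refine tendsto_const_nhds.congr' ?_
      filter_upwards [hχl x] with n hn
      simp only [u, hn, one_smul, enorm_mul]
      ring
    calc ∫⁻ x, ‖φ x‖ₑ ^ 4 = ∫⁻ x, liminf (fun n ↦ ‖u n x‖ₑ ^ 2) atTop :=
          lintegral_congr fun x ↦ (h1 x).liminf_eq.symm
      _ ≤ liminf (fun n ↦ ∫⁻ x, ‖u n x‖ₑ ^ 2) atTop :=
          lintegral_liminf_le fun n ↦ ((hu n).continuous.measurable.enorm.pow_const 2)
      _ ≤ liminf (fun _ ↦ c ^ 2 * L ^ 2 * (∫⁻ x, ‖φ x‖ₑ * D x) ^ 2) atTop :=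
          liminf_le_liminf (Eventually.of_forall hgns)
      _ = _ := liminf_const _
  have hcs : (∫⁻ x, ‖φ x‖ₑ * D x) ^ 2 ≤ (∫⁻ x, ‖φ x‖ₑ ^ 2) * ∫⁻ x, D x ^ 2 :=
    sq_lintegral_mul_le hφm.aemeasurable hD.aemeasurable
  have hD2 : ∫⁻ x, D x ^ 2 ≤ 3 * ((∫⁻ x, ‖φ x‖ₑ ^ 2) +
      ∑ i, ∫⁻ x, ‖LineDeriv.lineDerivOp (e i) φ x‖ₑ ^ 2) := by
    have hm : Measurable fun x ↦ ‖φ x‖ₑ ^ 2 + ∑ i, ‖LineDeriv.lineDerivOp (e i) φ x‖ₑ ^ 2 :=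
      (hφm.pow_const 2).add (Finset.measurable_fun_sum _ fun i _ ↦ (hDm i).pow_const 2)
    rw [← lintegral_finsetSum _ fun i _ ↦ (hDm i).pow_const 2,
      ← lintegral_add_left (hφm.pow_const 2), ← lintegral_const_mul _ hm]
    refine lintegral_mono fun x ↦ ?_
    simp only [D, Fin.sum_univ_two]
    have h (a b c : ℝ≥0∞) : (a + (b + c)) ^ 2 ≤ 3 * (a ^ 2 + (b ^ 2 + c ^ 2)) := by
      induction a with
      | top => simp
      | coe a =>
        induction b with
        | top => simp
        | coe b =>
          induction c with
          | top => simp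
          | coe c =>
            norm_cast
            rw [← NNReal.coe_le_coe]
            push_cast
            nlinarith [sq_nonneg ((a : ℝ) - b), sq_nonneg ((a : ℝ) - c), sq_nonneg ((b : ℝ) - c)]
    exact h _ _ _
  calc ∫⁻ x, ‖φ x‖ₑ ^ 4 ≤ c ^ 2 * L ^ 2 * ((∫⁻ x, ‖φ x‖ₑ ^ 2) * (3 * ((∫⁻ x, ‖φ x‖ₑ ^ 2) +
      ∑ i, ∫⁻ x, ‖LineDeriv.lineDerivOp (e i) φ x‖ₑ ^ 2))) := by
        refine hlim.trans ?_
        gcongr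
        exact hcs.trans (by gcongr)
    _ = _ := by push_cast; ring

open scoped FourierTransform

/-! ### Bounded Fourier multipliers on `L²` and the space `H¹` -/

open Classical in
/-- Multiplication by a bounded function. -/
def mulL (m : Plane → ℂ) : LC2 →L[ℂ] LC2 :=
  if h : MemLp m ∞ volume then (ContinuousLinearMap.mul ℂ ℂ).holderL volume ∞ 2 2 h.toLp else 0

lemma mulL_ae {m : Plane → ℂ} (h : MemLp m ∞ volume) (a : LC2) :
    mulL m a =ᵐ[volume] fun x ↦ m x * a x := by
  rw [mulL, dif_pos h]
  have h1 := (ContinuousLinearMap.mul ℂ ℂ).coeFn_holder (r := 2) (h.toLp) a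
  filter_upwards [h1, h.coeFn_toLp] with x hx hx'
  change ((ContinuousLinearMap.mul ℂ ℂ).holder 2 (h.toLp) a) x = _
  rw [hx, hx']
  rfl

lemma memLp_top_of_temperate {m : Plane → ℂ} (hm : m.HasTemperateGrowth) (h : ∀ ξ, ‖m ξ‖ ≤ 1) :
    MemLp m ∞ volume :=
  memLp_top_of_bound hm.1.continuous.aestronglyMeasurable 1 (Eventually.of_forall h)

/-- A Schwartz function as an element of `L²`. -/
def toL (θ : 𝓢(Plane, ℂ)) : LC2 := θ.toLp 2

lemma toL_ae (θ : 𝓢(Plane, ℂ)) : toL θ =ᵐ[volume] θ := θ.coeFn_toLp 2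

lemma fourierInv_toL (θ : 𝓢(Plane, ℂ)) : 𝓕⁻ (toL θ) = toL (𝓕⁻ θ) :=
  SchwartzMap.toLp_fourierInv_eq θ

lemma mulL_toLp {m : Plane → ℂ} (hm : m.HasTemperateGrowth) (h : ∀ ξ, ‖m ξ‖ ≤ 1)
    (θ : 𝓢(Plane, ℂ)) :
    mulL m (toL θ) = toL (SchwartzMap.smulLeftCLM ℂ m θ) := by
  refine Lp.ext ?_
  filter_upwards [mulL_ae (memLp_top_of_temperate hm h) (toL θ), toL_ae θ,
    toL_ae (SchwartzMap.smulLeftCLM ℂ m θ)] with x h1 h2 h3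
  rw [h1, h2, h3, SchwartzMap.smulLeftCLM_apply_apply hm, smul_eq_mul]

/-- The symbol of `∂ᵢ J⁻¹`. -/
def symD (i : Fin 2) (ξ : Plane) : ℂ := 2 * Real.pi * Complex.I * (ξ i : ℂ) * symJ (-1) ξ

lemma norm_symJ_neg_one_sq (ξ : Plane) : ‖symJ (-1) ξ‖ ^ 2 = (1 + lam ξ)⁻¹ := by
  have h := lam_nonneg ξ
  rw [symJ, Complex.norm_real, Real.norm_of_nonneg (by positivity), ← Real.rpow_natCast,
    ← Real.rpow_mul (by positivity), ← Real.rpow_neg_one]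
  norm_num

lemma lam_eq_sum (ξ : Plane) : lam ξ = ∑ i, (2 * Real.pi * ξ i) ^ 2 := by
  rw [lam, EuclideanSpace.norm_sq_eq, Fin.sum_univ_two, Fin.sum_univ_two]
  simp only [Real.norm_eq_abs, sq_abs]
  ring

lemma norm_symD_sq (i : Fin 2) (ξ : Plane) :
    ‖symD i ξ‖ ^ 2 = (2 * Real.pi * ξ i) ^ 2 * (1 + lam ξ)⁻¹ := by
  rw [symD, norm_mul, mul_pow, norm_symJ_neg_one_sq]
  simp [mul_pow, abs_of_pos Real.pi_pos]

/-- The symbolic form of ‖u‖² + ‖∇u‖² = ‖Ju‖². -/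
lemma symbol_sq_sum (ξ : Plane) : ‖symJ (-1) ξ‖ ^ 2 + ∑ i, ‖symD i ξ‖ ^ 2 = 1 := by
  have h := lam_nonneg ξ
  simp_rw [norm_symD_sq, norm_symJ_neg_one_sq, ← Finset.sum_mul, ← lam_eq_sum]
  field_simp

lemma norm_symJ_neg_one_le (ξ : Plane) : ‖symJ (-1) ξ‖ ≤ 1 := by
  have h := symbol_sq_sum ξ
  have h2 : 0 ≤ ∑ i, ‖symD i ξ‖ ^ 2 := by positivity
  nlinarith [norm_nonneg (symJ (-1) ξ)]

lemma norm_symD_le (i : Fin 2) (ξ : Plane) : ‖symD i ξ‖ ≤ 1 := by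
  have h := symbol_sq_sum ξ
  have h2 := Finset.single_le_sum (f := fun i ↦ ‖symD i ξ‖ ^ 2) (fun i _ ↦ by positivity)
    (Finset.mem_univ i)
  nlinarith [norm_nonneg (symD i ξ), sq_nonneg ‖symJ (-1) ξ‖]

lemma coord_temperate (i : Fin 2) : (fun ξ : Plane ↦ (ξ i : ℂ)).HasTemperateGrowth :=
  (Complex.ofRealCLM ∘L (EuclideanSpace.proj i : Plane →L[ℝ] ℝ)).hasTemperateGrowth

lemma symD_temperate (i : Fin 2) : (symD i).HasTemperateGrowth := by
  have h1 := coord_temperate i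
  have h2 := symJ_temperate (-1)
  have h3 : (fun _ : Plane ↦ (2 * Real.pi * Complex.I : ℂ)).HasTemperateGrowth := by fun_prop
  exact (h3.mul h1).mul h2

lemma memLp_symJ : MemLp (symJ (-1)) ∞ (volume : Measure Plane) :=
  memLp_top_of_temperate (symJ_temperate _) norm_symJ_neg_one_le

lemma memLp_symD (i : Fin 2) : MemLp (symD i) ∞ (volume : Measure Plane) :=
  memLp_top_of_temperate (symD_temperate i) (norm_symD_le i)

/-- `opU a = J⁻¹ 𝓕⁻¹ a`: elements of `H¹` are parametrised by the Fourier transform of `J u`. -/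
def opU : LC2 →L[ℂ] LC2 := FourierTransform.fourierInvCLM ℂ LC2 ∘L mulL (symJ (-1))

/-- `opD i a = ∂ᵢ J⁻¹ 𝓕⁻¹ a`. -/
def opD (i : Fin 2) : LC2 →L[ℂ] LC2 := FourierTransform.fourierInvCLM ℂ LC2 ∘L mulL (symD i)

lemma opU_apply (a : LC2) : opU a = 𝓕⁻ (mulL (symJ (-1)) a) := rfl

lemma opD_apply (i : Fin 2) (a : LC2) : opD i a = 𝓕⁻ (mulL (symD i) a) := rfl

lemma fourier_opU (a : LC2) : 𝓕 (opU a) = mulL (symJ (-1)) a := by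
  rw [opU_apply, FourierTransform.fourier_fourierInv_eq]

lemma fourier_opD (i : Fin 2) (a : LC2) : 𝓕 (opD i a) = mulL (symD i) a := by
  rw [opD_apply, FourierTransform.fourier_fourierInv_eq]

/-- The Schwartz function `J⁻¹ 𝓕⁻¹ θ`. -/
def schU (θ : 𝓢(Plane, ℂ)) : 𝓢(Plane, ℂ) := 𝓕⁻ (SchwartzMap.smulLeftCLM ℂ (symJ (-1)) θ)

lemma opU_toLp (θ : 𝓢(Plane, ℂ)) : opU (toL θ) = toL (schU θ) := by
  rw [opU_apply, mulL_toLp (symJ_temperate _) norm_symJ_neg_one_le, fourierInv_toL,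
    schU]

lemma lineDeriv_schU (i : Fin 2) (θ : 𝓢(Plane, ℂ)) :
    LineDeriv.lineDerivOp (e i) (schU θ) = 𝓕⁻ (SchwartzMap.smulLeftCLM ℂ (symD i) θ) := by
  rw [SchwartzMap.lineDeriv_eq_fourierMultiplierCLM, SchwartzMap.fourierMultiplierCLM_apply, schU,
    FourierTransform.fourier_fourierInv_eq, ← FourierTransform.fourierInv_smul]
  congr 1
  ext ξ
  have h1 : (fun ξ : Plane ↦ inner ℝ ξ (e i)).HasTemperateGrowth := by fun_prop
  rw [smul_apply, SchwartzMap.smulLeftCLM_apply_apply h1,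
    SchwartzMap.smulLeftCLM_apply_apply (symJ_temperate _),
    SchwartzMap.smulLeftCLM_apply_apply (symD_temperate i)]
  have h2 : inner ℝ ξ (e i) = ξ i := by simp [e, EuclideanSpace.inner_single_right]
  rw [h2, symD]
  simp only [smul_eq_mul, Complex.real_smul]
  ring

lemma opD_toLp (i : Fin 2) (θ : 𝓢(Plane, ℂ)) :
    opD i (toL θ) = toL (LineDeriv.lineDerivOp (e i) (schU θ)) := by
  rw [opD_apply, mulL_toLp (symD_temperate i) (norm_symD_le i), fourierInv_toL,
    lineDeriv_schU]

lemma norm_sq_eq_integral (a : LC2) : ‖a‖ ^ 2 = ∫ x, ‖a x‖ ^ 2 := by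
  rw [← inner_self_eq_norm_sq (𝕜 := ℂ) a, L2.inner_def]
  simp only [inner_self_eq_norm_sq_to_K]
  rw [← integral_re]
  · congr 1
    ext x
    norm_cast
  · have := L2.integrable_inner (𝕜 := ℂ) a a
    simpa only [inner_self_eq_norm_sq_to_K] using this

lemma integrable_norm_sq (a : LC2) : Integrable fun x ↦ ‖a x‖ ^ 2 :=
  (Lp.memLp a).integrable_norm_pow (by norm_num)

lemma norm_opU_sq_add (a : LC2) : ‖opU a‖ ^ 2 + ∑ i, ‖opD i a‖ ^ 2 = ‖a‖ ^ 2 := by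
  rw [← Lp.norm_fourier_eq (opU a), fourier_opU]
  simp_rw [fun i ↦ (Lp.norm_fourier_eq (opD i a)).symm, fourier_opD, norm_sq_eq_integral]
  rw [← integral_finsetSum _ fun i _ ↦ integrable_norm_sq _,
    ← integral_add (integrable_norm_sq _) (integrable_finsetSum _ fun i _ ↦ integrable_norm_sq _)]
  refine integral_congr_ae ?_
  filter_upwards [mulL_ae memLp_symJ a, mulL_ae (memLp_symD 0) a, mulL_ae (memLp_symD 1) a]
    with x h1 h2 h3
  have h := symbol_sq_sum x
  rw [Fin.sum_univ_two] at h ⊢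
  rw [h1, h2, h3]
  simp only [norm_mul, mul_pow]
  linear_combination (‖a x‖ ^ 2) * h

lemma le_of_sq_le_sq_of_nonneg {x y : ℝ} (hy : 0 ≤ y) (h : x ^ 2 ≤ y ^ 2) : x ≤ y :=
  (le_abs_self x).trans (abs_le_of_sq_le_sq h hy)

lemma norm_opU_le (a : LC2) : ‖opU a‖ ≤ ‖a‖ := by
  have h := norm_opU_sq_add a
  have h2 : 0 ≤ ∑ i, ‖opD i a‖ ^ 2 := Finset.sum_nonneg fun i _ ↦ sq_nonneg _
  exact le_of_sq_le_sq_of_nonneg (norm_nonneg a) (by linarith)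

lemma norm_opD_le (i : Fin 2) (a : LC2) : ‖opD i a‖ ≤ ‖a‖ := by
  have h := norm_opU_sq_add a
  have h2 := Finset.single_le_sum (f := fun i ↦ ‖opD i a‖ ^ 2) (fun i _ ↦ sq_nonneg _)
    (Finset.mem_univ i)
  have h3 := sq_nonneg ‖opU a‖
  exact le_of_sq_le_sq_of_nonneg (norm_nonneg a) (by linarith)

lemma enorm_opU_le (a : LC2) : ‖opU a‖ₑ ≤ ‖a‖ₑ := by
  rw [← ofReal_norm, ← ofReal_norm]
  exact ENNReal.ofReal_le_ofReal (norm_opU_le a)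

lemma enorm_opD_le (i : Fin 2) (a : LC2) : ‖opD i a‖ₑ ≤ ‖a‖ₑ := by
  rw [← ofReal_norm, ← ofReal_norm]
  exact ENNReal.ofReal_le_ofReal (norm_opD_le i a)

lemma exists_schwartz_tendsto (a : LC2) :
    ∃ θ : ℕ → 𝓢(Plane, ℂ), Tendsto (fun n ↦ toL (θ n)) atTop (𝓝 a) := by
  have hd : DenseRange (SchwartzMap.toLpCLM ℝ ℂ 2 (volume : Measure Plane)) :=
    SchwartzMap.denseRange_toLpCLM (by norm_num)
  have h (n : ℕ) : ∃ θ : 𝓢(Plane, ℂ), dist a (toL θ) < 1 / ((n : ℝ) + 1) :=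
    hd.exists_dist_lt a (by positivity)
  choose θ hθ using h
  refine ⟨θ, tendsto_iff_dist_tendsto_zero.2 ?_⟩
  refine squeeze_zero (fun n ↦ dist_nonneg) (fun n ↦ ?_) tendsto_one_div_add_atTop_nhds_zero_nat
  rw [dist_comm]
  exact (hθ n).le

lemma lintegral_schwartz_sq (φ : 𝓢(Plane, ℂ)) : ∫⁻ x, ‖φ x‖ₑ ^ 2 = ‖toL φ‖ₑ ^ 2 := by
  rw [← lintegral_enorm_sq_eq]
  refine lintegral_congr_ae ?_
  filter_upwards [toL_ae φ] with x hx
  rw [hx]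

lemma mul_sq_add_sum_sq_le (C : ℝ≥0) {x N : ℝ≥0∞} {d : Fin 2 → ℝ≥0∞} (hx : x ≤ N)
    (hd : ∀ i, d i ≤ N) :
    C * x ^ 2 * (x ^ 2 + ∑ i, d i ^ 2) ≤ ((3 * C : ℝ≥0) : ℝ≥0∞) * x ^ 2 * N ^ 2 := by
  calc C * x ^ 2 * (x ^ 2 + ∑ i, d i ^ 2) ≤ C * x ^ 2 * (N ^ 2 + ∑ _i : Fin 2, N ^ 2) := by
        gcongr with i _
        exact hd i
    _ = _ := by rw [Fin.sum_univ_two]; push_cast; ring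

lemma tendsto_lintegral_sub {b : ℕ → LC2} {a : LC2} (h : Tendsto b atTop (𝓝 a)) :
    Tendsto (fun n ↦ ∫⁻ x, ‖b n x - a x‖ₑ ^ 2) atTop (𝓝 0) := by
  have h1 : Tendsto (fun n ↦ ‖b n - a‖ₑ ^ 2) atTop (𝓝 0) := by
    have h2 := (tendsto_iff_edist_tendsto_0.1 h)
    simp_rw [edist_eq_enorm_sub] at h2
    simpa using ENNReal.Tendsto.pow (n := 2) h2
  refine h1.congr fun n ↦ ?_
  rw [← lintegral_enorm_sq_eq]
  refine lintegral_congr_ae ?_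
  filter_upwards [Lp.coeFn_sub (b n) a] with x hx
  rw [hx, Pi.sub_apply]

lemma ladyzhenskaya_toLp {C : ℝ≥0} (θ : 𝓢(Plane, ℂ))
    (hC : ∫⁻ x, ‖schU θ x‖ₑ ^ 4 ≤ C * (∫⁻ x, ‖schU θ x‖ₑ ^ 2) * ((∫⁻ x, ‖schU θ x‖ₑ ^ 2) +
      ∑ i, ∫⁻ x, ‖LineDeriv.lineDerivOp (e i) (schU θ) x‖ₑ ^ 2)) :
    ∫⁻ x, ‖opU (toL θ) x‖ₑ ^ 4 ≤
      ((3 * C : ℝ≥0) : ℝ≥0∞) * ‖opU (toL θ)‖ₑ ^ 2 * ‖toL θ‖ₑ ^ 2 := by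
  have h2 : ∫⁻ x, ‖opU (toL θ) x‖ₑ ^ 4 = ∫⁻ x, ‖schU θ x‖ₑ ^ 4 := by
    rw [opU_toLp]
    refine lintegral_congr_ae ?_
    filter_upwards [toL_ae (schU θ)] with x hx
    rw [hx]
  rw [h2]
  simp_rw [lintegral_schwartz_sq, ← opD_toLp, ← opU_toLp] at hC
  exact hC.trans (mul_sq_add_sum_sq_le C (enorm_opU_le _) fun i ↦ enorm_opD_le i _)

/-- **Ladyzhenskaya's inequality** in `H¹`. -/
theorem ladyzhenskaya : ∃ C : ℝ≥0, ∀ a : LC2,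
    ∫⁻ x, ‖opU a x‖ₑ ^ 4 ≤ C * ‖opU a‖ₑ ^ 2 * ‖a‖ₑ ^ 2 := by
  obtain ⟨C, hC⟩ := ladyzhenskaya_schwartz
  refine ⟨3 * C, fun a ↦ ?_⟩
  obtain ⟨θ, hθ⟩ := exists_schwartz_tendsto a
  have hU : Tendsto (fun n ↦ opU (toL (θ n))) atTop (𝓝 (opU a)) :=
    (opU.continuous.tendsto a).comp hθ
  have h1 := lintegral_pow_le_liminf (fun n ↦ (Lp.aestronglyMeasurable (opU (toL (θ n)))))
    (Lp.aestronglyMeasurable (opU a)) (tendsto_lintegral_sub hU) 4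
  have hc : Continuous fun p : LC2 × LC2 ↦
      ((3 * C : ℝ≥0) : ℝ≥0∞) * ‖p.1‖ₑ ^ 2 * ‖p.2‖ₑ ^ 2 := by
    have h3 : Continuous fun p : LC2 × LC2 ↦
        (((3 * C * ‖p.1‖₊ ^ 2 * ‖p.2‖₊ ^ 2 : ℝ≥0)) : ℝ≥0∞) :=
      ENNReal.continuous_coe.comp (by fun_prop)
    refine h3.congr fun p ↦ ?_
    simp only [enorm_eq_nnnorm]
    push_cast
    rfl
  have h2 := (hc.tendsto (opU a, a)).comp (hU.prodMk_nhds hθ)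
  refine h1.trans ?_
  exact (liminf_le_liminf (Eventually.of_forall fun n ↦
    ladyzhenskaya_toLp (θ n) (hC (schU (θ n))))).trans_eq h2.liminf_eq

open scoped FourierTransform

/-! ### The transport term -/

instance holderTriple_four : ENNReal.HolderTriple 4 4 2 := by
  refine ⟨?_⟩
  rw [← two_mul, show (4 : ℝ≥0∞) = 2 * 2 by norm_num,
    ENNReal.mul_inv (Or.inl (by norm_num)) (Or.inl (by norm_num)), ← mul_assoc,
    ENNReal.mul_inv_cancel (by norm_num) (by norm_num), one_mul]

lemma memLp_four {f : Plane → ℂ} (hf : AEStronglyMeasurable f volume)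
    (h : ∫⁻ x, ‖f x‖ₑ ^ 4 < ∞) : MemLp f 4 volume := by
  refine ⟨hf, ?_⟩
  rw [eLpNorm_lt_top_iff_lintegral_rpow_enorm_lt_top (by norm_num) (by norm_num)]
  simpa using h

lemma eLpNorm_four_pow (f : Plane → ℂ) : eLpNorm f 4 volume ^ 4 = ∫⁻ x, ‖f x‖ₑ ^ 4 := by
  have := eLpNorm_nnreal_pow_eq_lintegral (f := f) (μ := volume) (p := 4) (by norm_num)
  simpa using this

lemma memLp_four_opU (a : LC2) : MemLp (opU a) 4 volume := by
  obtain ⟨C, hC⟩ := ladyzhenskaya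
  refine memLp_four (Lp.aestronglyMeasurable _) ((hC a).trans_lt ?_)
  finiteness

lemma exists_eLpNorm_opU_le : ∃ K : ℝ≥0, ∀ a : LC2, eLpNorm (opU a) 4 volume ≤ K * ‖a‖ₑ := by
  obtain ⟨C, hC⟩ := ladyzhenskaya
  -- A constant at least 1 dominates its fourth root, so C ≤ K⁴ for K = max C 1.
  refine ⟨max C 1, fun a ↦ ?_⟩
  rw [← ENNReal.pow_le_pow_left_iff (n := 4) (by norm_num), eLpNorm_four_pow, mul_pow]
  have h1 : C ≤ max C 1 ^ 4 := (le_max_left C 1).trans (le_self_pow₀ (le_max_right C 1) (by norm_num))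
  calc _ ≤ C * ‖opU a‖ₑ ^ 2 * ‖a‖ₑ ^ 2 := hC a
    _ ≤ C * ‖a‖ₑ ^ 2 * ‖a‖ₑ ^ 2 := by
        gcongr
        exact enorm_opU_le a
    _ = C * ‖a‖ₑ ^ 4 := by ring
    _ ≤ _ := by
        gcongr
        exact_mod_cast h1

/-- The embedding of `H¹` into `L⁴`. -/
def opU4 : LC2 →L[ℂ] Lp ℂ 4 (volume : Measure Plane) :=
  LinearMap.mkContinuous
    { toFun := fun a ↦ (memLp_four_opU a).toLp
      map_add' := fun a b ↦ by
        rw [← MemLp.toLp_add]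
        refine MemLp.toLp_congr _ _ ?_
        rw [map_add]
        exact Lp.coeFn_add _ _
      map_smul' := fun c a ↦ by
        rw [RingHom.id_apply, ← MemLp.toLp_const_smul]
        refine MemLp.toLp_congr _ _ ?_
        rw [map_smul]
        exact Lp.coeFn_smul _ _ }
    exists_eLpNorm_opU_le.choose fun a ↦ by
      change ‖(memLp_four_opU a).toLp‖ ≤ _
      rw [Lp.norm_toLp]
      refine ENNReal.toReal_le_of_le_ofReal (by positivity)
        ((exists_eLpNorm_opU_le.choose_spec a).trans_eq ?_)
      rw [ENNReal.ofReal_mul (by positivity), ofReal_norm, ENNReal.ofReal_coe_nnreal]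

lemma opU4_ae (a : LC2) : opU4 a =ᵐ[volume] opU a := (memLp_four_opU a).coeFn_toLp

/-- The bilinear form `∫ ∂ᵢu z w` for `z ∈ L⁴`. -/
def transportForm (i : Fin 2) (z : Lp ℂ 4 (volume : Measure Plane)) (a : LC2) : ℂ :=
  (ContinuousLinearMap.mul ℂ ℂ).lpPairing volume 2 2 (opD i a)
    ((ContinuousLinearMap.mul ℂ ℂ).holderL volume 4 4 2 z (opU4 a))

lemma continuous_transportForm (i : Fin 2) (z : Lp ℂ 4 (volume : Measure Plane)) :
    Continuous (transportForm i z) := by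
  unfold transportForm
  have h1 : Continuous fun a : LC2 ↦
      (ContinuousLinearMap.mul ℂ ℂ).holderL (volume : Measure Plane) 4 4 2 z (opU4 a) :=
    (((ContinuousLinearMap.mul ℂ ℂ).holderL volume 4 4 2 z).comp opU4).continuous
  exact (((ContinuousLinearMap.mul ℂ ℂ).lpPairing (volume : Measure Plane) 2 2).continuous.comp
    (opD i).continuous).clm_apply h1

lemma transportForm_eq (i : Fin 2) (z : Lp ℂ 4 (volume : Measure Plane)) (a : LC2) :
    transportForm i z a = ∫ x, opD i a x * (z x * opU a x) := by
  rw [transportForm, ContinuousLinearMap.lpPairing_eq_integral]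
  refine integral_congr_ae ?_
  have h1 := (ContinuousLinearMap.mul ℂ ℂ).coeFn_holder (r := 2) z (opU4 a)
  filter_upwards [h1, opU4_ae a] with x h2 h3
  change opD i a x * ((ContinuousLinearMap.mul ℂ ℂ).holder 2 z (opU4 a)) x = _
  rw [h2, h3]
  rfl

lemma lineDeriv_mul_self (φ : 𝓢(Plane, ℂ)) (i : Fin 2) (x : Plane) :
    LineDeriv.lineDerivOp (e i) (SchwartzMap.smulLeftCLM ℂ φ φ) x
      = 2 * (LineDeriv.lineDerivOp (e i) φ x * φ x) := by
  rw [SchwartzMap.lineDerivOp_apply_eq_fderiv, SchwartzMap.lineDerivOp_apply_eq_fderiv,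
    SchwartzMap.smulLeftCLM_apply φ.hasTemperateGrowth]
  have h1 : HasFDerivAt (φ : Plane → ℂ) (fderiv ℝ φ x) x := (φ.differentiableAt).hasFDerivAt
  have h2 : HasFDerivAt (fun x ↦ φ x • φ x) _ x := h1.mul h1
  rw [h2.fderiv]
  simp only [add_apply, smul_apply, smul_eq_mul]
  ring

/-- The transport by a divergence free field conserves the energy. -/
theorem integral_transport_eq_zero {z : Fin 2 → LC2} (hz : ∀ i, MemLp (z i) 4 volume)
    (hdiv : divergence (fun i ↦ Lp.toTemperedDistribution (z i)) = 0) (a : LC2) :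
    ∑ i, ∫ x, opD i a x * (z i x * opU a x) = 0 := by
  have h1 (a : LC2) : ∑ i, ∫ x, opD i a x * (z i x * opU a x)
      = ∑ i, transportForm i (hz i).toLp a := by
    refine Finset.sum_congr rfl fun i _ ↦ ?_
    rw [transportForm_eq]
    refine integral_congr_ae ?_
    filter_upwards [(hz i).coeFn_toLp] with x hx
    rw [hx]
  -- For Schwartz φ, φ ∂ᵢφ = ½ ∂ᵢ(φ²), and φ² is an admissible test function in div z = 0.
  have h2 (θ : 𝓢(Plane, ℂ)) : ∑ i, transportForm i (hz i).toLp (toL θ) = 0 := by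
    rw [← h1]
    let ψ := SchwartzMap.smulLeftCLM ℂ (schU θ) (schU θ)
    have h3 (i : Fin 2) : ∫ x, opD i (toL θ) x * (z i x * opU (toL θ) x)
        = (1 / 2) * Lp.toTemperedDistribution (z i) (LineDeriv.lineDerivOp (e i) ψ) := by
      rw [Lp.toTemperedDistribution_apply, ← integral_const_mul]
      refine integral_congr_ae ?_
      rw [opD_toLp, opU_toLp]
      filter_upwards [toL_ae (schU θ), toL_ae (LineDeriv.lineDerivOp (e i) (schU θ))] with x h4 h5
      rw [h4, h5, lineDeriv_mul_self, smul_eq_mul]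
      ring
    have h4 := congrArg (fun u : 𝓢'(Plane, ℂ) ↦ u ψ) hdiv
    simp only [divergence, LinearMap.sum_apply, LinearMap.comp_apply, LinearMap.proj_apply,
      ContinuousLinearMap.coe_coe, LineDeriv.lineDerivOpCLM_apply] at h4
    have h5 : ∑ i, Lp.toTemperedDistribution (z i) (LineDeriv.lineDerivOp (e i) ψ) = 0 := by
      have h6 : (∑ i, LineDeriv.lineDerivOp (e i)
          (Lp.toTemperedDistribution (z i) : 𝓢'(Plane, ℂ))) ψ = 0 := h4
      rw [Fin.sum_univ_two] at h6 ⊢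
      rw [add_apply] at h6
      simp only [TemperedDistribution.lineDerivOp_apply_apply, map_neg] at h6
      linear_combination -h6
    simp_rw [h3]
    rw [← Finset.mul_sum, h5, mul_zero]
  rw [h1]
  -- Both sides are continuous in a, because H¹ embeds into L⁴ and z is in L⁴.
  obtain ⟨θ, hθ⟩ := exists_schwartz_tendsto a
  have hc : Continuous fun a ↦ ∑ i, transportForm i (hz i).toLp a :=
    continuous_finsetSum _ fun i _ ↦ continuous_transportForm i _
  refine tendsto_nhds_unique ((hc.tendsto a).comp hθ) ?_
  simp only [Function.comp_def, h2]
  exact tendsto_const_nhds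

open scoped FourierTransform ComplexConjugate

/-! ### Products of functions in `L⁴` -/

open Classical in
/-- The product of two functions, as an element of `L²`; junk if it is not square integrable. -/
def prodLp (z w : LC2) : LC2 := if h : MemLp (fun x ↦ z x * w x) 2 volume then h.toLp else 0

/-- The `L⁴` norm as a real number. -/
def norm4 (z : LC2) : ℝ := (eLpNorm z 4 volume).toReal

lemma norm4_nonneg (z : LC2) : 0 ≤ norm4 z := ENNReal.toReal_nonneg

lemma norm4_pow (z : LC2) : norm4 z ^ 4 = (∫⁻ x, ‖z x‖ₑ ^ 4).toReal := by
  rw [norm4, ← ENNReal.toReal_pow, eLpNorm_four_pow]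

lemma memLp_mul {z w : LC2} (hz : MemLp z 4 volume) (hw : MemLp w 4 volume) :
    MemLp (fun x ↦ z x * w x) 2 volume := hw.mul' hz

lemma prodLp_ae {z w : LC2} (hz : MemLp z 4 volume) (hw : MemLp w 4 volume) :
    prodLp z w =ᵐ[volume] fun x ↦ z x * w x := by
  rw [prodLp, dif_pos (memLp_mul hz hw)]
  exact MemLp.coeFn_toLp _

lemma norm_prodLp_le {z w : LC2} (hz : MemLp z 4 volume) (hw : MemLp w 4 volume) :
    ‖prodLp z w‖ ≤ norm4 z * norm4 w := by
  rw [prodLp, dif_pos (memLp_mul hz hw), Lp.norm_toLp, norm4, norm4, ← ENNReal.toReal_mul]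
  refine ENNReal.toReal_mono (ENNReal.mul_ne_top hz.2.ne hw.2.ne) ?_
  have h3 := eLpNorm_smul_le_mul_eLpNorm (p := 4) (q := 4) (r := 2) hw.1 hz.1
  refine le_trans ?_ h3
  exact le_rfl

lemma memLp_four_add {z w : LC2} (hz : MemLp z 4 volume) (hw : MemLp w 4 volume) :
    MemLp (z + w : LC2) 4 volume := (hz.add hw).ae_eq (Lp.coeFn_add z w).symm

lemma prodLp_add {z w w' : LC2} (hz : MemLp z 4 volume) (hw : MemLp w 4 volume)
    (hw' : MemLp w' 4 volume) : prodLp z (w + w') = prodLp z w + prodLp z w' := by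
  refine Lp.ext ?_
  filter_upwards [prodLp_ae hz (memLp_four_add hw hw'), prodLp_ae hz hw, prodLp_ae hz hw',
    Lp.coeFn_add w w', Lp.coeFn_add (prodLp z w) (prodLp z w')] with x h1 h2 h3 h4 h5
  rw [h1, h5, Pi.add_apply, h2, h3, h4, Pi.add_apply, mul_add]

lemma prodLp_comm {z w : LC2} (hz : MemLp z 4 volume) (hw : MemLp w 4 volume) :
    prodLp z w = prodLp w z := by
  refine Lp.ext ?_
  filter_upwards [prodLp_ae hz hw, prodLp_ae hw hz] with x h1 h2
  rw [h1, h2, mul_comm]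

/-- A square integrable function is real. -/
def IsRealFn (z : LC2) : Prop := ∀ᵐ x, conj (z x) = z x

lemma isRealFn_compLp (k : Fin 2) (h : L2Field) : IsRealFn (compLp k h) := by
  filter_upwards [compLp_ae k h] with x hx
  rw [hx, Complex.conj_ofReal]

/-- Since z and u are real, the Hermitian product is the conjugate of the bilinear integral, and
real parts agree. -/
lemma re_inner_opD_prodLp {z a : LC2} (hz : MemLp z 4 volume) (hzr : IsRealFn z)
    (har : IsRealFn (opU a)) (i : Fin 2) :
    (inner ℂ (opD i a) (prodLp z (opU a))).re = (∫ x, opD i a x * (z x * opU a x)).re := by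
  have h1 : inner ℂ (opD i a) (prodLp z (opU a)) = conj (∫ x, opD i a x * (z x * opU a x)) := by
    rw [L2.inner_def, ← integral_conj]
    refine integral_congr_ae ?_
    filter_upwards [prodLp_ae hz (memLp_four_opU a), hzr, har] with x h2 h3 h4
    rw [h2, RCLike.inner_apply]
    simp only [map_mul, h3, h4]
    ring
  rw [h1, Complex.conj_re]

lemma sum_re_inner_opD_prodLp {z : Fin 2 → LC2} {a : LC2} (hz : ∀ i, MemLp (z i) 4 volume)
    (hzr : ∀ i, IsRealFn (z i)) (hdiv : divergence (fun i ↦ Lp.toTemperedDistribution (z i)) = 0)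
    (har : IsRealFn (opU a)) :
    ∑ i, (inner ℂ (opD i a) (prodLp (z i) (opU a))).re = 0 := by
  simp_rw [fun i ↦ re_inner_opD_prodLp (hz i) (hzr i) har i, ← Complex.re_sum,
    integral_transport_eq_zero hz hdiv a, Complex.zero_re]

lemma norm_sq_eq_sum (h : L2Field) : ‖h‖ ^ 2 = ∑ k, ‖compLp k h‖ ^ 2 := by
  have h1 : ‖h‖ ^ 2 = ∫ x, ‖h x‖ ^ 2 := by
    rw [← real_inner_self_eq_norm_sq, L2.inner_def]
    simp only [real_inner_self_eq_norm_sq]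
  simp_rw [h1, norm_sq_eq_integral]
  rw [← integral_finsetSum _ fun k _ ↦ integrable_norm_sq _]
  refine integral_congr_ae ?_
  filter_upwards [compLp_ae 0 h, compLp_ae 1 h] with x h2 h3
  rw [Fin.sum_univ_two, h2, h3, EuclideanSpace.norm_sq_eq, Fin.sum_univ_two, Complex.norm_real,
    Complex.norm_real]

lemma norm4_opU_le : ∃ K : ℝ, 0 ≤ K ∧ ∀ a : LC2, norm4 (opU a) ^ 4 ≤ K * ‖opU a‖ ^ 2 * ‖a‖ ^ 2 := by
  obtain ⟨C, hC⟩ := ladyzhenskaya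
  refine ⟨C, C.coe_nonneg, fun a ↦ ?_⟩
  rw [norm4_pow]
  refine ENNReal.toReal_le_of_le_ofReal (by positivity) ((hC a).trans_eq ?_)
  rw [ENNReal.ofReal_mul (by positivity), ENNReal.ofReal_mul (by positivity),
    ENNReal.ofReal_pow (norm_nonneg _), ENNReal.ofReal_pow (norm_nonneg _), ofReal_norm,
    ofReal_norm, ENNReal.ofReal_coe_nnreal]

lemma divergence_toDist (h : HSp) :
    divergence (fun k ↦ Lp.toTemperedDistribution (compLp k h)) = 0 := h.2

/-! ### The energy inequality at a fixed time -/

/-- The time derivative of the energy of a velocity field with components `opU (a k)`, with noise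
`ζ` and force of components `J (c k)`. -/
def energyRate (γ α : ℝ) (u ζ : HSp) (a c : Fin 2 → LC2) : ℝ :=
  -2 * ∑ k, ‖a k‖ ^ 2 + 2 * (1 - γ) * ∑ k, ‖compLp k u‖ ^ 2
    + 2 * ∑ k, ∑ i, (inner ℂ (opD i (a k))
        (prodLp (compLp i (u + ζ : HSp)) (compLp k (u + ζ : HSp)))).re
    + 2 * α * ∑ k, (inner ℂ (compLp k u) (compLp k ζ)).re
    + 2 * ∑ k, (inner ℂ (a k) (c k)).re

/-- With z = u + y, the part of the second factor coming from u contributes nothing by conservation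
of energy. What remains is linear or quadratic in y; the factor 4 counts the pairs (k, i). -/
lemma sum_trilinear_le {a y : Fin 2 → LC2} (hy : ∀ k, MemLp (y k) 4 volume)
    (har : ∀ k, IsRealFn (opU (a k))) (hzr : ∀ k, IsRealFn (opU (a k) + y k))
    (hdiv : divergence (fun k ↦ Lp.toTemperedDistribution (opU (a k) + y k)) = 0)
    {A r s : ℝ} (hA : ∀ k, ‖a k‖ ≤ A)
    (hr : ∀ k, norm4 (y k) ≤ r) (hs : ∀ k, norm4 (opU (a k)) ≤ s) :
    ∑ k, ∑ i, (inner ℂ (opD i (a k))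
        (prodLp (opU (a i) + y i) (opU (a k) + y k))).re ≤ 4 * (A * (s * r + r * r)) := by
  have hu4 (k : Fin 2) : MemLp (opU (a k)) 4 volume := memLp_four_opU _
  have hz4 (k : Fin 2) : MemLp (opU (a k) + y k : LC2) 4 volume := memLp_four_add (hu4 k) (hy k)
  have h1 (k : Fin 2) : ∑ i, (inner ℂ (opD i (a k))
        (prodLp (opU (a i) + y i) (opU (a k) + y k))).re
      = ∑ i, (inner ℂ (opD i (a k)) (prodLp (opU (a i) + y i) (y k))).re := by
    have h2 := sum_re_inner_opD_prodLp (a := a k) (z := fun i ↦ opU (a i) + y i) hz4 hzr hdiv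
      (har k)
    rw [← sub_eq_zero, ← h2, ← Finset.sum_sub_distrib]
    refine Finset.sum_congr rfl fun i _ ↦ ?_
    rw [prodLp_add (hz4 i) (hu4 k) (hy k), inner_add_right, Complex.add_re]
    ring
  have hA0 : 0 ≤ A := (norm_nonneg _).trans (hA 0)
  have hr0 : 0 ≤ r := (norm4_nonneg _).trans (hr 0)
  have hs0 : 0 ≤ s := (norm4_nonneg _).trans (hs 0)
  have h3 (k i : Fin 2) : (inner ℂ (opD i (a k))
      (prodLp (opU (a i) + y i) (y k))).re ≤ A * (s * r + r * r) := by
    have h4 : ‖prodLp (opU (a i) + y i) (y k)‖ ≤ s * r + r * r := by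
      rw [prodLp_comm (hz4 i) (hy k), prodLp_add (hy k) (hu4 i) (hy i)]
      refine (norm_add_le _ _).trans (add_le_add ?_ ?_)
      · rw [prodLp_comm (hy k) (hu4 i)]
        exact (norm_prodLp_le (hu4 i) (hy k)).trans
          (mul_le_mul (hs i) (hr k) (norm4_nonneg _) hs0)
      · exact (norm_prodLp_le (hy k) (hy i)).trans
          (mul_le_mul (hr k) (hr i) (norm4_nonneg _) hr0)
    refine (Complex.re_le_norm _).trans ((norm_inner_le_norm _ _).trans ?_)
    exact mul_le_mul ((norm_opD_le i (a k)).trans (hA k)) h4 (norm_nonneg _) hA0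
  rw [Finset.sum_congr rfl fun k _ ↦ h1 k]
  calc _ ≤ ∑ _k : Fin 2, ∑ _i : Fin 2, A * (s * r + r * r) :=
        Finset.sum_le_sum fun k _ ↦ Finset.sum_le_sum fun i _ ↦ h3 k i
    _ = _ := by simp only [Fin.sum_univ_two]; ring

/-- Young's inequality on A·s·r leaves s²r²; then s² ≤ √K·m·A and a second use of Young leave m²r⁴.
The budget κA² is spent as κ/4 + κ/4 + κ/2, each time by completing a square. -/
lemma young_trilinear {κ K : ℝ} (hκ : 0 < κ) (hK : 0 ≤ K) : ∃ C : ℝ, 0 ≤ C ∧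
    ∀ A m r s : ℝ, 0 ≤ A → 0 ≤ m → 0 ≤ r → 0 ≤ s → s ^ 4 ≤ K * m ^ 2 * A ^ 2 →
      8 * (A * (s * r + r * r)) ≤ κ * A ^ 2 + C * (1 + m ^ 2) * r ^ 4 := by
  refine ⟨64 / κ + 1024 * K / κ ^ 3 * 2, by positivity, fun A m r s hA hm hr hs h ↦ ?_⟩
  have h0 : s ^ 2 ≤ √K * (m * A) := by
    refine le_of_sq_le_sq_of_nonneg (by positivity) ?_
    rw [mul_pow, Real.sq_sqrt hK]
    nlinarith
  have h1 : 8 * (A * (r * r)) ≤ κ / 4 * A ^ 2 + 64 / κ * r ^ 4 := by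
    have : κ / 4 * A ^ 2 + 64 / κ * r ^ 4 - 8 * (A * (r * r)) = 
      (κ * A - 16 * r ^ 2) ^ 2 / (4 * κ) := by field_simp; ring
    have h2 : 0 ≤ (κ * A - 16 * r ^ 2) ^ 2 / (4 * κ) := by positivity
    linarith
  have h2 : 8 * (A * (s * r)) ≤ κ / 4 * A ^ 2 + 64 / κ * (s ^ 2 * r ^ 2) := by
    have : κ / 4 * A ^ 2 + 64 / κ * (s ^ 2 * r ^ 2) - 8 * (A * (s * r)) = 
      (κ * A - 16 * (s * r)) ^ 2 / (4 * κ) := by field_simp; ring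
    have h2 : 0 ≤ (κ * A - 16 * (s * r)) ^ 2 / (4 * κ) := by positivity
    linarith
  have h3 : 64 / κ * (s ^ 2 * r ^ 2) ≤ κ / 2 * A ^ 2 + 1024 * K / κ ^ 3 * 2 * (m ^ 2 * r ^ 4) := by
    have h4 : 64 / κ * (s ^ 2 * r ^ 2) ≤ 64 / κ * ((√K * (m * A)) * r ^ 2) := by gcongr
    have : κ / 2 * A ^ 2 + 1024 * K / κ ^ 3 * 2 * (m ^ 2 * r ^ 4) - 64 / κ * ((√K * (m * A)) * r ^ 2)
        = (κ ^ 2 * A - 64 * (√K * m * r ^ 2)) ^ 2 / (2 * κ ^ 3) := by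
      field_simp
      linear_combination (-4096 * m ^ 2 * r ^ 4) * Real.sq_sqrt hK
    have h2 : 0 ≤ (κ ^ 2 * A - 64 * (√K * m * r ^ 2)) ^ 2 / (2 * κ ^ 3) := by positivity
    linarith
  have h5 : 0 ≤ 64 / κ * (m ^ 2 * r ^ 4) := by positivity
  have h6 : 0 ≤ 1024 * K / κ ^ 3 * r ^ 4 := by positivity
  nlinarith

lemma sum_re_inner_le (x y : Fin 2 → LC2) {X Y : ℝ} (hX : 0 ≤ X) (hY : 0 ≤ Y)
    (hx : ∑ k, ‖x k‖ ^ 2 = X ^ 2) (hy : ∑ k, ‖y k‖ ^ 2 = Y ^ 2) :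
    |∑ k, (inner ℂ (x k) (y k)).re| ≤ X * Y := by
  have h1 : |∑ k, (inner ℂ (x k) (y k)).re| ≤ ∑ k, ‖x k‖ * ‖y k‖ := by
    refine (Finset.abs_sum_le_sum_abs _ _).trans (Finset.sum_le_sum fun k _ ↦ ?_)
    exact (Complex.abs_re_le_norm _).trans (norm_inner_le_norm _ _)
  refine h1.trans (le_of_sq_le_sq_of_nonneg (by positivity) ?_)
  rw [mul_pow, ← hx, ← hy]
  exact Finset.sum_mul_sq_le_sq_mul_sq _ _ _

/-- Here A² = ∑‖a k‖² is ‖u‖² + ‖∇u‖², so -2A² + 2(1 - γ)‖u‖² is the full dissipation. Transport and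
force terms each spend κA²/2, and the damping term spends γ‖u‖²/2. The constant is fixed before α,
which is what later allows α to be chosen from it. -/
theorem exists_energyRate_le {γ : ℝ} (hγ : 0 < γ) : ∃ C : ℝ, 0 ≤ C ∧
    ∀ (α : ℝ) (u ζ : HSp) (a c : Fin 2 → LC2), (∀ k, compLp k u = opU (a k)) →
      (∀ k, MemLp (compLp k ζ) 4 volume) →
      energyRate γ α u ζ a c ≤ -γ * ‖u‖ ^ 2
        + C * (1 + ‖u‖ ^ 2) * ∑ k, norm4 (compLp k ζ) ^ 4
        + C * (α ^ 2 * ‖ζ‖ ^ 2 + ∑ k, ‖c k‖ ^ 2) := by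
  obtain ⟨K, hK, hKb⟩ := norm4_opU_le
  let κ : ℝ := min 1 (γ / 2)
  have hκ : 0 < κ := by positivity
  have hκ1 : κ ≤ 1 := min_le_left _ _
  have hκ2 : κ ≤ γ / 2 := min_le_right _ _
  obtain ⟨C, hC, hCb⟩ := young_trilinear (κ := κ / 2) (by positivity) hK
  refine ⟨C + 2 / γ + 2 / κ, by positivity, fun α u ζ a c ha hζ ↦ ?_⟩
  have hadd (k : Fin 2) : compLp k (u + ζ : HSp) = opU (a k) + compLp k ζ := by
    rw [Submodule.coe_add, map_add, ha]
  obtain ⟨A, hA0, hA⟩ : ∃ A : ℝ, 0 ≤ A ∧ ∑ k, ‖a k‖ ^ 2 = A ^ 2 :=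
    ⟨√(∑ k, ‖a k‖ ^ 2), Real.sqrt_nonneg _,
      (Real.sq_sqrt (Finset.sum_nonneg fun k _ ↦ sq_nonneg _)).symm⟩
  obtain ⟨F, hF0, hF⟩ : ∃ A : ℝ, 0 ≤ A ∧ ∑ k, ‖c k‖ ^ 2 = A ^ 2 :=
    ⟨√(∑ k, ‖c k‖ ^ 2), Real.sqrt_nonneg _,
      (Real.sq_sqrt (Finset.sum_nonneg fun k _ ↦ sq_nonneg _)).symm⟩
  obtain ⟨m, hm⟩ : ∃ m : ℝ, ‖u‖ = m := ⟨_, rfl⟩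
  obtain ⟨n, hn⟩ : ∃ n : ℝ, ‖ζ‖ = n := ⟨_, rfl⟩
  have hm0 : 0 ≤ m := hm ▸ norm_nonneg _
  have hn0 : 0 ≤ n := hn ▸ norm_nonneg _
  have hum : ∑ k, ‖compLp k u‖ ^ 2 = m ^ 2 := by rw [← norm_sq_eq_sum, ← hm]; rfl
  have hζn : ∑ k, ‖compLp k ζ‖ ^ 2 = n ^ 2 := by rw [← norm_sq_eq_sum, ← hn]; rfl
  let r := max (norm4 (compLp 0 ζ)) (norm4 (compLp 1 ζ))
  let s := max (norm4 (compLp 0 u)) (norm4 (compLp 1 u))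
  have hr (k : Fin 2) : norm4 (compLp k ζ) ≤ r := by
    fin_cases k
    exacts [le_max_left _ _, le_max_right _ _]
  have hs (k : Fin 2) : norm4 (opU (a k)) ≤ s := by
    rw [← ha]
    fin_cases k
    exacts [le_max_left _ _, le_max_right _ _]
  have hr0 : 0 ≤ r := (norm4_nonneg _).trans (hr 0)
  have hs0 : 0 ≤ s := (norm4_nonneg _).trans (hs 0)
  have hr4 : r ^ 4 ≤ ∑ k, norm4 (compLp k ζ) ^ 4 := by
    rw [Fin.sum_univ_two]
    have h0 := pow_nonneg (norm4_nonneg (compLp 0 ζ)) 4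
    have h1 := pow_nonneg (norm4_nonneg (compLp 1 ζ)) 4
    rcases max_choice (norm4 (compLp 0 ζ)) (norm4 (compLp 1 ζ)) with h | h <;>
      simp only [r, h] <;> linarith
  have hak (k : Fin 2) : ‖a k‖ ≤ A := by
    refine le_of_sq_le_sq_of_nonneg hA0 (hA ▸ ?_)
    exact Finset.single_le_sum (f := fun k ↦ ‖a k‖ ^ 2) (fun i _ ↦ sq_nonneg _) (Finset.mem_univ k)
  have huk (k : Fin 2) : ‖compLp k u‖ ≤ m := by
    refine le_of_sq_le_sq_of_nonneg hm0 (hum ▸ ?_)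
    exact Finset.single_le_sum (f := fun k ↦ ‖compLp k u‖ ^ 2) (fun i _ ↦ sq_nonneg _)
      (Finset.mem_univ k)
  have hs4' (k : Fin 2) : norm4 (compLp k u) ^ 4 ≤ K * m ^ 2 * A ^ 2 := by
    have h1 := hKb (a k)
    rw [← ha] at h1
    refine h1.trans ?_
    have h2 := pow_le_pow_left₀ (norm_nonneg _) (huk k) 2
    have h3 := pow_le_pow_left₀ (norm_nonneg _) (hak k) 2
    exact mul_le_mul (mul_le_mul_of_nonneg_left h2 hK) h3 (sq_nonneg _) (by positivity)
  have hs4 : s ^ 4 ≤ K * m ^ 2 * A ^ 2 := by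
    rcases max_choice (norm4 (compLp 0 u)) (norm4 (compLp 1 u)) with h | h <;>
      simp only [s, h]
    exacts [hs4' 0, hs4' 1]
  have hmA : m ^ 2 ≤ A ^ 2 := by
    rw [← hA, ← hum]
    refine Finset.sum_le_sum fun k _ ↦ ?_
    rw [ha]
    exact pow_le_pow_left₀ (norm_nonneg _) (norm_opU_le _) 2
  have htri := sum_trilinear_le (a := a) (y := fun k ↦ compLp k ζ) hζ
    (fun k ↦ by have h := isRealFn_compLp k (u : L2Field); rwa [ha] at h)
    (fun k ↦ by have h := isRealFn_compLp k (u + ζ : HSp); rwa [hadd] at h)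
    (by have h := divergence_toDist (u + ζ); simp_rw [hadd] at h; exact h) hak hr hs
  simp_rw [← hadd] at htri
  have hy := hCb A m r s hA0 hm0 hr0 hs0 hs4
  have hi1 := (abs_le.1 (sum_re_inner_le (fun k ↦ compLp k u) (fun k ↦ compLp k ζ) hm0 hn0 hum hζn))
  have hi1' : 2 * α * ∑ k, (inner ℂ (compLp k u) (compLp k ζ)).re ≤ 2 * (|α| * (m * n)) := by
    have h1 := sum_re_inner_le (fun k ↦ compLp k u) (fun k ↦ compLp k ζ) hm0 hn0 hum hζn
    have h2 := le_abs_self (α * ∑ k, (inner ℂ (compLp k u) (compLp k ζ)).re)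
    rw [abs_mul] at h2
    have h3 := mul_le_mul_of_nonneg_left h1 (abs_nonneg α)
    linarith
  have hi2 := (abs_le.1 (sum_re_inner_le a c hA0 hF0 hA hF)).2
  have hy1 : 2 * (|α| * (m * n)) ≤ γ / 2 * m ^ 2 + 2 / γ * (α ^ 2 * n ^ 2) := by
    have : γ / 2 * m ^ 2 + 2 / γ * (α ^ 2 * n ^ 2) - 2 * (|α| * (m * n))
        = (γ * m - 2 * |α| * n) ^ 2 / (2 * γ) := by
      rw [← sq_abs α]; field_simp; ring
    have h2 : 0 ≤ (γ * m - 2 * |α| * n) ^ 2 / (2 * γ) := by positivity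
    linarith
  have hy2 : 2 * (A * F) ≤ κ / 2 * A ^ 2 + 2 / κ * F ^ 2 := by
    have : κ / 2 * A ^ 2 + 2 / κ * F ^ 2 - 2 * (A * F) = (κ * A - 2 * F) ^ 2 / (2 * κ) := by
      field_simp; ring
    have h2 : 0 ≤ (κ * A - 2 * F) ^ 2 / (2 * κ) := by positivity
    linarith
  have hy3 : κ * m ^ 2 ≤ γ / 2 * m ^ 2 := by gcongr
  -- The unspent part of -2A² returns the 2m² contained in 2(1 - γ)m², up to κm² ≤ γm²/2; this
  -- leaves at most -γm².
  have hy4 : (2 - κ) * m ^ 2 ≤ (2 - κ) * A ^ 2 := mul_le_mul_of_nonneg_left hmA (by linarith)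
  rw [energyRate, hA, hum, hF, hm, hn]
  generalize ∑ k, norm4 (compLp k ζ) ^ 4 = Q at hr4 ⊢
  have hQ : 0 ≤ Q := (pow_nonneg hr0 4).trans hr4
  have hy5 : C * (1 + m ^ 2) * r ^ 4 ≤ C * (1 + m ^ 2) * Q := by gcongr
  have h1 : 0 ≤ (2 / γ + 2 / κ) * (1 + m ^ 2) * Q := by positivity
  have h2 : 0 ≤ (C + 2 / κ) * (α ^ 2 * n ^ 2) := by positivity
  have h3 : 0 ≤ (C + 2 / γ) * F ^ 2 := by positivity
  have h4 : 0 ≤ γ * m ^ 2 := by positivity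
  linarith

open scoped FourierTransform ComplexConjugate

/-- Measurability is checked against each y: on the measurable set where the product is square
integrable the inner product is a parameter integral of the jointly measurable `ev`, and elsewhere
it is 0. -/
lemma measurable_prodLp : Measurable fun p : LC2 × LC2 ↦ prodLp p.1 p.2 := by
  have hm : Measurable fun q : (LC2 × LC2) × Plane ↦ ev q.1.1 q.2 * ev q.1.2 q.2 := by
    have h1 : Measurable fun q : (LC2 × LC2) × Plane ↦ (q.1.1, q.2) := by fun_prop
    have h2 : Measurable fun q : (LC2 × LC2) × Plane ↦ (q.1.2, q.2) := by fun_prop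
    exact (measurable_ev.comp h1).mul (measurable_ev.comp h2)
  refine (stronglyMeasurable_of_inner fun y ↦ ?_).measurable
  let S : Set (LC2 × LC2) := {p | ∫⁻ x, ‖ev p.1 x * ev p.2 x‖ₑ ^ 2 < ∞}
  have hS : MeasurableSet S :=
    measurableSet_lt (hm.enorm.pow_const 2).lintegral_prod_right' measurable_const
  have hi : StronglyMeasurable fun p : LC2 × LC2 ↦
      ∫ x, (inner ℝ (ev p.1 x * ev p.2 x) (ev y x) : ℝ) := by
    have h1 : Measurable fun q : (LC2 × LC2) × Plane ↦
        (inner ℝ (ev q.1.1 q.2 * ev q.1.2 q.2) (ev y q.2) : ℝ) :=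
      hm.inner ((measurable_ev_right y).comp measurable_snd)
    exact h1.stronglyMeasurable.integral_prod_right'
  have heq : (fun p : LC2 × LC2 ↦ (inner ℝ (prodLp p.1 p.2) y : ℝ))
      = S.indicator fun p ↦ ∫ x, (inner ℝ (ev p.1 x * ev p.2 x) (ev y x) : ℝ) := by
    ext p
    have hae : (fun x ↦ p.1 x * p.2 x) =ᵐ[volume] fun x ↦ ev p.1 x * ev p.2 x := by
      filter_upwards [ev_ae p.1, ev_ae p.2] with x h1 h2
      rw [h1, h2]
    have hiff : MemLp (fun x ↦ p.1 x * p.2 x) 2 volume ↔ p ∈ S := by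
      have h1 : ∫⁻ x, ‖ev p.1 x * ev p.2 x‖ₑ ^ 2 = ∫⁻ x, ‖p.1 x * p.2 x‖ₑ ^ 2 := by
        refine lintegral_congr_ae ?_
        filter_upwards [hae] with x hx
        rw [hx]
      rw [Set.mem_ofPred_eq, h1]
      have h2 : AEStronglyMeasurable (fun x ↦ p.1 x * p.2 x) volume :=
        (Lp.aestronglyMeasurable p.1).mul (Lp.aestronglyMeasurable p.2)
      rw [MemLp, and_iff_right h2,
        eLpNorm_lt_top_iff_lintegral_rpow_enorm_lt_top (by norm_num) (by norm_num)]
      simp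
    by_cases hp : p ∈ S
    · rw [Set.indicator_of_mem hp, prodLp, dif_pos (hiff.2 hp), L2.inner_def]
      refine integral_congr_ae ?_
      filter_upwards [(hiff.2 hp).coeFn_toLp, hae, ev_ae y] with x h1 h2 h3
      rw [h1, h2, h3]
    · rw [Set.indicator_of_notMem hp, prodLp, dif_neg (fun h ↦ hp (hiff.1 h)), inner_zero_left]
  rw [heq]
  exact hi.measurable.indicator hS

/-! ### Testing with Schwartz functions on the Fourier side -/

lemma integrable_schwartz_mul (σ : 𝓢(Plane, ℂ)) (a : LC2) : Integrable fun x ↦ σ x * a x :=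
  (σ.memLp 2 volume).integrable_mul (Lp.memLp a)

/-- Multiplication by a nowhere vanishing Gaussian makes g integrable, and integrable functions
embed injectively into the tempered distributions. -/
lemma ae_eq_zero_of_forall_schwartz {g : Plane → ℂ}
    (hg : ∀ σ : 𝓢(Plane, ℂ), Integrable fun x ↦ σ x * g x)
    (h : ∀ σ : 𝓢(Plane, ℂ), ∫ x, σ x * g x = 0) : ∀ᵐ x, g x = 0 := by
  let G := gaussS one_pos
  have hG : MemLp (fun x ↦ G x * g x) 1 volume := memLp_one_iff_integrable.2 (hg G)
  have h0 : Lp.toTemperedDistribution hG.toLp = Lp.toTemperedDistribution (0 : Lp ℂ 1 volume) := by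
    ext θ
    rw [Lp.toTemperedDistribution_apply, Lp.toTemperedDistribution_apply]
    have h1 : ∫ x, θ x • (0 : Lp ℂ 1 (volume : Measure Plane)) x = 0 := by
      rw [← integral_zero Plane ℂ (μ := volume)]
      refine integral_congr_ae ?_
      filter_upwards [Lp.coeFn_zero ℂ 1 (volume : Measure Plane)] with x hx
      rw [hx, Pi.zero_apply, smul_zero]
    rw [h1, ← h (SchwartzMap.smulLeftCLM ℂ θ G)]
    refine integral_congr_ae ?_
    filter_upwards [hG.coeFn_toLp] with x hx
    rw [hx, SchwartzMap.smulLeftCLM_apply_apply θ.hasTemperateGrowth, smul_eq_mul, smul_eq_mul,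
      mul_assoc]
  have h1 := toTemperedDistribution_injective h0
  have h2 : (fun x ↦ G x * g x) =ᵐ[volume] 0 :=
    hG.coeFn_toLp.symm.trans (h1 ▸ Lp.coeFn_zero ℂ 1 volume)
  filter_upwards [h2] with x hx
  have hx' : G x * g x = 0 := hx
  refine (mul_eq_zero.1 hx').resolve_left ?_
  rw [gaussS_apply, symH]
  exact_mod_cast (Real.exp_pos _).ne'

lemma toTemperedDistribution_fourier (a : LC2) (σ : 𝓢(Plane, ℂ)) :
    Lp.toTemperedDistribution a (𝓕 σ) = ∫ ξ, σ ξ * (𝓕 a) ξ := by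
  rw [← TemperedDistribution.fourier_apply, Lp.fourier_toTemperedDistribution_eq,
    Lp.toTemperedDistribution_apply]
  rfl

lemma J_apply_fourier (s : ℝ) (a : LC2) (σ : 𝓢(Plane, ℂ)) :
    J s (Lp.toTemperedDistribution a) (𝓕 σ)
      = ∫ ξ, SchwartzMap.smulLeftCLM ℂ (symJ s) σ ξ * (𝓕 a) ξ := by
  rw [J_eq, TemperedDistribution.fourierMultiplierCLM_apply_apply,
    FourierTransform.fourierInv_fourier_eq, toTemperedDistribution_fourier]

/-- Multiplication of a Schwartz function by `2πiξᵢ`. -/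
def mulXi (i : Fin 2) (σ : 𝓢(Plane, ℂ)) : 𝓢(Plane, ℂ) :=
  SchwartzMap.smulLeftCLM ℂ (fun ξ : Plane ↦ 2 * Real.pi * Complex.I * (ξ i : ℂ)) σ

lemma mulXi_apply (i : Fin 2) (σ : 𝓢(Plane, ℂ)) (ξ : Plane) :
    mulXi i σ ξ = 2 * Real.pi * Complex.I * (ξ i : ℂ) * σ ξ := by
  have h3 : (fun _ : Plane ↦ (2 * Real.pi * Complex.I : ℂ)).HasTemperateGrowth := by fun_prop
  have h4 : (fun ξ : Plane ↦ 2 * Real.pi * Complex.I * (ξ i : ℂ)).HasTemperateGrowth :=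
    h3.mul (coord_temperate i)
  rw [mulXi, SchwartzMap.smulLeftCLM_apply_apply h4, smul_eq_mul]

lemma lineDeriv_fourier (i : Fin 2) (σ : 𝓢(Plane, ℂ)) :
    LineDeriv.lineDerivOp (e i) (𝓕 σ) = -𝓕 (mulXi i σ) := by
  rw [SchwartzMap.lineDerivOp_fourier_eq, ← FourierTransform.fourier_neg]
  congr 1
  ext ξ
  have h1 : (fun ξ : Plane ↦ inner ℝ ξ (e i)).HasTemperateGrowth := by fun_prop
  have h2 : inner ℝ ξ (e i) = ξ i := by simp [e, EuclideanSpace.inner_single_right]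
  rw [smul_apply, SchwartzMap.smulLeftCLM_apply_apply h1, neg_apply, mulXi_apply, h2]
  simp only [smul_eq_mul, Complex.real_smul]
  ring

lemma laplacian_fourier (σ : 𝓢(Plane, ℂ)) :
    Laplacian.laplacian (𝓕 σ) = ∑ i, 𝓕 (mulXi i (mulXi i σ)) := by
  rw [SchwartzMap.laplacian_eq_sum (EuclideanSpace.basisFun (Fin 2) ℝ)]
  refine Finset.sum_congr rfl fun i _ ↦ ?_
  have h1 : EuclideanSpace.basisFun (Fin 2) ℝ i = e i := by simp [e]
  rw [h1, lineDeriv_fourier, LineDeriv.lineDerivOp_neg, lineDeriv_fourier, neg_neg]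

/-- The distributional divergence, tested with Fourier transforms of Schwartz functions, becomes the
relation ξ · û = 0. -/
lemma div_free_fourier (h : HSp) : ∀ᵐ ξ : Plane, ∑ i, (ξ i : ℂ) * (𝓕 (compLp i h)) ξ = 0 := by
  have h1 (σ : 𝓢(Plane, ℂ)) (i : Fin 2) :
      Integrable fun ξ : Plane ↦ mulXi i σ ξ * (𝓕 (compLp i h)) ξ :=
    integrable_schwartz_mul _ _
  have h2 (σ : 𝓢(Plane, ℂ)) (ξ : Plane) :
      σ ξ * ∑ i, (ξ i : ℂ) * (𝓕 (compLp i h)) ξ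
        = (2 * Real.pi * Complex.I)⁻¹ * ∑ i, mulXi i σ ξ * (𝓕 (compLp i h)) ξ := by
    rw [Finset.mul_sum, Finset.mul_sum]
    refine Finset.sum_congr rfl fun i _ ↦ ?_
    rw [mulXi_apply]
    have : (Real.pi : ℂ) ≠ 0 := by exact_mod_cast Real.pi_ne_zero
    field_simp
  refine ae_eq_zero_of_forall_schwartz (fun σ ↦ ?_) fun σ ↦ ?_
  · simp_rw [h2]
    exact (integrable_finsetSum _ fun i _ ↦ h1 σ i).const_mul _
  · simp_rw [h2]
    rw [integral_const_mul, integral_finsetSum _ fun i _ ↦ h1 σ i]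
    have h3 : (∑ i, LineDeriv.lineDerivOp (e i)
        (Lp.toTemperedDistribution (compLp i h) : 𝓢'(Plane, ℂ))) (𝓕 σ) = 0 := by
      have h4 := congrArg (fun u : 𝓢'(Plane, ℂ) ↦ u (𝓕 σ)) (divergence_toDist h)
      simp only [divergence, LinearMap.sum_apply, LinearMap.comp_apply, LinearMap.proj_apply,
        ContinuousLinearMap.coe_coe, LineDeriv.lineDerivOpCLM_apply] at h4
      exact h4
    have h5 (i : Fin 2) : ∫ ξ, mulXi i σ ξ * (𝓕 (compLp i h)) ξ = (LineDeriv.lineDerivOp (e i)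
        (Lp.toTemperedDistribution (compLp i h) : 𝓢'(Plane, ℂ))) (𝓕 σ) := by
      rw [TemperedDistribution.lineDerivOp_apply_apply, lineDeriv_fourier, neg_neg,
        toTemperedDistribution_fourier]
    simp_rw [h5]
    rw [Fin.sum_univ_two] at h3 ⊢
    rw [add_apply] at h3
    rw [h3, mul_zero]

open scoped FourierTransform ComplexConjugate

/-! ### The equation on the Fourier side -/

/-- The bilinear pairing of a Schwartz function with an `L²` function. -/
def schPair (τ : 𝓢(Plane, ℂ)) (b : LC2) : ℂ := ∫ ξ, τ ξ * b ξ

/-- A test field whose Fourier transform is divergence free. -/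
def curlTest (σ : 𝓢(Plane, ℂ)) : Fin 2 → 𝓢(Plane, ℂ) := ![mulXi 1 σ, -mulXi 0 σ]

lemma div_curlTest (σ : 𝓢(Plane, ℂ)) :
    ∑ i, LineDeriv.lineDerivOp (e i) (𝓕 (curlTest σ i)) = 0 := by
  rw [Fin.sum_univ_two, lineDeriv_fourier, lineDeriv_fourier, ← neg_add, neg_eq_zero,
    ← FourierTransform.fourier_add]
  have : mulXi 0 (curlTest σ 0) + mulXi 1 (curlTest σ 1) = 0 := by
    ext ξ
    simp only [curlTest, Matrix.cons_val_zero, Matrix.cons_val_one, add_apply, mulXi_apply,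
      neg_apply, zero_apply]
    ring
  rw [this, FourierTransform.fourier_zero]

lemma pair_fourier (h : HSp) (η : Fin 2 → 𝓢(Plane, ℂ)) :
    pair (toDist h) (fun k ↦ 𝓕 (η k)) = ∑ k, schPair (η k) (𝓕 (compLp k h)) := by
  refine Finset.sum_congr rfl fun k _ ↦ ?_
  rw [toDist_apply, toTemperedDistribution_fourier, schPair]

lemma pairA_fourier (h : HSp) (η : Fin 2 → 𝓢(Plane, ℂ)) :
    pairA (toDist h) (fun k ↦ 𝓕 (η k))
      = -∑ k, ∑ i, schPair (mulXi i (mulXi i (η k))) (𝓕 (compLp k h)) := by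
  rw [pairA, pair, ← Finset.sum_neg_distrib]
  refine Finset.sum_congr rfl fun k _ ↦ ?_
  rw [neg_apply, TemperedDistribution.laplacian_apply_apply, laplacian_fourier, map_sum,
    toDist_apply]
  simp_rw [toTemperedDistribution_fourier]
  rfl

/-- The minus sign in `pairB` cancels the one from differentiating a Fourier transform. The L⁴
hypothesis ensures that `prodLp` is the genuine product. -/
lemma pairB_fourier (z : HSp) (hz : ∀ k, MemLp (compLp k z) 4 volume) (η : Fin 2 → 𝓢(Plane, ℂ)) :
    pairB z z (fun k ↦ 𝓕 (η k))
      = ∑ k, ∑ i, schPair (mulXi i (η k)) (𝓕 (prodLp (compLp i z) (compLp k z))) := by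
  have h1 (i k : Fin 2) : schPair (mulXi i (η k)) (𝓕 (prodLp (compLp i z) (compLp k z)))
      = ∫ x, 𝓕 (mulXi i (η k)) x * prodLp (compLp i z) (compLp k z) x := by
    rw [schPair, ← toTemperedDistribution_fourier, Lp.toTemperedDistribution_apply]
    rfl
  simp_rw [h1]
  rw [pairB, Finset.sum_comm, ← integral_neg]
  simp_rw [← integral_finsetSum _ fun k _ ↦ integrable_schwartz_mul _ _]
  rw [← integral_finsetSum _ fun i _ ↦
    integrable_finsetSum _ fun k _ ↦ integrable_schwartz_mul _ _]
  refine integral_congr_ae ?_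
  have h2 : ∀ᵐ x, ∀ i k : Fin 2, prodLp (compLp i z) (compLp k z) x
      = compLp i z x * compLp k z x :=
    ae_all_iff.2 fun i ↦ ae_all_iff.2 fun k ↦ prodLp_ae (hz i) (hz k)
  have h3 : ∀ᵐ x, ∀ i : Fin 2, compLp i z x = (((z : L2Field) x i : ℝ) : ℂ) :=
    ae_all_iff.2 fun i ↦ compLp_ae i z
  filter_upwards [h2, h3] with x h2 h3
  rw [← Finset.sum_neg_distrib]
  refine Finset.sum_congr rfl fun i _ ↦ ?_
  rw [← Finset.sum_neg_distrib]
  refine Finset.sum_congr rfl fun k _ ↦ ?_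
  rw [h2, h3, h3, lineDeriv_fourier, neg_apply]
  ring

lemma pair_force_fourier {f : VecDist} {c : Fin 2 → LC2}
    (hc : ∀ k, J (-1) (f k) = Lp.toTemperedDistribution (c k)) (η : Fin 2 → 𝓢(Plane, ℂ)) :
    pair f (fun k ↦ 𝓕 (η k))
      = ∑ k, schPair (SchwartzMap.smulLeftCLM ℂ (symJ 1) (η k)) (𝓕 (c k)) := by
  refine Finset.sum_congr rfl fun k _ ↦ ?_
  rw [← J_J_neg 1 (f k), hc, J_apply_fourier, schPair]

/-- The right hand side of the equation, tested on the Fourier side. -/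
def weakRate (γ α : ℝ) (V Z : Fin 2 → LC2) (β : Fin 2 → Fin 2 → LC2) (c : Fin 2 → LC2)
    (η : Fin 2 → 𝓢(Plane, ℂ)) : ℂ :=
  ∑ k, (∑ i, schPair (mulXi i (mulXi i (η k))) (V k) - γ * schPair (η k) (V k)
    - ∑ i, schPair (mulXi i (η k)) (β i k) + α * schPair (η k) (Z k)
    + schPair (SchwartzMap.smulLeftCLM ℂ (symJ 1) (η k)) (c k))

section Joint

variable {μ : Measure ℝ} {B : ℝ → LC2}

lemma measurable_joint (hB : Measurable B) : Measurable fun p : ℝ × Plane ↦ ev (B p.1) p.2 := by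
  have h1 : Measurable fun p : ℝ × Plane ↦ (B p.1, p.2) := by fun_prop
  exact measurable_ev.comp h1

lemma lintegral_ev_sq (a : LC2) : ∫⁻ ξ, ‖ev a ξ‖ₑ ^ 2 = ‖a‖ₑ ^ 2 := by
  rw [← lintegral_enorm_sq_eq]
  refine lintegral_congr_ae ?_
  filter_upwards [ev_ae a] with x hx
  rw [hx]

lemma memLp_two_of_lintegral {A : Type*} [MeasurableSpace A] {ν : Measure A} {F : A → ℂ}
    (hF : AEStronglyMeasurable F ν) (h : ∫⁻ x, ‖F x‖ₑ ^ 2 ∂ν < ∞) : MemLp F 2 ν := by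
  refine ⟨hF, ?_⟩
  rw [eLpNorm_lt_top_iff_lintegral_rpow_enorm_lt_top (by norm_num) (by norm_num)]
  simpa using h

lemma memLp_joint [SFinite μ] (hB : Measurable B) (h : ∫⁻ s, ‖B s‖ₑ ^ 2 ∂μ < ∞) :
    MemLp (fun p : ℝ × Plane ↦ ev (B p.1) p.2) 2 (μ.prod volume) := by
  have hm := measurable_joint hB
  refine memLp_two_of_lintegral hm.aestronglyMeasurable ?_
  rw [lintegral_prod _ (hm.enorm.pow_const 2).aemeasurable]
  simpa only [lintegral_ev_sq] using h

lemma memLp_schwartz_joint [IsFiniteMeasure μ] (τ : 𝓢(Plane, ℂ)) :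
    MemLp (fun p : ℝ × Plane ↦ τ p.2) 2 (μ.prod volume) :=
  (τ.memLp 2 volume).comp_snd μ

lemma integrable_joint [IsFiniteMeasure μ] (hB : Measurable B) (h : ∫⁻ s, ‖B s‖ₑ ^ 2 ∂μ < ∞)
    (τ : 𝓢(Plane, ℂ)) :
    Integrable (fun p : ℝ × Plane ↦ τ p.2 * ev (B p.1) p.2) (μ.prod volume) :=
  (memLp_schwartz_joint τ).integrable_mul (memLp_joint hB h)

lemma schPair_eq_ev (τ : 𝓢(Plane, ℂ)) (b : LC2) : schPair τ b = ∫ ξ, τ ξ * ev b ξ := by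
  refine integral_congr_ae ?_
  filter_upwards [ev_ae b] with x hx
  rw [hx]

lemma integrable_schwartz_mul_ev (τ : 𝓢(Plane, ℂ)) (b : LC2) :
    Integrable fun ξ ↦ τ ξ * ev b ξ := by
  refine (integrable_schwartz_mul τ b).congr ?_
  filter_upwards [ev_ae b] with x hx
  rw [hx]

lemma integrable_schPair [IsFiniteMeasure μ] (hB : Measurable B) (h : ∫⁻ s, ‖B s‖ₑ ^ 2 ∂μ < ∞)
    (τ : 𝓢(Plane, ℂ)) : Integrable (fun s ↦ schPair τ (B s)) μ := by
  simp_rw [schPair_eq_ev]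
  exact (integrable_joint hB h τ).integral_prod_left

lemma intervalIntegrable_schPair {t : ℝ} (ht : 0 ≤ t) (hB : Measurable B)
    (h : ∫⁻ s in Set.Ioc 0 t, ‖B s‖ₑ ^ 2 < ∞) (τ : 𝓢(Plane, ℂ)) :
    IntervalIntegrable (fun s ↦ schPair τ (B s)) volume 0 t :=
  (intervalIntegrable_iff_integrableOn_Ioc_of_le ht).2 (integrable_schPair hB h τ)

end Joint

/-- The Fourier transforms of the components of a velocity field. -/
def hatL (h : HSp) (k : Fin 2) : LC2 := 𝓕 (compLp k h)

/-- The Fourier transforms of the products of the components of a velocity field. -/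
def hatProd (z : HSp) (i k : Fin 2) : LC2 := 𝓕 (prodLp (compLp i z) (compLp k z))

/-- The quadratic term is rewritten through products only at almost every time, where u + ζ is in
L⁴; the square-integrability hypotheses justify splitting the time integral. -/
theorem weak_equation {γ α : ℝ} {f : VecDist} {ζ u : ℝ≥0 → HSp} (hsol : IsSolution γ α f ζ u)
    {c : Fin 2 → LC2} (hc : ∀ k, J (-1) (f k) = Lp.toTemperedDistribution (c k)) {t : ℝ≥0}
    (hu : ∀ k, Measurable fun s : ℝ ↦ hatL (u s.toNNReal) k)
    (hζ : ∀ k, Measurable fun s : ℝ ↦ hatL (ζ s.toNNReal) k)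
    (hb : ∀ i k, Measurable fun s : ℝ ↦ hatProd (u s.toNNReal + ζ s.toNNReal) i k)
    (hu2 : ∀ k, ∫⁻ s in Set.Ioc 0 (t : ℝ), ‖hatL (u s.toNNReal) k‖ₑ ^ 2 < ∞)
    (hζ2 : ∀ k, ∫⁻ s in Set.Ioc 0 (t : ℝ), ‖hatL (ζ s.toNNReal) k‖ₑ ^ 2 < ∞)
    (hb2 : ∀ i k, ∫⁻ s in Set.Ioc 0 (t : ℝ), ‖hatProd (u s.toNNReal + ζ s.toNNReal) i k‖ₑ ^ 2 < ∞)
    (hz : ∀ᵐ s : ℝ, s ∈ Set.Ioc 0 (t : ℝ) →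
      ∀ k, MemLp (compLp k (u s.toNNReal + ζ s.toNNReal : HSp)) 4 volume)
    (σ : 𝓢(Plane, ℂ)) :
    ∑ k, schPair (curlTest σ k) (hatL (u t) k) = ∫ s in (0 : ℝ)..t,
      weakRate γ α (hatL (u s.toNNReal)) (hatL (ζ s.toNNReal))
        (hatProd (u s.toNNReal + ζ s.toNNReal)) (fun k ↦ 𝓕 (c k)) (curlTest σ) := by
  have ht : (0 : ℝ) ≤ t := t.2
  have heq := hsol.equation t (fun k ↦ 𝓕 (curlTest σ k)) (div_curlTest σ)
  have hu' (k : Fin 2) (τ : 𝓢(Plane, ℂ)) := intervalIntegrable_schPair ht (hu k) (hu2 k) τ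
  have hζ' (k : Fin 2) (τ : 𝓢(Plane, ℂ)) := intervalIntegrable_schPair ht (hζ k) (hζ2 k) τ
  have hb' (i k : Fin 2) (τ : 𝓢(Plane, ℂ)) := intervalIntegrable_schPair ht (hb i k) (hb2 i k) τ
  simp_rw [pair_force_fourier hc, pair_fourier, pairA_fourier] at heq
  have hB : ∀ᵐ s : ℝ, s ∈ Set.uIoc 0 (t : ℝ) →
      -∑ k, ∑ i, schPair (mulXi i (mulXi i (curlTest σ k))) (hatL (u s.toNNReal) k)
        + γ * ∑ k, schPair (curlTest σ k) (hatL (u s.toNNReal) k)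
        + pairB (u s.toNNReal + ζ s.toNNReal) (u s.toNNReal + ζ s.toNNReal)
            (fun k ↦ 𝓕 (curlTest σ k))
      = -∑ k, ∑ i, schPair (mulXi i (mulXi i (curlTest σ k))) (hatL (u s.toNNReal) k)
        + γ * ∑ k, schPair (curlTest σ k) (hatL (u s.toNNReal) k)
        + ∑ k, ∑ i, schPair (mulXi i (curlTest σ k))
            (hatProd (u s.toNNReal + ζ s.toNNReal) i k) := by
    filter_upwards [hz] with s hs hst
    rw [Set.uIoc_of_le ht] at hst
    rw [pairB_fourier _ (hs hst)]
    rfl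
  have hB' := intervalIntegral.integral_congr_ae hB
  have hfin {F : Fin 2 → ℝ → ℂ} (hF : ∀ k, IntervalIntegrable (F k) volume 0 t) :
      IntervalIntegrable (fun s ↦ ∑ k, F k s) volume 0 t := by
    have := IntervalIntegrable.sum Finset.univ fun k _ ↦ hF k
    exact this.congr fun s _ ↦ Finset.sum_apply _ _ _
  have hL : IntervalIntegrable (fun s : ℝ ↦
      -∑ k, ∑ i, schPair (mulXi i (mulXi i (curlTest σ k))) (hatL (u s.toNNReal) k)
        + γ * ∑ k, schPair (curlTest σ k) (hatL (u s.toNNReal) k)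
        + ∑ k, ∑ i, schPair (mulXi i (curlTest σ k))
            (hatProd (u s.toNNReal + ζ s.toNNReal) i k)) volume 0 t := ((hfin fun k ↦ hfin fun i ↦ hu' k (mulXi i (mulXi i (curlTest σ k)))).neg.add
    ((hfin fun k ↦ hu' k (curlTest σ k)).const_mul (γ : ℂ))).add
      (hfin fun k ↦ hfin fun i ↦ hb' i k (mulXi i (curlTest σ k)))
  have hR := ((hfin fun k ↦ hζ' k (curlTest σ k)).const_mul (α : ℂ)).add
    (intervalIntegrable_const (μ := volume) (a := (0 : ℝ)) (b := t)
      (c := ∑ k, schPair (SchwartzMap.smulLeftCLM ℂ (symJ 1) (curlTest σ k)) (𝓕 (c k))))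
  have h1 : ∑ k, schPair (curlTest σ k) (hatL (u t) k)
      = (∫ s in (0 : ℝ)..t, (α * ∑ k, schPair (curlTest σ k) (hatL (ζ s.toNNReal) k)
          + ∑ k, schPair (SchwartzMap.smulLeftCLM ℂ (symJ 1) (curlTest σ k)) (𝓕 (c k))))
        - ∫ s in (0 : ℝ)..t,
          (-∑ k, ∑ i, schPair (mulXi i (mulXi i (curlTest σ k))) (hatL (u s.toNNReal) k)
          + γ * ∑ k, schPair (curlTest σ k) (hatL (u s.toNNReal) k)
          + ∑ k, ∑ i, schPair (mulXi i (curlTest σ k))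
            (hatProd (u s.toNNReal + ζ s.toNNReal) i k)) := by
    rw [← hB', eq_sub_iff_add_eq]
    exact heq
  rw [h1, ← intervalIntegral.integral_sub hR hL]
  refine intervalIntegral.integral_congr fun s _ ↦ ?_
  simp only [weakRate, Fin.sum_univ_two]
  ring

open scoped FourierTransform ComplexConjugate

/-! ### The energy identity on the Fourier side -/

/-- The right hand side of the equation for the `k`-th component, at the frequency `ξ`. -/
def rateH (γ α : ℝ) (V Z : Fin 2 → LC2) (β : Fin 2 → Fin 2 → LC2) (c : Fin 2 → LC2) (k : Fin 2)
    (ξ : Plane) : ℂ :=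
  -((lam ξ : ℂ) + γ) * ev (V k) ξ - ∑ i, 2 * Real.pi * Complex.I * (ξ i : ℂ) * ev (β i k) ξ
    + α * ev (Z k) ξ + symJ 1 ξ * ev (c k) ξ

/-- The right hand side of the vorticity equation, at the frequency `ξ`. -/
def rateCurl (γ α : ℝ) (V Z : Fin 2 → LC2) (β : Fin 2 → Fin 2 → LC2) (c : Fin 2 → LC2)
    (ξ : Plane) : ℂ :=
  2 * Real.pi * Complex.I * ((ξ 1 : ℂ) * rateH γ α V Z β c 0 ξ - (ξ 0 : ℂ) * rateH γ α V Z β c 1 ξ)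

/-- The integrand of `weakRate`. -/
def weakRateFun (γ α : ℝ) (V Z : Fin 2 → LC2) (β : Fin 2 → Fin 2 → LC2) (c : Fin 2 → LC2)
    (η : Fin 2 → 𝓢(Plane, ℂ)) (ξ : Plane) : ℂ :=
  ∑ k, (∑ i, mulXi i (mulXi i (η k)) ξ * ev (V k) ξ - γ * (η k ξ * ev (V k) ξ)
    - ∑ i, mulXi i (η k) ξ * ev (β i k) ξ + α * (η k ξ * ev (Z k) ξ)
    + SchwartzMap.smulLeftCLM ℂ (symJ 1) (η k) ξ * ev (c k) ξ)

lemma weakRate_eq_integral (γ α : ℝ) (V Z : Fin 2 → LC2) (β : Fin 2 → Fin 2 → LC2)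
    (c : Fin 2 → LC2) (η : Fin 2 → 𝓢(Plane, ℂ)) :
    weakRate γ α V Z β c η = ∫ ξ, weakRateFun γ α V Z β c η ξ := by
  have h (τ : 𝓢(Plane, ℂ)) (b : LC2) := integrable_schwartz_mul_ev τ b
  have hs (k : Fin 2) := integrable_finsetSum Finset.univ fun i (_ : i ∈ Finset.univ) ↦
    h (mulXi i (mulXi i (η k))) (V k)
  have hs' (k : Fin 2) := integrable_finsetSum Finset.univ fun i (_ : i ∈ Finset.univ) ↦
    h (mulXi i (η k)) (β i k)
  have hsub {F F' : Plane → ℂ} (hF : Integrable F) (hF' : Integrable F') :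
      Integrable fun ξ ↦ F ξ - F' ξ := hF.sub hF'
  have hadd {F F' : Plane → ℂ} (hF : Integrable F) (hF' : Integrable F') :
      Integrable fun ξ ↦ F ξ + F' ξ := hF.add hF'
  have h1 (k : Fin 2) := hsub (hs k) ((h (η k) (V k)).const_mul (γ : ℂ))
  have h2 (k : Fin 2) := hsub (h1 k) (hs' k)
  have h3 (k : Fin 2) := hadd (h2 k) ((h (η k) (Z k)).const_mul (α : ℂ))
  have h4 (k : Fin 2) := hadd (h3 k) (h (SchwartzMap.smulLeftCLM ℂ (symJ 1) (η k)) (c k))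
  unfold weakRate weakRateFun
  rw [integral_finsetSum _ fun k _ ↦ h4 k]
  refine Finset.sum_congr rfl fun k _ ↦ ?_
  simp_rw [schPair_eq_ev]
  rw [← integral_finsetSum _ fun i _ ↦ h (mulXi i (mulXi i (η k))) (V k),
    ← integral_finsetSum _ fun i _ ↦ h (mulXi i (η k)) (β i k), ← integral_const_mul,
    ← integral_const_mul, ← integral_sub (hs k) ((h (η k) (V k)).const_mul (γ : ℂ)),
    ← integral_sub (h1 k) (hs' k), ← integral_add (h2 k) ((h (η k) (Z k)).const_mul (α : ℂ)),
    ← integral_add (h3 k) (h (SchwartzMap.smulLeftCLM ℂ (symJ 1) (η k)) (c k))]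

/-- The curl test field factors out σ, so that the equation can be localised in frequency;
multiplying twice by 2πiξᵢ and summing gives -`lam ξ`. -/
lemma weakRateFun_curlTest (γ α : ℝ) (V Z : Fin 2 → LC2) (β : Fin 2 → Fin 2 → LC2)
    (c : Fin 2 → LC2) (σ : 𝓢(Plane, ℂ)) (ξ : Plane) :
    weakRateFun γ α V Z β c (curlTest σ) ξ = σ ξ * rateCurl γ α V Z β c ξ := by
  have hl : (lam ξ : ℂ) = ∑ i, (2 * Real.pi * (ξ i : ℂ)) ^ 2 := by
    rw [lam_eq_sum]; push_cast; rfl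
  simp only [weakRateFun, rateCurl, rateH, hl, Fin.sum_univ_two, curlTest, Matrix.cons_val_zero,
    Matrix.cons_val_one, mulXi_apply, neg_apply,
    SchwartzMap.smulLeftCLM_apply_apply (symJ_temperate 1), smul_eq_mul]
  have hI : Complex.I ^ 3 = -Complex.I := by rw [pow_succ, Complex.I_sq]; ring
  ring_nf
  simp only [hI, Complex.I_sq]
  ring

lemma cx_primitive_sq {L : ℝ → ℂ} {T : ℝ} (hT : 0 ≤ T) (hL : IntervalIntegrable L volume 0 T) :
    ‖∫ s in (0 : ℝ)..T, L s‖ ^ 2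
      = ∫ t in (0 : ℝ)..T, 2 * (conj (∫ s in (0 : ℝ)..t, L s) * L t).re := by
  have hre : IntervalIntegrable (fun s ↦ (L s).re) volume 0 T :=
    ⟨hL.1.re, hL.2.re⟩
  have him : IntervalIntegrable (fun s ↦ (L s).im) volume 0 T :=
    ⟨hL.1.im, hL.2.im⟩
  have hsub {t : ℝ} (ht : t ∈ Set.Icc 0 T) : IntervalIntegrable L volume 0 t :=
    hL.mono_set (by rw [Set.uIcc_of_le ht.1, Set.uIcc_of_le hT]; exact Set.Icc_subset_Icc_right ht.2)
  have h1 {t : ℝ} (ht : t ∈ Set.Icc 0 T) :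
      (∫ s in (0 : ℝ)..t, L s).re = ∫ s in (0 : ℝ)..t, (L s).re := by
    have := Complex.reCLM.intervalIntegral_comp_comm (hsub ht)
    exact this.symm
  have h2 {t : ℝ} (ht : t ∈ Set.Icc 0 T) :
      (∫ s in (0 : ℝ)..t, L s).im = ∫ s in (0 : ℝ)..t, (L s).im := by
    have := Complex.imCLM.intervalIntegral_comp_comm (hsub ht)
    exact this.symm
  have hc1 : IntervalIntegrable (fun t ↦ 2 * (∫ s in (0 : ℝ)..t, (L s).re) * (L t).re) volume 0 T :=
    hre.continuousOn_mul (continuousOn_const.mul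
      (intervalIntegral.continuousOn_primitive_interval' hre Set.left_mem_uIcc))
  have hc2 : IntervalIntegrable (fun t ↦ 2 * (∫ s in (0 : ℝ)..t, (L s).im) * (L t).im) volume 0 T :=
    him.continuousOn_mul (continuousOn_const.mul
      (intervalIntegral.continuousOn_primitive_interval' him Set.left_mem_uIcc))
  rw [Complex.sq_norm, Complex.normSq_apply, h1 ⟨hT, le_rfl⟩, h2 ⟨hT, le_rfl⟩, ← sq, ← sq,
    primitive_sq hT hre, primitive_sq hT him, ← intervalIntegral.integral_add hc1 hc2]
  refine intervalIntegral.integral_congr fun t ht ↦ ?_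
  rw [Set.uIcc_of_le hT] at ht
  simp only [Complex.mul_re, Complex.conj_re, Complex.conj_im, h1 ht, h2 ht]
  ring

section Energy

variable {γ α T : ℝ} {V Z : Fin 2 → ℝ → LC2} {β : Fin 2 → Fin 2 → ℝ → LC2} {c : Fin 2 → LC2}

/-- The integrability hypotheses of the energy identity on the Fourier side. -/
structure SpectralData (T : ℝ) (V Z : Fin 2 → ℝ → LC2) (β : Fin 2 → Fin 2 → ℝ → LC2) : Prop where
  measV : ∀ k, Measurable (V k)
  measZ : ∀ k, Measurable (Z k)
  measβ : ∀ i k, Measurable (β i k)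
  sqV : ∀ k, ∫⁻ s in Set.Ioc 0 T, ‖V k s‖ₑ ^ 2 < ∞
  sqZ : ∀ k, ∫⁻ s in Set.Ioc 0 T, ‖Z k s‖ₑ ^ 2 < ∞
  sqβ : ∀ i k, ∫⁻ s in Set.Ioc 0 T, ‖β i k s‖ₑ ^ 2 < ∞

lemma SpectralData.mono (h : SpectralData T V Z β) {t : ℝ} (ht : t ≤ T) :
    SpectralData t V Z β where
  measV := h.measV
  measZ := h.measZ
  measβ := h.measβ
  sqV k := (lintegral_mono_set (Set.Ioc_subset_Ioc_right ht)).trans_lt (h.sqV k)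
  sqZ k := (lintegral_mono_set (Set.Ioc_subset_Ioc_right ht)).trans_lt (h.sqZ k)
  sqβ i k := (lintegral_mono_set (Set.Ioc_subset_Ioc_right ht)).trans_lt (h.sqβ i k)

lemma SpectralData.integrable_weakRateFun (h : SpectralData T V Z β) (γ α : ℝ) (c : Fin 2 → LC2)
    (η : Fin 2 → 𝓢(Plane, ℂ)) :
    Integrable (fun p : ℝ × Plane ↦ weakRateFun γ α (fun k ↦ V k p.1) (fun k ↦ Z k p.1)
      (fun i k ↦ β i k p.1) c η p.2) ((volume.restrict (Set.Ioc 0 T)).prod volume) := by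
  unfold weakRateFun
  have hc (k : Fin 2) : ∫⁻ _s in Set.Ioc 0 T, ‖c k‖ₑ ^ 2 < ∞ := by
    rw [lintegral_const]; finiteness
  refine integrable_finsetSum _ fun k _ ↦ ?_
  refine Integrable.add (Integrable.add (Integrable.sub (Integrable.sub ?_ ?_) ?_) ?_) ?_
  · exact integrable_finsetSum _ fun i _ ↦ integrable_joint (h.measV k) (h.sqV k) _
  · exact (integrable_joint (h.measV k) (h.sqV k) _).const_mul _
  · exact integrable_finsetSum _ fun i _ ↦ integrable_joint (h.measβ i k) (h.sqβ i k) _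
  · exact (integrable_joint (h.measZ k) (h.sqZ k) _).const_mul _
  · exact integrable_joint (B := fun _ ↦ c k) measurable_const (hc k) _

lemma SpectralData.measurable_rateCurl (h : SpectralData T V Z β) (γ α : ℝ) (c : Fin 2 → LC2) :
    Measurable fun p : ℝ × Plane ↦ rateCurl γ α (fun k ↦ V k p.1) (fun k ↦ Z k p.1)
      (fun i k ↦ β i k p.1) c p.2 := by
  have h1 (k : Fin 2) := measurable_joint (h.measV k)
  have h2 (k : Fin 2) := measurable_joint (h.measZ k)
  have h3 (i k : Fin 2) := measurable_joint (h.measβ i k)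
  have h4 (k : Fin 2) : Measurable fun p : ℝ × Plane ↦ ev (c k) p.2 :=
    (measurable_ev_right (c k)).comp measurable_snd
  have h5 : Measurable fun p : ℝ × Plane ↦ (lam p.2 : ℂ) :=
    (Complex.continuous_ofReal.comp (continuous_lam.comp continuous_snd)).measurable
  have h6 : Measurable fun p : ℝ × Plane ↦ symJ 1 p.2 :=
    ((symJ_temperate 1).1.continuous.comp continuous_snd).measurable
  have h7 (i : Fin 2) : Measurable fun p : ℝ × Plane ↦ (p.2 i : ℂ) :=
    ((coord_temperate i).1.continuous.comp continuous_snd).measurable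
  unfold rateCurl rateH
  simp only [Fin.sum_univ_two]
  fun_prop

/-- The vorticity at a fixed time is the primitive of its rate, at almost every frequency. -/
lemma SpectralData.curl_eq_primitive (h : SpectralData T V Z β) (hT : 0 ≤ T)
    (heq : ∀ σ : 𝓢(Plane, ℂ), ∑ k, schPair (curlTest σ k) (V k T) = ∫ s in (0 : ℝ)..T,
      weakRate γ α (fun k ↦ V k s) (fun k ↦ Z k s) (fun i k ↦ β i k s) c (curlTest σ)) :
    ∀ᵐ ξ : Plane, 2 * Real.pi * Complex.I * ((ξ 1 : ℂ) * ev (V 0 T) ξ - (ξ 0 : ℂ) * ev (V 1 T) ξ)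
      = ∫ s in (0 : ℝ)..T,
        rateCurl γ α (fun k ↦ V k s) (fun k ↦ Z k s) (fun i k ↦ β i k s) c ξ := by
  have hint (σ : 𝓢(Plane, ℂ)) := h.integrable_weakRateFun γ α c (curlTest σ)
  simp_rw [weakRateFun_curlTest] at hint
  have h1 (σ : 𝓢(Plane, ℂ)) (ξ : Plane) : σ ξ *
      (2 * Real.pi * Complex.I * ((ξ 1 : ℂ) * ev (V 0 T) ξ - (ξ 0 : ℂ) * ev (V 1 T) ξ)
        - ∫ s in (0 : ℝ)..T,
          rateCurl γ α (fun k ↦ V k s) (fun k ↦ Z k s) (fun i k ↦ β i k s) c ξ)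
      = ∑ k, curlTest σ k ξ * ev (V k T) ξ - ∫ s in Set.Ioc 0 T,
        σ ξ * rateCurl γ α (fun k ↦ V k s) (fun k ↦ Z k s) (fun i k ↦ β i k s) c ξ := by
    rw [integral_const_mul, intervalIntegral.integral_of_le hT, mul_sub]
    simp only [Fin.sum_univ_two, curlTest, Matrix.cons_val_zero, Matrix.cons_val_one, mulXi_apply,
      neg_apply]
    ring
  have hi1 (σ : 𝓢(Plane, ℂ)) : Integrable fun ξ ↦ ∑ k, curlTest σ k ξ * ev (V k T) ξ :=
    integrable_finsetSum _ fun k _ ↦ integrable_schwartz_mul_ev _ _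
  have hi2 (σ : 𝓢(Plane, ℂ)) := (hint σ).integral_prod_right
  have h2 : ∀ᵐ ξ : Plane,
      2 * Real.pi * Complex.I * ((ξ 1 : ℂ) * ev (V 0 T) ξ - (ξ 0 : ℂ) * ev (V 1 T) ξ)
        - ∫ s in (0 : ℝ)..T,
          rateCurl γ α (fun k ↦ V k s) (fun k ↦ Z k s) (fun i k ↦ β i k s) c ξ = 0 := by
    refine ae_eq_zero_of_forall_schwartz (fun σ ↦ ?_) fun σ ↦ ?_
    · simp_rw [h1]
      exact (hi1 σ).sub (hi2 σ)
    · simp_rw [h1]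
      rw [integral_sub (hi1 σ) (hi2 σ),
        integral_finsetSum _ fun k _ ↦ integrable_schwartz_mul_ev _ _]
      simp_rw [← schPair_eq_ev, heq σ, weakRate_eq_integral, weakRateFun_curlTest]
      rw [intervalIntegral.integral_of_le hT, sub_eq_zero]
      exact integral_integral_swap (hint σ)
  filter_upwards [h2] with ξ hξ
  exact sub_eq_zero.1 hξ

end Energy

open scoped FourierTransform ComplexConjugate

/-- The energy density at the frequency `ξ`, in terms of `J u` and `∇u`. -/
def energyDensity (γ α : ℝ) (V Z : Fin 2 → LC2) (β : Fin 2 → Fin 2 → LC2) (c : Fin 2 → LC2)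
    (ξ : Plane) : ℂ :=
  ∑ k, (-(conj (symJ 1 ξ * ev (V k) ξ) * (symJ 1 ξ * ev (V k) ξ))
    + (1 - γ) * (conj (ev (V k) ξ) * ev (V k) ξ)
    + ∑ i, conj (symD i ξ * (symJ 1 ξ * ev (V k) ξ)) * ev (β i k) ξ
    + α * (conj (ev (V k) ξ) * ev (Z k) ξ)
    + conj (symJ 1 ξ * ev (V k) ξ) * ev (c k) ξ)

lemma conj_symJ (s : ℝ) (ξ : Plane) : conj (symJ s ξ) = symJ s ξ := Complex.conj_ofReal _

lemma symJ_one_mul_self (ξ : Plane) : symJ 1 ξ * symJ 1 ξ = 1 + (lam ξ : ℂ) := by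
  have h := lam_nonneg ξ
  rw [symJ, ← Complex.ofReal_mul, ← Real.rpow_add (by positivity)]
  norm_num

lemma symJ_neg_one_mul (ξ : Plane) : symJ (-1) ξ * symJ 1 ξ = 1 := congrFun (symJ_mul_neg 1) ξ

lemma symD_mul_symJ (i : Fin 2) (ξ : Plane) :
    symD i ξ * symJ 1 ξ = 2 * Real.pi * Complex.I * (ξ i : ℂ) := by
  rw [symD, mul_assoc, symJ_neg_one_mul, mul_one]

/-- The right side is the natural density û̄ · ∂ₜû; the left side redistributes the powers of |ξ| so
that every factor is square integrable when u is in H¹. -/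
lemma energyDensity_eq (γ α : ℝ) (V Z : Fin 2 → LC2) (β : Fin 2 → Fin 2 → LC2) (c : Fin 2 → LC2)
    (ξ : Plane) :
    energyDensity γ α V Z β c ξ = ∑ k, conj (ev (V k) ξ) * rateH γ α V Z β c k ξ := by
  unfold energyDensity rateH
  refine Finset.sum_congr rfl fun k _ ↦ ?_
  have h1 (i : Fin 2) : conj (symD i ξ * (symJ 1 ξ * ev (V k) ξ))
      = -(2 * Real.pi * Complex.I * (ξ i : ℂ)) * conj (ev (V k) ξ) := by
    rw [← mul_assoc, symD_mul_symJ, map_mul]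
    simp [Complex.conj_ofReal, Complex.conj_ofNat]
  simp only [h1, map_mul, conj_symJ, Fin.sum_univ_two]
  linear_combination (-(conj (ev (V k) ξ)) * ev (V k) ξ) * symJ_one_mul_self ξ

/-- Lagrange's identity in the plane: the product of the components along ξ^⊥ equals |ξ|² times the
scalar product, up to a term containing ξ · V = 0. No divergence condition on the rate is needed. -/
lemma conj_curl_mul_rateCurl (γ α : ℝ) (V Z : Fin 2 → LC2) (β : Fin 2 → Fin 2 → LC2)
    (c : Fin 2 → LC2) {ξ : Plane} (hdiv : ∑ i, (ξ i : ℂ) * ev (V i) ξ = 0) :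
    conj (2 * Real.pi * Complex.I * ((ξ 1 : ℂ) * ev (V 0) ξ - (ξ 0 : ℂ) * ev (V 1) ξ))
      * rateCurl γ α V Z β c ξ = (lam ξ : ℂ) * energyDensity γ α V Z β c ξ := by
  have hl : (lam ξ : ℂ) = ∑ i, (2 * Real.pi * (ξ i : ℂ)) ^ 2 := by
    rw [lam_eq_sum]; push_cast; rfl
  have hd := congrArg conj hdiv
  rw [energyDensity_eq, rateCurl, hl]
  simp only [Fin.sum_univ_two, map_mul, map_sub, map_add, map_zero, Complex.conj_ofReal,
    Complex.conj_I, Complex.conj_ofNat] at hd ⊢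
  linear_combination (-(2 * Real.pi) ^ 2 * ((ξ 0 : ℂ) * rateH γ α V Z β c 0 ξ
    + (ξ 1 : ℂ) * rateH γ α V Z β c 1 ξ)) * hd
    - ((2 * Real.pi) ^ 2 * ((ξ 1 : ℂ) * conj (ev (V 0) ξ) - (ξ 0 : ℂ) * conj (ev (V 1) ξ))
      * ((ξ 1 : ℂ) * rateH γ α V Z β c 0 ξ - (ξ 0 : ℂ) * rateH γ α V Z β c 1 ξ)) * Complex.I_sq

lemma norm_curl_sq {V : Fin 2 → ℂ} {ξ : Plane} (hdiv : ∑ i, (ξ i : ℂ) * V i = 0) :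
    ‖2 * Real.pi * Complex.I * ((ξ 1 : ℂ) * V 0 - (ξ 0 : ℂ) * V 1)‖ ^ 2
      = lam ξ * ∑ k, ‖V k‖ ^ 2 := by
  have hd := congrArg conj hdiv
  have h : (((‖2 * Real.pi * Complex.I * ((ξ 1 : ℂ) * V 0 - (ξ 0 : ℂ) * V 1)‖ ^ 2 : ℝ)) : ℂ)
      = ((lam ξ * ∑ k, ‖V k‖ ^ 2 : ℝ) : ℂ) := by
    rw [lam_eq_sum]
    push_cast
    simp_rw [← Complex.conj_mul']
    simp only [Fin.sum_univ_two, map_mul, map_sub, map_add, map_zero, Complex.conj_ofReal,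
      Complex.conj_I, Complex.conj_ofNat] at hd hdiv ⊢
    linear_combination (-(2 * Real.pi) ^ 2 * ((ξ 0 : ℂ) * V 0 + (ξ 1 : ℂ) * V 1)) * hd
    - ((2 * Real.pi) ^ 2 * ((ξ 1 : ℂ) * conj (V 0) - (ξ 0 : ℂ) * conj (V 1))
      * ((ξ 1 : ℂ) * V 0 - (ξ 0 : ℂ) * V 1)) * Complex.I_sq
  exact_mod_cast h

section Energy

variable {γ α T : ℝ} {V Z : Fin 2 → ℝ → LC2} {β : Fin 2 → Fin 2 → ℝ → LC2} {c : Fin 2 → LC2}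

/-- Every term is a product of two functions in L²((0,T) × ℝ²); the gradient terms use |`symD`| ≤ 1.
-/
lemma SpectralData.integrable_energyDensity (h : SpectralData T V Z β)
    (hA : ∀ k, ∫⁻ s in Set.Ioc 0 T, ∫⁻ ξ, ‖symJ 1 ξ * ev (V k s) ξ‖ₑ ^ 2 < ∞) :
    Integrable (fun p : ℝ × Plane ↦ energyDensity γ α (fun k ↦ V k p.1) (fun k ↦ Z k p.1)
      (fun i k ↦ β i k p.1) c p.2) ((volume.restrict (Set.Ioc 0 T)).prod volume) := by
  have hc (k : Fin 2) : ∫⁻ _s in Set.Ioc 0 T, ‖c k‖ₑ ^ 2 < ∞ := by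
    rw [lintegral_const]; finiteness
  have hc2 (k : Fin 2) : MemLp (fun p : ℝ × Plane ↦ ev (c k) p.2) 2
      ((volume.restrict (Set.Ioc 0 T)).prod volume) :=
    memLp_joint (B := fun _ ↦ c k) measurable_const (hc k)
  have hV2 (k : Fin 2) := memLp_joint (h.measV k) (h.sqV k)
  have hA2 (k : Fin 2) : MemLp (fun p : ℝ × Plane ↦ symJ 1 p.2 * ev (V k p.1) p.2) 2
      ((volume.restrict (Set.Ioc 0 T)).prod volume) := by
    have h6 : Measurable fun p : ℝ × Plane ↦ symJ 1 p.2 :=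
      ((symJ_temperate 1).1.continuous.comp continuous_snd).measurable
    have h7 : Measurable fun p : ℝ × Plane ↦ symJ 1 p.2 * ev (V k p.1) p.2 :=
      h6.mul (measurable_joint (h.measV k))
    refine memLp_two_of_lintegral h7.aestronglyMeasurable ?_
    rw [lintegral_prod _ (h7.enorm.pow_const 2).aemeasurable]
    exact hA k
  have hD2 (i k : Fin 2) : MemLp (fun p : ℝ × Plane ↦
      symD i p.2 * (symJ 1 p.2 * ev (V k p.1) p.2)) 2
      ((volume.restrict (Set.Ioc 0 T)).prod volume) := by
    have h6 : Measurable fun p : ℝ × Plane ↦ symD i p.2 :=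
      ((symD_temperate i).1.continuous.comp continuous_snd).measurable
    refine (hA2 k).of_le (h6.aestronglyMeasurable.mul (hA2 k).1) (Eventually.of_forall fun p ↦ ?_)
    rw [norm_mul]
    exact mul_le_of_le_one_left (norm_nonneg _) (norm_symD_le i p.2)
  have hmul {F F' : ℝ × Plane → ℂ}
      (hF : MemLp F 2 ((volume.restrict (Set.Ioc 0 T)).prod volume))
      (hF' : MemLp F' 2 ((volume.restrict (Set.Ioc 0 T)).prod volume)) :
      Integrable (fun p ↦ conj (F p) * F' p) ((volume.restrict (Set.Ioc 0 T)).prod volume) :=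
    MemLp.integrable_mul hF.star hF'
  unfold energyDensity
  refine integrable_finsetSum _ fun k _ ↦ ?_
  refine Integrable.add (Integrable.add (Integrable.add (Integrable.add ?_ ?_) ?_) ?_) ?_
  · exact (hmul (hA2 k) (hA2 k)).neg
  · exact (hmul (hV2 k) (hV2 k)).const_mul _
  · exact integrable_finsetSum _ fun i _ ↦ hmul (hD2 i k) (memLp_joint (h.measβ i k) (h.sqβ i k))
  · exact (hmul (hV2 k) (memLp_joint (h.measZ k) (h.sqZ k))).const_mul _
  · exact hmul (hA2 k) (hc2 k)

/-- At almost every frequency the vorticity is, for almost all times, the primitive of its rate. -/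
lemma SpectralData.ae_curl_eq_primitive (h : SpectralData T V Z β)
    (heq : ∀ t ∈ Set.Icc 0 T, ∀ σ : 𝓢(Plane, ℂ), ∑ k, schPair (curlTest σ k) (V k t)
      = ∫ s in (0 : ℝ)..t,
        weakRate γ α (fun k ↦ V k s) (fun k ↦ Z k s) (fun i k ↦ β i k s) c (curlTest σ)) :
    ∀ᵐ ξ : Plane, ∀ᵐ t ∂(volume.restrict (Set.Ioc 0 T)),
      2 * Real.pi * Complex.I * ((ξ 1 : ℂ) * ev (V 0 t) ξ - (ξ 0 : ℂ) * ev (V 1 t) ξ)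
      = ∫ s in (0 : ℝ)..t,
        rateCurl γ α (fun k ↦ V k s) (fun k ↦ Z k s) (fun i k ↦ β i k s) c ξ := by
  let L (p : ℝ × Plane) : ℂ := rateCurl γ α (fun k ↦ V k p.1) (fun k ↦ Z k p.1)
    (fun i k ↦ β i k p.1) c p.2
  have hL : Measurable L := h.measurable_rateCurl γ α c
  let y (p : ℝ × Plane) : ℂ :=
    2 * Real.pi * Complex.I * ((p.2 1 : ℂ) * ev (V 0 p.1) p.2 - (p.2 0 : ℂ) * ev (V 1 p.1) p.2)
  have h7 (i : Fin 2) : Measurable fun p : ℝ × Plane ↦ (p.2 i : ℂ) :=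
    ((coord_temperate i).1.continuous.comp continuous_snd).measurable
  have hy : Measurable y := by
    have h1 := measurable_joint (h.measV 0)
    have h2 := measurable_joint (h.measV 1)
    have h3 := h7 0
    have h4 := h7 1
    fun_prop
  -- The primitive is written over the fixed interval with a cutoff, which makes it jointly
  -- measurable in time and frequency.
  let Y (p : ℝ × Plane) : ℂ := ∫ r in Set.Ioc 0 T, if r ≤ p.1 then L (r, p.2) else 0
  have hY : Measurable Y := by
    have h1 : Measurable fun q : (ℝ × Plane) × ℝ ↦ if q.2 ≤ q.1.1 then L (q.2, q.1.2) else 0 := by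
      have h2 : Measurable fun q : (ℝ × Plane) × ℝ ↦ (q.2, q.1.2) := by fun_prop
      exact Measurable.ite (measurableSet_le (by fun_prop) (by fun_prop)) (hL.comp h2)
        measurable_const
    exact (h1.stronglyMeasurable.integral_prod_right').measurable
  have hYeq {t : ℝ} (ht : t ∈ Set.Ioc 0 T) (ξ : Plane) : Y (t, ξ) = ∫ s in (0 : ℝ)..t, L (s, ξ) := by
    have h1 : ∀ r, (if r ≤ t then L (r, ξ) else 0) = (Set.Iic t).indicator (fun r ↦ L (r, ξ)) r :=
      fun r ↦ by simp [Set.indicator_apply]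
    simp only [Y, h1]
    rw [setIntegral_indicator measurableSet_Iic, intervalIntegral.integral_of_le ht.1.le,
      Set.Ioc_inter_Iic, inf_eq_right.2 ht.2]
  have h1 : ∀ᵐ t ∂(volume.restrict (Set.Ioc 0 T)), ∀ᵐ ξ : Plane, y (t, ξ) = Y (t, ξ) := by
    refine (ae_restrict_iff' measurableSet_Ioc).2 (Eventually.of_forall fun t ht ↦ ?_)
    have h2 := (h.mono ht.2).curl_eq_primitive ht.1.le (heq t ⟨ht.1.le, ht.2⟩)
    filter_upwards [h2] with ξ hξ
    rw [hYeq ht]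
    exact hξ
  -- For each t the exceptional set of frequencies may depend on t; Fubini's theorem exchanges the
  -- two quantifiers.
  have h2 := (Measure.ae_ae_comm (p := fun (t : ℝ) (ξ : Plane) ↦ y (t, ξ) = Y (t, ξ))
    (measurableSet_eq_fun hy hY)).1 h1
  filter_upwards [h2] with ξ hξ
  filter_upwards [hξ, ae_restrict_mem measurableSet_Ioc] with t ht htm
  rw [hYeq htm] at ht
  exact ht

/-- **The energy identity.** -/
theorem SpectralData.energy_identity (h : SpectralData T V Z β) (hT : 0 ≤ T)
    (hA : ∀ k, ∫⁻ s in Set.Ioc 0 T, ∫⁻ ξ, ‖symJ 1 ξ * ev (V k s) ξ‖ₑ ^ 2 < ∞)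
    (hdiv : ∀ s, ∀ᵐ ξ : Plane, ∑ i, (ξ i : ℂ) * V i s ξ = 0)
    (heq : ∀ t ∈ Set.Icc 0 T, ∀ σ : 𝓢(Plane, ℂ), ∑ k, schPair (curlTest σ k) (V k t)
      = ∫ s in (0 : ℝ)..t,
        weakRate γ α (fun k ↦ V k s) (fun k ↦ Z k s) (fun i k ↦ β i k s) c (curlTest σ)) :
    ∑ k, ‖V k T‖ ^ 2 = ∫ s in (0 : ℝ)..T, ∫ ξ, 2 * (energyDensity γ α (fun k ↦ V k s)
      (fun k ↦ Z k s) (fun i k ↦ β i k s) c ξ).re := by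
  have hE := h.integrable_energyDensity (γ := γ) (α := α) (c := c) hA
  have hE' : Integrable (fun p : ℝ × Plane ↦ 2 * (energyDensity γ α (fun k ↦ V k p.1)
      (fun k ↦ Z k p.1) (fun i k ↦ β i k p.1) c p.2).re)
      ((volume.restrict (Set.Ioc 0 T)).prod volume) := hE.re.const_mul 2
  have hev (s : ℝ) : ∀ᵐ ξ : Plane, ∑ i, (ξ i : ℂ) * ev (V i s) ξ = 0 := by
    filter_upwards [hdiv s, ev_ae (V 0 s), ev_ae (V 1 s)] with ξ h1 h2 h3
    rw [Fin.sum_univ_two] at h1 ⊢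
    rw [h2, h3, h1]
  have hev' : ∀ᵐ ξ : Plane, ∀ᵐ s ∂(volume.restrict (Set.Ioc 0 T)),
      ∑ i, (ξ i : ℂ) * ev (V i s) ξ = 0 := by
    refine (Measure.ae_ae_comm (p := fun (s : ℝ) (ξ : Plane) ↦ ∑ i, (ξ i : ℂ) * ev (V i s) ξ = 0)
      ?_).1 (Eventually.of_forall hev)
    refine measurableSet_eq_fun (Finset.measurable_fun_sum _ fun i _ ↦ ?_) measurable_const
    exact (((coord_temperate i).1.continuous.comp continuous_snd).measurable).mul
      (measurable_joint (h.measV i))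
  -- Testing with the Gaussian makes its product with the rate integrable in (s, ξ). The Gaussian
  -- has no zeros, so at almost every ξ the rate itself is integrable in time.
  have hint := h.integrable_weakRateFun γ α c (curlTest (gaussS one_pos))
  simp_rw [weakRateFun_curlTest] at hint
  have hpt : ∀ᵐ ξ : Plane, ∑ k, ‖ev (V k T) ξ‖ ^ 2 = ∫ s in Set.Ioc 0 T,
      2 * (energyDensity γ α (fun k ↦ V k s) (fun k ↦ Z k s) (fun i k ↦ β i k s) c ξ).re := by
    have hne : ∀ᵐ ξ : Plane, ξ ≠ 0 := by
      rw [ae_iff]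
      simp
    filter_upwards [h.curl_eq_primitive hT (heq T ⟨hT, le_rfl⟩), h.ae_curl_eq_primitive heq, hev T,
      hev', hint.prod_left_ae, hne] with ξ h1 h2 h3 h4 h5 hξ
    have hlam : 0 < lam ξ := by
      have : 0 < ‖ξ‖ := norm_pos_iff.2 hξ
      unfold lam; positivity
    have hG : gaussS one_pos ξ ≠ 0 := by
      rw [gaussS_apply, symH]
      exact_mod_cast (Real.exp_pos _).ne'
    have hLi : IntervalIntegrable (fun s ↦ rateCurl γ α (fun k ↦ V k s) (fun k ↦ Z k s)
        (fun i k ↦ β i k s) c ξ) volume 0 T := by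
      rw [intervalIntegrable_iff_integrableOn_Ioc_of_le hT]
      refine (h5.const_mul (gaussS one_pos ξ)⁻¹).congr (Eventually.of_forall fun s ↦ ?_)
      simp only
      rw [inv_mul_cancel_left₀ hG]
    -- The squared vorticity is `lam ξ` times the energy at ξ, and by the chain rule it is also `lam
    -- ξ` times the integrated density; away from ξ = 0 the factor cancels.
    have h6 := norm_curl_sq (V := fun k ↦ ev (V k T) ξ) h3
    rw [h1, cx_primitive_sq hT hLi, intervalIntegral.integral_of_le hT] at h6
    have h7 : ∫ s in Set.Ioc 0 T, 2 * (conj (∫ r in (0 : ℝ)..s, rateCurl γ α (fun k ↦ V k r)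
          (fun k ↦ Z k r) (fun i k ↦ β i k r) c ξ) * rateCurl γ α (fun k ↦ V k s)
          (fun k ↦ Z k s) (fun i k ↦ β i k s) c ξ).re
        = ∫ s in Set.Ioc 0 T, lam ξ * (2 * (energyDensity γ α (fun k ↦ V k s) (fun k ↦ Z k s)
          (fun i k ↦ β i k s) c ξ).re) := by
      refine integral_congr_ae ?_
      filter_upwards [h2, h4] with s h8 h9
      rw [← h8, conj_curl_mul_rateCurl γ α _ _ _ _ h9, Complex.re_ofReal_mul]
      ring
    rw [h7, integral_const_mul] at h6
    exact (mul_left_cancel₀ hlam.ne' h6).symm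
  rw [intervalIntegral.integral_of_le hT]
  have hswap := integral_integral_swap (f := fun (s : ℝ) (ξ : Plane) ↦
    2 * (energyDensity γ α (fun k ↦ V k s) (fun k ↦ Z k s) (fun i k ↦ β i k s) c ξ).re) hE'
  rw [hswap, ← integral_congr_ae hpt]
  have hsq (k : Fin 2) : Integrable fun ξ ↦ ‖ev (V k T) ξ‖ ^ 2 := by
    refine (integrable_norm_sq (V k T)).congr ?_
    filter_upwards [ev_ae (V k T)] with ξ hξ
    rw [hξ]
  rw [integral_finsetSum _ fun k _ ↦ hsq k]
  refine Finset.sum_congr rfl fun k _ ↦ ?_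
  rw [norm_sq_eq_integral]
  refine integral_congr_ae ?_
  filter_upwards [ev_ae (V k T)] with ξ hξ
  rw [hξ]

end Energy

open scoped FourierTransform ComplexConjugate

/-! ### The energy rate of a velocity field in `H¹` -/

lemma toTemperedDistribution_opU (b : LC2) :
    (Lp.toTemperedDistribution (opU (𝓕 b)) : 𝓢'(Plane, ℂ))
      = J (-1) (Lp.toTemperedDistribution b) := by
  ext φ
  obtain ⟨σ, rfl⟩ : ∃ σ : 𝓢(Plane, ℂ), 𝓕 σ = φ := ⟨𝓕⁻ φ, FourierTransform.fourier_fourierInv_eq φ⟩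
  rw [J_apply_fourier, toTemperedDistribution_fourier, fourier_opU]
  refine integral_congr_ae ?_
  filter_upwards [mulL_ae memLp_symJ (𝓕 b)] with ξ hξ
  rw [hξ, SchwartzMap.smulLeftCLM_apply_apply (symJ_temperate _), smul_eq_mul]
  ring

lemma exists_opU_of_sobNorm_lt_top {h : HSp} (hh : sobNorm 1 2 (toDist h) < ∞) :
    ∃ a : Fin 2 → LC2, ∀ k, compLp k h = opU (a k) ∧ ‖a k‖ₑ ≤ sobNorm 1 2 (toDist h) := by
  have h1 (k : Fin 2) : ∃ a : LC2, compLp k h = opU a ∧ ‖a‖ₑ ≤ sobNorm 1 2 (toDist h) := by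
    have h2 := distLpNorm_le_sobNorm (p := 2) (by norm_num) 1 (toDist h) k
    obtain ⟨b, hb⟩ := exists_of_distLpNorm_lt_top (h2.trans_lt hh)
    refine ⟨𝓕 b, ?_, ?_⟩
    · apply toTemperedDistribution_injective
      rw [toTemperedDistribution_opU, ← hb, toDist_apply]
      have h3 := J_J_neg (-1) (Lp.toTemperedDistribution (compLp k h) : 𝓢'(Plane, ℂ))
      rw [neg_neg] at h3
      exact h3.symm
    · rw [hb, distLpNorm_toTemperedDistribution] at h2
      rwa [← ofReal_norm, Lp.norm_fourier_eq, ofReal_norm]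
  choose a ha using h1
  exact ⟨a, ha⟩

lemma symJ_mul_hatL {h : HSp} {a : LC2} {k : Fin 2} (ha : compLp k h = opU a) :
    ∀ᵐ ξ, symJ 1 ξ * ev (hatL h k) ξ = a ξ := by
  have h1 : hatL h k = mulL (symJ (-1)) a := by rw [hatL, ha, fourier_opU]
  filter_upwards [ev_ae (hatL h k), mulL_ae memLp_symJ a] with ξ h2 h3
  rw [h2, h1, h3, ← mul_assoc, mul_comm (symJ 1 ξ), symJ_neg_one_mul, one_mul]

lemma inner_eq_integral (x y : LC2) : inner ℂ x y = ∫ ξ, conj (x ξ) * y ξ := by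
  rw [L2.inner_def]
  refine integral_congr_ae (Eventually.of_forall fun ξ ↦ ?_)
  simp only [RCLike.inner_apply]
  ring

lemma integrable_conj_mul (x y : LC2) : Integrable fun ξ ↦ conj (x ξ) * y ξ :=
  MemLp.integrable_mul (Lp.memLp x).star (Lp.memLp y)

lemma norm_hatL (h : HSp) (k : Fin 2) : ‖hatL h k‖ = ‖compLp k h‖ := Lp.norm_fourier_eq _

lemma integrable_density_aux (γ α : ℂ) (A V Z C : LC2) (D B : Fin 2 → LC2) :
    Integrable fun ξ ↦ -(conj (A ξ) * A ξ) + γ * (conj (V ξ) * V ξ)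
      + ∑ i, conj (D i ξ) * B i ξ + α * (conj (V ξ) * Z ξ) + conj (A ξ) * C ξ := by
  refine Integrable.add (Integrable.add (Integrable.add (Integrable.add ?_ ?_) ?_) ?_) ?_
  · exact (integrable_conj_mul A A).neg
  · exact (integrable_conj_mul V V).const_mul _
  · exact integrable_finsetSum _ fun i _ ↦ integrable_conj_mul (D i) (B i)
  · exact (integrable_conj_mul V Z).const_mul _
  · exact integrable_conj_mul A C

lemma integral_density_aux (γ α : ℂ) (A V Z C : LC2) (D B : Fin 2 → LC2) :
    ∫ ξ, (-(conj (A ξ) * A ξ) + γ * (conj (V ξ) * V ξ)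
      + ∑ i, conj (D i ξ) * B i ξ + α * (conj (V ξ) * Z ξ) + conj (A ξ) * C ξ)
    = -inner ℂ A A + γ * inner ℂ V V + ∑ i, inner ℂ (D i) (B i) + α * inner ℂ V Z
      + inner ℂ A C := by
  have hadd {F F' : Plane → ℂ} (hF : Integrable F) (hF' : Integrable F') :
      Integrable fun ξ ↦ F ξ + F' ξ := hF.add hF'
  have i1 : Integrable fun ξ ↦ -(conj (A ξ) * A ξ) := (integrable_conj_mul A A).neg
  have j2 : Integrable fun ξ ↦ γ * (conj (V ξ) * V ξ) := (integrable_conj_mul V V).const_mul _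
  have j3 : Integrable fun ξ ↦ ∑ i, conj (D i ξ) * B i ξ :=
    integrable_finsetSum _ fun i _ ↦ integrable_conj_mul (D i) (B i)
  have j4 : Integrable fun ξ ↦ α * (conj (V ξ) * Z ξ) := (integrable_conj_mul V Z).const_mul _
  rw [integral_add (hadd (hadd (hadd i1 j2) j3) j4) (integrable_conj_mul A C),
    integral_add (hadd (hadd i1 j2) j3) j4, integral_add (hadd i1 j2) j3, integral_add i1 j2,
    integral_neg, integral_const_mul, integral_const_mul,
    integral_finsetSum _ fun i _ ↦ integrable_conj_mul (D i) (B i)]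
  simp_rw [← inner_eq_integral]

lemma inner_hatL (u ζ : HSp) (k : Fin 2) :
    inner ℂ (hatL u k) (hatL ζ k) = inner ℂ (compLp k u) (compLp k ζ) := Lp.inner_fourier_eq _ _

lemma inner_mulL_symD (a b : LC2) (i : Fin 2) :
    inner ℂ (mulL (symD i) a) (𝓕 b) = inner ℂ (opD i a) b := by
  rw [← fourier_opD, Lp.inner_fourier_eq]

/-- Plancherel's theorem term by term; the density was arranged so that each term is an inner
product in L². -/
theorem integral_energyDensity (γ α : ℝ) {u ζ : HSp} {a : Fin 2 → LC2}
    (ha : ∀ k, compLp k u = opU (a k)) (c : Fin 2 → LC2) :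
    ∫ ξ, 2 * (energyDensity γ α (hatL u) (hatL ζ) (hatProd (u + ζ)) c ξ).re
      = energyRate γ α u ζ a c := by
  have hae : ∀ᵐ ξ, energyDensity γ α (hatL u) (hatL ζ) (hatProd (u + ζ)) c ξ
      = ∑ k, (-(conj (a k ξ) * a k ξ) + (1 - γ) * (conj (hatL u k ξ) * hatL u k ξ)
        + ∑ i, conj (mulL (symD i) (a k) ξ) * hatProd (u + ζ) i k ξ
        + α * (conj (hatL u k ξ) * hatL ζ k ξ) + conj (a k ξ) * c k ξ) := by
    have h1 : ∀ᵐ ξ, ∀ k, symJ 1 ξ * ev (hatL u k) ξ = a k ξ :=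
      ae_all_iff.2 fun k ↦ symJ_mul_hatL (ha k)
    have h2 : ∀ᵐ ξ, ∀ k, ev (hatL u k) ξ = hatL u k ξ := ae_all_iff.2 fun k ↦ ev_ae _
    have h3 : ∀ᵐ ξ, ∀ k, ev (hatL ζ k) ξ = hatL ζ k ξ := ae_all_iff.2 fun k ↦ ev_ae _
    have h4 : ∀ᵐ ξ, ∀ i k, ev (hatProd (u + ζ) i k) ξ = hatProd (u + ζ) i k ξ :=
      ae_all_iff.2 fun i ↦ ae_all_iff.2 fun k ↦ ev_ae _
    have h5 : ∀ᵐ ξ, ∀ k, ev (c k) ξ = c k ξ := ae_all_iff.2 fun k ↦ ev_ae _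
    have h6 : ∀ᵐ ξ, ∀ i k, mulL (symD i) (a k) ξ = symD i ξ * a k ξ :=
      ae_all_iff.2 fun i ↦ ae_all_iff.2 fun k ↦ mulL_ae (memLp_symD i) _
    filter_upwards [h1, h2, h3, h4, h5, h6] with ξ h1 h2 h3 h4 h5 h6
    simp only [energyDensity, h1, h3, h4, h5, h6]
    simp only [h2]
  have i5 (k : Fin 2) := integrable_density_aux (1 - γ) α (a k) (hatL u k) (hatL ζ k) (c k)
    (fun i ↦ mulL (symD i) (a k)) (fun i ↦ hatProd (u + ζ) i k)
  have hI : ∫ ξ, energyDensity γ α (hatL u) (hatL ζ) (hatProd (u + ζ)) c ξ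
      = ∑ k, (-inner ℂ (a k) (a k) + (1 - γ) * inner ℂ (compLp k u) (compLp k u)
        + ∑ i, inner ℂ (opD i (a k))
          (prodLp (compLp i (u + ζ : HSp)) (compLp k (u + ζ : HSp)))
        + α * inner ℂ (compLp k u) (compLp k ζ) + inner ℂ (a k) (c k)) := by
    rw [integral_congr_ae hae, integral_finsetSum _ fun k _ ↦ i5 k]
    refine Finset.sum_congr rfl fun k _ ↦ ?_
    rw [integral_density_aux (1 - γ) α (a k) (hatL u k) (hatL ζ k) (c k)
      (fun i ↦ mulL (symD i) (a k)) (fun i ↦ hatProd (u + ζ) i k), inner_hatL, inner_hatL]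
    simp_rw [hatProd, inner_mulL_symD]
  have hint : Integrable (energyDensity γ α (hatL u) (hatL ζ) (hatProd (u + ζ)) c) := by
    refine (integrable_finsetSum Finset.univ fun k (_ : k ∈ Finset.univ) ↦ i5 k).congr ?_
    filter_upwards [hae] with ξ hξ
    rw [hξ]
  have hre : ∫ ξ, (energyDensity γ α (hatL u) (hatL ζ) (hatProd (u + ζ)) c ξ).re
      = (∫ ξ, energyDensity γ α (hatL u) (hatL ζ) (hatProd (u + ζ)) c ξ).re := integral_re hint
  have hn (x : LC2) : (inner ℂ x x).re = ‖x‖ ^ 2 := inner_self_eq_norm_sq (𝕜 := ℂ) x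
  rw [integral_const_mul, hre, hI, energyRate]
  have hγ : (1 - (γ : ℂ)) = ((1 - γ : ℝ) : ℂ) := by push_cast; rfl
  simp only [Complex.add_re, Complex.neg_re, hγ, Complex.re_ofReal_mul, hn,
    Fin.sum_univ_two]
  ring

open scoped FourierTransform ComplexConjugate

/-! ### The pathwise energy estimate -/

/-- The integrability of a noise path on bounded time intervals. -/
structure IsGoodPath (ζ : ℝ≥0 → HSp) : Prop where
  meas : Measurable fun s : ℝ ↦ ζ s.toNNReal
  sq : ∀ T : ℝ, ∫⁻ s in Set.Ioc 0 T, ‖ζ s.toNNReal‖ₑ ^ 2 < ∞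
  four : ∀ (T : ℝ) (k : Fin 2), ∫⁻ s in Set.Ioc 0 T, ∫⁻ x, ‖compLp k (ζ s.toNNReal) x‖ₑ ^ 4 < ∞

lemma measurable_compLp (k : Fin 2) : Measurable fun h : HSp ↦ compLp k h :=
  ((compLp k).continuous.comp continuous_subtype_val).measurable

lemma measurable_fourier : Measurable fun a : LC2 ↦ (𝓕 a : LC2) :=
  (FourierTransform.fourierCLM ℂ LC2).continuous.measurable

lemma measurable_hatL (k : Fin 2) : Measurable fun h : HSp ↦ hatL h k :=
  ((FourierTransform.fourierCLM ℂ LC2).continuous.comp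
    ((compLp k).continuous.comp continuous_subtype_val)).measurable

lemma measurable_apply_pair {X A B : Type*} [MeasurableSpace X] [MeasurableSpace A]
    [MeasurableSpace B] {f : A → A → B} (hf : Measurable fun p : A × A ↦ f p.1 p.2) {a b : X → A}
    (ha : Measurable a) (hb : Measurable b) : Measurable fun x ↦ f (a x) (b x) :=
  hf.comp (ha.prodMk hb)

lemma measurable_prodLp_comp {X : Type*} [MeasurableSpace X] {a b : X → LC2}
    (ha : Measurable a) (hb : Measurable b) : Measurable fun x ↦ prodLp (a x) (b x) :=
  measurable_apply_pair measurable_prodLp ha hb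

lemma measurable_fourier_comp {X : Type*} [MeasurableSpace X] {a : X → LC2}
    (ha : Measurable a) : Measurable fun x ↦ (𝓕 (a x) : LC2) :=
  Measurable.comp measurable_fourier ha

lemma measurable_hatProd (i k : Fin 2) : Measurable fun h : HSp ↦ hatProd h i k :=
  measurable_fourier_comp (measurable_prodLp_comp (measurable_compLp i) (measurable_compLp k))

lemma enorm_compLp_le (k : Fin 2) (h : HSp) : ‖compLp k h‖ₑ ≤ ‖h‖ₑ := by
  rw [← ofReal_norm, ← ofReal_norm]
  exact ENNReal.ofReal_le_ofReal (norm_compLp_le k h)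

lemma enorm_hatL_le (h : HSp) (k : Fin 2) : ‖hatL h k‖ₑ ≤ ‖h‖ₑ := by
  rw [← ofReal_norm, norm_hatL, ofReal_norm]
  exact enorm_compLp_le k h

lemma enorm_prodLp_sq_le (z w : LC2) :
    ‖prodLp z w‖ₑ ^ 2 ≤ (∫⁻ x, ‖z x‖ₑ ^ 4) + ∫⁻ x, ‖w x‖ₑ ^ 4 := by
  by_cases h : MemLp (fun x ↦ z x * w x) 2 volume
  · rw [← lintegral_enorm_sq_eq, ← lintegral_add_left
      ((Lp.stronglyMeasurable z).enorm.pow_const 4)]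
    refine lintegral_mono_ae ?_
    rw [prodLp, dif_pos h]
    filter_upwards [h.coeFn_toLp] with x hx
    rw [hx, enorm_mul]
    have key (a b : ℝ≥0∞) : (a * b) ^ 2 ≤ a ^ 4 + b ^ 4 := by
      rcases le_total a b with h | h
      · calc (a * b) ^ 2 ≤ (b * b) ^ 2 := by gcongr
          _ = b ^ 4 := by ring
          _ ≤ _ := le_add_self
      · calc (a * b) ^ 2 ≤ (a * a) ^ 2 := by gcongr
          _ = a ^ 4 := by ring
          _ ≤ _ := le_self_add
    exact key _ _
  · rw [prodLp, dif_neg h]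
    simp

lemma enorm_add_pow_four_le (a b : ℝ≥0∞) : (a + b) ^ 4 ≤ 16 * (a ^ 4 + b ^ 4) := by
  rcases le_total a b with h | h
  · calc (a + b) ^ 4 ≤ (b + b) ^ 4 := by gcongr
      _ = 16 * b ^ 4 := by ring
      _ ≤ _ := by gcongr; exact le_add_self
  · calc (a + b) ^ 4 ≤ (a + a) ^ 4 := by gcongr
      _ = 16 * a ^ 4 := by ring
      _ ≤ _ := by gcongr; exact le_self_add

lemma lintegral_add_four_le (z w : LC2) :
    ∫⁻ x, ‖(z + w : LC2) x‖ₑ ^ 4 ≤ 16 * ((∫⁻ x, ‖z x‖ₑ ^ 4) + ∫⁻ x, ‖w x‖ₑ ^ 4) := by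
  have hm : Measurable fun x ↦ ‖z x‖ₑ ^ 4 + ‖w x‖ₑ ^ 4 :=
    ((Lp.stronglyMeasurable z).enorm.pow_const 4).add
      ((Lp.stronglyMeasurable w).enorm.pow_const 4)
  rw [← lintegral_add_left ((Lp.stronglyMeasurable z).enorm.pow_const 4),
    ← lintegral_const_mul _ hm]
  refine lintegral_mono_ae ?_
  filter_upwards [Lp.coeFn_add z w] with x hx
  rw [hx, Pi.add_apply]
  refine le_trans ?_ (enorm_add_pow_four_le _ _)
  exact pow_le_pow_left' (enorm_add_le _ _) 4

/-- The square of the `L²` norm of the `k`-th component of `J u`. -/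
def enstrophy (k : Fin 2) (h : HSp) : ℝ≥0∞ := ∫⁻ ξ, ‖symJ 1 ξ * ev (hatL h k) ξ‖ₑ ^ 2

lemma measurable_symJ (s : ℝ) : Measurable (symJ s) :=
  (symJ_temperate s).1.continuous.measurable

lemma measurable_enstrophy (k : Fin 2) : Measurable (enstrophy k) := by
  have h1 : Measurable fun p : HSp × Plane ↦ ev (hatL p.1 k) p.2 :=
    measurable_ev.comp (((measurable_hatL k).comp measurable_fst).prodMk measurable_snd)
  have h2 : Measurable fun p : HSp × Plane ↦ ‖symJ 1 p.2 * ev (hatL p.1 k) p.2‖ₑ ^ 2 :=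
    (((measurable_symJ 1).comp measurable_snd).mul h1).enorm.pow_const 2
  exact h2.lintegral_prod_right'

lemma enstrophy_eq_of_opU {h : HSp} {a : LC2} {k : Fin 2} (ha : compLp k h = opU a) :
    enstrophy k h = ‖a‖ₑ ^ 2 := by
  rw [← lintegral_enorm_sq_eq]
  refine lintegral_congr_ae ?_
  filter_upwards [symJ_mul_hatL ha] with ξ hξ
  rw [hξ]

/-- Finite Sobolev norm gives finite `enstrophy`, a parameter integral that is visibly measurable in
h, whereas `sobNorm` is built from an infimum. -/
lemma enstrophy_le (h : HSp) (k : Fin 2) : enstrophy k h ≤ (sobNorm 1 2 (toDist h)) ^ 2 := by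
  by_cases hh : sobNorm 1 2 (toDist h) < ∞
  · obtain ⟨a, ha⟩ := exists_opU_of_sobNorm_lt_top hh
    rw [enstrophy_eq_of_opU (ha k).1]
    exact pow_le_pow_left' (ha k).2 2
  · rw [not_lt_top_iff.1 hh]
    simp

lemma exists_opU_of_enstrophy {h : HSp} {k : Fin 2} (hh : enstrophy k h < ∞) :
    ∃ a : LC2, compLp k h = opU a := by
  have hm : Measurable fun ξ ↦ symJ 1 ξ * ev (hatL h k) ξ :=
    (measurable_symJ 1).mul (measurable_ev_right _)
  have h2 : MemLp (fun ξ ↦ symJ 1 ξ * ev (hatL h k) ξ) 2 volume := by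
    refine ⟨hm.aestronglyMeasurable, ?_⟩
    rw [eLpNorm_lt_top_iff_lintegral_rpow_enorm_lt_top (by norm_num) (by norm_num)]
    simpa [enstrophy] using hh
  refine ⟨h2.toLp, ?_⟩
  have h3 : hatL h k = 𝓕 (opU h2.toLp) := by
    rw [fourier_opU]
    apply Lp.ext
    filter_upwards [ev_ae (hatL h k), mulL_ae memLp_symJ h2.toLp, h2.coeFn_toLp] with ξ h4 h5 h6
    rw [h5, h6, ← mul_assoc, symJ_neg_one_mul, one_mul, h4]
  have h4 := congrArg (fun b : LC2 ↦ (𝓕⁻ b : LC2)) h3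
  simpa only [hatL, FourierTransform.fourierInv_fourier_eq] using h4

lemma exists_lintegral_compLp_four_le : ∃ C : ℝ≥0, ∀ (h : HSp) (k : Fin 2), enstrophy k h < ∞ →
    ∫⁻ x, ‖compLp k h x‖ₑ ^ 4 ≤ C * ‖h‖ₑ ^ 2 * enstrophy k h := by
  obtain ⟨C, hC⟩ := ladyzhenskaya
  refine ⟨C, fun h k hh ↦ ?_⟩
  obtain ⟨a, ha⟩ := exists_opU_of_enstrophy hh
  rw [enstrophy_eq_of_opU ha]
  have h1 := hC a
  rw [← ha] at h1
  refine h1.trans (mul_le_mul' (mul_le_mul' le_rfl ?_) le_rfl)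
  exact pow_le_pow_left' (enorm_compLp_le k h) 2

section Path

variable {γ α : ℝ} {f : VecDist} {ζ u : ℝ≥0 → HSp}

lemma IsSolution.lintegral_sobNorm (hsol : IsSolution γ α f ζ u) (T : ℝ) :
    ∫⁻ s in Set.Ioc 0 T, (sobNorm 1 2 (toDist (u s.toNNReal))) ^ 2 < ∞ := by
  have h := hsol.locally_L2_H1 T.toNNReal
  rw [restrict_Ioo_eq_restrict_Ioc] at h
  refine (lintegral_mono_set ?_).trans_lt h
  exact Set.Ioc_subset_Ioc_right (Real.le_coe_toNNReal T)

lemma IsSolution.continuous_path (hsol : IsSolution γ α f ζ u) :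
    Continuous fun s : ℝ ↦ u s.toNNReal :=
  hsol.continuous.comp continuous_real_toNNReal

lemma IsSolution.exists_bound (hsol : IsSolution γ α f ζ u) (T : ℝ) :
    ∃ M : ℝ≥0, ∀ s ∈ Set.Ioc 0 T, ‖u s.toNNReal‖ₑ ≤ M := by
  obtain ⟨M, hM⟩ := (isCompact_Icc (a := (0 : ℝ)) (b := T)).exists_bound_of_continuousOn
    hsol.continuous_path.continuousOn
  refine ⟨M.toNNReal, fun s hs ↦ ?_⟩
  rw [← ofReal_norm]
  exact ENNReal.ofReal_le_ofReal (hM s ⟨hs.1.le, hs.2⟩)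

lemma sq_lintegral_lt_top_of_bound {F : ℝ → ℝ≥0∞} {T : ℝ} {M : ℝ≥0}
    (h : ∀ s ∈ Set.Ioc 0 T, F s ≤ M) : ∫⁻ s in Set.Ioc 0 T, F s < ∞ := by
  refine (setLIntegral_mono measurable_const h).trans_lt ?_
  rw [lintegral_const]
  finiteness

lemma IsSolution.lintegral_enstrophy (hsol : IsSolution γ α f ζ u) (T : ℝ) (k : Fin 2) :
    ∫⁻ s in Set.Ioc 0 T, enstrophy k (u s.toNNReal) < ∞ :=
  (lintegral_mono fun _ ↦ enstrophy_le _ k).trans_lt (hsol.lintegral_sobNorm T)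

lemma IsSolution.ae_enstrophy (hsol : IsSolution γ α f ζ u) (T : ℝ) :
    ∀ᵐ s ∂(volume.restrict (Set.Ioc 0 T)), ∀ k, enstrophy k (u s.toNNReal) < ∞ := by
  refine ae_all_iff.2 fun k ↦ ae_lt_top ?_ (hsol.lintegral_enstrophy T k).ne
  exact (measurable_enstrophy k).comp hsol.continuous_path.measurable

/-- Paths bounded in H and square integrable in H¹ lie in L⁴ of space-time, by Ladyzhenskaya's
inequality. -/
lemma IsSolution.lintegral_four (hsol : IsSolution γ α f ζ u) (T : ℝ) (k : Fin 2) :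
    ∫⁻ s in Set.Ioc 0 T, ∫⁻ x, ‖compLp k (u s.toNNReal) x‖ₑ ^ 4 < ∞ := by
  obtain ⟨C, hC⟩ := exists_lintegral_compLp_four_le
  obtain ⟨M, hM⟩ := hsol.exists_bound T
  have h1 : ∀ᵐ s ∂(volume.restrict (Set.Ioc 0 T)),
      ∫⁻ x, ‖compLp k (u s.toNNReal) x‖ₑ ^ 4 ≤ (C * M ^ 2 : ℝ≥0) * enstrophy k (u s.toNNReal) := by
    filter_upwards [hsol.ae_enstrophy T, ae_restrict_mem measurableSet_Ioc] with s h1 h2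
    refine (hC _ k (h1 k)).trans (mul_le_mul' ?_ le_rfl)
    push_cast
    exact mul_le_mul' le_rfl (pow_le_pow_left' (hM s h2) 2)
  refine (lintegral_mono_ae h1).trans_lt ?_
  have hm : Measurable fun s : ℝ ↦ enstrophy k (u s.toNNReal) :=
    (measurable_enstrophy k).comp hsol.continuous_path.measurable
  rw [lintegral_const_mul _ hm]
  exact ENNReal.mul_lt_top ENNReal.coe_lt_top (hsol.lintegral_enstrophy T k)

lemma measurable_lintegral_compLp_four {z : ℝ → HSp} (hz : Measurable z) (k : Fin 2) :
    Measurable fun s ↦ ∫⁻ x, ‖compLp k (z s) x‖ₑ ^ 4 :=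
  (measurable_lintegral_enorm_pow 4).comp ((measurable_compLp k).comp hz)

lemma lintegral_sum_four (hsol : IsSolution γ α f ζ u) (hζ : IsGoodPath ζ) (T : ℝ) (k : Fin 2) :
    ∫⁻ s in Set.Ioc 0 T, ∫⁻ x,
      ‖compLp k (u s.toNNReal + ζ s.toNNReal : HSp) x‖ₑ ^ 4 < ∞ := by
  have h1 (s : ℝ) : ∫⁻ x, ‖compLp k (u s.toNNReal + ζ s.toNNReal : HSp) x‖ₑ ^ 4
      ≤ 16 * ((∫⁻ x, ‖compLp k (u s.toNNReal) x‖ₑ ^ 4)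
        + ∫⁻ x, ‖compLp k (ζ s.toNNReal) x‖ₑ ^ 4) := by
    rw [Submodule.coe_add, map_add]
    exact lintegral_add_four_le _ _
  have h2 := measurable_lintegral_compLp_four hsol.continuous_path.measurable k
  have h3 := measurable_lintegral_compLp_four hζ.meas k
  have h4 : Measurable fun s : ℝ ↦ (∫⁻ x, ‖compLp k (u s.toNNReal) x‖ₑ ^ 4)
      + ∫⁻ x, ‖compLp k (ζ s.toNNReal) x‖ₑ ^ 4 := h2.add h3
  refine (lintegral_mono h1).trans_lt ?_
  rw [lintegral_const_mul _ h4, lintegral_add_left h2]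
  exact ENNReal.mul_lt_top (by norm_num) (ENNReal.add_lt_top.2 ⟨hsol.lintegral_four T k, hζ.four T k⟩)

lemma measurable_sum (hsol : IsSolution γ α f ζ u) (hζ : IsGoodPath ζ) :
    Measurable fun s : ℝ ↦ (u s.toNNReal + ζ s.toNNReal : HSp) :=
  hsol.continuous_path.measurable.add hζ.meas

/-- The products are square integrable in space-time because u and ζ both lie in L⁴ there. -/
lemma spectralData (hsol : IsSolution γ α f ζ u) (hζ : IsGoodPath ζ) (T : ℝ) :
    SpectralData T (fun k s ↦ hatL (u s.toNNReal) k) (fun k s ↦ hatL (ζ s.toNNReal) k)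
      (fun i k s ↦ hatProd (u s.toNNReal + ζ s.toNNReal) i k) where
  measV k := (measurable_hatL k).comp hsol.continuous_path.measurable
  measZ k := (measurable_hatL k).comp hζ.meas
  measβ i k := (measurable_hatProd i k).comp (measurable_sum hsol hζ)
  sqV k := by
    obtain ⟨M, hM⟩ := hsol.exists_bound T
    refine sq_lintegral_lt_top_of_bound (M := M ^ 2) fun s hs ↦ ?_
    push_cast
    exact pow_le_pow_left' ((enorm_hatL_le _ k).trans (hM s hs)) 2
  sqZ k := (lintegral_mono fun s ↦ pow_le_pow_left' (enorm_hatL_le _ k) 2).trans_lt (hζ.sq T)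
  sqβ i k := by
    have h1 (s : ℝ) : ‖hatProd (u s.toNNReal + ζ s.toNNReal) i k‖ₑ ^ 2
        ≤ (∫⁻ x, ‖compLp i (u s.toNNReal + ζ s.toNNReal : HSp) x‖ₑ ^ 4)
          + ∫⁻ x, ‖compLp k (u s.toNNReal + ζ s.toNNReal : HSp) x‖ₑ ^ 4 := by
      rw [hatProd, ← ofReal_norm, Lp.norm_fourier_eq, ofReal_norm]
      exact enorm_prodLp_sq_le _ _
    refine (lintegral_mono h1).trans_lt ?_
    rw [lintegral_add_left (measurable_lintegral_compLp_four (measurable_sum hsol hζ) i)]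
    exact ENNReal.add_lt_top.2 ⟨lintegral_sum_four hsol hζ T i, lintegral_sum_four hsol hζ T k⟩

end Path

open scoped FourierTransform ComplexConjugate

/-! ### The energy identity along a path and the logarithmic estimate. -/

section Path

variable {γ α : ℝ} {f : VecDist} {ζ u : ℝ≥0 → HSp} {c : Fin 2 → LC2}

/-- The time derivative of the energy `‖u‖²` along a solution. -/
def energyDeriv (γ α : ℝ) (c : Fin 2 → LC2) (u ζ : HSp) : ℝ :=
  ∫ ξ, 2 * (energyDensity γ α (hatL u) (hatL ζ) (hatProd (u + ζ)) (fun k ↦ 𝓕 (c k)) ξ).re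

lemma integrable_energyDensity_path (hsol : IsSolution γ α f ζ u) (hζ : IsGoodPath ζ)
    (c : Fin 2 → LC2) (T : ℝ) :
    Integrable (fun p : ℝ × Plane ↦ energyDensity γ α (hatL (u p.1.toNNReal))
      (hatL (ζ p.1.toNNReal)) (hatProd (u p.1.toNNReal + ζ p.1.toNNReal)) c p.2)
      ((volume.restrict (Set.Ioc 0 T)).prod volume) :=
  (spectralData hsol hζ T).integrable_energyDensity fun k ↦ hsol.lintegral_enstrophy T k

lemma intervalIntegrable_energyDeriv (hsol : IsSolution γ α f ζ u) (hζ : IsGoodPath ζ)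
    (c : Fin 2 → LC2) {T : ℝ} (hT : 0 ≤ T) :
    IntervalIntegrable (fun s ↦ energyDeriv γ α c (u s.toNNReal) (ζ s.toNNReal)) volume 0 T := by
  rw [intervalIntegrable_iff_integrableOn_Ioc_of_le hT]
  have h1 := (integrable_energyDensity_path hsol hζ (fun k ↦ 𝓕 (c k)) T).re.const_mul 2
  exact h1.integral_prod_left

lemma ae_memLp_four {z : ℝ → HSp} (hz : Measurable z) {T : ℝ}
    (h : ∀ k, ∫⁻ s in Set.Ioc 0 T, ∫⁻ x, ‖compLp k (z s) x‖ₑ ^ 4 < ∞) :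
    ∀ᵐ s ∂(volume.restrict (Set.Ioc 0 T)), ∀ k, MemLp (compLp k (z s)) 4 volume := by
  refine ae_all_iff.2 fun k ↦ ?_
  filter_upwards [ae_lt_top (measurable_lintegral_compLp_four hz k) (h k).ne] with s hs
  exact memLp_four (Lp.aestronglyMeasurable _) hs

theorem norm_sq_eq_integral_energyDeriv (hsol : IsSolution γ α f ζ u) (hζ : IsGoodPath ζ)
    (hc : ∀ k, J (-1) (f k) = Lp.toTemperedDistribution (c k)) {T : ℝ} (hT : 0 ≤ T) :
    ‖u T.toNNReal‖ ^ 2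
      = ∫ s in (0 : ℝ)..T, energyDeriv γ α c (u s.toNNReal) (ζ s.toNNReal) := by
  have h1 := (spectralData hsol hζ T).energy_identity (γ := γ) (α := α) (c := fun k ↦ 𝓕 (c k)) hT
    (fun k ↦ hsol.lintegral_enstrophy T k) (fun s ↦ div_free_fourier _) ?_
  · unfold energyDeriv
    rw [← h1]
    refine (norm_sq_eq_sum (u T.toNNReal : L2Field)).trans ?_
    exact Finset.sum_congr rfl fun k _ ↦ by rw [norm_hatL]
  · intro t ht σ
    have hd := spectralData hsol hζ t
    have h2 := weak_equation hsol hc (t := t.toNNReal) hd.measV hd.measZ hd.measβ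
    rw [Real.coe_toNNReal t ht.1] at h2
    refine h2 hd.sqV hd.sqZ hd.sqβ ?_ σ
    rw [← ae_restrict_iff' measurableSet_Ioc]
    exact ae_memLp_four (measurable_sum hsol hζ) fun k ↦ lintegral_sum_four hsol hζ t k

theorem exists_energyDeriv_le (hγ : 0 < γ) : ∃ C : ℝ, 0 ≤ C ∧
    ∀ {α : ℝ} {f : VecDist} {ζ u : ℝ≥0 → HSp} {c : Fin 2 → LC2}, IsSolution γ α f ζ u →
      IsGoodPath ζ → ∀ T : ℝ, ∀ᵐ s ∂(volume.restrict (Set.Ioc 0 T)),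
        energyDeriv γ α c (u s.toNNReal) (ζ s.toNNReal) ≤ -γ * ‖u s.toNNReal‖ ^ 2
          + C * (1 + ‖u s.toNNReal‖ ^ 2) * ∑ k, norm4 (compLp k (ζ s.toNNReal)) ^ 4
          + C * (α ^ 2 * ‖ζ s.toNNReal‖ ^ 2 + ∑ k, ‖c k‖ ^ 2) := by
  obtain ⟨C, hC, h⟩ := exists_energyRate_le hγ
  refine ⟨C, hC, fun {α f ζ u c} hsol hζ T ↦ ?_⟩
  filter_upwards [hsol.ae_enstrophy T, ae_memLp_four hζ.meas (hζ.four T)] with s h1 h2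
  choose a ha using fun k ↦ exists_opU_of_enstrophy (h1 k)
  rw [energyDeriv, integral_energyDensity γ α ha]
  have h3 := h α _ (ζ s.toNNReal) a (fun k ↦ 𝓕 (c k)) ha h2
  simpa only [Lp.norm_fourier_eq] using h3

/-- The quantity by which the time averages of the energy are controlled. -/
def noiseLoad (α C R F : ℝ) (ζ : HSp) : ℝ≥0∞ :=
  ENNReal.ofReal (C * (1 + 1 / R)) * (∑ k, ∫⁻ x, ‖compLp k ζ x‖ₑ ^ 4)
    + ENNReal.ofReal (C / R) * (ENNReal.ofReal (α ^ 2) * ‖ζ‖ₑ ^ 2 + ENNReal.ofReal F)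

lemma measurable_noiseLoad (α C R F : ℝ) : Measurable (noiseLoad α C R F) := by
  have h1 (k : Fin 2) : Measurable fun ζ : HSp ↦ ∫⁻ x, ‖compLp k ζ x‖ₑ ^ 4 :=
    (measurable_lintegral_enorm_pow 4).comp (measurable_compLp k)
  have h2 : Measurable fun ζ : HSp ↦ ∑ k, ∫⁻ x, ‖compLp k ζ x‖ₑ ^ 4 :=
    Finset.measurable_fun_sum _ fun k _ ↦ h1 k
  exact (h2.const_mul _).add ((((measurable_enorm.pow_const 2).const_mul _).add
    measurable_const).const_mul _)

lemma IsGoodPath.lintegral_noiseLoad (hζ : IsGoodPath ζ) (α C R F T : ℝ) :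
    ∫⁻ s in Set.Ioc 0 T, noiseLoad α C R F (ζ s.toNNReal) < ∞ := by
  have h1 (k : Fin 2) := measurable_lintegral_compLp_four hζ.meas k
  have h2 : Measurable fun s : ℝ ↦ ∑ k, ∫⁻ x, ‖compLp k (ζ s.toNNReal) x‖ₑ ^ 4 :=
    Finset.measurable_fun_sum _ fun k _ ↦ h1 k
  have h3 : Measurable fun s : ℝ ↦ ‖ζ s.toNNReal‖ₑ ^ 2 := hζ.meas.enorm.pow_const 2
  have h4 : Measurable fun s : ℝ ↦ ENNReal.ofReal (α ^ 2) * ‖ζ s.toNNReal‖ₑ ^ 2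
      + ENNReal.ofReal F := (h3.const_mul _).add measurable_const
  unfold noiseLoad
  rw [lintegral_add_left (h2.const_mul _), lintegral_const_mul _ h2, lintegral_const_mul _ h4,
    lintegral_add_left (h3.const_mul _), lintegral_const_mul _ h3,
    lintegral_finsetSum _ fun k _ ↦ h1 k, lintegral_const]
  refine ENNReal.add_lt_top.2 ⟨ENNReal.mul_lt_top ENNReal.ofReal_lt_top
    (ENNReal.sum_lt_top.2 fun k _ ↦ hζ.four T k), ENNReal.mul_lt_top ENNReal.ofReal_lt_top
    (ENNReal.add_lt_top.2 ⟨ENNReal.mul_lt_top ENNReal.ofReal_lt_top (hζ.sq T), ?_⟩)⟩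
  finiteness

lemma toReal_noiseLoad {α C R F : ℝ} (hC : 0 ≤ C) (hR : 0 < R) (hF : 0 ≤ F) {ζ : HSp}
    (h : ∀ k, ∫⁻ x, ‖compLp k ζ x‖ₑ ^ 4 < ∞) :
    (noiseLoad α C R F ζ).toReal = C * (1 + 1 / R) * ∑ k, norm4 (compLp k ζ) ^ 4
      + C / R * (α ^ 2 * ‖ζ‖ ^ 2 + F) := by
  have h1 : ∑ k, ∫⁻ x, ‖compLp k ζ x‖ₑ ^ 4 ≠ ∞ := (ENNReal.sum_lt_top.2 fun k _ ↦ h k).ne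
  have h2 : ENNReal.ofReal (α ^ 2) * ‖ζ‖ₑ ^ 2 ≠ ∞ :=
    ENNReal.mul_ne_top ENNReal.ofReal_ne_top (ENNReal.pow_ne_top enorm_ne_top)
  have h3 : 0 ≤ C * (1 + 1 / R) := by positivity
  have h4 : 0 ≤ C / R := by positivity
  have h5 : 0 ≤ α ^ 2 := by positivity
  rw [noiseLoad, ENNReal.toReal_add (ENNReal.mul_ne_top ENNReal.ofReal_ne_top h1)
    (ENNReal.mul_ne_top ENNReal.ofReal_ne_top (ENNReal.add_ne_top.2 ⟨h2, ENNReal.ofReal_ne_top⟩)),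
    ENNReal.toReal_mul, ENNReal.toReal_mul, ENNReal.toReal_add h2 ENNReal.ofReal_ne_top,
    ENNReal.toReal_mul, ENNReal.toReal_pow, toReal_enorm, ENNReal.toReal_ofReal h3,
    ENNReal.toReal_ofReal h4, ENNReal.toReal_ofReal h5, ENNReal.toReal_ofReal hF,
    ENNReal.toReal_sum fun k _ ↦ (h k).ne]
  simp_rw [norm4_pow]

/-- After division by R + m the coefficients are bounded through (1 + m)/(R + m) ≤ 1 + 1/R and 1/(R
+ m) ≤ 1/R; the growth in m is gone. -/
lemma logarithmic_rate_le {γ C R m q p D : ℝ} (hC : 0 ≤ C) (hR : 0 < R) (hm : 0 ≤ m) (hq : 0 ≤ q)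
    (hp : 0 ≤ p) (hD : D ≤ -γ * m + C * (1 + m) * q + C * p) :
    (R + m)⁻¹ * D ≤ C * (1 + 1 / R) * q + C / R * p - γ * (m / (R + m)) := by
  have hRm : 0 < R + m := by positivity
  rw [inv_mul_le_iff₀ hRm]
  refine hD.trans ?_
  have h1 : (R + m) * (γ * (m / (R + m))) = γ * m := by field_simp
  have h2 : 1 + m ≤ (R + m) * (1 + 1 / R) := by
    have : (R + m) * (1 + 1 / R) = R + m + 1 + m / R := by field_simp; ring
    rw [this]
    have : 0 ≤ m / R := by positivity
    linarith
  have h3 : 1 ≤ (R + m) / R := by rw [le_div_iff₀ hR]; linarith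
  have h4 : C * q * (1 + m) ≤ C * q * ((R + m) * (1 + 1 / R)) :=
    mul_le_mul_of_nonneg_left h2 (by positivity)
  have h5 : C * p * 1 ≤ C * p * ((R + m) / R) := mul_le_mul_of_nonneg_left h3 (by positivity)
  rw [mul_sub, h1]
  have h6 : (R + m) * (C * (1 + 1 / R) * q + C / R * p)
      = C * q * ((R + m) * (1 + 1 / R)) + C * p * ((R + m) / R) := by ring
  rw [h6]
  linarith

theorem exists_lintegral_energy_ratio_le (hγ : 0 < γ) : ∃ C : ℝ, 0 ≤ C ∧
    ∀ {α : ℝ} {f : VecDist} {ζ u : ℝ≥0 → HSp} {c : Fin 2 → LC2}, IsSolution γ α f ζ u →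
      IsGoodPath ζ → (∀ k, J (-1) (f k) = Lp.toTemperedDistribution (c k)) →
      ∀ {T R : ℝ}, 0 ≤ T → 0 < R →
        ∫⁻ s in Set.Ioc 0 T,
          ENNReal.ofReal (γ * (‖u s.toNNReal‖ ^ 2 / (R + ‖u s.toNNReal‖ ^ 2)))
        ≤ ∫⁻ s in Set.Ioc 0 T, noiseLoad α C R (∑ k, ‖c k‖ ^ 2) (ζ s.toNNReal) := by
  obtain ⟨C, hC, hD⟩ := exists_energyDeriv_le hγ
  refine ⟨C, hC, fun {α f ζ u c} hsol hζ hc {T R} hT hR ↦ ?_⟩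
  set N : ℝ → ℝ≥0∞ := fun s ↦ noiseLoad α C R (∑ k, ‖c k‖ ^ 2) (ζ s.toNNReal) with hN
  set A : ℝ → ℝ := fun s ↦ γ * (‖u s.toNNReal‖ ^ 2 / (R + ‖u s.toNNReal‖ ^ 2)) with hA
  have hm (s : ℝ) : 0 ≤ ‖u s.toNNReal‖ ^ 2 := sq_nonneg _
  have hF : 0 ≤ ∑ k, ‖c k‖ ^ 2 := Finset.sum_nonneg fun k _ ↦ sq_nonneg _
  have hA0 (s : ℝ) : 0 ≤ A s := mul_nonneg hγ.le (div_nonneg (hm s) (add_nonneg hR.le (hm s)))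
  have hcn : Continuous fun s : ℝ ↦ ‖u s.toNNReal‖ ^ 2 := hsol.continuous_path.norm.pow 2
  have hAc : Continuous A :=
    (hcn.div (continuous_const.add hcn) fun s ↦ (add_pos_of_pos_of_nonneg hR (hm s)).ne').const_mul γ
  have hAi : IntegrableOn A (Set.Ioc 0 T) := hAc.integrableOn_Ioc
  have hNm : Measurable N := (measurable_noiseLoad α C R _).comp hζ.meas
  have hNt := hζ.lintegral_noiseLoad α C R (∑ k, ‖c k‖ ^ 2) T
  have hNi : IntegrableOn (fun s ↦ (N s).toReal) (Set.Ioc 0 T) :=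
    integrable_toReal_of_lintegral_ne_top hNm.aemeasurable hNt.ne
  have hint := intervalIntegrable_energyDeriv hsol hζ c (α := α) (γ := γ) hT
  have hnn : ∀ t ∈ Set.Icc 0 T,
      0 ≤ ∫ s in (0 : ℝ)..t, energyDeriv γ α c (u s.toNNReal) (ζ s.toNNReal) := fun t ht ↦ by
    rw [← norm_sq_eq_integral_energyDeriv hsol hζ hc ht.1]
    exact sq_nonneg _
  -- The energy is the primitive of `energyDeriv`, so this is the increment of log(R + ‖u‖²) from
  -- the rest state; it is nonnegative, and no upper bound on the final energy is required.
  have hlog := log_primitive hT hR hint hnn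
  have hlog' : 0 ≤ ∫ s in Set.Ioc 0 T,
      (R + ‖u s.toNNReal‖ ^ 2)⁻¹ * energyDeriv γ α c (u s.toNNReal) (ζ s.toNNReal) := by
    rw [intervalIntegral.integral_of_le hT] at hlog
    refine hlog.trans_eq (setIntegral_congr_fun measurableSet_Ioc fun t ht ↦ ?_)
    rw [← norm_sq_eq_integral_energyDeriv hsol hζ hc ht.1.le]
  have hle : ∀ᵐ s ∂(volume.restrict (Set.Ioc 0 T)),
      (R + ‖u s.toNNReal‖ ^ 2)⁻¹ * energyDeriv γ α c (u s.toNNReal) (ζ s.toNNReal)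
        ≤ (N s).toReal - A s := by
    have hfour : ∀ᵐ s ∂(volume.restrict (Set.Ioc 0 T)), ∀ k,
        ∫⁻ x, ‖compLp k (ζ s.toNNReal) x‖ₑ ^ 4 < ∞ :=
      ae_all_iff.2 fun k ↦ ae_lt_top (measurable_lintegral_compLp_four hζ.meas k) (hζ.four T k).ne
    filter_upwards [hD hsol hζ (c := c) T, hfour] with s h1 h2
    rw [hN, toReal_noiseLoad hC hR hF h2]
    refine logarithmic_rate_le hC hR (hm s) ?_ ?_ h1
    · refine Finset.sum_nonneg fun k _ ↦ ?_
      rw [norm4_pow]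
      exact ENNReal.toReal_nonneg
    · exact add_nonneg (mul_nonneg (sq_nonneg _) (sq_nonneg _)) hF
  have hDi : IntegrableOn (fun s ↦ (R + ‖u s.toNNReal‖ ^ 2)⁻¹
      * energyDeriv γ α c (u s.toNNReal) (ζ s.toNNReal)) (Set.Ioc 0 T) := by
    have h1 := (intervalIntegrable_iff_integrableOn_Ioc_of_le hT).1 hint
    refine h1.bdd_mul (c := R⁻¹) ?_ (Eventually.of_forall fun s ↦ ?_)
    · exact ((continuous_const.add hcn).inv₀
        fun s ↦ (add_pos_of_pos_of_nonneg hR (hm s)).ne').aestronglyMeasurable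
    · have h2 : 0 < R + ‖u s.toNNReal‖ ^ 2 := add_pos_of_pos_of_nonneg hR (hm s)
      rw [norm_inv, Real.norm_of_nonneg h2.le]
      exact inv_anti₀ hR (le_add_of_nonneg_right (hm s))
  have hfin : 0 ≤ ∫ s in Set.Ioc 0 T, ((N s).toReal - A s) := hlog'.trans (integral_mono_ae hDi (hNi.sub hAi) hle)
  rw [integral_sub hNi hAi, sub_nonneg] at hfin
  have h5 := ENNReal.ofReal_le_ofReal hfin
  rw [ofReal_integral_eq_lintegral_ofReal hAi (Eventually.of_forall hA0),
    ofReal_integral_eq_lintegral_ofReal hNi (Eventually.of_forall fun s ↦ ENNReal.toReal_nonneg)]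
    at h5
  exact h5.trans (lintegral_mono fun s ↦ ENNReal.ofReal_toReal_le)

end Path

open scoped FourierTransform ComplexConjugate

/-! ### Averaging over the probability space -/

/-- Markov's argument: ‖X‖²/(R + ‖X‖²) exceeds 1/2 as soon as ‖X‖² > R. -/
lemma mul_measure_norm_gt_le {Ω : Type*} [MeasurableSpace Ω] {P : Measure Ω} {γ R : ℝ}
    (hγ : 0 < γ) (hR : 0 < R) (X : Ω → HSp) (hX : Measurable X) :
    ENNReal.ofReal (γ / 2) * P {ω | √R < ‖X ω‖}
      ≤ ∫⁻ ω, ENNReal.ofReal (γ * (‖X ω‖ ^ 2 / (R + ‖X ω‖ ^ 2))) ∂P := by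
  rw [← setLIntegral_const]
  refine (setLIntegral_mono_ae' (measurableSet_lt measurable_const hX.norm)
    (Eventually.of_forall fun ω hω ↦ ?_)).trans (setLIntegral_le_lintegral _ _)
  refine ENNReal.ofReal_le_ofReal ?_
  have h1 : R < ‖X ω‖ ^ 2 := by
    have := (Real.sqrt_lt' (lt_of_le_of_lt (Real.sqrt_nonneg R) hω)).1 hω
    exact this
  rw [div_eq_mul_inv]
  refine mul_le_mul_of_nonneg_left ?_ hγ.le
  rw [le_div_iff₀ (by linarith)]
  linarith

section Average

variable {Ω : Type*} [mΩ : MeasurableSpace Ω] {P : Measure Ω} [IsProbabilityMeasure P]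

lemma measurable_toNNReal_path {z : ℝ≥0 → Ω → HSp} (hz : StronglyMeasurable (Function.uncurry z)) :
    Measurable fun p : ℝ × Ω ↦ z p.1.toNNReal p.2 :=
  hz.measurable.comp ((measurable_real_toNNReal.comp measurable_fst).prodMk measurable_snd)

lemma lintegral_lintegral_path_comm {F : HSp → ℝ≥0∞} (hF : Measurable F) {z : ℝ≥0 → Ω → HSp}
    (hz : StronglyMeasurable (Function.uncurry z)) (T : ℝ) :
    ∫⁻ ω, (∫⁻ s in Set.Ioc 0 T, F (z s.toNNReal ω)) ∂P
      = ∫⁻ s in Set.Ioc 0 T, ∫⁻ ω, F (z s.toNNReal ω) ∂P := by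
  have h1 : Measurable fun p : Ω × ℝ ↦ F (z p.2.toNNReal p.1) :=
    (hF.comp (measurable_toNNReal_path hz)).comp measurable_swap
  exact lintegral_lintegral_swap (f := fun ω s ↦ F (z (Real.toNNReal s) ω)) h1.aemeasurable

/-- Integer horizons suffice, so a single exceptional event serves all T. -/
lemma ae_lintegral_path_lt_top {F : HSp → ℝ≥0∞} (hF : Measurable F) {z : ℝ≥0 → Ω → HSp}
    (hz : StronglyMeasurable (Function.uncurry z)) {K : ℝ≥0∞} (hK : K < ∞)
    (h : ∀ t, ∫⁻ ω, F (z t ω) ∂P ≤ K) :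
    ∀ᵐ ω ∂P, ∀ T : ℝ, ∫⁻ s in Set.Ioc 0 T, F (z s.toNNReal ω) < ∞ := by
  have h1 (n : ℕ) : ∀ᵐ ω ∂P, ∫⁻ s in Set.Ioc (0 : ℝ) n, F (z s.toNNReal ω) < ∞ := by
    have h2 : Measurable fun ω ↦ ∫⁻ s in Set.Ioc (0 : ℝ) n, F (z s.toNNReal ω) :=
      (hF.comp (measurable_toNNReal_path hz)).lintegral_prod_left'
    refine ae_lt_top h2 (ne_of_lt ?_)
    rw [lintegral_lintegral_path_comm hF hz]
    refine (lintegral_mono fun s : ℝ ↦ h s.toNNReal).trans_lt ?_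
    rw [lintegral_const]
    finiteness
  filter_upwards [ae_all_iff.2 h1] with ω hω T
  obtain ⟨n, hn⟩ := exists_nat_ge T
  exact (lintegral_mono_set (Set.Ioc_subset_Ioc_right hn)).trans_lt (hω n)

lemma enorm_sq_eq_sum_compLp (h : HSp) : ‖h‖ₑ ^ 2 = ∑ k, ‖compLp k h‖ₑ ^ 2 := by
  have h1 := congrArg ENNReal.ofReal (norm_sq_eq_sum (h : L2Field))
  rw [ENNReal.ofReal_sum_of_nonneg fun k _ ↦ sq_nonneg _, ENNReal.ofReal_pow (norm_nonneg _),
    ofReal_norm] at h1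
  refine h1.trans (Finset.sum_congr rfl fun k _ ↦ ?_)
  rw [ENNReal.ofReal_pow (norm_nonneg _), ofReal_norm]

lemma lintegral_compLp_pow (h : HSp) (k : Fin 2) (p : ℕ) :
    ∫⁻ x, ‖compLp k h x‖ₑ ^ p = ∫⁻ x, ‖(h : L2Field) x k‖ₑ ^ p := by
  refine lintegral_congr_ae ?_
  filter_upwards [compLp_ae k h] with x hx
  rw [hx, ← ofReal_norm, Complex.norm_real, ofReal_norm]

lemma ae_isGoodPath {ζ : ℝ≥0 → Ω → HSp} (hζ : StronglyMeasurable (Function.uncurry ζ))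
    {η M : ℝ≥0∞} (hη : η < ∞) (hM : M < ∞)
    (h4 : ∀ t k, ∫⁻ ω, (∫⁻ x, ‖compLp k (ζ t ω) x‖ₑ ^ 4) ∂P ≤ η)
    (h2 : ∀ t, ∫⁻ ω, ‖ζ t ω‖ₑ ^ 2 ∂P ≤ M) :
    ∀ᵐ ω ∂P, IsGoodPath fun t ↦ ζ t ω := by
  have h5 (k : Fin 2) : Measurable fun h : HSp ↦ ∫⁻ x, ‖compLp k h x‖ₑ ^ 4 :=
    (measurable_lintegral_enorm_pow 4).comp (measurable_compLp k)
  have h6 : Measurable fun h : HSp ↦ ‖h‖ₑ ^ 2 := measurable_enorm.pow_const 2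
  filter_upwards [ae_lintegral_path_lt_top h6 hζ hM h2,
    ae_all_iff.2 fun k ↦ ae_lintegral_path_lt_top (h5 k) hζ hη fun t ↦ h4 t k] with ω h7 h8
  exact ⟨(measurable_toNNReal_path hζ).comp measurable_prodMk_right, h7, fun T k ↦ h8 k T⟩

lemma lintegral_noiseLoad_le {ζ : ℝ≥0 → Ω → HSp} (hζ : StronglyMeasurable (Function.uncurry ζ))
    {η M : ℝ≥0∞} (h4 : ∀ t k, ∫⁻ ω, (∫⁻ x, ‖compLp k (ζ t ω) x‖ₑ ^ 4) ∂P ≤ η)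
    (h2 : ∀ t, ∫⁻ ω, ‖ζ t ω‖ₑ ^ 2 ∂P ≤ M) (α C R F : ℝ) (t : ℝ≥0) :
    ∫⁻ ω, noiseLoad α C R F (ζ t ω) ∂P
      ≤ ENNReal.ofReal (C * (1 + 1 / R)) * (2 * η)
        + ENNReal.ofReal (C / R) * (ENNReal.ofReal (α ^ 2) * M + ENNReal.ofReal F) := by
  have hm : Measurable (ζ t) := hζ.measurable.comp measurable_prodMk_left
  have h5 (k : Fin 2) : Measurable fun ω ↦ ∫⁻ x, ‖compLp k (ζ t ω) x‖ₑ ^ 4 :=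
    ((measurable_lintegral_enorm_pow 4).comp (measurable_compLp k)).comp hm
  have h6 : Measurable fun ω ↦ ‖ζ t ω‖ₑ ^ 2 := hm.enorm.pow_const 2
  have h7 : Measurable fun ω ↦ ∑ k, ∫⁻ x, ‖compLp k (ζ t ω) x‖ₑ ^ 4 :=
    Finset.measurable_fun_sum _ fun k _ ↦ h5 k
  have h8 : Measurable fun ω ↦ ENNReal.ofReal (α ^ 2) * ‖ζ t ω‖ₑ ^ 2 + ENNReal.ofReal F :=
    (h6.const_mul _).add measurable_const
  unfold noiseLoad
  rw [lintegral_add_left (h7.const_mul _), lintegral_const_mul _ h7, lintegral_const_mul _ h8,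
    lintegral_add_left (h6.const_mul _), lintegral_const_mul _ h6,
    lintegral_finsetSum _ fun k _ ↦ h5 k, lintegral_const, measure_univ, mul_one]
  refine add_le_add (mul_le_mul' le_rfl ?_)
    (mul_le_mul' le_rfl (add_le_add (mul_le_mul' le_rfl (h2 t)) le_rfl))
  rw [Fin.sum_univ_two, two_mul]
  exact add_le_add (h4 t 0) (h4 t 1)

lemma measurable_energyRatio (γ : ℝ) (R : ℝ) :
    Measurable fun h : HSp ↦ ENNReal.ofReal (γ * (‖h‖ ^ 2 / (R + ‖h‖ ^ 2))) :=
  ENNReal.measurable_ofReal.comp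
    (((measurable_norm.pow_const 2).div (measurable_const.add (measurable_norm.pow_const 2))).const_mul γ)

/-- The pathwise estimate integrated over Ω, with Tonelli's theorem to exchange time and
expectation. The constant C precedes α, the noise and R. -/
theorem exists_average_measure_le {γ : ℝ} (hγ : 0 < γ) : ∃ C : ℝ, 0 ≤ C ∧
    ∀ {α : ℝ} {f : VecDist} {ζ u : ℝ≥0 → Ω → HSp} {c : Fin 2 → LC2} {η M : ℝ≥0∞},
      StronglyMeasurable (Function.uncurry ζ) → StronglyMeasurable (Function.uncurry u) →
      (∀ᵐ ω ∂P, IsSolution γ α f (fun t ↦ ζ t ω) (fun t ↦ u t ω)) →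
      (∀ k, J (-1) (f k) = Lp.toTemperedDistribution (c k)) → η < ∞ → M < ∞ →
      (∀ t k, ∫⁻ ω, (∫⁻ x, ‖compLp k (ζ t ω) x‖ₑ ^ 4) ∂P ≤ η) →
      (∀ t, ∫⁻ ω, ‖ζ t ω‖ₑ ^ 2 ∂P ≤ M) → ∀ {T R : ℝ}, 0 ≤ T → 0 < R →
        ENNReal.ofReal (γ / 2) * ∫⁻ s in Set.Ioc 0 T, P {ω | √R < ‖u s.toNNReal ω‖}
        ≤ ENNReal.ofReal T * (ENNReal.ofReal (C * (1 + 1 / R)) * (2 * η)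
          + ENNReal.ofReal (C / R)
            * (ENNReal.ofReal (α ^ 2) * M + ENNReal.ofReal (∑ k, ‖c k‖ ^ 2))) := by
  obtain ⟨C, hC, h⟩ := exists_lintegral_energy_ratio_le hγ
  refine ⟨C, hC, fun {α f ζ u c η M} hζ hu hsol hc hη hM h4 h2 {T R} hT hR ↦ ?_⟩
  have hum (s : ℝ) : Measurable fun ω ↦ u s.toNNReal ω :=
    hu.measurable.comp measurable_prodMk_left
  have hE := measurable_energyRatio γ R
  calc ENNReal.ofReal (γ / 2) * ∫⁻ s in Set.Ioc 0 T, P {ω | √R < ‖u s.toNNReal ω‖}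
      = ∫⁻ s in Set.Ioc 0 T, ENNReal.ofReal (γ / 2) * P {ω | √R < ‖u s.toNNReal ω‖} :=
        (lintegral_const_mul' _ _ ENNReal.ofReal_ne_top).symm
    _ ≤ ∫⁻ s in Set.Ioc 0 T, ∫⁻ ω, ENNReal.ofReal
          (γ * (‖u s.toNNReal ω‖ ^ 2 / (R + ‖u s.toNNReal ω‖ ^ 2))) ∂P :=
        lintegral_mono fun s ↦ mul_measure_norm_gt_le hγ hR _ (hum s)
    _ = ∫⁻ ω, (∫⁻ s in Set.Ioc 0 T, ENNReal.ofReal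
          (γ * (‖u s.toNNReal ω‖ ^ 2 / (R + ‖u s.toNNReal ω‖ ^ 2)))) ∂P :=
        (lintegral_lintegral_path_comm hE hu T).symm
    _ ≤ ∫⁻ ω, (∫⁻ s in Set.Ioc 0 T, noiseLoad α C R (∑ k, ‖c k‖ ^ 2) (ζ s.toNNReal ω)) ∂P := by
        refine lintegral_mono_ae ?_
        filter_upwards [hsol, ae_isGoodPath hζ hη hM h4 h2] with ω h5 h6
        exact h h5 h6 hc hT hR
    _ = ∫⁻ s in Set.Ioc 0 T, ∫⁻ ω, noiseLoad α C R (∑ k, ‖c k‖ ^ 2) (ζ s.toNNReal ω) ∂P :=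
        lintegral_lintegral_path_comm (measurable_noiseLoad _ _ _ _) hζ T
    _ ≤ ∫⁻ _s in Set.Ioc 0 T, (ENNReal.ofReal (C * (1 + 1 / R)) * (2 * η)
          + ENNReal.ofReal (C / R)
            * (ENNReal.ofReal (α ^ 2) * M + ENNReal.ofReal (∑ k, ‖c k‖ ^ 2))) :=
        lintegral_mono fun s ↦ lintegral_noiseLoad_le hζ h4 h2 α C R _ s.toNNReal
    _ = _ := by
        rw [lintegral_const, Measure.restrict_apply_univ, Real.volume_Ioc, sub_zero, mul_comm]

lemma average_measureReal_lt {S : ℝ → Set Ω} {γ ε T : ℝ} {L : ℝ≥0∞} (hγ : 0 < γ)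
    (hT : 0 < T) (hS : Measurable fun s ↦ P (S s))
    (h : ENNReal.ofReal (γ / 2) * ∫⁻ s in Set.Ioc 0 T, P (S s) ≤ ENNReal.ofReal T * L)
    (hL : L < ENNReal.ofReal (ε * γ / 2)) :
    (1 / T) * ∫ s in (0 : ℝ)..T, P.real (S s) < ε := by
  have h1 : ENNReal.ofReal (γ / 2) * ∫⁻ s in Set.Ioc 0 T, P (S s)
      < ENNReal.ofReal (γ / 2) * ENNReal.ofReal (ε * T) := by
    refine h.trans_lt ?_
    rw [← ENNReal.ofReal_mul (by positivity), show γ / 2 * (ε * T) = T * (ε * γ / 2) by ring,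
      ENNReal.ofReal_mul hT.le]
    exact (ENNReal.mul_lt_mul_iff_right (by simpa using hT) ENNReal.ofReal_ne_top).2 hL
  have h2 := lt_of_mul_lt_mul_left' h1
  rw [intervalIntegral.integral_of_le hT.le]
  have h3 : ∫ s in Set.Ioc 0 T, P.real (S s) = (∫⁻ s in Set.Ioc 0 T, P (S s)).toReal :=
    integral_toReal hS.aemeasurable (Eventually.of_forall fun s ↦ measure_lt_top P _)
  rw [h3, one_div, inv_mul_lt_iff₀ hT, mul_comm]
  exact (ENNReal.lt_ofReal_iff_toReal_lt h2.ne_top).1 h2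

lemma exists_radius {C δ : ℝ} {K : ℝ≥0∞} (hδ : 0 < δ) (hK : K < ∞) :
    ∃ R : ℝ, 1 ≤ R ∧ ENNReal.ofReal (C / R) * K < ENNReal.ofReal δ := by
  have h1 : Tendsto (fun R : ℝ ↦ ENNReal.ofReal (C / R) * K) atTop (𝓝 (ENNReal.ofReal 0 * K)) :=
    ENNReal.Tendsto.mul_const (ENNReal.tendsto_ofReal (tendsto_const_nhds.div_atTop tendsto_id))
      (Or.inr hK.ne)
  rw [ENNReal.ofReal_zero, zero_mul] at h1
  exact ((eventually_ge_atTop 1).and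
    (h1.eventually (gt_mem_nhds (ENNReal.ofReal_pos.2 hδ)))).exists

/-- For R ≥ 1 the factor 1 + 1/R is at most 2, so a fourth moment of δ/(4(C + 1)) costs at most δ,
uniformly in R. -/
lemma load_lt {C δ R : ℝ} {K : ℝ≥0∞} (hC : 0 ≤ C) (hδ : 0 < δ) (hR : 1 ≤ R)
    (hK : K < ENNReal.ofReal δ) :
    ENNReal.ofReal (C * (1 + 1 / R)) * (2 * ENNReal.ofReal (δ / (4 * (C + 1)))) + K
      < ENNReal.ofReal (2 * δ) := by
  have h1 : ENNReal.ofReal (C * (1 + 1 / R)) * (2 * ENNReal.ofReal (δ / (4 * (C + 1))))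
      ≤ ENNReal.ofReal δ := by
    rw [show (2 : ℝ≥0∞) = ENNReal.ofReal 2 by simp, ← ENNReal.ofReal_mul (by norm_num),
      ← ENNReal.ofReal_mul (by positivity)]
    refine ENNReal.ofReal_le_ofReal ?_
    have h2 : 1 / R ≤ 1 := by rw [div_le_one (by linarith)]; exact hR
    calc C * (1 + 1 / R) * (2 * (δ / (4 * (C + 1))))
        ≤ (C + 1) * (1 + 1) * (2 * (δ / (4 * (C + 1)))) := by gcongr; linarith
      _ = δ := by field_simp; ring
  rw [two_mul δ, ENNReal.ofReal_add hδ.le hδ.le]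
  exact ENNReal.add_lt_add_of_le_of_lt (ne_top_of_le_ne_top ENNReal.ofReal_ne_top h1) h1 hK

end Average

end DampedNS

end

/-! ### The choice of the damping and of the radius. -/

theorem mainTheorem7
    {Ω : Type*} [mΩ : MeasurableSpace Ω] (P : Measure Ω) [IsProbabilityMeasure P]
    (𝓕 : Filtration ℝ≥0 mΩ)
    {Y : Type*} [NormedAddCommGroup Y] [InnerProductSpace ℝ Y] [CompleteSpace Y]
    [TopologicalSpace.SeparableSpace Y]
    (w : ℝ≥0 → Y → Ω → ℝ) (hw : IsCylindricalWiener 𝓕 P w)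
    (γ : ℝ) (hγ : 0 < γ) (g : ℝ) (hg : g ∈ Set.Ioo (0 : ℝ) 1)
    (G : HSp → Y →ₗ[ℝ] VecDist)
    (hGm : ∀ (y : Y) (k : Fin 2) (φ : 𝓢(Plane, ℂ)), Measurable fun v : HSp ↦ G v y k φ)
    (hG1 : IsBoundedNoise (-g) 2 G) (hG2 : IsBoundedNoise (-g) 4 G)
    (f : VecDist) (hf : MemHsol (-1) 2 f)
    (v : ℝ≥0 → Ω → HSp) (hv : IsStronglyProgressive 𝓕 v)
    (hvc : ∀ᵐ ω ∂P, Continuous fun t ↦ v t ω)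
    (ζ u : ℝ → ℝ≥0 → Ω → HSp)
    (hζ : ∀ α, 0 < α → IsStochasticConvolution 𝓕 P w G v γ α (ζ α))
    (hum : ∀ α, 0 < α → StronglyMeasurable (Function.uncurry (u α)))
    (hu : ∀ α, 0 < α → ∀ᵐ ω ∂P, IsSolution γ α f (fun t ↦ ζ α t ω) (fun t ↦ u α t ω))
    (ε : ℝ) (hε : 0 < ε) :
    ∃ α R : ℝ, 0 < α ∧ 0 < R ∧ ∀ T : ℝ, 0 < T →
      (1 / T) * ∫ t in (0 : ℝ)..T, P.real {ω | R < ‖u α t.toNNReal ω‖} < ε := by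
  obtain ⟨C, hC, hmain⟩ := exists_average_measure_le (P := P) hγ
  have hC1 : 0 < 4 * (C + 1) := by positivity
  have hδ : 0 < ε * γ / 4 := by positivity
  -- The load must stay below εγ/2. Half of it, δ = εγ/4, is allotted to the fourth moment of the
  -- noise, which does not improve with R and must be made small through α.
  obtain ⟨α, hα, M, hM, hnoise⟩ := exists_small_noise hg hw hGm hG1 hG2 hv hγ hζ
    (η := ENNReal.ofReal (ε * γ / 4 / (4 * (C + 1)))) (ENNReal.ofReal_pos.2 (div_pos hδ hC1))
  have hζm := (hζ α hα).measurable
  have h4 (t : ℝ≥0) (k : Fin 2) : ∫⁻ ω, (∫⁻ x, ‖compLp k (ζ α t ω) x‖ₑ ^ 4) ∂P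
      ≤ ENNReal.ofReal (ε * γ / 4 / (4 * (C + 1))) := by
    simp_rw [lintegral_compLp_pow]
    exact (hnoise t k).1
  have h2 (t : ℝ≥0) : ∫⁻ ω, ‖ζ α t ω‖ₑ ^ 2 ∂P ≤ 2 * M := by
    have hm (k : Fin 2) : Measurable fun ω ↦ ‖compLp k (ζ α t ω)‖ₑ ^ 2 :=
      (((measurable_compLp k).comp (hζm.measurable.comp measurable_prodMk_left)).enorm).pow_const 2
    simp_rw [enorm_sq_eq_sum_compLp]
    rw [lintegral_finsetSum _ fun k _ ↦ hm k]
    simp_rw [← lintegral_enorm_sq_eq, lintegral_compLp_pow]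
    rw [Fin.sum_univ_two, two_mul]
    exact add_le_add (hnoise t 0).2 (hnoise t 1).2
  choose c hc using fun k ↦ hf.exists_lp (by norm_num) k
  have hK : ENNReal.ofReal (α ^ 2) * (2 * M) + ENNReal.ofReal (∑ k, ‖c k‖ ^ 2) < ∞ := by finiteness
  -- The other half covers α²𝔼‖ζ‖² and the force. Both may be large once α is fixed, but they carry
  -- the factor C/R.
  obtain ⟨R, hR1, hR⟩ := exists_radius (C := C) hδ hK
  have hR0 : 0 < R := one_pos.trans_le hR1
  refine ⟨α, √R, hα, Real.sqrt_pos.2 hR0, fun T hT ↦ ?_⟩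
  have hS : Measurable fun s : ℝ ↦ P {ω | √R < ‖u α s.toNNReal ω‖} :=
    measurable_measure_prodMk_left
      (measurableSet_lt measurable_const (measurable_toNNReal_path (hum α hα)).norm)
  refine average_measureReal_lt hγ hT hS (hmain hζm (hum α hα) (hu α hα) hc ENNReal.ofReal_lt_top
    (ENNReal.mul_lt_top (by norm_num) hM) h4 h2 hT.le hR0) ?_
  have h := load_lt hC hδ hR1 hR
  rwa [show 2 * (ε * γ / 4) = ε * γ / 2 by ring] at h
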